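/- Let $F$ be a field of characteristic different from $2$ with algebraic closure $\overline F$. Let either $E=F$ and $\sigma=\mathrm{id}$ (symplectic/orthogonal case), or let $E/F$ be a quadratic extension with nontrivial automorphism $\sigma$ (unitary case). Let $V=W\oplus X\oplus W'$ be a finite-dimensional $E$-vector space with a nondegenerate form $\Phi$, conjugate-linear in the first and linear in the second variable, which is symmetric or antisymmetric if $E=F$ and Hermitian in the unitary case. Assume that $W$ and $W'$ are totally isotropic and put in duality by $\Phi$, and that $X=(W\oplus W')^{\perp}$. Let $k=\dim_E W\le \dim_E X$, and assume that $k$ is even if $\Phi$ is antisymmetric. Let $G^1=\mathrm{Isom}(V)$, $H=\mathrm{Isom}(X)$ (the full isometry groups), let $M\subseteq G^1$ be the stabilizer of $W$ and $W'$, and let $N$ be the unipotent radical of the stabilizer $P$ of $W$ in $G^1$. All of these are the $F$-points of varieties over $F$; bold letters denote $\overline F$-points. An element of $N$ is determined by the components $\xi:X\to W$ and $\eta:W'\to W$, and is written $n(\xi,\eta)$; it acts as $1$ on $W$, as $1+\xi$ on $X$ and as $1-\xi^*+\eta$ on $W'$, where $\xi^*:W'\to X$ is defined by $\Phi(\xi^*w',x)=\Phi(w',\xi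 x)$. Let $N'=\{n(\xi,\eta)\in N:\eta \text{ invertible}\}$ and $\mathrm{Norm}(n(\xi,\eta))=1+\xi^*\eta^{-1}\xi\in H$ for $n(\xi,\eta)\in N'$. Put $\mathrm{Int}(m)n=mnm^{-1}$. For a nondegenerate $k$-dimensional subspace $Y$ of $X$ let $H_Y=\{h\in H: h|_{Y^\perp}=\mathrm{id}\}$. For a maximal torus $T$ of $H_Y$ defined over $F$, let $T_{\mathrm{reg}}$ be the set of $\gamma\in T$ that are regular (the centralizer of $\gamma$ in $\mathbf H_{\mathbf Y}$ is $\mathbf T$) and for which $(\gamma-1)|_Y$ is invertible; $\mathbf T_{\mathrm{reg}}$ is defined in the same way over $\overline F$. Let $N_{Y,T}$ be the set of $n\in N'$ such that $\mathrm{Norm}(n)$ is conjugate in $H_Y$ to an element of $T_{\mathrm{reg}}$, and let $N^{Y,T}=\{\mathrm{Int}(h)n:h\in H,\ n\in N_{Y,T}\}$, where $H$ acts through its natural embedding in $M$. For each $Y$ fix an $E$-linear map $\xi_Y:X\to W$ that is zero on $Y^\perp$ and maps $Y$ isomorphically onto $W$; put $\xi_Y^+=\xi_Y^*(\xi_Y\xi_Y^*)^{-1}$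 and, for $\gamma\in T_{\mathrm{reg}}$, $n_Y(\gamma)=n\bigl(\xi_Y,(\xi_Y(\gamma-1)\xi_Y^+)^{-1}\xi_Y\xi_Y^*\bigr)$. Assume that $H_Y$ is not odd orthogonal, i.e. that $k$ is even if $\Phi$ is symmetric and $E=F$. Let $\mathbf Y$ be a nondegenerate subspace of $\mathbf X$ of the dimension $k$ (over $\overline F$ in the symplectic/orthogonal case; free of rank $k$ over $E\otimes_F\overline F$ in the unitary case), let $\mathbf T$ be a maximal torus of $\mathbf H_{\mathbf Y}$, let $\mathbf H^{\mathbf T}=\{h\gamma h^{-1}:h\in\mathbf H,\gamma\in\mathbf T_{\mathrm{reg}}\}$ and $\mathbf N_{\mathrm{reg}}=\{n\in\mathbf N':\mathrm{Norm}(n)\in\mathbf H^{\mathbf T}\}$, and let $N_{\mathrm{reg}}=\mathbf N_{\mathrm{reg}}\cap N$ be the set of its $F$-points. Then: 1. $\mathbf N_{\mathrm{reg}}$ is nonempty and Zariski open in $\mathbf N$. 2. $N_{\mathrm{reg}}=\bigcup_{Y,T}N^{Y,T}$, where $Y$ runs over representatives of the $H$-orbits of nondegenerate $k$-dimensional subspaces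 of $X$ and, for each $Y$, $T$ runs over representatives of the $H_Y$-conjugacy classes of maximal tori of $H_Y$ defined over $F$. 3. For the same $Y,T$, there is a disjoint decomposition $$N_{\mathrm{reg}}=\bigsqcup_{Y,T}\{\mathrm{Int}(m)\,n_Y(\gamma): m\in M,\ \gamma\in T_{\mathrm{reg}}\}.$$ -/

import Mathlib

open scoped TensorProduct

/-! ### Zariski topology and rational structures on finite-dimensional vector spaces -/

section Zariski

/-- Polynomial functions on a vector space `U` over an infinite field `K`: the `K`-algebra
of functions generated by the linear functionals. -/
def polyFun (K U : Type*) [Field K] [AddCommGroup U] [Module K U] : Subalgebra K (U → K) :=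
  Algebra.adjoin K (Set.range (fun l : Module.Dual K U => (l : U → K)))

/-- The Zariski topology on a vector space `U`, with basic open sets `p ≠ 0` for
`p` a polynomial function. -/
abbrev zariski (K U : Type*) [Field K] [AddCommGroup U] [Module K U] : TopologicalSpace U :=
  TopologicalSpace.generateFrom {s | ∃ p ∈ polyFun K U, s = {x | p x ≠ 0}}

variable (F K X : Type*) [Field F] [Field K] [Algebra F K] [AddCommGroup X] [Module F X]

/-- The polynomial functions with coefficients in `F` on `End(K ⊗ X)`, for its `F`-structure
`End_F(X)`: generated over `F` by the functionals that take values in `F` on `End_F(X)`. -/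
def ratPolyFun : Subalgebra F (Module.End K (K ⊗[F] X) → K) :=
  Algebra.adjoin F {f | ∃ l : Module.Dual K (Module.End K (K ⊗[F] X)),
    (∀ g : Module.End F X, l (g.baseChange K) ∈ Set.range (algebraMap F K)) ∧ f = l}

/-- A subset of `End(K ⊗ X)` is defined over `F` if its vanishing ideal is spanned over `K`
by polynomials with coefficients in `F`. -/
def IsDefinedOver (s : Set (Module.End K (K ⊗[F] X))) : Prop :=
  ∀ p ∈ polyFun K (Module.End K (K ⊗[F] X)), (∀ x ∈ s, p x = 0) →
    p ∈ Submodule.span K {q : Module.End K (K ⊗[F] X) → K |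
      q ∈ ratPolyFun F K X ∧ ∀ x ∈ s, q x = 0}

end Zariski

section Torus

variable {K X : Type*} [Field K] [AddCommGroup X] [Module K X]

/-- The elements of a group of linear automorphisms, as a set of endomorphisms. -/
def endSet (T : Subgroup (X ≃ₗ[K] X)) : Set (Module.End K X) :=
  {a | ∃ t ∈ T, a = (t : X →ₗ[K] X)}

/-- An algebraic torus in `GL(X)` over an algebraically closed field `K`: a subgroup that is
Zariski closed in `GL(X)`, connected, and (simultaneously) diagonalizable. -/
def IsTorus (T : Subgroup (X ≃ₗ[K] X)) : Prop :=
  (∃ Z, @IsClosed _ (zariski K (Module.End K X)) Z ∧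
    ∀ t : X ≃ₗ[K] X, t ∈ T ↔ (t : X →ₗ[K] X) ∈ Z) ∧
  @IsConnected _ (zariski K (Module.End K X)) (endSet T) ∧
  ∃ (n : ℕ) (b : Module.Basis (Fin n) K X), ∀ t ∈ T, ∀ i, ∃ c : K, t (b i) = c • b i

end Torus

/-- The two-sided inverse of a bijective linear map (arbitrary if there is none). -/
noncomputable def linInv {K A B : Type*} [Field K] [AddCommGroup A] [Module K A]
    [AddCommGroup B] [Module K B] (f : A →ₗ[K] B) : B →ₗ[K] A :=
  Classical.epsilon (fun g => f ∘ₗ g = LinearMap.id ∧ g ∘ₗ f = LinearMap.id)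

/-! ### The space `V = W ⊕ X ⊕ U` and its groups -/

/-- The linear algebra data, over a field `K`, from which the classical group and its parabolic
subgroup are formed: the spaces `W`, `X`, `U` (where `U` is the isotropic space dual to `W`),
with operators indexed by `S` (the scalar multiplications by the elements of a quadratic
extension, in the unitary case), a `K`-bilinear form on `X` and a `K`-bilinear pairing of `U`
with `W`, both with values in a `K`-space `C` with an involution. -/
structure LeviDatum (K S C W X U : Type*) [Field K] [AddCommGroup C] [Module K C]
    [AddCommGroup W] [Module K W] [AddCommGroup X] [Module K X] [AddCommGroup U] [Module K U] where
  conj : C →ₗ[K] C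
  sign : ℤˣ
  opW : S → Module.End K W
  opX : S → Module.End K X
  opU : S → Module.End K U
  form : X →ₗ[K] X →ₗ[K] C
  pair : U →ₗ[K] W →ₗ[K] C

/-- Base change of a bilinear map. -/
noncomputable def bilinBaseChange {F : Type*} (K : Type*) {A B C : Type*} [Field F] [Field K]
    [Algebra F K] [AddCommGroup A] [Module F A] [AddCommGroup B] [Module F B]
    [AddCommGroup C] [Module F C] (f : A →ₗ[F] B →ₗ[F] C) :
    (K ⊗[F] A) →ₗ[K] (K ⊗[F] B) →ₗ[K] (K ⊗[F] C) :=
  ((LinearMap.baseChangeHom F K B C) ∘ₗ f).liftBaseChange K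

theorem bilinBaseChange_tmul {F K A B C : Type*} [Field F] [Field K]
    [Algebra F K] [AddCommGroup A] [Module F A] [AddCommGroup B] [Module F B]
    [AddCommGroup C] [Module F C] (f : A →ₗ[F] B →ₗ[F] C) (s t : K) (a : A) (b : B) :
    bilinBaseChange K f (s ⊗ₜ a) (t ⊗ₜ b) = (s * t) ⊗ₜ f a b := by
  simp [bilinBaseChange, TensorProduct.smul_tmul']

namespace LeviDatum

section Generic

variable {K S C W X U : Type*} [Field K] [AddCommGroup C] [Module K C]
    [AddCommGroup W] [Module K W] [AddCommGroup X] [Module K X] [AddCommGroup U] [Module K U]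
variable (D : LeviDatum K S C W X U)

/-- The form on `V = W ⊕ X ⊕ U`: `X` is orthogonal to `W ⊕ U`, the spaces `W` and `U` are
totally isotropic, and `U` is paired with `W`. -/
def formV (v w : W × X × U) : C :=
  D.form v.2.1 w.2.1 + D.pair v.2.2 w.1 + (D.sign : ℤ) • D.conj (D.pair w.2.2 v.1)

/-- The operators on `V`. -/
def opV (s : S) (v : W × X × U) : W × X × U := (D.opW s v.1, D.opX s v.2.1, D.opU s v.2.2)

/-- `a` is a linear isometry of `V` (linear also over the operators). -/
def IsIsomV (a : Module.End K (W × X × U)) : Prop :=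
  (∀ s v, a (D.opV s v) = D.opV s (a v)) ∧ ∀ v w, D.formV (a v) (a w) = D.formV v w

/-- The Levi subgroup `M`: isometries of `V` preserving `W` and `U`. -/
def levi : Set ((W × X × U) ≃ₗ[K] (W × X × U)) :=
  {m | D.IsIsomV (m : (W × X × U) →ₗ[K] (W × X × U)) ∧
    (∀ w, (m (w, 0, 0)).2 = 0) ∧ ∀ u, (m (0, 0, u)).1 = 0 ∧ (m (0, 0, u)).2.1 = 0}

/-- The unipotent radical `N` of the stabilizer of `W`: isometries of `V` acting trivially on
`W`, on `(W + X) / W` and on `V / (W + X)`. -/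
def unipRad : Set (Module.End K (W × X × U)) :=
  {n | D.IsIsomV n ∧ (∀ w, n (w, 0, 0) = (w, 0, 0)) ∧ (∀ x, (n (0, x, 0)).2 = (x, 0)) ∧
    ∀ u, (n (0, 0, u)).2.2 = u}

/-- The component `ξ : X → W` of an endomorphism of `V`. -/
def xiOf (n : Module.End K (W × X × U)) : X →ₗ[K] W :=
  LinearMap.fst K W (X × U) ∘ₗ n ∘ₗ LinearMap.inr K W (X × U) ∘ₗ LinearMap.inl K X U

/-- The component `η : U → W` of an endomorphism of `V`. -/
def etaOf (n : Module.End K (W × X × U)) : U →ₗ[K] W :=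
  LinearMap.fst K W (X × U) ∘ₗ n ∘ₗ LinearMap.inr K W (X × U) ∘ₗ LinearMap.inr K X U

/-- The adjoint `ξ* : U → X` of `ξ : X → W`, with `Φ(ξ* u, x) = Φ(u, ξ x)`. -/
noncomputable def adj (f : X →ₗ[K] W) : U →ₗ[K] X :=
  Classical.epsilon (fun a => ∀ u x, D.form (a u) x = D.pair u (f x))

/-- The endomorphism `n(ξ, η)` of `V`: it is the identity on `W`, `1 + ξ` on `X`, and
`1 - ξ* + η` on `U`. -/
noncomputable def unip (f : X →ₗ[K] W) (e : U →ₗ[K] W) : Module.End K (W × X × U) :=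
  (LinearMap.fst K W (X × U) + f ∘ₗ LinearMap.fst K X U ∘ₗ LinearMap.snd K W (X × U)
      + e ∘ₗ LinearMap.snd K X U ∘ₗ LinearMap.snd K W (X × U)).prod
    ((LinearMap.fst K X U ∘ₗ LinearMap.snd K W (X × U)
        - D.adj f ∘ₗ LinearMap.snd K X U ∘ₗ LinearMap.snd K W (X × U)).prod
      (LinearMap.snd K X U ∘ₗ LinearMap.snd K W (X × U)))

theorem unip_apply (f : X →ₗ[K] W) (e : U →ₗ[K] W) (w : W) (x : X) (u : U) :
    D.unip f e (w, x, u) = (w + f x + e u, x - D.adj f u, u) := by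
  simp [unip]

/-- The subset of `N` where `η` is invertible. -/
def unipRadInv : Set (Module.End K (W × X × U)) :=
  {n | n ∈ D.unipRad ∧ Function.Bijective (etaOf n)}

/-- The Goldberg-Shahidi norm `1 + ξ* η⁻¹ ξ` of `n = n(ξ, η)`. -/
noncomputable def normMap (n : Module.End K (W × X × U)) : Module.End K X :=
  1 + D.adj (xiOf n) ∘ₗ linInv (etaOf n) ∘ₗ xiOf n

/-- The group `H` of isometries of `X`. -/
def isomX : Subgroup (X ≃ₗ[K] X) where
  carrier := {h | (∀ s x, h (D.opX s x) = D.opX s (h x)) ∧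
    ∀ x y, D.form (h x) (h y) = D.form x y}
  one_mem' := ⟨fun _ _ => rfl, fun _ _ => rfl⟩
  mul_mem' {a b} ha hb :=
    ⟨fun s x => by simp [ha.1, hb.1], fun x y => by simp [ha.2, hb.2]⟩
  inv_mem' {a} ha := by
    refine ⟨fun s x => a.injective ?_, fun x y => ?_⟩
    · rw [ha.1]
      change a (a.symm _) = D.opX s (a (a.symm x))
      simp
    · rw [← ha.2]
      change D.form (a (a.symm x)) (a (a.symm y)) = _
      simp

/-- The orthogonal complement in `X` of a subspace. -/
def perp (Y : Submodule K X) : Set X := {x | ∀ y ∈ Y, D.form y x = 0}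

/-- `Y` is a nondegenerate subspace of `X` (stable under the operators) of the same dimension
as `W`. -/
def IsNondegSub (Y : Submodule K X) : Prop :=
  (∀ s, ∀ y ∈ Y, D.opX s y ∈ Y) ∧ (∀ y ∈ Y, (∀ z ∈ Y, D.form y z = 0) → y = 0) ∧
    Module.finrank K Y = Module.finrank K W

/-- The group `H_Y` of isometries of `X` that are the identity on the orthogonal complement
of `Y`. -/
def isomFix (Y : Submodule K X) : Subgroup (X ≃ₗ[K] X) where
  carrier := {h | h ∈ D.isomX ∧ ∀ x ∈ D.perp Y, h x = x}
  one_mem' := ⟨D.isomX.one_mem, fun _ _ => rfl⟩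
  mul_mem' {a b} ha hb :=
    ⟨D.isomX.mul_mem ha.1 hb.1, fun x hx => by simp [hb.2 x hx, ha.2 x hx]⟩
  inv_mem' {a} ha := by
    refine ⟨D.isomX.inv_mem ha.1, fun x hx => a.injective ?_⟩
    change a (a.symm x) = a x
    simp [ha.2 x hx]

/-- `T` is a maximal torus of the algebraic group `H_Y` (for `K` algebraically closed). -/
def IsMaxTorus (Y : Submodule K X) (T : Subgroup (X ≃ₗ[K] X)) : Prop :=
  T ≤ D.isomFix Y ∧ IsTorus T ∧ ∀ T', T' ≤ D.isomFix Y → IsTorus T' → T ≤ T' → T' = T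

/-- `T_reg`: the elements `t` of `T` that are regular, in the sense that their centralizer in
`H_Y` is `T`, and for which `t - 1` is invertible on `Y`. -/
def regSet (Y : Submodule K X) (T : Subgroup (X ≃ₗ[K] X)) : Set (X ≃ₗ[K] X) :=
  {t | t ∈ T ∧ (∀ h, h ∈ D.isomFix Y → h * t = t * h → h ∈ T) ∧
    Set.BijOn (fun y => t y - y) Y Y}

/-- The elements of `N` with invertible `η` whose norm is conjugate in `H` to an element
of `T_reg` (for `K` algebraically closed). -/
def regUnip (Y : Submodule K X) (T : Subgroup (X ≃ₗ[K] X)) : Set (Module.End K (W × X × U)) :=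
  {n | n ∈ D.unipRadInv ∧ ∃ h ∈ D.isomX, ∃ t ∈ D.regSet Y T,
    D.normMap n = ((h * t * h⁻¹ : X ≃ₗ[K] X) : X →ₗ[K] X)}

/-- `f : X → W` extends by zero on the orthogonal complement of `Y` an isomorphism of `Y`
with `W` (compatible with the operators). -/
def IsXi (Y : Submodule K X) (f : X →ₗ[K] W) : Prop :=
  (∀ s x, f (D.opX s x) = D.opW s (f x)) ∧ Set.BijOn f Y Set.univ ∧ ∀ x ∈ D.perp Y, f x = 0

/-- The right inverse `ξ⁺ = ξ* (ξ ξ*)⁻¹` of `ξ`. -/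
noncomputable def xiPlus (f : X →ₗ[K] W) : W →ₗ[K] X := D.adj f ∘ₗ linInv (f ∘ₗ D.adj f)

/-- The element `(ξ (h - 1) ξ⁺)⁻¹` of `End(W)`. -/
noncomputable def hG (f : X →ₗ[K] W) (h : X ≃ₗ[K] X) : Module.End K W :=
  linInv (f ∘ₗ ((h : X →ₗ[K] X) - LinearMap.id) ∘ₗ D.xiPlus f)

/-- The section `n_Y(h) = n(ξ, (ξ (h - 1) ξ⁺)⁻¹ ξ ξ*)` of the norm. -/
noncomputable def nY (f : X →ₗ[K] W) (h : X ≃ₗ[K] X) : Module.End K (W × X × U) :=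
  D.unip f (D.hG f h ∘ₗ f ∘ₗ D.adj f)

/-- The base change of the data to an extension field of `F`. -/
noncomputable def baseChange {F : Type*} (K : Type*) {S C W X U : Type*} [Field F] [Field K]
    [Algebra F K] [AddCommGroup C] [Module F C] [AddCommGroup W] [Module F W]
    [AddCommGroup X] [Module F X] [AddCommGroup U] [Module F U]
    (D : LeviDatum F S C W X U) :
    LeviDatum K S (K ⊗[F] C) (K ⊗[F] W) (K ⊗[F] X) (K ⊗[F] U) where
  conj := D.conj.baseChange K
  sign := D.sign
  opW s := (D.opW s).baseChange K
  opX s := (D.opX s).baseChange K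
  opU s := (D.opU s).baseChange K
  form := bilinBaseChange K D.form
  pair := bilinBaseChange K D.pair

end Generic

section Rational

variable {F : Type*} (K : Type*) {S C W X U : Type*} [Field F] [Field K]
    [Algebra F K] [AddCommGroup C] [Module F C] [AddCommGroup W] [Module F W]
    [AddCommGroup X] [Module F X] [AddCommGroup U] [Module F U]
variable (D : LeviDatum F S C W X U)

/-- The canonical map from `V` to its base change. -/
def inclV (v : W × X × U) : (K ⊗[F] W) × (K ⊗[F] X) × (K ⊗[F] U) :=
  (1 ⊗ₜ v.1, 1 ⊗ₜ v.2.1, 1 ⊗ₜ v.2.2)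

/-- The `F`-points of a set `s` of endomorphisms of the base change of `V`. -/
def ratPoints (s : Set (Module.End K ((K ⊗[F] W) × (K ⊗[F] X) × (K ⊗[F] U)))) :
    Set (Module.End F (W × X × U)) :=
  {n | ∃ a ∈ s, ∀ v, a (inclV K v) = inclV K (n v)}

/-- `T` (given by its points over the algebraically closed field `K`) is a maximal torus of
`H_Y` that is defined over `F`. -/
def IsRatMaxTorus (Y : Submodule F X)
    (T : Subgroup ((K ⊗[F] X) ≃ₗ[K] (K ⊗[F] X))) : Prop :=
  (D.baseChange K).IsMaxTorus (Y.baseChange K) T ∧ IsDefinedOver F K X (endSet T)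

/-- The `F`-points of `T_reg`. -/
def ratRegSet (Y : Submodule F X) (T : Subgroup ((K ⊗[F] X) ≃ₗ[K] (K ⊗[F] X))) :
    Set (X ≃ₗ[F] X) :=
  {t | t ∈ D.isomFix Y ∧ t.baseChange F K X X ∈ (D.baseChange K).regSet (Y.baseChange K) T}

/-- The set `N_{Y,T}` of elements of `N` with invertible `η` whose norm is conjugate in
`H_Y` to an element of `T_reg`. -/
def lowerSet (Y : Submodule F X) (T : Subgroup ((K ⊗[F] X) ≃ₗ[K] (K ⊗[F] X))) :
    Set (Module.End F (W × X × U)) :=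
  {n | n ∈ D.unipRadInv ∧ ∃ h ∈ D.isomFix Y, ∃ t ∈ D.ratRegSet K Y T,
    D.normMap n = ((h * t * h⁻¹ : X ≃ₗ[F] X) : X →ₗ[F] X)}

/-- The set `N^{Y,T}` of `H`-conjugates of the elements of `N_{Y,T}`. -/
def upperSet (Y : Submodule F X) (T : Subgroup ((K ⊗[F] X) ≃ₗ[K] (K ⊗[F] X))) :
    Set (Module.End F (W × X × U)) :=
  {n | ∃ h ∈ D.isomX, ∃ a ∈ D.lowerSet K Y T,
    n = ((LinearEquiv.refl F W).prodCongr (h.prodCongr (LinearEquiv.refl F U))).conj a}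

/-- The set of `Int(m) n_Y(t)`, for `m` in `M` and `t` in `T_reg`, where `n_Y` is formed with
the map `f : X → W`. -/
def orbitSet (Y : Submodule F X) (T : Subgroup ((K ⊗[F] X) ≃ₗ[K] (K ⊗[F] X)))
    (f : X →ₗ[F] W) : Set (Module.End F (W × X × U)) :=
  {n | ∃ m ∈ D.levi, ∃ t ∈ D.ratRegSet K Y T, n = m.conj (D.nY f t)}

/-- `R` is a system of representatives for the orbits of `H` on the nondegenerate subspaces
of `X` of the dimension of `W`. -/
def IsSubspaceReps (R : Set (Submodule F X)) : Prop :=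
  (∀ Y ∈ R, D.IsNondegSub Y) ∧ ∀ Y, D.IsNondegSub Y →
    ∃! Z, Z ∈ R ∧ ∃ h ∈ D.isomX, Z = Y.map (h : X →ₗ[F] X)

/-- `R` is a system of representatives for the conjugacy classes, under the group `H_Y` of
`F`-points, of maximal tori of `H_Y` defined over `F`. -/
def IsTorusReps (Y : Submodule F X)
    (R : Set (Subgroup ((K ⊗[F] X) ≃ₗ[K] (K ⊗[F] X)))) : Prop :=
  (∀ T ∈ R, D.IsRatMaxTorus K Y T) ∧ ∀ T, D.IsRatMaxTorus K Y T →
    ∃! T', T' ∈ R ∧ ∃ h ∈ D.isomFix Y,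
      T' = T.map (MulAut.conj (h.baseChange F K X X)).toMonoidHom

end Rational

end LeviDatum

section Hermitian

variable {F E W X U : Type*} [Field F] [Field E] [Algebra F E]
    [AddCommGroup W] [Module F W] [Module E W] [IsScalarTower F E W]
    [AddCommGroup X] [Module F X] [Module E X] [IsScalarTower F E X]
    [AddCommGroup U] [Module F U] [Module E U] [IsScalarTower F E U]

/-- A sesquilinear map over `E`, seen as a bilinear map over `F`. -/
def sesqRestrict (s : E ≃ₐ[F] E) (f : U →ₛₗ[(s : E →+* E)] W →ₗ[E] E) : U →ₗ[F] W →ₗ[F] E :=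
  LinearMap.mk₂ F (fun u w => f u w)
    (fun a b w => by simp)
    (fun c u w => by
      rw [← algebraMap_smul E c u, map_smulₛₗ]
      simp [Algebra.smul_def])
    (fun u a b => by simp)
    (fun c u w => by
      rw [← algebraMap_smul E c w, map_smul]
      simp [Algebra.smul_def])

/-- The data over `F` given by an `ε`-Hermitian form on `X` and a sesquilinear pairing of `U`
with `W`; the operators are the scalar multiplications by elements of `E`. -/
def hermitianDatum (s : E ≃ₐ[F] E) (e : ℤˣ) (form : X →ₛₗ[(s : E →+* E)] X →ₗ[E] E)
    (pair : U →ₛₗ[(s : E →+* E)] W →ₗ[E] E) : LeviDatum F E E W X U where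
  conj := s.toLinearMap
  sign := e
  opW c := Algebra.lsmul F F W c
  opX c := Algebra.lsmul F F X c
  opU c := Algebra.lsmul F F U c
  form := sesqRestrict s form
  pair := sesqRestrict s pair

end Hermitian

/-! Scalars. Composing the forms with the trace of E/F gives K-bilinear forms on which E acts
through operators with known adjoints. The axioms `IsHerm` record this situation; they cover the
symplectic, orthogonal and unitary cases at once and are stable under base change, so one argument
serves F and its algebraic closure.

Norm. Let ξ, η be the components of n in N'. The relation that makes n an isometry is, after the
substitution u = η⁻¹ξx, the statement that Norm(n) is an isometry. Moreover Norm(n) ξ* = ξ*(1 + A)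
with A = η⁻¹ξξ* (`innerEnd`). If ξξ* is invertible, then Y = im ξ* is nondegenerate of dimension k,
and Norm(n) lies in H_Y and acts on Y like 1 + A. The norm is invariant under GL(W) and equivariant
under H. Conversely, n_Y(t) has norm t, and every n in N' of norm t is a GL(W)-conjugate of n_Y(t)
(`nY_mem`, `exists_conj_nY`). So M-orbits on the relevant part of N' correspond to H-conjugacy
classes of norms, which turns assertion 2 into assertion 3 (`upperSet_eq_orbitSet`).

Over the algebraic closure. The operators split X into eigenspaces X_φ and X_φ', equal if E = F and
totally isotropic otherwise. Hyperbolic bases (e_i in X_φ, f_i in X_φ') of spaces of dimension k are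
all conjugate under H, and the maximal tori of H_Y are the diagonal groups of the hyperbolic bases
of Y (`exists_eq_diagSub`). A diagonal element with eigenvalues c_i, c_i⁻¹ belongs to T_reg exactly
when the numbers satisfy `Dist`. This does not mention Y or T, so neither does N_reg. Translated to
A, membership of n in N_reg means that η and ξξ* are invertible and that A has simple spectrum on
the two eigenspaces of W' (`simpleOn_of_mem_regUnip`, `mem_regUnip_of_simpleOn`). These are
nonvanishing conditions for determinants and discriminants, which gives openness; n_Y at a regular
diagonal element gives a point.

Over F. If n is an F-point of N_reg, then Y = im ξ* is defined over F, and Norm(n) is a rational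
element of H_Y that is regular for a unique maximal torus T, its centralizer. That T is defined over
F is shown without Galois theory. Let B be the commutant of Norm(n) and the operators, supported on
Y; then a ↦ a (a*)⁻¹, on the invertible elements of K ⊗ B, parametrizes T by rational functions over
F, and the image of such a parametrization has its ideal defined over F (`isDefinedOver_of_regular`,
`isDefinedOver_of_param`). For disjointness, a regular t recovers Y = im(t - 1) and T, so conjugate
norms lead to conjugate pairs (Y, T) (`eq_of_mem_upperSet`). -/

set_option linter.unusedSectionVars false

/-! ### Scalar-valued forms and adjoints -/

namespace LeviDatum

section Basic

variable {K S C W X U : Type*} [Field K] [AddCommGroup C] [Module K C]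
    [AddCommGroup W] [Module K W] [AddCommGroup X] [Module K X] [AddCommGroup U] [Module K U]

/-- The form on `X`, composed with a linear functional. -/
def bX (D : LeviDatum K S C W X U) (tr : C →ₗ[K] K) : X →ₗ[K] X →ₗ[K] K := D.form.compr₂ tr

/-- The pairing of `U` with `W`, composed with a linear functional. -/
def bP (D : LeviDatum K S C W X U) (tr : C →ₗ[K] K) : U →ₗ[K] W →ₗ[K] K := D.pair.compr₂ tr

/-- The sign of the form, as a scalar. -/
def eps (D : LeviDatum K S C W X U) : K := ((D.sign : ℤ) : K)

/-- The properties of the data that come from a nondegenerate `ε`-Hermitian form and a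
nondegenerate sesquilinear pairing, in terms of a trace functional `tr` on the values. -/
structure IsHerm (D : LeviDatum K S C W X U) (tr : C →ₗ[K] K) (σ : S → S)
    (opC : S → Module.End K C) : Prop where
  invol : ∀ s, σ (σ s) = s
  conj_conj : ∀ c, D.conj (D.conj c) = c
  tr_conj : ∀ c, tr (D.conj c) = tr c
  form_symm : ∀ x y, D.form y x = (D.sign : ℤ) • D.conj (D.form x y)
  form_op : ∀ s x y, D.form x (D.opX s y) = opC s (D.form x y)
  pair_op : ∀ s u w, D.pair u (D.opW s w) = opC s (D.pair u w)
  form_op_left : ∀ s x y, D.form (D.opX s x) y = D.form x (D.opX (σ s) y)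
  conj_op : ∀ s c, D.conj (opC (σ s) c) = opC s (D.conj c)
  pair_op_left : ∀ s u w, D.pair (D.opU s u) w = D.pair u (D.opW (σ s) w)
  tr_sep : ∀ c, (∀ s, tr (opC s c) = 0) → c = 0
  form_nondeg : ∀ x, (∀ y, D.bX tr x y = 0) → x = 0
  pair_nondeg_left : ∀ u, (∀ w, D.bP tr u w = 0) → u = 0
  pair_nondeg_right : ∀ w, (∀ u, D.bP tr u w = 0) → w = 0

variable {D : LeviDatum K S C W X U} {tr : C →ₗ[K] K} {σ : S → S} {opC : S → Module.End K C}

theorem bX_apply (x y : X) : D.bX tr x y = tr (D.form x y) := rfl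

theorem bP_apply (u : U) (w : W) : D.bP tr u w = tr (D.pair u w) := rfl

theorem eps_mul_eps : D.eps * D.eps = 1 := by
  unfold eps
  rcases Int.units_eq_one_or D.sign with h | h <;> simp [h]

theorem eps_ne_zero : D.eps ≠ 0 := fun h => by
  have := D.eps_mul_eps
  simp [h] at this

theorem eps_eq : D.eps = 1 ∨ D.eps = -1 := by
  unfold eps
  rcases Int.units_eq_one_or D.sign with h | h <;> simp [h]

namespace IsHerm

variable (hD : D.IsHerm tr σ opC)
include hD

theorem bX_symm (x y : X) : D.bX tr y x = D.eps * D.bX tr x y := by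
  rw [bX_apply, bX_apply, hD.form_symm x y, map_zsmul, hD.tr_conj, eps, zsmul_eq_mul]

theorem bX_op_left (s : S) (x y : X) : D.bX tr (D.opX s x) y = D.bX tr x (D.opX (σ s) y) := by
  rw [bX_apply, bX_apply, hD.form_op_left]

theorem bX_op_right (s : S) (x y : X) : D.bX tr x (D.opX s y) = D.bX tr (D.opX (σ s) x) y := by
  rw [hD.bX_op_left, hD.invol]

theorem bP_op_left (s : S) (u : U) (w : W) :
    D.bP tr (D.opU s u) w = D.bP tr u (D.opW (σ s) w) := by
  rw [bP_apply, bP_apply, hD.pair_op_left]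

theorem eq_of_tr {c d : C} (h : ∀ s, tr (opC s c) = tr (opC s d)) : c = d := by
  rw [← sub_eq_zero]
  exact hD.tr_sep _ fun s => by simp [h s]

theorem bX_ext {x x' : X} (h : ∀ y, D.bX tr x y = D.bX tr x' y) : x = x' := by
  rw [← sub_eq_zero]
  exact hD.form_nondeg _ fun y => by simp [h y]

theorem bX_ext_right {x x' : X} (h : ∀ y, D.bX tr y x = D.bX tr y x') : x = x' :=
  hD.bX_ext fun y => by rw [hD.bX_symm, hD.bX_symm y x', h]

theorem bP_ext {u u' : U} (h : ∀ w, D.bP tr u w = D.bP tr u' w) : u = u' := by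
  rw [← sub_eq_zero]
  exact hD.pair_nondeg_left _ fun y => by simp [h y]

/-- The traces of the multiples of a value of the form determine that value, and an operator on the
values can be moved into the second variable. A map commuting with the operators therefore preserves
the form as soon as it preserves its trace. -/
theorem mem_isomX_iff (h : X ≃ₗ[K] X) : h ∈ D.isomX ↔ (∀ s x, h (D.opX s x) = D.opX s (h x)) ∧
    ∀ x y, D.bX tr (h x) (h y) = D.bX tr x y := by
  refine ⟨fun hh => ⟨hh.1, fun x y => by rw [bX_apply, bX_apply, hh.2]⟩, fun hh => ⟨hh.1, ?_⟩⟩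
  intro x y
  refine hD.eq_of_tr fun s => ?_
  rw [← hD.form_op, ← hD.form_op, ← hh.1]
  exact hh.2 _ _

theorem tr_formV (v w : W × X × U) : tr (D.formV v w) =
    D.bX tr v.2.1 w.2.1 + D.bP tr v.2.2 w.1 + D.eps * D.bP tr w.2.2 v.1 := by
  rw [formV, map_add, map_add, map_zsmul, hD.tr_conj, eps, zsmul_eq_mul]
  rfl

theorem formV_op (s : S) (v w : W × X × U) :
    D.formV v (D.opV s w) = opC s (D.formV v w) := by
  simp only [formV, opV, map_add, map_zsmul, hD.form_op, hD.pair_op, hD.pair_op_left, hD.conj_op]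

theorem isIsomV_iff (n : Module.End K (W × X × U)) : D.IsIsomV n ↔
    (∀ s v, n (D.opV s v) = D.opV s (n v)) ∧
    ∀ v w, tr (D.formV (n v) (n w)) = tr (D.formV v w) := by
  refine ⟨fun hn => ⟨hn.1, fun v w => by rw [hn.2]⟩, fun hn => ⟨hn.1, fun v w => ?_⟩⟩
  refine hD.eq_of_tr fun s => ?_
  rw [← hD.formV_op, ← hD.formV_op, ← hn.1]
  exact hn.2 _ _

variable [FiniteDimensional K W] [FiniteDimensional K X] [FiniteDimensional K U]

omit [FiniteDimensional K W] [FiniteDimensional K U] in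
theorem exists_bX_eq (l : Module.Dual K X) : ∃ x, ∀ y, D.bX tr x y = l y := by
  have hinj : Function.Injective (D.bX tr) := by
    rw [injective_iff_map_eq_zero]
    exact fun x hx => hD.form_nondeg x fun y => by simp [hx]
  have hs : Function.Surjective (D.bX tr) :=
    (LinearMap.injective_iff_surjective_of_finrank_eq_finrank Subspace.dual_finrank_eq.symm).1 hinj
  obtain ⟨x, hx⟩ := hs l
  exact ⟨x, fun y => by rw [hx]⟩

omit [FiniteDimensional K W] [FiniteDimensional K U] in
/-- Every linear functional-valued map is represented by the form. -/
theorem exists_linear_bX_eq {A : Type*} [AddCommGroup A] [Module K A]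
    (g : A →ₗ[K] Module.Dual K X) : ∃ a : A →ₗ[K] X, ∀ u x, D.bX tr (a u) x = g u x := by
  choose a ha using fun u => hD.exists_bX_eq (g u)
  refine ⟨⟨⟨a, fun u v => hD.bX_ext fun y => ?_⟩, fun c u => hD.bX_ext fun y => ?_⟩, ha⟩
  · simp [ha]
  · simp [ha]

omit [FiniteDimensional K W] [FiniteDimensional K U] in
-- The choice in `adj` is genuine: nondegeneracy represents the functionals `x ↦ tr Φ(u, f x)`, and
-- since `f` commutes with the operators the identity of traces lifts to one between values in `C`.
theorem form_adj {f : X →ₗ[K] W} (hf : ∀ s x, f (D.opX s x) = D.opW s (f x)) (u : U) (x : X) :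
    D.form (D.adj f u) x = D.pair u (f x) := by
  have : ∃ a : U →ₗ[K] X, ∀ u x, D.form (a u) x = D.pair u (f x) := by
    obtain ⟨a, ha⟩ := hD.exists_linear_bX_eq ((D.bP tr).compl₂ f)
    refine ⟨a, fun u x => hD.eq_of_tr fun s => ?_⟩
    rw [← hD.form_op, ← hD.pair_op, ← hf]
    exact ha u _
  exact Classical.epsilon_spec this u x

omit [FiniteDimensional K W] [FiniteDimensional K U] in
theorem bX_adj {f : X →ₗ[K] W} (hf : ∀ s x, f (D.opX s x) = D.opW s (f x)) (u : U) (x : X) :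
    D.bX tr (D.adj f u) x = D.bP tr u (f x) := by
  rw [bX_apply, bP_apply, hD.form_adj hf]

omit [FiniteDimensional K W] [FiniteDimensional K U] in
theorem bX_adj_right {f : X →ₗ[K] W} (hf : ∀ s x, f (D.opX s x) = D.opW s (f x)) (u : U) (x : X) :
    D.bX tr x (D.adj f u) = D.eps * D.bP tr u (f x) := by
  rw [hD.bX_symm, hD.bX_adj hf]

omit [FiniteDimensional K W] [FiniteDimensional K U] in
theorem adj_eq {f : X →ₗ[K] W} (hf : ∀ s x, f (D.opX s x) = D.opW s (f x)) {a : U →ₗ[K] X}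
    (ha : ∀ u x, D.bX tr (a u) x = D.bP tr u (f x)) : D.adj f = a :=
  LinearMap.ext fun u => hD.bX_ext fun x => by rw [hD.bX_adj hf, ha]

omit [FiniteDimensional K W] [FiniteDimensional K U] in
theorem adj_op {f : X →ₗ[K] W} (hf : ∀ s x, f (D.opX s x) = D.opW s (f x)) (s : S) (u : U) :
    D.adj f (D.opU s u) = D.opX s (D.adj f u) :=
  hD.bX_ext fun x => by
    rw [hD.bX_adj hf, hD.bP_op_left, ← hf, ← hD.bX_adj hf, ← hD.bX_op_left]

omit [FiniteDimensional K X] in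
theorem finrank_eq : Module.finrank K U = Module.finrank K W := by
  apply le_antisymm
  · rw [← Subspace.dual_finrank_eq (V := W)]
    refine LinearMap.finrank_le_finrank_of_injective (f := D.bP tr) ?_
    rw [injective_iff_map_eq_zero]
    exact fun x hx => hD.pair_nondeg_left x fun y => by simp [hx]
  · rw [← Subspace.dual_finrank_eq (V := U)]
    refine LinearMap.finrank_le_finrank_of_injective (f := (D.bP tr).flip) ?_
    rw [injective_iff_map_eq_zero]
    exact fun x hx => hD.pair_nondeg_right x fun y => by
      rw [← LinearMap.flip_apply, hx, LinearMap.zero_apply]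

end IsHerm

end Basic

end LeviDatum

/-! ### Two-sided inverses of bijective linear maps -/

section LinInv

variable {K A B : Type*} [Field K] [AddCommGroup A] [Module K A] [AddCommGroup B] [Module K B]

theorem linInv_spec {f : A →ₗ[K] B} (hf : Function.Bijective f) :
    f ∘ₗ linInv f = LinearMap.id ∧ linInv f ∘ₗ f = LinearMap.id := by
  refine Classical.epsilon_spec (p := fun g => f ∘ₗ g = LinearMap.id ∧ g ∘ₗ f = LinearMap.id)
    ⟨((LinearEquiv.ofBijective f hf).symm : B →ₗ[K] A), ?_, ?_⟩
  · ext x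
    exact (LinearEquiv.ofBijective f hf).apply_symm_apply x
  · ext x
    exact (LinearEquiv.ofBijective f hf).symm_apply_apply x

theorem apply_linInv {f : A →ₗ[K] B} (hf : Function.Bijective f) (x : B) : f (linInv f x) = x :=
  LinearMap.congr_fun (linInv_spec hf).1 x

theorem linInv_apply {f : A →ₗ[K] B} (hf : Function.Bijective f) (x : A) : linInv f (f x) = x :=
  LinearMap.congr_fun (linInv_spec hf).2 x

theorem linInv_eq {f : A →ₗ[K] B} {g : B →ₗ[K] A} (h₁ : ∀ x, f (g x) = x) (h₂ : ∀ x, g (f x) = x) :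
    linInv f = g := by
  have hf : Function.Bijective f := ⟨Function.LeftInverse.injective h₂,
    Function.RightInverse.surjective h₁⟩
  exact LinearMap.ext fun x => hf.1 (by rw [apply_linInv hf, h₁])

theorem linInv_bijective {f : A →ₗ[K] B} (hf : Function.Bijective f) :
    Function.Bijective (linInv f) :=
  ⟨Function.LeftInverse.injective (apply_linInv hf),
    Function.RightInverse.surjective (linInv_apply hf)⟩

end LinInv

/-! ### The unipotent radical in coordinates -/

namespace LeviDatum

section Unipotent

variable {K S C W X U : Type*} [Field K] [AddCommGroup C] [Module K C]
    [AddCommGroup W] [Module K W] [AddCommGroup X] [Module K X] [AddCommGroup U] [Module K U]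
variable {D : LeviDatum K S C W X U} {tr : C →ₗ[K] K} {σ : S → S} {opC : S → Module.End K C}

/-- The relation between `ξ` and `η` that makes `n(ξ, η)` an isometry. -/
def UnipRel (D : LeviDatum K S C W X U) (tr : C →ₗ[K] K) (f : X →ₗ[K] W) (e : U →ₗ[K] W) : Prop :=
  ∀ u v, D.bX tr (D.adj f u) (D.adj f v) + D.bP tr u (e v) + D.eps * D.bP tr v (e u) = 0

theorem xiOf_apply (n : Module.End K (W × X × U)) (x : X) : xiOf n x = (n (0, x, 0)).1 := rfl

theorem etaOf_apply (n : Module.End K (W × X × U)) (u : U) : etaOf n u = (n (0, 0, u)).1 := rfl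

theorem xiOf_unip (f : X →ₗ[K] W) (e : U →ₗ[K] W) : xiOf (D.unip f e) = f := by
  ext x
  simp [xiOf_apply, unip_apply]

theorem etaOf_unip (f : X →ₗ[K] W) (e : U →ₗ[K] W) : etaOf (D.unip f e) = e := by
  ext x
  simp [etaOf_apply, unip_apply]

theorem normMap_unip (f : X →ₗ[K] W) (e : U →ₗ[K] W) :
    D.normMap (D.unip f e) = 1 + D.adj f ∘ₗ linInv e ∘ₗ f := by
  rw [normMap, xiOf_unip, etaOf_unip]

theorem xiOf_op {n : Module.End K (W × X × U)} (hn : D.IsIsomV n) (s : S) (x : X) :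
    xiOf n (D.opX s x) = D.opW s (xiOf n x) := by
  have := congrArg Prod.fst (hn.1 s (0, x, 0))
  simpa [opV, xiOf_apply] using this

theorem etaOf_op {n : Module.End K (W × X × U)} (hn : D.IsIsomV n) (s : S) (u : U) :
    etaOf n (D.opU s u) = D.opW s (etaOf n u) := by
  have := congrArg Prod.fst (hn.1 s (0, 0, u))
  simpa [opV, etaOf_apply] using this

namespace IsHerm

variable (hD : D.IsHerm tr σ opC)
include hD

variable [FiniteDimensional K X]

/-- Testing the isometry on a vector of `X` against one of `U` forces the component `U → X` to be
`-ξ*`; the other components are prescribed or free. -/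
theorem eq_unip {n : Module.End K (W × X × U)} (hn : n ∈ D.unipRad) :
    n = D.unip (xiOf n) (etaOf n) := by
  obtain ⟨hi, hW, hX, hU⟩ := hn
  have key : ∀ u, (n (0, 0, u)).2.1 = - D.adj (xiOf n) u := by
    intro u
    refine hD.bX_ext_right fun x => ?_
    have h1 := ((hD.isIsomV_iff n).1 hi).2 (0, x, 0) (0, 0, u)
    rw [hD.tr_formV, hD.tr_formV, hX, hU, ← xiOf_apply] at h1
    simp only [map_zero, LinearMap.zero_apply, zero_add, mul_zero] at h1
    rw [map_neg, hD.bX_adj_right (xiOf_op hi)]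
    linear_combination h1
  refine LinearMap.ext fun v => ?_
  obtain ⟨w, x, u⟩ := v
  have hv : ((w, x, u) : W × X × U) = (w, 0, 0) + (0, x, 0) + (0, 0, u) := by simp
  rw [unip_apply, hv, map_add, map_add, hW]
  ext
  · simp [xiOf_apply, etaOf_apply]
  · simp [hX, key, sub_eq_add_neg]
  · simp [hX, hU]

theorem unipRel_of_mem {n : Module.End K (W × X × U)} (hn : n ∈ D.unipRad) :
    D.UnipRel tr (xiOf n) (etaOf n) := by
  intro u v
  have h1 := ((hD.isIsomV_iff n).1 hn.1).2 (0, 0, u) (0, 0, v)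
  rw [hD.eq_unip hn, hD.tr_formV, hD.tr_formV] at h1
  simpa [unip_apply, xiOf_unip, etaOf_unip] using h1

theorem unip_mem {f : X →ₗ[K] W} {e : U →ₗ[K] W} (hf : ∀ s x, f (D.opX s x) = D.opW s (f x))
    (he : ∀ s x, e (D.opU s x) = D.opW s (e x)) (hr : D.UnipRel tr f e) :
    D.unip f e ∈ D.unipRad := by
  refine ⟨(hD.isIsomV_iff _).2 ⟨?_, ?_⟩, ?_, ?_, ?_⟩
  · rintro s ⟨w, x, u⟩
    simp [opV, unip_apply, hf, he, hD.adj_op hf]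
  · rintro ⟨w, x, u⟩ ⟨w', x', u'⟩
    have := hr u u'
    simp only [hD.tr_formV, unip_apply, map_sub, map_add, LinearMap.sub_apply,
      hD.bX_adj hf, hD.bX_adj_right hf, mul_add] at this ⊢
    linear_combination this
  · intro w
    simp [unip_apply]
  · intro x
    simp [unip_apply]
  · intro u
    simp [unip_apply]

theorem mem_unipRad_iff (n : Module.End K (W × X × U)) : n ∈ D.unipRad ↔
    ∃ f e, (∀ s x, f (D.opX s x) = D.opW s (f x)) ∧ (∀ s x, e (D.opU s x) = D.opW s (e x)) ∧
      D.UnipRel tr f e ∧ n = D.unip f e := by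
  refine ⟨fun hn => ⟨xiOf n, etaOf n, xiOf_op hn.1, etaOf_op hn.1, hD.unipRel_of_mem hn,
    hD.eq_unip hn⟩, ?_⟩
  rintro ⟨f, e, hf, he, hr, rfl⟩
  exact hD.unip_mem hf he hr

/-- For `u = η⁻¹ξx` and `v = η⁻¹ξy` one has `η u = ξ x` and `η v = ξ y`, so `UnipRel` at `(u, v)`
says exactly that the extra terms in the expanded product cancel. -/
theorem normMap_isom {f : X →ₗ[K] W} {e : U →ₗ[K] W} (hf : ∀ s x, f (D.opX s x) = D.opW s (f x))
    (hr : D.UnipRel tr f e) (hb : Function.Bijective e) (x y : X) :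
    D.bX tr (x + D.adj f (linInv e (f x))) (y + D.adj f (linInv e (f y))) = D.bX tr x y := by
  have := hr (linInv e (f x)) (linInv e (f y))
  simp only [apply_linInv hb] at this
  simp only [map_add, LinearMap.add_apply, hD.bX_adj hf, hD.bX_adj_right hf] at this ⊢
  linear_combination this

end IsHerm

end Unipotent

end LeviDatum

/-! ### Nondegenerate subspaces and the groups H_Y -/

namespace LeviDatum

section Nondegenerate

variable {K S C W X U : Type*} [Field K] [AddCommGroup C] [Module K C]
    [AddCommGroup W] [Module K W] [AddCommGroup X] [Module K X] [AddCommGroup U] [Module K U]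
variable {D : LeviDatum K S C W X U} {tr : C →ₗ[K] K} {σ : S → S} {opC : S → Module.End K C}

/-- A linear automorphism from an isometry. -/
theorem IsHerm.exists_isomX (hD : D.IsHerm tr σ opC) [FiniteDimensional K X] (g : Module.End K X)
    (hg : ∀ s x, g (D.opX s x) = D.opX s (g x)) (hb : ∀ x y, D.bX tr (g x) (g y) = D.bX tr x y) :
    ∃ h ∈ D.isomX, (h : X →ₗ[K] X) = g := by
  have hinj : Function.Injective g := by
    rw [injective_iff_map_eq_zero]
    refine fun x hx => hD.form_nondeg x fun y => ?_
    rw [← hb, hx]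
    simp
  refine ⟨LinearEquiv.ofInjectiveEndo g hinj, (hD.mem_isomX_iff _).2 ⟨?_, ?_⟩, ?_⟩
  · simpa using hg
  · simpa using hb
  · ext x
    simp

theorem IsHerm.adj_linInv_op (hD : D.IsHerm tr σ opC) [FiniteDimensional K X]
    {f : X →ₗ[K] W} {e : U →ₗ[K] W}
    (hf : ∀ s x, f (D.opX s x) = D.opW s (f x)) (he : ∀ s x, e (D.opU s x) = D.opW s (e x))
    (hb : Function.Bijective e) (s : S) (x : X) :
    D.adj f (linInv e (f (D.opX s x))) = D.opX s (D.adj f (linInv e (f x))) := by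
  rw [← hD.adj_op hf, hf]
  congr 1
  exact hb.1 (by rw [apply_linInv hb, he, apply_linInv hb])

theorem IsHerm.exists_normMap (hD : D.IsHerm tr σ opC) [FiniteDimensional K X]
    {n : Module.End K (W × X × U)} (hn : n ∈ D.unipRadInv) :
    ∃ h ∈ D.isomX, (h : X →ₗ[K] X) = D.normMap n := by
  have h1 := xiOf_op hn.1.1
  have h2 := etaOf_op hn.1.1
  refine hD.exists_isomX _ (fun s x => ?_) fun x y => ?_
  · simp [normMap, hD.adj_linInv_op h1 h2 hn.2]
  · simpa [normMap] using hD.normMap_isom h1 (hD.unipRel_of_mem hn.1) hn.2 x y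

/-- The orthogonal complement of `Y` for the scalar-valued form. -/
def orth (D : LeviDatum K S C W X U) (tr : C →ₗ[K] K) (Y : Submodule K X) : Submodule K X where
  carrier := {x | ∀ y ∈ Y, D.bX tr y x = 0}
  add_mem' ha hb y hy := by rw [map_add, ha y hy, hb y hy, add_zero]
  zero_mem' y _ := map_zero _
  smul_mem' c x hx y hy := by rw [map_smul, hx y hy, smul_zero]

/-- A subspace that is stable under the operators and nondegenerate. -/
def IsNS (D : LeviDatum K S C W X U) (tr : C →ₗ[K] K) (Y : Submodule K X) : Prop :=
  (∀ s, ∀ y ∈ Y, D.opX s y ∈ Y) ∧ ∀ y ∈ Y, (∀ z ∈ Y, D.bX tr y z = 0) → y = 0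

namespace IsHerm

variable (hD : D.IsHerm tr σ opC)
include hD

theorem mem_orth' {Y : Submodule K X} {x : X} :
    x ∈ D.orth tr Y ↔ ∀ y ∈ Y, D.bX tr x y = 0 := by
  refine ⟨fun h y hy => ?_, fun h y hy => ?_⟩
  · rw [hD.bX_symm, h y hy, mul_zero]
  · rw [hD.bX_symm, h y hy, mul_zero]

/-- For a stable `Y` the form and its trace define the same complement, because an operator applied
to the value can be moved onto a vector of `Y`. -/
theorem mem_perp_iff {Y : Submodule K X} (hY : ∀ s, ∀ y ∈ Y, D.opX s y ∈ Y) {x : X} :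
    x ∈ D.perp Y ↔ x ∈ D.orth tr Y := by
  refine ⟨fun h y hy => by rw [bX_apply, h y hy, map_zero], fun h y hy => ?_⟩
  refine hD.tr_sep _ fun s => ?_
  rw [← hD.form_op, ← bX_apply, hD.bX_op_right]
  exact h _ (hY _ _ hy)

theorem isNondegSub_iff (Y : Submodule K X) :
    D.IsNondegSub Y ↔ D.IsNS tr Y ∧ Module.finrank K Y = Module.finrank K W := by
  unfold IsNondegSub IsNS
  rw [and_assoc]
  refine and_congr_right fun h1 => and_congr_left fun _ => forall₂_congr fun y hy => ?_
  refine imp_congr_left ⟨fun h z hz => by rw [bX_apply, h z hz, map_zero], fun h z hz => ?_⟩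
  refine hD.tr_sep _ fun s => ?_
  rw [← hD.form_op, ← bX_apply]
  exact h _ (h1 _ _ hz)

theorem orth_op {Y : Submodule K X} (hY : ∀ s, ∀ y ∈ Y, D.opX s y ∈ Y) (s : S) (x : X)
    (hx : x ∈ D.orth tr Y) : D.opX s x ∈ D.orth tr Y := fun y hy => by
  rw [hD.bX_op_right]
  exact hx _ (hY _ _ hy)

omit hD in
theorem eq_zero_of_mem_orth {Y : Submodule K X} (hD : D.IsHerm tr σ opC) (hY : D.IsNS tr Y) {x : X}
    (h1 : x ∈ Y) (h2 : x ∈ D.orth tr Y) : x = 0 :=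
  hY.2 x h1 (hD.mem_orth'.1 h2)

variable [FiniteDimensional K X]

/-- The form identifies `Y` with its dual, and `q x` represents the restriction to `Y` of the
functional defined by `x`. This orthogonal projection replaces the decomposition `X = Y ⊕ Y^⊥`
throughout. -/
theorem exists_proj {Y : Submodule K X} (hY : D.IsNS tr Y) :
    ∃ q : Module.End K X, (∀ x, q x ∈ Y) ∧ ∀ x, x - q x ∈ D.orth tr Y := by
  let B : Y →ₗ[K] Module.Dual K Y := (D.bX tr).domRestrict₁₂ Y Y
  have hinj : Function.Injective B := by
    rw [injective_iff_map_eq_zero]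
    intro y hy
    refine Subtype.ext (hY.2 y y.2 fun z hz => ?_)
    exact LinearMap.congr_fun hy ⟨z, hz⟩
  let e := LinearEquiv.ofInjectiveOfFinrankEq B hinj Subspace.dual_finrank_eq.symm
  refine ⟨Y.subtype ∘ₗ e.symm ∘ₗ Submodule.dualRestrict Y ∘ₗ D.bX tr, fun x => by simp, fun x => ?_⟩
  rw [hD.mem_orth']
  intro y hy
  have h1 : B (e.symm (Submodule.dualRestrict Y (D.bX tr x))) =
    Submodule.dualRestrict Y (D.bX tr x) := e.apply_symm_apply _
  have h2 := LinearMap.congr_fun h1 ⟨y, hy⟩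
  rw [map_sub, LinearMap.sub_apply, sub_eq_zero]
  exact h2.symm

theorem isNS_orth {Y : Submodule K X} (hY : D.IsNS tr Y) : D.IsNS tr (D.orth tr Y) := by
  refine ⟨hD.orth_op hY.1, fun y hy h => hD.form_nondeg y fun z => ?_⟩
  obtain ⟨q, hq1, hq2⟩ := hD.exists_proj hY
  have : z = q z + (z - q z) := by abel
  rw [this, map_add, h _ (hq2 z), hD.mem_orth'.1 hy _ (hq1 z), add_zero]

theorem mem_of_orth_orth {Y : Submodule K X} (hY : D.IsNS tr Y) {x : X}
    (hx : ∀ y ∈ D.orth tr Y, D.bX tr x y = 0) : x ∈ Y := by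
  obtain ⟨q, hq1, hq2⟩ := hD.exists_proj hY
  have : x - q x = 0 := by
    refine hD.eq_zero_of_mem_orth (hD.isNS_orth hY) (hq2 x) (hD.mem_orth'.2 fun y hy => ?_)
    rw [map_sub, LinearMap.sub_apply, hx y hy, hD.bX_symm, hD.mem_orth'.1 hy _ (hq1 x)]
    simp
  rw [sub_eq_zero.1 this]
  exact hq1 x

/-- An endomorphism that preserves `Y` and its complement commutes with the projection. -/
theorem proj_comm {Y : Submodule K X} (hY : D.IsNS tr Y) {q : Module.End K X}
    (hq1 : ∀ x, q x ∈ Y) (hq2 : ∀ x, x - q x ∈ D.orth tr Y) {g : Module.End K X}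
    (hg1 : ∀ y ∈ Y, g y ∈ Y) (hg2 : ∀ y ∈ D.orth tr Y, g y ∈ D.orth tr Y) (x : X) :
    q (g x) = g (q x) := by
  rw [← sub_eq_zero]
  refine hD.eq_zero_of_mem_orth hY (Y.sub_mem (hq1 _) (hg1 _ (hq1 x))) ?_
  have : q (g x) - g (q x) = g (x - q x) - (g x - q (g x)) := by
    rw [map_sub]
    abel
  rw [this]
  exact Submodule.sub_mem _ (hg2 _ (hq2 x)) (hq2 _)

theorem proj_of_mem {Y : Submodule K X} (hY : D.IsNS tr Y) {q : Module.End K X}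
    (hq1 : ∀ x, q x ∈ Y) (hq2 : ∀ x, x - q x ∈ D.orth tr Y) {y : X} (hy : y ∈ Y) : q y = y := by
  have := hD.eq_zero_of_mem_orth hY (Y.sub_mem hy (hq1 y)) (hq2 y)
  exact (sub_eq_zero.1 this).symm

theorem proj_of_mem_orth {Y : Submodule K X} (hY : D.IsNS tr Y) {q : Module.End K X}
    (hq1 : ∀ x, q x ∈ Y) (hq2 : ∀ x, x - q x ∈ D.orth tr Y) {y : X} (hy : y ∈ D.orth tr Y) :
    q y = 0 := by
  refine hD.eq_zero_of_mem_orth hY (hq1 y) ?_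
  have := Submodule.sub_mem _ hy (hq2 y)
  rwa [sub_sub_cancel] at this

/-- Two linear maps that agree on `Y` and on its orthogonal complement are equal. -/
theorem ext_of_nondeg {A : Type*} [AddCommGroup A] [Module K A] {Y : Submodule K X}
    (hY : D.IsNS tr Y) {g g' : X →ₗ[K] A} (h1 : ∀ y ∈ Y, g y = g' y)
    (h2 : ∀ y ∈ D.orth tr Y, g y = g' y) : g = g' := by
  obtain ⟨q, hq1, hq2⟩ := hD.exists_proj hY
  ext x
  have : x = q x + (x - q x) := by abel
  rw [this, map_add, map_add, h1 _ (hq1 x), h2 _ (hq2 x)]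

omit [FiniteDimensional K X] in
theorem isomX_orth {Y : Submodule K X} {h : X ≃ₗ[K] X} (hh : h ∈ D.isomX)
    (hY : ∀ y, h y ∈ Y ↔ y ∈ Y) (x : X) (hx : x ∈ D.orth tr Y) : h x ∈ D.orth tr Y := by
  intro y hy
  obtain ⟨z, rfl⟩ := h.surjective y
  rw [((hD.mem_isomX_iff h).1 hh).2]
  exact hx z ((hY z).1 hy)

/-- `h` is an isometry fixing `Y^⊥` pointwise, so it preserves the complement of `Y^⊥`, which is
`Y`. -/
theorem isomFix_mem {Y : Submodule K X} (hY : D.IsNS tr Y) {h : X ≃ₗ[K] X} (hh : h ∈ D.isomFix Y)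
    {y : X} (hy : y ∈ Y) : h y ∈ Y := by
  refine hD.mem_of_orth_orth hY fun z hz => ?_
  rw [← hh.2 z ((hD.mem_perp_iff hY.1).2 hz), ((hD.mem_isomX_iff h).1 hh.1).2]
  exact hz y hy

omit [FiniteDimensional K X] in
theorem isomFix_orth {Y : Submodule K X} (hY : D.IsNS tr Y) {h : X ≃ₗ[K] X} (hh : h ∈ D.isomFix Y)
    {y : X} (hy : y ∈ D.orth tr Y) : h y = y :=
  hh.2 y ((hD.mem_perp_iff hY.1).2 hy)

theorem isNS_map {Y : Submodule K X} (hY : D.IsNS tr Y) {h : X ≃ₗ[K] X} (hh : h ∈ D.isomX) :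
    D.IsNS tr (Y.map (h : X →ₗ[K] X)) := by
  have h1 := (hD.mem_isomX_iff h).1 hh
  constructor
  · rintro s _ ⟨y, hy, rfl⟩
    exact ⟨D.opX s y, hY.1 s y hy, h1.1 s y⟩
  · rintro _ ⟨y, hy, rfl⟩ hz
    have : y = 0 := hY.2 y hy fun z hz' => by
      rw [← h1.2]
      exact hz _ ⟨z, hz', rfl⟩
    simp [this]

theorem mem_orth_map {Y : Submodule K X} {h : X ≃ₗ[K] X} (hh : h ∈ D.isomX) (x : X) :
    x ∈ D.orth tr (Y.map (h : X →ₗ[K] X)) ↔ h.symm x ∈ D.orth tr Y := by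
  have h1 := (hD.mem_isomX_iff h).1 hh
  constructor
  · intro hx y hy
    rw [← h1.2, h.apply_symm_apply]
    exact hx _ ⟨y, hy, rfl⟩
  · rintro hx _ ⟨y, hy, rfl⟩
    have := hx y hy
    rw [← h1.2, h.apply_symm_apply] at this
    exact this

theorem isomFix_map {Y : Submodule K X} (hY : D.IsNS tr Y) {h g : X ≃ₗ[K] X} (hh : h ∈ D.isomX)
    (hg : g ∈ D.isomFix Y) : h * g * h⁻¹ ∈ D.isomFix (Y.map (h : X →ₗ[K] X)) := by
  refine ⟨D.isomX.mul_mem (D.isomX.mul_mem hh hg.1) (D.isomX.inv_mem hh), fun x hx => ?_⟩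
  rw [hD.mem_perp_iff (hD.isNS_map hY hh).1, hD.mem_orth_map hh] at hx
  change h (g (h.symm x)) = x
  rw [hD.isomFix_orth hY hg hx, h.apply_symm_apply]

end IsHerm

end Nondegenerate

end LeviDatum

/-! ### The Levi subgroup and its action on N -/

namespace LeviDatum

section Levi

variable {K S C W X U : Type*} [Field K] [AddCommGroup C] [Module K C]
    [AddCommGroup W] [Module K W] [AddCommGroup X] [Module K X] [AddCommGroup U] [Module K U]
variable {D : LeviDatum K S C W X U} {tr : C →ₗ[K] K} {σ : S → S} {opC : S → Module.End K C}

/-- The components of an element of the Levi subgroup. -/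
structure IsLevi (D : LeviDatum K S C W X U) (tr : C →ₗ[K] K) (g : W ≃ₗ[K] W) (h : X ≃ₗ[K] X)
    (g' : U ≃ₗ[K] U) : Prop where
  opW : ∀ s w, g (D.opW s w) = D.opW s (g w)
  opU : ∀ s u, g' (D.opU s u) = D.opU s (g' u)
  mem : h ∈ D.isomX
  pair : ∀ u w, D.bP tr (g' u) (g w) = D.bP tr u w

/-- The block diagonal automorphism of `V`. -/
def blockDiag (g : W ≃ₗ[K] W) (h : X ≃ₗ[K] X) (g' : U ≃ₗ[K] U) :
    (W × X × U) ≃ₗ[K] (W × X × U) := g.prodCongr (h.prodCongr g')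

theorem blockDiag_apply (g : W ≃ₗ[K] W) (h : X ≃ₗ[K] X) (g' : U ≃ₗ[K] U) (w : W) (x : X) (u : U) :
    blockDiag g h g' (w, x, u) = (g w, h x, g' u) := rfl

theorem blockDiag_symm_apply (g : W ≃ₗ[K] W) (h : X ≃ₗ[K] X) (g' : U ≃ₗ[K] U) (w : W) (x : X)
    (u : U) : (blockDiag g h g').symm (w, x, u) = (g.symm w, h.symm x, g'.symm u) := rfl

theorem IsLevi.symm {g : W ≃ₗ[K] W} {h : X ≃ₗ[K] X} {g' : U ≃ₗ[K] U} (hl : D.IsLevi tr g h g') :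
    D.IsLevi tr g.symm h.symm g'.symm where
  opW s w := g.injective (by rw [hl.opW]; simp)
  opU s w := g'.injective (by rw [hl.opU]; simp)
  mem := D.isomX.inv_mem hl.mem
  pair u w := by rw [← hl.pair]; simp

theorem IsLevi.trans {g g₁ : W ≃ₗ[K] W} {h h₁ : X ≃ₗ[K] X} {g' g₁' : U ≃ₗ[K] U}
    (hl : D.IsLevi tr g h g') (hl₁ : D.IsLevi tr g₁ h₁ g₁') :
    D.IsLevi tr (g.trans g₁) (h.trans h₁) (g'.trans g₁') where
  opW s w := by simp [hl.opW, hl₁.opW]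
  opU s w := by simp [hl.opU, hl₁.opU]
  mem := D.isomX.mul_mem hl₁.mem hl.mem
  pair u w := by simp [hl.pair, hl₁.pair]

theorem conj_blockDiag_blockDiag (g g₁ : W ≃ₗ[K] W) (h h₁ : X ≃ₗ[K] X) (g' g₁' : U ≃ₗ[K] U)
    (n : Module.End K (W × X × U)) : (blockDiag g₁ h₁ g₁').conj ((blockDiag g h g').conj n) =
    (blockDiag (g.trans g₁) (h.trans h₁) (g'.trans g₁')).conj n := rfl

theorem isLevi_of_mem {h : X ≃ₗ[K] X} (hh : h ∈ D.isomX) :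
    D.IsLevi tr (LinearEquiv.refl K W) h (LinearEquiv.refl K U) :=
  ⟨fun _ _ => rfl, fun _ _ => rfl, hh, fun _ _ => rfl⟩

namespace IsHerm

variable (hD : D.IsHerm tr σ opC)
include hD

theorem blockDiag_mem_levi {g : W ≃ₗ[K] W} {h : X ≃ₗ[K] X} {g' : U ≃ₗ[K] U}
    (hl : D.IsLevi tr g h g') : blockDiag g h g' ∈ D.levi := by
  have hh := (hD.mem_isomX_iff h).1 hl.mem
  refine ⟨(hD.isIsomV_iff _).2 ⟨?_, ?_⟩, fun w => by simp [blockDiag_apply],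
    fun u => by simp [blockDiag_apply]⟩
  · rintro s ⟨w, x, u⟩
    simp [opV, blockDiag_apply, hl.opW, hl.opU, hh.1]
  · rintro ⟨w, x, u⟩ ⟨w', x', u'⟩
    simp [hD.tr_formV, blockDiag_apply, hh.2, hl.pair]

/-- `g'` is the contragredient of `g`, transported through the identification of `U` with the dual
of `W`. -/
theorem exists_isLevi [FiniteDimensional K W] [FiniteDimensional K U] {g : W ≃ₗ[K] W}
    (hg : ∀ s w, g (D.opW s w) = D.opW s (g w)) {h : X ≃ₗ[K] X} (hh : h ∈ D.isomX) :
    ∃ g' : U ≃ₗ[K] U, D.IsLevi tr g h g' := by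
  have hfr := hD.finrank_eq
  have hinj : Function.Injective (D.bP tr) := by
    rw [injective_iff_map_eq_zero]
    exact fun x hx => hD.pair_nondeg_left x fun y => by simp [hx]
  let b : U ≃ₗ[K] Module.Dual K W :=
    LinearEquiv.ofInjectiveOfFinrankEq (D.bP tr) hinj (hfr.trans Subspace.dual_finrank_eq.symm)
  have hb : ∀ u, b u = D.bP tr u := fun u => rfl
  let g' : U ≃ₗ[K] U := (b.trans g.symm.dualMap).trans b.symm
  have hp : ∀ u w, D.bP tr (g' u) (g w) = D.bP tr u w := by
    intro u w
    have : b (g' u) = g.symm.dualMap (b u) := b.apply_symm_apply _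
    rw [← hb, this]
    simp [LinearEquiv.dualMap_apply, hb]
  refine ⟨g', hg, fun s u => hD.bP_ext fun w => ?_, hh, hp⟩
  obtain ⟨w, rfl⟩ := g.surjective w
  rw [hp, hD.bP_op_left, hD.bP_op_left, ← hg, hp]

/-- `X` is the orthogonal complement of `W ⊕ U`, so an isometry that preserves `W` and `U` preserves
`X` as well. -/
theorem exists_blockDiag [FiniteDimensional K W] [FiniteDimensional K X] [FiniteDimensional K U]
    {m : (W × X × U) ≃ₗ[K] (W × X × U)} (hm : m ∈ D.levi) :
    ∃ g h g', D.IsLevi tr g h g' ∧ m = blockDiag g h g' := by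
  obtain ⟨hi, hW, hU⟩ := hm
  have hi' := (hD.isIsomV_iff _).1 hi
  simp only [LinearEquiv.coe_coe] at hi'
  have hW2 : ∀ w, m (w, 0, 0) = ((m (w, 0, 0)).1, 0, 0) := fun w =>
    Prod.ext rfl (hW w)
  have hU2 : ∀ u, m (0, 0, u) = (0, 0, (m (0, 0, u)).2.2) := fun u =>
    Prod.ext (hU u).1 (Prod.ext (hU u).2 rfl)
  let g₀ : W →ₗ[K] W := LinearMap.fst K W (X × U) ∘ₗ (m : _ →ₗ[K] _) ∘ₗ LinearMap.inl K W (X × U)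
  let g₀' : U →ₗ[K] U := LinearMap.snd K X U ∘ₗ LinearMap.snd K W (X × U) ∘ₗ (m : _ →ₗ[K] _) ∘ₗ
    LinearMap.inr K W (X × U) ∘ₗ LinearMap.inr K X U
  let h₀ : X →ₗ[K] X := LinearMap.fst K X U ∘ₗ LinearMap.snd K W (X × U) ∘ₗ (m : _ →ₗ[K] _) ∘ₗ
    LinearMap.inr K W (X × U) ∘ₗ LinearMap.inl K X U
  have hg₀ : ∀ w, m (w, 0, 0) = (g₀ w, 0, 0) := hW2
  have hg₀' : ∀ u, m (0, 0, u) = (0, 0, g₀' u) := hU2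
  have ig : Function.Injective g₀ := fun w w' hw => by
    have := m.injective ((hg₀ w).trans ((congrArg (fun a => (a, (0 : X × U))) hw).trans (hg₀ w').symm))
    exact congrArg Prod.fst this
  have ig' : Function.Injective g₀' := fun w w' hw => by
    have := m.injective ((hg₀' w).trans
      ((congrArg (fun a => ((0 : W), (0 : X), a)) hw).trans (hg₀' w').symm))
    exact congrArg (fun v => v.2.2) this
  have hX1 : ∀ x, (m (0, x, 0)).1 = 0 := fun x => hD.pair_nondeg_right _ fun u => by
    obtain ⟨u, rfl⟩ := (LinearMap.injective_iff_surjective.1 ig') u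
    have := hi'.2 (0, x, 0) (0, 0, u)
    rw [hD.tr_formV, hD.tr_formV, hg₀'] at this
    simpa [eps_ne_zero] using this
  have hX2 : ∀ x, (m (0, x, 0)).2.2 = 0 := fun x => hD.pair_nondeg_left _ fun w => by
    obtain ⟨w, rfl⟩ := (LinearMap.injective_iff_surjective.1 ig) w
    have := hi'.2 (0, x, 0) (w, 0, 0)
    rw [hD.tr_formV, hD.tr_formV, hg₀] at this
    simpa using this
  have hh₀ : ∀ x, m (0, x, 0) = (0, h₀ x, 0) := fun x =>
    Prod.ext (hX1 x) (Prod.ext rfl (hX2 x))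
  obtain ⟨h, hh, hhe⟩ := hD.exists_isomX h₀ (fun s x => by
      have := hi'.1 s (0, x, 0)
      simp only [opV, map_zero, hh₀] at this
      exact congrArg (fun v => v.2.1) this) fun x y => by
      have := hi'.2 (0, x, 0) (0, y, 0)
      rw [hD.tr_formV, hD.tr_formV, hh₀, hh₀] at this
      simpa using this
  refine ⟨LinearEquiv.ofInjectiveEndo g₀ ig, h, LinearEquiv.ofInjectiveEndo g₀' ig',
    ⟨fun s w => ?_, fun s u => ?_, hh, fun u w => ?_⟩, ?_⟩
  · have := hi'.1 s (w, 0, 0)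
    simp only [opV, map_zero, hg₀] at this
    simpa using congrArg (fun v => v.1) this
  · have := hi'.1 s (0, 0, u)
    simp only [opV, map_zero, hg₀'] at this
    simpa using congrArg (fun v => v.2.2) this
  · have := hi'.2 (0, 0, u) (w, 0, 0)
    rw [hD.tr_formV, hD.tr_formV, hg₀, hg₀'] at this
    simpa using this
  · ext v : 1
    obtain ⟨w, x, u⟩ := v
    have hv : ((w, x, u) : W × X × U) = (w, 0, 0) + (0, x, 0) + (0, 0, u) := by simp
    rw [blockDiag_apply, hv, map_add, map_add, hg₀, hg₀', hh₀, ← hhe]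
    simp

variable [FiniteDimensional K X]

theorem adj_conj {f : X →ₗ[K] W} (hf : ∀ s x, f (D.opX s x) = D.opW s (f x))
    {g : W ≃ₗ[K] W} {h : X ≃ₗ[K] X} {g' : U ≃ₗ[K] U} (hl : D.IsLevi tr g h g') :
    D.adj ((g : W →ₗ[K] W) ∘ₗ f ∘ₗ (h.symm : X →ₗ[K] X)) =
      (h : X →ₗ[K] X) ∘ₗ D.adj f ∘ₗ (g'.symm : U →ₗ[K] U) := by
  have hh := (hD.mem_isomX_iff h).1 hl.mem
  have hh' := (hD.mem_isomX_iff _).1 hl.symm.mem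
  refine hD.adj_eq (fun s x => by simp [hh'.1, hf, hl.opW]) fun u x => ?_
  simp only [LinearMap.comp_apply, LinearEquiv.coe_coe]
  rw [← hh'.2, h.symm_apply_apply, hD.bX_adj hf, ← hl.pair]
  simp

theorem conj_unip {f : X →ₗ[K] W} (hf : ∀ s x, f (D.opX s x) = D.opW s (f x)) (e : U →ₗ[K] W)
    {g : W ≃ₗ[K] W} {h : X ≃ₗ[K] X} {g' : U ≃ₗ[K] U} (hl : D.IsLevi tr g h g') :
    (blockDiag g h g').conj (D.unip f e) = D.unip ((g : W →ₗ[K] W) ∘ₗ f ∘ₗ (h.symm : X →ₗ[K] X))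
      ((g : W →ₗ[K] W) ∘ₗ e ∘ₗ (g'.symm : U →ₗ[K] U)) := by
  refine LinearMap.ext fun v => ?_
  obtain ⟨w, x, u⟩ := v
  rw [unip_apply, LinearEquiv.conj_apply_apply, blockDiag_symm_apply, unip_apply, blockDiag_apply,
    hD.adj_conj hf hl]
  simp

/-- Conjugation replaces `ξ` by `g ξ h⁻¹` and `η` by `g η g'⁻¹`; in `ξ*η⁻¹ξ` the factors `g` and
`g'` cancel. So the norm is invariant under `GL(W)` and equivariant under `H`. -/
theorem conj_mem_unipRadInv {n : Module.End K (W × X × U)} (hn : n ∈ D.unipRadInv)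
    {g : W ≃ₗ[K] W} {h : X ≃ₗ[K] X} {g' : U ≃ₗ[K] U} (hl : D.IsLevi tr g h g') :
    (blockDiag g h g').conj n ∈ D.unipRadInv ∧
    D.normMap ((blockDiag g h g').conj n) = h.conj (D.normMap n) := by
  obtain ⟨f, e, hf, he, hr, rfl⟩ := (hD.mem_unipRad_iff n).1 hn.1
  have hh := (hD.mem_isomX_iff h).1 hl.mem
  have hh' := (hD.mem_isomX_iff _).1 hl.symm.mem
  have hb : Function.Bijective e := by simpa [etaOf_unip] using hn.2
  rw [hD.conj_unip hf e hl]
  refine ⟨⟨hD.unip_mem (fun s x => by simp [hh'.1, hf, hl.opW])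
    (fun s x => by simp [hl.symm.opU, he, hl.opW]) fun u v => ?_, ?_⟩, ?_⟩
  · have := hr (g'.symm u) (g'.symm v)
    rw [← hl.pair _ (e (g'.symm v)), ← hl.pair _ (e (g'.symm u)), ← hh.2] at this
    rw [hD.adj_conj hf hl]
    simpa using this
  · rw [etaOf_unip]
    simpa using hb
  · rw [normMap_unip, normMap_unip, hD.adj_conj hf hl]
    have : linInv ((g : W →ₗ[K] W) ∘ₗ e ∘ₗ (g'.symm : U →ₗ[K] U)) =
        (g' : U →ₗ[K] U) ∘ₗ linInv e ∘ₗ (g.symm : W →ₗ[K] W) :=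
      linInv_eq (fun x => by simp [apply_linInv hb]) fun x => by simp [linInv_apply hb]
    rw [this]
    ext x
    simp [LinearEquiv.conj_apply_apply]

end IsHerm

end Levi

end LeviDatum

/-! ### The section n_Y and the fibres of the norm -/

namespace LeviDatum

section Orbits

variable {K S C W X U : Type*} [Field K] [AddCommGroup C] [Module K C]
    [AddCommGroup W] [Module K W] [AddCommGroup X] [Module K X] [AddCommGroup U] [Module K U]
variable {D : LeviDatum K S C W X U} {tr : C →ₗ[K] K} {σ : S → S} {opC : S → Module.End K C}

namespace IsHerm

variable (hD : D.IsHerm tr σ opC)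
include hD
variable [FiniteDimensional K W] [FiniteDimensional K X] [FiniteDimensional K U]

theorem adj_injective {f : X →ₗ[K] W} (hf : ∀ s x, f (D.opX s x) = D.opW s (f x))
    (hs : Function.Surjective f) : Function.Injective (D.adj (U := U) f) := by
  rw [injective_iff_map_eq_zero]
  refine fun u hu => hD.pair_nondeg_left u fun w => ?_
  obtain ⟨x, rfl⟩ := hs w
  rw [← hD.bX_adj hf, hu]
  simp

theorem adj_mem {Y : Submodule K X} (hY : D.IsNS tr Y) {f : X →ₗ[K] W} (hf : D.IsXi Y f) (u : U) :
    D.adj f u ∈ Y :=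
  hD.mem_of_orth_orth hY fun z hz => by
    rw [hD.bX_adj hf.1, hf.2.2 z ((hD.mem_perp_iff hY.1).2 hz), map_zero]

/-- `ξ*` is injective with values in `Y`, and `ξ` is injective on `Y`; the dimensions of `U` and `W`
agree. -/
theorem comp_adj_bijective {Y : Submodule K X} (hY : D.IsNS tr Y) {f : X →ₗ[K] W}
    (hf : D.IsXi Y f) : Function.Bijective (f ∘ₗ D.adj (U := U) f) := by
  have hs : Function.Surjective f := fun w => by
    obtain ⟨y, _, hy⟩ := hf.2.1.2.2 (Set.mem_univ w)
    exact ⟨y, hy⟩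
  have hinj : Function.Injective (f ∘ₗ D.adj (U := U) f) := fun u v huv =>
    hD.adj_injective hf.1 hs (hf.2.1.2.1 (hD.adj_mem hY hf u) (hD.adj_mem hY hf v) huv)
  exact ⟨hinj, (LinearMap.injective_iff_surjective_of_finrank_eq_finrank hD.finrank_eq).1 hinj⟩

theorem xiPlus_mem {Y : Submodule K X} (hY : D.IsNS tr Y) {f : X →ₗ[K] W} (hf : D.IsXi Y f)
    (w : W) : D.xiPlus f w ∈ Y := hD.adj_mem hY hf _

theorem apply_xiPlus {Y : Submodule K X} (hY : D.IsNS tr Y) {f : X →ₗ[K] W} (hf : D.IsXi Y f)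
    (w : W) : f (D.xiPlus f w) = w := apply_linInv (hD.comp_adj_bijective hY hf) w

theorem xiPlus_apply {Y : Submodule K X} (hY : D.IsNS tr Y) {f : X →ₗ[K] W} (hf : D.IsXi Y f)
    {y : X} (hy : y ∈ Y) : D.xiPlus f (f y) = y :=
  hf.2.1.2.1 (hD.xiPlus_mem hY hf _) hy (hD.apply_xiPlus hY hf _)

theorem xiPlus_op {Y : Submodule K X} (hY : D.IsNS tr Y) {f : X →ₗ[K] W} (hf : D.IsXi Y f)
    (s : S) (w : W) : D.xiPlus f (D.opW s w) = D.opX s (D.xiPlus f w) :=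
  hf.2.1.2.1 (hD.xiPlus_mem hY hf _) (hY.1 s _ (hD.xiPlus_mem hY hf _)) (by
    rw [hD.apply_xiPlus hY hf, hf.1, hD.apply_xiPlus hY hf])

theorem comp_xiPlus_bijective {Y : Submodule K X} (hY : D.IsNS tr Y) {f : X →ₗ[K] W}
    (hf : D.IsXi Y f) {t : X ≃ₗ[K] X} (ht : Set.BijOn (fun y => t y - y) Y Y) :
    Function.Bijective (f ∘ₗ ((t : X →ₗ[K] X) - LinearMap.id) ∘ₗ D.xiPlus f) := by
  have hinj : Function.Injective (f ∘ₗ ((t : X →ₗ[K] X) - LinearMap.id) ∘ₗ D.xiPlus f) := by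
    intro w w' hw
    have h1 := hf.2.1.2.1 (ht.1 (hD.xiPlus_mem hY hf w)) (ht.1 (hD.xiPlus_mem hY hf w')) hw
    have h2 := ht.2.1 (hD.xiPlus_mem hY hf w) (hD.xiPlus_mem hY hf w') h1
    rw [← hD.apply_xiPlus hY hf w, h2, hD.apply_xiPlus hY hf]
  exact ⟨hinj, LinearMap.injective_iff_surjective.1 hinj⟩

/-- The section `n_Y` takes values in `N'`, and composed with the norm it is the identity. -/
theorem nY_mem {Y : Submodule K X} (hY : D.IsNS tr Y) {f : X →ₗ[K] W} (hf : D.IsXi Y f)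
    {t : X ≃ₗ[K] X} (ht1 : t ∈ D.isomFix Y) (ht : Set.BijOn (fun y => t y - y) Y Y) :
    D.nY (U := U) f t ∈ D.unipRadInv ∧ D.normMap (D.nY (U := U) f t) = (t : X →ₗ[K] X) := by
  have hfa := hD.comp_adj_bijective hY hf
  have hc := hD.comp_xiPlus_bijective hY hf ht
  have ht1' := (hD.mem_isomX_iff t).1 ht1.1
  have hs : Function.Surjective f := fun w => ⟨_, hD.apply_xiPlus hY hf w⟩
  set e : U →ₗ[K] W := D.hG f t ∘ₗ f ∘ₗ D.adj f with he
  have heb : Function.Bijective e := (linInv_bijective hc).comp hfa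
  have hce : ∀ u, (f ∘ₗ ((t : X →ₗ[K] X) - LinearMap.id) ∘ₗ D.xiPlus f) (e u) = f (D.adj f u) :=
    fun u => apply_linInv hc _
  have hco : ∀ s w, (f ∘ₗ ((t : X →ₗ[K] X) - LinearMap.id) ∘ₗ D.xiPlus f) (D.opW s w) =
      D.opW s ((f ∘ₗ ((t : X →ₗ[K] X) - LinearMap.id) ∘ₗ D.xiPlus f) w) := fun s w => by
    simp only [LinearMap.comp_apply, hD.xiPlus_op hY hf, LinearMap.sub_apply, LinearEquiv.coe_coe,
      ht1'.1, LinearMap.id_apply, ← map_sub, hf.1]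
  have heo : ∀ s u, e (D.opU s u) = D.opW s (e u) := by
    intro s u
    apply hc.1
    rw [hce, hco, hce, hD.adj_op hf.1, hf.1]
  -- Both sides depend only on the projection of `x` to `Y`. For `x` in `Y` the definition of `e`
  -- makes the two sides equal after applying `f`, and `f` is injective on `Y`, where both lie.
  have hinv : ∀ x, D.adj f (linInv e (f x)) = t x - x := by
    intro x
    obtain ⟨q, hq1, hq2⟩ := hD.exists_proj hY
    have h1 : f x = f (q x) := by
      have := hf.2.2 _ ((hD.mem_perp_iff hY.1).2 (hq2 x))
      rwa [map_sub, sub_eq_zero] at this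
    have h2 : t x - x = t (q x) - q x := by
      have := hD.isomFix_orth hY ht1 (hq2 x)
      rw [map_sub] at this
      rw [← sub_eq_zero] at this ⊢
      rw [← this]
      abel
    rw [h1, h2]
    have h3 : f (D.adj f (linInv e (f (q x)))) = f (t (q x) - q x) := by
      apply (linInv_bijective hc).1
      have h4 : linInv (f ∘ₗ ((t : X →ₗ[K] X) - LinearMap.id) ∘ₗ D.xiPlus f)
          (f (D.adj f (linInv e (f (q x))))) = f (q x) := apply_linInv heb (f (q x))
      rw [h4]
      apply hc.1
      rw [apply_linInv hc]
      simp [hD.xiPlus_apply hY hf (hq1 x)]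
    exact hf.2.1.2.1 (hD.adj_mem hY hf _) (ht.1 (hq1 x)) h3
  -- The computation of `normMap_isom` read backwards: with `e u = f x` and `e v = f y` one gets `t
  -- x = x + ξ* u` and `t y = y + ξ* v`, and the isometry property of `t` expands to the relation.
  have hrel : D.UnipRel tr f e := by
    intro u v
    obtain ⟨x, hx⟩ := hs (e u)
    obtain ⟨y, hy⟩ := hs (e v)
    have hx' := hinv x
    have hy' := hinv y
    rw [hx, linInv_apply heb] at hx'
    rw [hy, linInv_apply heb] at hy'
    have h1 := ht1'.2 x y
    have h2 : t x = x + D.adj f u := by rw [hx']; abel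
    have h3 : t y = y + D.adj f v := by rw [hy']; abel
    rw [h2, h3] at h1
    simp only [map_add, LinearMap.add_apply, hD.bX_adj hf.1 u y, hD.bX_adj_right hf.1 v x,
      hx, hy] at h1
    linear_combination h1
  refine ⟨⟨hD.unip_mem hf.1 heo hrel, ?_⟩, ?_⟩
  · rw [nY, etaOf_unip]
    exact heb
  · rw [nY, normMap_unip]
    ext x
    simp only [LinearMap.add_apply, Module.End.one_apply, LinearMap.comp_apply]
    rw [← he, hinv]
    simp

/-- If the norm of `n(ξ, η)` lies in `H_Y` and `Norm - 1` is invertible on `Y`, then `ξ` is an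
isomorphism of `Y` with `W` extended by zero. -/
theorem isXi_of_norm {Y : Submodule K X}
    (hfr : Module.finrank K Y = Module.finrank K W) {n : Module.End K (W × X × U)}
    (hn : n ∈ D.unipRadInv) {t : X ≃ₗ[K] X} (ht1 : t ∈ D.isomFix Y)
    (ht : Set.BijOn (fun y => t y - y) Y Y) (hnt : D.normMap n = (t : X →ₗ[K] X)) :
    D.IsXi Y (xiOf n) := by
  have hf := xiOf_op hn.1.1
  have hb := hn.2
  have hinv : ∀ x, t x = x + D.adj (xiOf n) (linInv (etaOf n) (xiOf n x)) := fun x => by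
    have := LinearMap.congr_fun hnt x
    simpa [normMap] using this.symm
  -- Where `ξ` vanishes the norm is the identity, whereas `t - 1` is injective on `Y`.
  have hinjY : ∀ y ∈ Y, xiOf n y = 0 → y = 0 := by
    intro y hy h0
    have := hinv y
    rw [h0, map_zero, map_zero, add_zero] at this
    exact ht.2.1 hy Y.zero_mem (by simp [this])
  have hfY : Function.Injective ((xiOf n).domRestrict Y) := by
    rw [injective_iff_map_eq_zero]
    exact fun y hy => Subtype.ext (hinjY y y.2 hy)
  have hsY := (LinearMap.injective_iff_surjective_of_finrank_eq_finrank hfr).1 hfY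
  have hs : Function.Surjective (xiOf n) := fun w => by
    obtain ⟨y, hy⟩ := hsY w
    exact ⟨y, hy⟩
  refine ⟨hf, ⟨fun _ _ => Set.mem_univ _, fun y hy z hz hyz => ?_, fun w _ => ?_⟩, fun x hx => ?_⟩
  · exact sub_eq_zero.1 (hinjY _ (Y.sub_mem hy hz) (by rw [map_sub, hyz, sub_self]))
  · obtain ⟨y, hy⟩ := hsY w
    exact ⟨y, y.2, hy⟩
  · have := hinv x
    rw [ht1.2 x hx, left_eq_add] at this
    have := (map_eq_zero_iff _ (hD.adj_injective hf hs)).1 this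
    exact (map_eq_zero_iff _ (linInv_bijective hb).1).1 this

/-- Two elements of `N'` with the same norm and the same surjective `ξ` are equal. -/
theorem eq_of_norm_eq {n n' : Module.End K (W × X × U)} (hn : n ∈ D.unipRadInv)
    (hn' : n' ∈ D.unipRadInv) (hx : xiOf n = xiOf n') (hs : Function.Surjective (xiOf n))
    (hnorm : D.normMap n = D.normMap n') : n = n' := by
  have he : etaOf n = etaOf n' := by
    have h1 : ∀ w, linInv (etaOf n) w = linInv (etaOf n') w := by
      intro w
      obtain ⟨x, rfl⟩ := hs w
      apply hD.adj_injective (xiOf_op hn.1.1) hs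
      have := LinearMap.congr_fun hnorm x
      rw [normMap, normMap, ← hx] at this
      simpa using this
    ext u
    apply (linInv_bijective hn.2).1
    rw [linInv_apply hn.2, h1, linInv_apply hn'.2]
  rw [hD.eq_unip hn.1, hD.eq_unip hn'.1, hx, he]

/-- The elements of `N'` with norm `t` are conjugate under `GL(W)` to `n_Y(t)`. -/
theorem exists_conj_nY {Y : Submodule K X} (hY : D.IsNS tr Y)
    (hfr : Module.finrank K Y = Module.finrank K W) {n : Module.End K (W × X × U)}
    (hn : n ∈ D.unipRadInv) {t : X ≃ₗ[K] X} (ht1 : t ∈ D.isomFix Y)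
    (ht : Set.BijOn (fun y => t y - y) Y Y) (hnt : D.normMap n = (t : X →ₗ[K] X))
    {f : X →ₗ[K] W} (hf : D.IsXi Y f) :
    ∃ g g', D.IsLevi tr g 1 g' ∧ n = (blockDiag g 1 g').conj (D.nY f t) := by
  have hxi := hD.isXi_of_norm hfr hn ht1 ht hnt
  have hinj : Function.Injective (xiOf n ∘ₗ D.xiPlus f) := fun w w' hw => by
    have := hxi.2.1.2.1 (hD.xiPlus_mem hY hf w) (hD.xiPlus_mem hY hf w') hw
    rw [← hD.apply_xiPlus hY hf w, this, hD.apply_xiPlus hY hf]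
  -- The equation `g ∘ f = ξ` leaves only this candidate, since `f⁺` is a right inverse of `f`.
  let g : W ≃ₗ[K] W := LinearEquiv.ofInjectiveEndo _ hinj
  have hg : ∀ w, g w = xiOf n (D.xiPlus f w) := fun w => rfl
  obtain ⟨g', hl⟩ := hD.exists_isLevi (g := g)
    (fun s w => by rw [hg, hD.xiPlus_op hY hf, hxi.1, hg]) D.isomX.one_mem
  obtain ⟨hm, hnm⟩ := hD.nY_mem hY hf ht1 ht
  obtain ⟨hc1, hc2⟩ := hD.conj_mem_unipRadInv hm hl
  refine ⟨g, g', hl, hD.eq_of_norm_eq hn hc1 ?_ ?_ ?_⟩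
  · rw [nY, hD.conj_unip hf.1 _ hl, xiOf_unip]
    refine hD.ext_of_nondeg hY (fun y hy => ?_) fun y hy => ?_
    · change _ = g (f y)
      rw [hg, hD.xiPlus_apply hY hf hy]
    · change _ = g (f y)
      rw [hf.2.2 y ((hD.mem_perp_iff hY.1).2 hy), hxi.2.2 y ((hD.mem_perp_iff hY.1).2 hy), map_zero]
  · intro w
    obtain ⟨y, _, hy⟩ := hxi.2.1.2.2 (Set.mem_univ w)
    exact ⟨y, hy⟩
  · rw [hc2, hnm, hnt]
    rfl

end IsHerm

end Orbits

end LeviDatum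

/-! ### Base change of linear maps -/

section BaseChange

variable {F K A B : Type*} [Field F] [Field K] [Algebra F K] [AddCommGroup A] [Module F A]
  [AddCommGroup B] [Module F B]

/-- The extension to the base change of a linear functional. -/
noncomputable def Module.Dual.extend (K : Type*) [Field K] [Algebra F K] (l : A →ₗ[F] F) :
    (K ⊗[F] A) →ₗ[K] K := ((Algebra.linearMap F K) ∘ₗ l).liftBaseChange K

theorem Module.Dual.extend_tmul (l : A →ₗ[F] F) (k : K) (a : A) :
    Module.Dual.extend K l (k ⊗ₜ a) = k * algebraMap F K (l a) := by
  simp [Module.Dual.extend]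

/-- A jointly injective family of functionals remains so under base change. -/
theorem eq_zero_of_extend_eq_zero {J : Type*} {L : J → A →ₗ[F] F}
    (hL : ∀ a, (∀ j, L j a = 0) → a = 0) {x : K ⊗[F] A}
    (hx : ∀ j, Module.Dual.extend K (L j) x = 0) : x = 0 := by
  -- Expand `x` in a basis of `K` over `F`. A functional over `F` acts on each coordinate
  -- separately, so the coordinates are killed one by one.
  let κ := Module.Basis.ofVectorSpace F K
  obtain ⟨c, rfl⟩ := TensorProduct.eq_repr_basis_left κ x
  have : c = 0 := by
    ext i
    refine hL _ fun j => ?_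
    have h1 := hx j
    rw [Finsupp.sum, map_sum] at h1
    have h2 : ∑ i ∈ c.support, L j (c i) • κ i = 0 := by
      rw [← h1]
      refine Finset.sum_congr rfl fun i _ => ?_
      rw [Module.Dual.extend_tmul, Algebra.smul_def, mul_comm]
    by_cases hi : i ∈ c.support
    · exact linearIndependent_iff'.1 κ.linearIndependent _ _ h2 i hi
    · rw [Finsupp.notMem_support_iff.1 hi, map_zero]
  rw [this]
  simp

theorem one_tmul_injective {a b : A} (h : (1 : K) ⊗ₜ[F] a = 1 ⊗ₜ b) : a = b := by
  rw [← sub_eq_zero]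
  refine (Module.forall_dual_apply_eq_zero_iff F _).1 fun l => ?_
  have := congrArg (Module.Dual.extend K l) h
  rw [Module.Dual.extend_tmul, Module.Dual.extend_tmul, one_mul, one_mul] at this
  rw [map_sub, (algebraMap F K).injective this, sub_self]

theorem injective_of_baseChange {f : A →ₗ[F] B} (h : Function.Injective (f.baseChange K)) :
    Function.Injective f := fun a b hab => by
  apply one_tmul_injective (F := F) (K := K)
  apply h
  rw [LinearMap.baseChange_tmul, LinearMap.baseChange_tmul, hab]

theorem baseChange_comp_apply {C : Type*} [AddCommGroup C] [Module F C] (f : A →ₗ[F] B)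
    (g : B →ₗ[F] C) (x : K ⊗[F] A) :
    g.baseChange K (f.baseChange K x) = (g ∘ₗ f).baseChange K x := by
  rw [LinearMap.baseChange_comp]
  rfl

theorem baseChange_bijective {f : A →ₗ[F] B} (h : Function.Bijective f) :
    Function.Bijective (f.baseChange K) := by
  refine ⟨Function.LeftInverse.injective (g := (linInv f).baseChange K) fun x => ?_,
    Function.RightInverse.surjective (g := (linInv f).baseChange K) fun x => ?_⟩
  · rw [baseChange_comp_apply, (linInv_spec h).2, LinearMap.baseChange_id]
    rfl
  · rw [baseChange_comp_apply, (linInv_spec h).1, LinearMap.baseChange_id]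
    rfl

theorem linInv_baseChange {f : A →ₗ[F] B} (h : Function.Bijective f) :
    linInv (f.baseChange K) = (linInv f).baseChange K := by
  refine linInv_eq (fun x => ?_) fun x => ?_
  · rw [baseChange_comp_apply, (linInv_spec h).1, LinearMap.baseChange_id]
    rfl
  · rw [baseChange_comp_apply, (linInv_spec h).2, LinearMap.baseChange_id]
    rfl

theorem baseChange_equiv_apply (h : A ≃ₗ[F] B) (x : K ⊗[F] A) :
    h.baseChange F K A B x = (h : A →ₗ[F] B).baseChange K x := rfl

theorem equiv_baseChange_mul (g h : A ≃ₗ[F] A) : (g * h).baseChange F K A A =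
    g.baseChange F K A A * h.baseChange F K A A := by
  ext x
  change ((g : A →ₗ[F] A) ∘ₗ (h : A →ₗ[F] A)).baseChange K x = _
  rw [← baseChange_comp_apply]
  rfl

theorem equiv_baseChange_one : (1 : A ≃ₗ[F] A).baseChange F K A A = 1 := by
  ext x
  change (LinearMap.id : A →ₗ[F] A).baseChange K x = _
  rw [LinearMap.baseChange_id]
  rfl

theorem equiv_baseChange_inv (g : A ≃ₗ[F] A) : (g⁻¹).baseChange F K A A =
    (g.baseChange F K A A)⁻¹ := by
  rw [eq_inv_iff_mul_eq_one, ← equiv_baseChange_mul, inv_mul_cancel, equiv_baseChange_one]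

end BaseChange

/-! ### Base change of the axioms -/

namespace LeviDatum

section

variable {F K S C W X U : Type*} [Field F] [Field K] [Algebra F K] [AddCommGroup C] [Module F C]
    [AddCommGroup W] [Module F W] [AddCommGroup X] [Module F X] [AddCommGroup U] [Module F U]
variable {D : LeviDatum F S C W X U} {tr : C →ₗ[F] F} {σ : S → S} {opC : S → Module.End F C}

theorem bX_baseChange_tmul (k l : K) (x y : X) :
    (D.baseChange K).bX (Module.Dual.extend K tr) (k ⊗ₜ x) (l ⊗ₜ y) =
      k * l * algebraMap F K (D.bX tr x y) := by
  rw [bX_apply, baseChange, bilinBaseChange_tmul, Module.Dual.extend_tmul, bX_apply]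

theorem bP_baseChange_tmul (k l : K) (x : U) (y : W) :
    (D.baseChange K).bP (Module.Dual.extend K tr) (k ⊗ₜ x) (l ⊗ₜ y) =
      k * l * algebraMap F K (D.bP tr x y) := by
  rw [bP_apply, baseChange, bilinBaseChange_tmul, Module.Dual.extend_tmul, bP_apply]

theorem bX_baseChange_tmul_right (y : X) (x : K ⊗[F] X) :
    (D.baseChange K).bX (Module.Dual.extend K tr) x (1 ⊗ₜ y) =
      Module.Dual.extend K ((D.bX tr).flip y) x := by
  induction x with
  | zero => simp
  | add a b ha hb => simp only [map_add, LinearMap.add_apply, ha, hb]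
  | tmul k x => rw [bX_baseChange_tmul, Module.Dual.extend_tmul, mul_one]; rfl

theorem bP_baseChange_tmul_right (y : W) (x : K ⊗[F] U) :
    (D.baseChange K).bP (Module.Dual.extend K tr) x (1 ⊗ₜ y) =
      Module.Dual.extend K ((D.bP tr).flip y) x := by
  induction x with
  | zero => simp
  | add a b ha hb => simp only [map_add, LinearMap.add_apply, ha, hb]
  | tmul k x => rw [bP_baseChange_tmul, Module.Dual.extend_tmul, mul_one]; rfl

theorem bP_baseChange_tmul_left (y : U) (x : K ⊗[F] W) :
    (D.baseChange K).bP (Module.Dual.extend K tr) (1 ⊗ₜ y) x =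
      Module.Dual.extend K (D.bP tr y) x := by
  induction x with
  | zero => simp
  | add a b ha hb => simp only [map_add, ha, hb]
  | tmul k x => rw [bP_baseChange_tmul, Module.Dual.extend_tmul, one_mul]

theorem baseChange_opX (s : S) : (D.baseChange K).opX s = (D.opX s).baseChange K := rfl
theorem baseChange_opW (s : S) : (D.baseChange K).opW s = (D.opW s).baseChange K := rfl
theorem baseChange_opU (s : S) : (D.baseChange K).opU s = (D.opU s).baseChange K := rfl
theorem baseChange_conj : (D.baseChange K).conj = D.conj.baseChange K := rfl
theorem baseChange_sign : (D.baseChange K).sign = D.sign := rfl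
theorem baseChange_form_tmul (k l : K) (x y : X) :
    (D.baseChange K).form (k ⊗ₜ x) (l ⊗ₜ y) = (k * l) ⊗ₜ D.form x y := bilinBaseChange_tmul _ _ _ _ _
theorem baseChange_pair_tmul (k l : K) (x : U) (y : W) :
    (D.baseChange K).pair (k ⊗ₜ x) (l ⊗ₜ y) = (k * l) ⊗ₜ D.pair x y := bilinBaseChange_tmul _ _ _ _ _

theorem eps_baseChange : (D.baseChange K).eps = algebraMap F K D.eps := by
  simp [eps, baseChange_sign]

/-- Two biadditive maps on base changes that agree on pure tensors are equal. -/
theorem tensor_ext₂ {A B M : Type*} [AddCommGroup A] [Module F A] [AddCommGroup B] [Module F B]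
    [AddCommGroup M] {f g : K ⊗[F] A → K ⊗[F] B → M}
    (fl : ∀ a a' b, f (a + a') b = f a b + f a' b) (fr : ∀ a b b', f a (b + b') = f a b + f a b')
    (gl : ∀ a a' b, g (a + a') b = g a b + g a' b) (gr : ∀ a b b', g a (b + b') = g a b + g a b')
    (h : ∀ k a l b, f (k ⊗ₜ a) (l ⊗ₜ b) = g (k ⊗ₜ a) (l ⊗ₜ b)) (a : K ⊗[F] A) (b : K ⊗[F] B) :
    f a b = g a b := by
  have f0 : ∀ b, f 0 b = 0 := fun b => by simpa using fl 0 0 b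
  have g0 : ∀ b, g 0 b = 0 := fun b => by simpa using gl 0 0 b
  have f0' : ∀ b, f b 0 = 0 := fun b => by simpa using fr b 0 0
  have g0' : ∀ b, g b 0 = 0 := fun b => by simpa using gr b 0 0
  induction a with
  | zero => rw [f0, g0]
  | add a a' ha ha' => rw [fl, gl, ha, ha']
  | tmul k a =>
    induction b with
    | zero => rw [f0', g0']
    | add b b' hb hb' => rw [fr, gr, hb, hb']
    | tmul l b => exact h k a l b

theorem tensor_ext {A M : Type*} [AddCommGroup A] [Module F A]
    [AddCommGroup M] {f g : K ⊗[F] A → M}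
    (fl : ∀ a a', f (a + a') = f a + f a')
    (gl : ∀ a a', g (a + a') = g a + g a')
    (h : ∀ k a, f (k ⊗ₜ a) = g (k ⊗ₜ a)) (a : K ⊗[F] A) : f a = g a := by
  induction a with
  | zero =>
    have f0 := fl 0 0
    have g0 := gl 0 0
    simp only [add_zero, left_eq_add] at f0 g0
    rw [f0, g0]
  | add a a' ha ha' => rw [fl, gl, ha, ha']
  | tmul k a => exact h k a

/-- The identities are additive in each variable and are checked on pure tensors. The nondegeneracy
conditions and `tr_sep` are not of this kind; they survive because a separating family of
functionals over `F` remains separating over `K`. -/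
theorem IsHerm.baseChange (hD : D.IsHerm tr σ opC) :
    (D.baseChange K).IsHerm (Module.Dual.extend K tr) σ (fun s => (opC s).baseChange K) where
  invol := hD.invol
  conj_conj := tensor_ext (fun a b => by simp) (fun a b => rfl) fun k a => by
    simp [baseChange_conj, hD.conj_conj]
  tr_conj := tensor_ext (fun a b => by simp) (fun a b => by simp) fun k a => by
    simp [baseChange_conj, Module.Dual.extend_tmul, hD.tr_conj]
  form_symm := tensor_ext₂ (fun a a' b => by simp) (fun a b b' => by simp)
    (fun a a' b => by simp) (fun a b b' => by simp) fun k a l b => by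
      rw [baseChange_form_tmul, baseChange_form_tmul, baseChange_conj, baseChange_sign,
        LinearMap.baseChange_tmul, hD.form_symm a b, mul_comm, TensorProduct.tmul_smul]
  form_op s := tensor_ext₂ (fun a a' b => by simp) (fun a b b' => by simp)
    (fun a a' b => by simp) (fun a b b' => by simp) fun k a l b => by
      rw [baseChange_opX, LinearMap.baseChange_tmul, baseChange_form_tmul, baseChange_form_tmul,
        LinearMap.baseChange_tmul, hD.form_op]
  pair_op s := tensor_ext₂ (fun a a' b => by simp) (fun a b b' => by simp)
    (fun a a' b => by simp) (fun a b b' => by simp) fun k a l b => by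
      rw [baseChange_opW, LinearMap.baseChange_tmul, baseChange_pair_tmul, baseChange_pair_tmul,
        LinearMap.baseChange_tmul, hD.pair_op]
  form_op_left s := tensor_ext₂ (fun a a' b => by simp) (fun a b b' => by simp)
    (fun a a' b => by simp) (fun a b b' => by simp) fun k a l b => by
      rw [baseChange_opX, LinearMap.baseChange_tmul, baseChange_form_tmul, baseChange_opX,
        LinearMap.baseChange_tmul, baseChange_form_tmul, hD.form_op_left]
  pair_op_left s := tensor_ext₂ (fun a a' b => by simp) (fun a b b' => by simp)
    (fun a a' b => by simp) (fun a b b' => by simp) fun k a l b => by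
      rw [baseChange_opU, LinearMap.baseChange_tmul, baseChange_pair_tmul, baseChange_opW,
        LinearMap.baseChange_tmul, baseChange_pair_tmul, hD.pair_op_left]
  conj_op s := tensor_ext (fun a b => by simp) (fun a b => by simp) fun k a => by
    simp [baseChange_conj, hD.conj_op]
  tr_sep c hc := by
    refine eq_zero_of_extend_eq_zero (L := fun s => tr ∘ₗ opC s) hD.tr_sep fun s => ?_
    rw [← hc s]
    exact tensor_ext (f := fun c => Module.Dual.extend K (tr ∘ₗ opC s) c)
      (g := fun c => Module.Dual.extend K tr ((opC s).baseChange K c))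
      (fun a b => by simp) (fun a b => by simp)
      (fun k a => by simp [Module.Dual.extend_tmul]) c
  form_nondeg x hx := by
    refine eq_zero_of_extend_eq_zero (L := fun y => (D.bX tr).flip y) hD.form_nondeg fun y => ?_
    rw [← bX_baseChange_tmul_right, hx]
  pair_nondeg_left x hx := by
    refine eq_zero_of_extend_eq_zero (L := fun y => (D.bP tr).flip y) hD.pair_nondeg_left
      fun y => ?_
    rw [← bP_baseChange_tmul_right, hx]
  pair_nondeg_right x hx := by
    refine eq_zero_of_extend_eq_zero (L := fun y => D.bP tr y) hD.pair_nondeg_right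
      fun y => ?_
    rw [← bP_baseChange_tmul_left, hx]

end

end LeviDatum

/-! ### Base change of subspaces, and rational points of N -/

section BaseChangeSubmodule

variable {F K A B : Type*} [Field F] [Field K] [Algebra F K] [AddCommGroup A] [Module F A]
  [AddCommGroup B] [Module F B]

theorem baseChange_apply_mem {g : A →ₗ[F] B} {Z : Submodule F B} (h : ∀ a, g a ∈ Z)
    (x : K ⊗[F] A) : g.baseChange K x ∈ Z.baseChange K := by
  induction x with
  | zero => simp
  | add a b ha hb => rw [map_add]; exact Submodule.add_mem _ ha hb
  | tmul k a => exact Submodule.tmul_mem_baseChange_of_mem k (h a)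

theorem baseChange_apply_mem_of_mem {g : A →ₗ[F] B} {Y : Submodule F A} {Z : Submodule F B}
    (h : ∀ a ∈ Y, g a ∈ Z) {x : K ⊗[F] A} (hx : x ∈ Y.baseChange K) :
    g.baseChange K x ∈ Z.baseChange K := by
  obtain ⟨z, rfl⟩ := hx
  rw [baseChange_comp_apply]
  exact baseChange_apply_mem (g := g ∘ₗ Y.subtype) (fun a => h _ a.2) z

theorem finrank_submodule_baseChange (Y : Submodule F A) :
    Module.finrank K (Y.baseChange K) = Module.finrank F Y := by
  rw [← Module.finrank_baseChange (R := K) (S := F) (M' := Y)]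
  exact (Submodule.toBaseChange.toLinearEquiv K Y).finrank_eq.symm

end BaseChangeSubmodule

namespace LeviDatum

section

variable {F K S C W X U : Type*} [Field F] [Field K] [Algebra F K] [AddCommGroup C] [Module F C]
    [AddCommGroup W] [Module F W] [AddCommGroup X] [Module F X] [AddCommGroup U] [Module F U]
variable {D : LeviDatum F S C W X U} {tr : C →ₗ[F] F} {σ : S → S} {opC : S → Module.End F C}

namespace IsHerm

variable (hD : D.IsHerm tr σ opC)
include hD

theorem baseChange_orth {Y Z : Submodule F X} (h : ∀ y ∈ Y, ∀ z ∈ Z, D.bX tr y z = 0)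
    {y z : K ⊗[F] X} (hy : y ∈ Y.baseChange K) (hz : z ∈ Z.baseChange K) :
    (D.baseChange K).bX (Module.Dual.extend K tr) y z = 0 := by
  obtain ⟨y, rfl⟩ := hy
  obtain ⟨z, rfl⟩ := hz
  exact tensor_ext₂ (f := fun y z => (D.baseChange K).bX (Module.Dual.extend K tr)
      (Y.subtype.baseChange K y) (Z.subtype.baseChange K z)) (g := fun _ _ => 0)
    (fun a a' b => by simp) (fun a b b' => by simp)
    (fun a a' b => by simp) (fun a b b' => by simp) (fun k a l b => by
      simp only [LinearMap.baseChange_tmul]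
      rw [bX_baseChange_tmul, Submodule.subtype_apply, Submodule.subtype_apply, h _ a.2 _ b.2]
      simp) y z

theorem proj_baseChange {Y : Submodule F X} {q : Module.End F X}
    (hq1 : ∀ x, q x ∈ Y) (hq2 : ∀ x, x - q x ∈ D.orth tr Y) (x : K ⊗[F] X) :
    q.baseChange K x ∈ Y.baseChange K ∧ x - q.baseChange K x ∈
      (D.baseChange K).orth (Module.Dual.extend K tr) (Y.baseChange K) := by
  refine ⟨baseChange_apply_mem hq1 x, fun y hy => ?_⟩
  have h1 : x - q.baseChange K x = (LinearMap.id - q).baseChange K x := by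
    rw [LinearMap.baseChange_sub, LinearMap.baseChange_id]
    rfl
  rw [h1]
  exact hD.baseChange_orth (Z := D.orth tr Y) (fun y hy z hz => hz y hy) hy
    (baseChange_apply_mem (fun a => hq2 a) x)

variable [FiniteDimensional F X]

/-- The orthogonal projection onto `Y` extends to `K ⊗ X`, so a vector of `K ⊗ Y` orthogonal to `K ⊗
Y` is orthogonal to everything. -/
theorem isNS_baseChange {Y : Submodule F X} (hY : D.IsNS tr Y) :
    (D.baseChange K).IsNS (Module.Dual.extend K tr) (Y.baseChange K) := by
  refine ⟨fun s y hy => baseChange_apply_mem_of_mem (hY.1 s) hy, fun y hy h => ?_⟩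
  obtain ⟨q, hq1, hq2⟩ := hD.exists_proj hY
  refine hD.baseChange.form_nondeg y fun x => ?_
  obtain ⟨h1, h2⟩ := hD.proj_baseChange hq1 hq2 x
  have : x = q.baseChange K x + (x - q.baseChange K x) := by abel
  rw [this, map_add, h _ h1, h2 y hy, add_zero]

omit [FiniteDimensional F X] in
theorem isomX_baseChange {h : X ≃ₗ[F] X} (hh : h ∈ D.isomX) :
    h.baseChange F K X X ∈ (D.baseChange K).isomX := by
  have h1 := (hD.mem_isomX_iff h).1 hh
  refine (hD.baseChange.mem_isomX_iff _).2 ⟨fun s => ?_, ?_⟩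
  · exact tensor_ext (fun a b => by simp) (fun a b => by simp) fun k a => by
      simp [baseChange_equiv_apply, baseChange_opX, h1.1]
  · exact tensor_ext₂ (fun a a' b => by simp) (fun a b b' => by simp)
      (fun a a' b => by simp) (fun a b b' => by simp) fun k a l b => by
      simp [baseChange_equiv_apply, bX_baseChange_tmul, h1.2]

/-- On the complement of `K ⊗ Y` the base change of `1 - q` is the identity, so vectors there are
built from `Y^⊥`, where the two maps agree. -/
theorem apply_eq_of_orth_baseChange {Y : Submodule F X} (hY : D.IsNS tr Y) {g g' : Module.End F X}
    (hg : ∀ x ∈ D.orth tr Y, g x = g' x) {x : K ⊗[F] X}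
    (hx : x ∈ (D.baseChange K).orth (Module.Dual.extend K tr) (Y.baseChange K)) :
    g.baseChange K x = g'.baseChange K x := by
  obtain ⟨q, hq1, hq2⟩ := hD.exists_proj hY
  have h1 : q.baseChange K x = 0 := hD.baseChange.proj_of_mem_orth (hD.isNS_baseChange hY)
    (fun x => (hD.proj_baseChange hq1 hq2 x).1) (fun x => (hD.proj_baseChange hq1 hq2 x).2) hx
  have h2 : (LinearMap.id - q).baseChange K x = x := by
    rw [LinearMap.baseChange_sub, LinearMap.baseChange_id, LinearMap.sub_apply, h1, sub_zero]
    rfl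
  rw [← h2, baseChange_comp_apply, baseChange_comp_apply]
  congr 2
  ext y
  exact hg _ (hq2 y)

theorem isomFix_baseChange {Y : Submodule F X} (hY : D.IsNS tr Y) {h : X ≃ₗ[F] X}
    (hh : h ∈ D.isomFix Y) :
    h.baseChange F K X X ∈ (D.baseChange K).isomFix (Y.baseChange K) := by
  refine ⟨hD.isomX_baseChange hh.1, fun x hx => ?_⟩
  rw [hD.baseChange.mem_perp_iff (hD.isNS_baseChange hY).1] at hx
  rw [baseChange_equiv_apply, hD.apply_eq_of_orth_baseChange hY (g' := LinearMap.id)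
    (fun x hx => hD.isomFix_orth hY hh hx) hx, LinearMap.baseChange_id]
  rfl

theorem op_baseChange {f : X →ₗ[F] W} (hf : ∀ s x, f (D.opX s x) = D.opW s (f x)) (s : S)
    (x : K ⊗[F] X) : f.baseChange K ((D.baseChange K).opX s x) =
      (D.baseChange K).opW s (f.baseChange K x) := by
  rw [baseChange_opX, baseChange_opW, baseChange_comp_apply, baseChange_comp_apply]
  congr 2
  ext x
  exact hf s x

theorem adj_baseChange {f : X →ₗ[F] W} (hf : ∀ s x, f (D.opX s x) = D.opW s (f x)) :
    (D.baseChange K).adj (f.baseChange K) = (D.adj f).baseChange K := by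
  refine hD.baseChange.adj_eq (hD.op_baseChange hf) ?_
  exact tensor_ext₂ (fun a a' b => by simp) (fun a b b' => by simp)
      (fun a a' b => by simp) (fun a b b' => by simp) fun k a l b => by
      simp [bX_baseChange_tmul, bP_baseChange_tmul, hD.bX_adj hf]

/-- The base change of an element of `N`. -/
theorem unip_baseChange_mem {n : Module.End F (W × X × U)} (hn : n ∈ D.unipRad) :
    (D.baseChange K).unip ((xiOf n).baseChange K) ((etaOf n).baseChange K) ∈
      (D.baseChange K).unipRad := by
  have hf := xiOf_op hn.1
  have he := etaOf_op hn.1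
  have hr := hD.unipRel_of_mem hn
  refine hD.baseChange.unip_mem (hD.op_baseChange hf) (fun s x => ?_) ?_
  · rw [baseChange_opU, baseChange_opW, baseChange_comp_apply, baseChange_comp_apply]
    congr 2
    ext x
    exact he s x
  · unfold UnipRel
    rw [hD.adj_baseChange hf]
    refine tensor_ext₂ (fun a a' b => ?_) (fun a b b' => ?_) (fun a a' b => by simp)
      (fun a b b' => by simp) fun k a l b => ?_
    · simp only [map_add, LinearMap.add_apply]
      ring
    · simp only [map_add, LinearMap.add_apply]
      ring
    · simp only [LinearMap.baseChange_tmul, bX_baseChange_tmul, bP_baseChange_tmul, eps_baseChange]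
      have := congrArg (algebraMap F K) (hr a b)
      simp only [map_add, map_mul, map_zero] at this
      linear_combination k * l * this

theorem unip_baseChange_apply {n : Module.End F (W × X × U)} (hn : n ∈ D.unipRad)
    (v : W × X × U) : (D.baseChange K).unip ((xiOf n).baseChange K) ((etaOf n).baseChange K)
      (inclV K v) = inclV K (n v) := by
  have h1 := LinearMap.congr_fun (hD.eq_unip hn) v
  obtain ⟨w, x, u⟩ := v
  rw [h1, unip_apply, inclV, inclV, unip_apply, hD.adj_baseChange (xiOf_op hn.1)]
  simp [TensorProduct.tmul_add, TensorProduct.tmul_sub]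

omit hD [FiniteDimensional F X] in
theorem inclV_injective {v w : W × X × U} (h : inclV (F := F) K v = inclV K w) : v = w :=
  Prod.ext (one_tmul_injective (F := F) (K := K) (congrArg Prod.fst h))
    (Prod.ext (one_tmul_injective (F := F) (K := K) (congrArg (fun a => a.2.1) h))
      (one_tmul_injective (F := F) (K := K) (congrArg (fun a => a.2.2) h)))

omit hD [FiniteDimensional F X] in
theorem formV_inclV (v w : W × X × U) :
    (D.baseChange K).formV (inclV K v) (inclV K w) = 1 ⊗ₜ D.formV v w := by
  simp only [formV, inclV, baseChange_form_tmul, baseChange_pair_tmul, baseChange_conj,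
    baseChange_sign, LinearMap.baseChange_tmul, one_mul, TensorProduct.tmul_add,
    TensorProduct.tmul_smul]

omit hD [FiniteDimensional F X] in
theorem opV_inclV (s : S) (v : W × X × U) :
    (D.baseChange K).opV s (inclV K v) = inclV K (D.opV s v) := rfl

/-- The elements of `N` over `F` are those of `N` over `K` that preserve `V`. -/
theorem mem_unipRad_of_baseChange {n : Module.End F (W × X × U)}
    {a : Module.End K ((K ⊗[F] W) × (K ⊗[F] X) × (K ⊗[F] U))} (ha : a ∈ (D.baseChange K).unipRad)
    (han : ∀ v, a (inclV K v) = inclV K (n v)) : n ∈ D.unipRad ∧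
    a = (D.baseChange K).unip ((xiOf n).baseChange K) ((etaOf n).baseChange K) := by
  have hz : ∀ w, inclV (F := F) K ((w, 0, 0) : W × X × U) = (1 ⊗ₜ w, 0, 0) := fun w => by simp [inclV]
  have hz1 : ∀ w, inclV (F := F) K ((0, w, 0) : W × X × U) = (0, 1 ⊗ₜ w, 0) := fun w => by simp [inclV]
  have hz2 : ∀ w, inclV (F := F) K ((0, 0, w) : W × X × U) = (0, 0, 1 ⊗ₜ w) := fun w => by simp [inclV]
  have hn : n ∈ D.unipRad := by
    refine ⟨⟨fun s v => ?_, fun v w => ?_⟩, fun w => ?_, fun x => ?_, fun u => ?_⟩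
    · apply inclV_injective (F := F) (K := K)
      rw [← han, ← opV_inclV, ← opV_inclV, ha.1.1, han]
    · apply one_tmul_injective (F := F) (K := K)
      rw [← formV_inclV, ← formV_inclV, ← han, ← han, ha.1.2]
    · apply inclV_injective (F := F) (K := K)
      rw [← han, hz, ha.2.1]
    · have h1 := ha.2.2.1 (1 ⊗ₜ x)
      rw [← hz1, han] at h1
      refine Prod.ext (one_tmul_injective (F := F) (K := K) (congrArg Prod.fst h1))
        (one_tmul_injective (F := F) (K := K) ((congrArg Prod.snd h1).trans ?_))
      simp
    · have h1 := ha.2.2.2 (1 ⊗ₜ u)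
      rw [← hz2, han] at h1
      exact one_tmul_injective (F := F) (K := K) h1
  refine ⟨hn, ?_⟩
  have h2 : ∀ v, a (inclV K v) = (D.baseChange K).unip ((xiOf n).baseChange K)
      ((etaOf n).baseChange K) (inclV K v) := fun v => by
    rw [han, hD.unip_baseChange_apply hn]
  have ht : ∀ (k : K) (v : W × X × U), a (k • inclV K v) = (D.baseChange K).unip
      ((xiOf n).baseChange K) ((etaOf n).baseChange K) (k • inclV K v) := fun k v => by
    rw [map_smul, map_smul, h2]
  refine LinearMap.ext fun v => ?_
  obtain ⟨w, x, u⟩ := v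
  have hv : ((w, x, u) : (K ⊗[F] W) × (K ⊗[F] X) × (K ⊗[F] U)) =
    (w, 0, 0) + (0, x, 0) + (0, 0, u) := by simp
  rw [hv, map_add, map_add, map_add, map_add]
  congr 1
  · congr 1
    · refine tensor_ext (f := fun w => a (w, 0, 0)) (g := fun w => (D.baseChange K).unip
        ((xiOf n).baseChange K) ((etaOf n).baseChange K) (w, 0, 0)) (fun w w' => ?_)
        (fun w w' => ?_) (fun k w => ?_) w
      · rw [← map_add]; simp
      · rw [← map_add]; simp
      · have := ht k (w, 0, 0)
        rw [hz] at this
        simpa [TensorProduct.smul_tmul'] using this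
    · refine tensor_ext (f := fun w => a (0, w, 0)) (g := fun w => (D.baseChange K).unip
        ((xiOf n).baseChange K) ((etaOf n).baseChange K) (0, w, 0)) (fun w w' => ?_)
        (fun w w' => ?_) (fun k w => ?_) x
      · rw [← map_add]; simp
      · rw [← map_add]; simp
      · have := ht k (0, w, 0)
        rw [hz1] at this
        simpa [TensorProduct.smul_tmul'] using this
  · refine tensor_ext (f := fun w => a (0, 0, w)) (g := fun w => (D.baseChange K).unip
      ((xiOf n).baseChange K) ((etaOf n).baseChange K) (0, 0, w)) (fun w w' => ?_)
      (fun w w' => ?_) (fun k w => ?_) u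
    · rw [← map_add]; simp
    · rw [← map_add]; simp
    · have := ht k (0, 0, w)
      rw [hz2] at this
      simpa [TensorProduct.smul_tmul'] using this

theorem normMap_baseChange {n : Module.End F (W × X × U)} (hn : n ∈ D.unipRadInv) :
    (D.baseChange K).normMap ((D.baseChange K).unip ((xiOf n).baseChange K)
      ((etaOf n).baseChange K)) = (D.normMap n).baseChange K := by
  rw [normMap_unip, hD.adj_baseChange (xiOf_op hn.1.1), linInv_baseChange hn.2, normMap,
    LinearMap.baseChange_add, LinearMap.baseChange_comp, LinearMap.baseChange_comp,
    LinearMap.baseChange_one]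

end IsHerm

end

end LeviDatum

/-- The common eigenspace of a family of operators. -/
def eigSp {K S M : Type*} [Field K] [AddCommGroup M] [Module K M] (op : S → Module.End K M)
    (φ : S → K) : Submodule K M where
  carrier := {x | ∀ s, op s x = φ s • x}
  add_mem' ha hb s := by rw [map_add, ha s, hb s, smul_add]
  zero_mem' s := by simp
  smul_mem' c x hx s := by rw [map_smul, hx s, smul_comm]

theorem mem_eigSp {K S M : Type*} [Field K] [AddCommGroup M] [Module K M] {op : S → Module.End K M}
    {φ : S → K} {x : M} : x ∈ eigSp op φ ↔ ∀ s, op s x = φ s • x := Iff.rfl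

/-- The polynomial `a + b t` in an operator. -/
def affOp {K M : Type*} [Field K] [AddCommGroup M] [Module K M] (a b : K) (t : Module.End K M) :
    Module.End K M := a • LinearMap.id + b • t

theorem affOp_apply {K M : Type*} [Field K] [AddCommGroup M] [Module K M] (a b : K)
    (t : Module.End K M) (x : M) : affOp a b t x = a • x + b • t x := rfl

/-! ### Split operators and hyperbolic planes -/

namespace LeviDatum

section Split

variable {K S C W X U : Type*} [Field K] [AddCommGroup C] [Module K C]
    [AddCommGroup W] [Module K W] [AddCommGroup X] [Module K X] [AddCommGroup U] [Module K U]
variable {D : LeviDatum K S C W X U} {tr : C →ₗ[K] K} {σ : S → S} {opC : S → Module.End K C}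

/-- The operators are split: each of the spaces is the sum of the eigenspaces for `φ` and `φ'`,
two systems of eigenvalues that are exchanged by the involution (and may be equal). -/
structure IsSplit (D : LeviDatum K S C W X U) (σ : S → S) (φ φ' : S → K) (δ : S) (a b : K) :
    Prop where
  conj : ∀ s, φ' s = φ (σ s)
  projW : ∀ x, affOp a b (D.opW δ) x ∈ eigSp D.opW φ ∧ x - affOp a b (D.opW δ) x ∈ eigSp D.opW φ'
  projX : ∀ x, affOp a b (D.opX δ) x ∈ eigSp D.opX φ ∧ x - affOp a b (D.opX δ) x ∈ eigSp D.opX φ'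
  projU : ∀ x, affOp a b (D.opU δ) x ∈ eigSp D.opU φ ∧ x - affOp a b (D.opU δ) x ∈ eigSp D.opU φ'
  swap : ∃ τ : W ≃ₗ[K] W, ∀ s w, τ (D.opW s w) = D.opW (σ s) (τ w)
  even : φ = φ' → Even (Module.finrank K W)

/-- Vectors `e ∈ X_φ` and `f ∈ X_φ'` that span a hyperbolic plane. -/
structure HypPair (D : LeviDatum K S C W X U) (tr : C →ₗ[K] K) (φ φ' : S → K) (e f : X) :
    Prop where
  he : e ∈ eigSp D.opX φ
  hf : f ∈ eigSp D.opX φ'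
  ee : D.bX tr e e = 0
  ff : D.bX tr f f = 0
  ef : D.bX tr e f = 1

/-- A hyperbolic basis of a subspace `Y`, consisting of vectors in `X_φ` and in `X_φ'`. -/
structure HypBasis (D : LeviDatum K S C W X U) (tr : C →ₗ[K] K) (φ φ' : S → K)
    (Y : Submodule K X) {m : ℕ} (e f : Fin m → X) : Prop where
  memE : ∀ i, e i ∈ Y
  memF : ∀ i, f i ∈ Y
  he : ∀ i, e i ∈ eigSp D.opX φ
  hf : ∀ i, f i ∈ eigSp D.opX φ'
  ee : ∀ i j, D.bX tr (e i) (e j) = 0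
  ff : ∀ i j, D.bX tr (f i) (f j) = 0
  ef : ∀ i j, D.bX tr (e i) (f j) = if i = j then 1 else 0
  span : ∀ y ∈ Y, y = ∑ i, D.bX tr y (f i) • e i + ∑ i, D.bX tr (e i) y • f i

variable {φ φ' : S → K} {δ : S} {a b : K}

/-- The orthogonal complement in `Z` of a plane. -/
def planeCompl (D : LeviDatum K S C W X U) (tr : C →ₗ[K] K) (Z : Submodule K X) (e f : X) :
    Submodule K X := Z ⊓ (LinearMap.ker (D.bX tr e) ⊓ LinearMap.ker (D.bX tr f))

theorem mem_planeCompl {Z : Submodule K X} {e f z : X} : z ∈ D.planeCompl tr Z e f ↔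
    z ∈ Z ∧ D.bX tr e z = 0 ∧ D.bX tr f z = 0 := Iff.rfl

namespace IsHerm

variable (hD : D.IsHerm tr σ opC) (hS : D.IsSplit σ φ φ' δ a b)
include hD

theorem fe {e f : X} (h : D.HypPair tr φ φ' e f) : D.bX tr f e = D.eps := by
  rw [hD.bX_symm, h.ef, mul_one]

theorem sub_mem_planeCompl {Z : Submodule K X} {e f : X} (h : D.HypPair tr φ φ' e f)
    (he : e ∈ Z) (hf : f ∈ Z) {z : X} (hz : z ∈ Z) :
    z - (D.bX tr z f • e + D.bX tr e z • f) ∈ D.planeCompl tr Z e f := by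
  refine ⟨Z.sub_mem hz (Z.add_mem (Z.smul_mem _ he) (Z.smul_mem _ hf)), ?_, ?_⟩
  · simp [h.ee, h.ef]
  · simp [h.ff, hD.fe h, hD.bX_symm z f, mul_comm]

include hS

/-- Stability holds because `e` and `f` are eigenvectors of the operators. For nondegeneracy, any
test vector of `Z` may be corrected by an element of the plane. -/
theorem isNS_planeCompl {Z : Submodule K X} (hZ : D.IsNS tr Z) {e f : X}
    (h : D.HypPair tr φ φ' e f) (he : e ∈ Z) (hf : f ∈ Z) :
    D.IsNS tr (D.planeCompl tr Z e f) := by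
  refine ⟨fun s z hz => ⟨hZ.1 s z hz.1, ?_, ?_⟩, fun z hz h0 => hZ.2 z hz.1 fun y hy => ?_⟩
  · have := hz.2.1
    rw [SetLike.mem_coe, LinearMap.mem_ker] at this ⊢
    rw [hD.bX_op_right, mem_eigSp.1 h.he, map_smul, LinearMap.smul_apply, this, smul_zero]
  · have := hz.2.2
    rw [SetLike.mem_coe, LinearMap.mem_ker] at this ⊢
    rw [hD.bX_op_right, mem_eigSp.1 h.hf, map_smul, LinearMap.smul_apply, this, smul_zero]
  · have h1 := h0 _ (hD.sub_mem_planeCompl h he hf hy)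
    have h2 : D.bX tr z e = 0 := by rw [hD.bX_symm, (mem_planeCompl.1 hz).2.1, mul_zero]
    have h3 : D.bX tr z f = 0 := by rw [hD.bX_symm, (mem_planeCompl.1 hz).2.2, mul_zero]
    simpa [h2, h3] using h1

omit hS in
theorem finrank_planeCompl [FiniteDimensional K X] {Z : Submodule K X} {e f : X}
    (h : D.HypPair tr φ φ' e f) (he : e ∈ Z) (hf : f ∈ Z) :
    Module.finrank K (D.planeCompl tr Z e f) + 2 = Module.finrank K Z := by
  let L : Z →ₗ[K] K × K := ((D.bX tr e).prod (D.bX tr f)) ∘ₗ Z.subtype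
  have hL : ∀ z, L z = (D.bX tr e z, D.bX tr f z) := fun z => rfl
  have hs : LinearMap.range L = ⊤ := by
    rw [LinearMap.range_eq_top]
    rintro ⟨c, d⟩
    refine ⟨c • ⟨f, hf⟩ + (D.eps * d) • ⟨e, he⟩, ?_⟩
    rw [map_add, map_smul, map_smul, hL, hL]
    simp only [h.ee, h.ef, h.ff, hD.fe h]
    ext
    · simp
    · simp only [Prod.smul_mk, Prod.mk_add_mk, smul_eq_mul, mul_zero, zero_add]
      linear_combination d * D.eps_mul_eps
  have hk : D.planeCompl tr Z e f = (LinearMap.ker L).map Z.subtype := by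
    ext z
    rw [mem_planeCompl, Submodule.mem_map]
    constructor
    · rintro ⟨h1, h2, h3⟩
      exact ⟨⟨z, h1⟩, Prod.ext h2 h3, rfl⟩
    · rintro ⟨y, hy, rfl⟩
      exact ⟨y.2, congrArg Prod.fst hy, congrArg Prod.snd hy⟩
  have h1 := LinearMap.finrank_range_add_finrank_ker L
  rw [hs, finrank_top, Module.finrank_prod, Module.finrank_self] at h1
  rw [hk, Submodule.finrank_map_subtype_eq]
  omega

/-- Moving an operator across the form multiplies the product by `φ s` on one side and by `φ (σ s) =
φ' s` on the other; a nonzero product would force `φ = φ'`. -/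
theorem bX_eig_self (hne : φ ≠ φ') {x y : X} (hx : x ∈ eigSp D.opX φ) (hy : y ∈ eigSp D.opX φ) :
    D.bX tr x y = 0 := by
  by_contra h0
  apply hne
  funext s
  have := hD.bX_op_left s x y
  rw [hx s, hy (σ s), map_smul, map_smul, LinearMap.smul_apply, smul_eq_mul, smul_eq_mul,
    ← hS.conj] at this
  exact mul_right_cancel₀ h0 this

theorem conj' (s : S) : φ s = φ' (σ s) := by
  rw [hS.conj, hD.invol]

theorem bX_eig_self' (hne : φ ≠ φ') {x y : X} (hx : x ∈ eigSp D.opX φ')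
    (hy : y ∈ eigSp D.opX φ') : D.bX tr x y = 0 := by
  by_contra h0
  apply hne
  funext s
  have := hD.bX_op_left s x y
  rw [hx s, hy (σ s), map_smul, map_smul, LinearMap.smul_apply, smul_eq_mul, smul_eq_mul,
    ← hD.conj' hS] at this
  exact (mul_right_cancel₀ h0 this).symm

omit hD in
theorem _root_.LeviDatum.IsSplit.mem_eigSp_of_eq (heq : φ = φ') (x : X) : x ∈ eigSp D.opX φ := by
  have h := hS.projX x
  rw [← heq] at h
  have := Submodule.add_mem _ h.1 h.2
  rwa [add_sub_cancel] at this

omit hD hS in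
theorem affOp_mem {Z : Submodule K X} (hZ : D.IsNS tr Z) {z : X} (hz : z ∈ Z) :
    affOp a b (D.opX δ) z ∈ Z :=
  Z.add_mem (Z.smul_mem _ hz) (Z.smul_mem _ (hZ.1 _ _ hz))

omit hS in
-- If `x` is not isotropic, the square of `c x + y` is a quadratic polynomial in `c` and has a root;
-- independence of `x` and `y` keeps the vector nonzero.
theorem exists_isotropic_ne [IsAlgClosed K] (h2 : (2 : K) ≠ 0) [FiniteDimensional K X]
    {Z : Submodule K X} (hd : 2 ≤ Module.finrank K Z) :
    ∃ e ∈ Z, e ≠ 0 ∧ D.bX tr e e = 0 := by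
  have : Nontrivial Z := Module.nontrivial_of_finrank_pos (R := K) (by omega)
  obtain ⟨x, hx⟩ := exists_ne (0 : Z)
  by_cases hxx : D.bX tr (x : X) (x : X) = 0
  · exact ⟨x, x.2, by simpa using hx, hxx⟩
  obtain ⟨y, hy⟩ := exists_linearIndependent_pair_of_one_lt_finrank (R := K) (M := Z) (by omega) hx
  rw [LinearIndependent.pair_iff] at hy
  have : NeZero (2 : K) := ⟨h2⟩
  obtain ⟨c, hc⟩ := exists_quadratic_eq_zero (a := D.bX tr (x : X) x)
    (b := D.bX tr (x : X) y + D.bX tr (y : X) x) (c := D.bX tr (y : X) y) hxx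
    (IsAlgClosed.exists_eq_mul_self _)
  refine ⟨c • x + y, Z.add_mem (Z.smul_mem _ x.2) y.2, fun h0 => ?_, ?_⟩
  · have := hy c 1 (Subtype.ext (by simpa using h0))
    exact one_ne_zero this.2
  · simp only [map_add, map_smul, LinearMap.add_apply, LinearMap.smul_apply, smul_eq_mul]
    linear_combination hc

omit hS in
theorem exists_bX_ne_zero {Z : Submodule K X} (hZ : D.IsNS tr Z) {z : X} (hz : z ∈ Z)
    (h0 : z ≠ 0) : ∃ y ∈ Z, D.bX tr z y ≠ 0 := by
  by_contra! h
  exact h0 (hZ.2 z hz h)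

/-- A nonzero stable nondegenerate subspace contains a hyperbolic pair, if its dimension is not
one in the orthogonal case. -/
theorem exists_hypPair [IsAlgClosed K] (h2 : (2 : K) ≠ 0) [FiniteDimensional K X]
    {Z : Submodule K X} (hZ : D.IsNS tr Z) (hne : Z ≠ ⊥)
    (hd : φ = φ' → 2 ≤ Module.finrank K Z) :
    ∃ e ∈ Z, ∃ f ∈ Z, D.HypPair tr φ φ' e f := by
  by_cases heq : φ = φ'
  · obtain ⟨e, he, he0, hee⟩ := hD.exists_isotropic_ne h2 (hd heq)
    obtain ⟨y, hy, hey⟩ := hD.exists_bX_ne_zero hZ he he0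
    set c := D.bX tr e y with hc
    set d := D.bX tr y y with hdd
    have hye : D.bX tr y e = D.eps * c := hD.bX_symm e y
    have hyy : D.eps * d = d := (hD.bX_symm y y).symm
    -- Scale `y` to have product `1` with `e`, then subtract the multiple of `e` that cancels its
    -- square. For the sign `-1` the square `d` is already zero.
    refine ⟨e, he, c⁻¹ • y - (c⁻¹ * c⁻¹ * d / 2) • e, Z.sub_mem (Z.smul_mem _ hy) (Z.smul_mem _ he),
      hS.mem_eigSp_of_eq heq e, ?_, hee, ?_, ?_⟩
    · rw [← heq]
      exact hS.mem_eigSp_of_eq heq _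
    · simp only [map_sub, map_smul, LinearMap.sub_apply, LinearMap.smul_apply, smul_eq_mul,
        ← hc, ← hdd, hye, hee]
      rcases D.eps_eq with h | h
      · rw [h]
        field_simp
        ring
      · rw [h] at hyy
        have hd0 : d = 0 := by
          have : 2 * d = 0 := by linear_combination -hyy
          exact (mul_eq_zero.1 this).resolve_left h2
        rw [hd0]
        simp
    · simp only [map_sub, map_smul, smul_eq_mul, ← hc, hee]
      field_simp
      simp
  · obtain ⟨z, hz, hz0⟩ := Submodule.exists_mem_ne_zero_of_ne_bot hne
    obtain ⟨y, hy, hzy⟩ := hD.exists_bX_ne_zero hZ hz hz0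
    have hpz := affOp_mem (a := a) (b := b) (δ := δ) hZ hz
    have hpy := affOp_mem (a := a) (b := b) (δ := δ) hZ hy
    obtain ⟨z1, z2⟩ := hS.projX z
    obtain ⟨y1, y2⟩ := hS.projX y
    set z' := affOp a b (D.opX δ) z
    set y' := affOp a b (D.opX δ) y
    have key : ∀ e ∈ Z, ∀ f ∈ Z, e ∈ eigSp D.opX φ → f ∈ eigSp D.opX φ' → D.bX tr e f ≠ 0 →
        ∃ e ∈ Z, ∃ f ∈ Z, D.HypPair tr φ φ' e f := fun e he f hf he' hf' hef =>
      ⟨e, he, (D.bX tr e f)⁻¹ • f, Z.smul_mem _ hf, he', Submodule.smul_mem _ _ hf',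
        hD.bX_eig_self hS heq he' he', hD.bX_eig_self' hS heq (Submodule.smul_mem _ _ hf')
          (Submodule.smul_mem _ _ hf'), by rw [map_smul, smul_eq_mul, inv_mul_cancel₀ hef]⟩
    -- The nonzero product of `z` and `y` is a sum of two terms pairing opposite eigenspaces.
    -- Depending on which term survives, `e` is a component of `z` or of `y`.
    by_cases h1 : D.bX tr z' (y - y') = 0
    · refine key y' hpy (z - z') (Z.sub_mem hz hpz) y1 z2 fun h3 => hzy ?_
      have h4 : D.bX tr (z - z') y' = 0 := by rw [hD.bX_symm, h3, mul_zero]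
      have h5 := hD.bX_eig_self hS heq z1 y1
      have h6 := hD.bX_eig_self' hS heq z2 y2
      simp only [map_sub, LinearMap.sub_apply] at h1 h4 h6
      linear_combination h1 + h4 + h5 + h6
    · exact key z' hpz (y - y') (Z.sub_mem hy hpy) z1 y2 h1

end IsHerm

end Split

end LeviDatum

/-! ### Hyperbolic bases and their conjugacy -/

namespace LeviDatum

section HypBases

variable {K S C W X U : Type*} [Field K] [AddCommGroup C] [Module K C]
    [AddCommGroup W] [Module K W] [AddCommGroup X] [Module K X] [AddCommGroup U] [Module K U]
variable {D : LeviDatum K S C W X U} {tr : C →ₗ[K] K} {σ : S → S} {opC : S → Module.End K C}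
variable {φ φ' : S → K} {δ : S} {a b : K}

theorem HypBasis.finrank_eq {Y : Submodule K X} {m : ℕ} {e f : Fin m → X}
    (hB : D.HypBasis tr φ φ' Y e f) : Module.finrank K Y = 2 * m := by
  let L : Y ≃ₗ[K] (Fin m → K) × (Fin m → K) :=
    { toFun := fun y => (fun i => D.bX tr y (f i), fun i => D.bX tr (e i) y)
      map_add' := fun y z => by ext <;> simp
      map_smul' := fun c y => by ext <;> simp
      invFun := fun c => ∑ i, c.1 i • ⟨e i, hB.memE i⟩ + ∑ i, c.2 i • ⟨f i, hB.memF i⟩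
      left_inv := fun y => Subtype.ext (by simpa using (hB.span y y.2).symm)
      right_inv := fun c => by
        ext i
        · simp [hB.ef, hB.ff]
        · simp [hB.ef, hB.ee] }
  rw [L.finrank_eq]
  simp
  ring

theorem HypBasis.hypPair {Y : Submodule K X} {m : ℕ} {e f : Fin m → X}
    (hB : D.HypBasis tr φ φ' Y e f) (i : Fin m) : D.HypPair tr φ φ' (e i) (f i) :=
  ⟨hB.he i, hB.hf i, hB.ee i i, hB.ff i i, by rw [hB.ef, if_pos rfl]⟩

namespace IsHerm

variable (hD : D.IsHerm tr σ opC) (hS : D.IsSplit σ φ φ' δ a b)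
include hD

theorem hypBasis_fe {Y : Submodule K X} {m : ℕ} {e f : Fin m → X}
    (hB : D.HypBasis tr φ φ' Y e f) (i j : Fin m) :
    D.bX tr (f i) (e j) = if i = j then D.eps else 0 := by
  rw [hD.bX_symm, hB.ef]
  simp [eq_comm]

theorem hypBasis_cons {Z : Submodule K X} {e₀ f₀ : X} (h : D.HypPair tr φ φ' e₀ f₀)
    (he : e₀ ∈ Z) (hf : f₀ ∈ Z) {m : ℕ} {e f : Fin m → X}
    (hB : D.HypBasis tr φ φ' (D.planeCompl tr Z e₀ f₀) e f) :
    D.HypBasis tr φ φ' Z (Fin.cons e₀ e : Fin (m + 1) → X) (Fin.cons f₀ f : Fin (m + 1) → X) := by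
  have e1 : ∀ i, D.bX tr e₀ (e i) = 0 := fun i => (mem_planeCompl.1 (hB.memE i)).2.1
  have e2 : ∀ i, D.bX tr e₀ (f i) = 0 := fun i => (mem_planeCompl.1 (hB.memF i)).2.1
  have e3 : ∀ i, D.bX tr f₀ (e i) = 0 := fun i => (mem_planeCompl.1 (hB.memE i)).2.2
  have e4 : ∀ i, D.bX tr f₀ (f i) = 0 := fun i => (mem_planeCompl.1 (hB.memF i)).2.2
  have e1' : ∀ i, D.bX tr (e i) e₀ = 0 := fun i => by rw [hD.bX_symm, e1, mul_zero]
  have e2' : ∀ i, D.bX tr (f i) e₀ = 0 := fun i => by rw [hD.bX_symm, e2, mul_zero]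
  have e3' : ∀ i, D.bX tr (e i) f₀ = 0 := fun i => by rw [hD.bX_symm, e3, mul_zero]
  have e4' : ∀ i, D.bX tr (f i) f₀ = 0 := fun i => by rw [hD.bX_symm, e4, mul_zero]
  constructor
  · exact Fin.cases he fun i => (hB.memE i).1
  · exact Fin.cases hf fun i => (hB.memF i).1
  · exact Fin.cases h.he hB.he
  · exact Fin.cases h.hf hB.hf
  · exact Fin.cases (Fin.cases h.ee e1) fun i => Fin.cases (e1' i) (hB.ee i)
  · exact Fin.cases (Fin.cases h.ff e4) fun i => Fin.cases (e4' i) (hB.ff i)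
  · refine Fin.cases (Fin.cases ?_ fun i => ?_) fun i => Fin.cases ?_ fun j => ?_
    · simpa using h.ef
    · simpa [(Fin.succ_ne_zero i).symm] using e2 i
    · simpa using e3' i
    · simpa using hB.ef i j
  · intro z hz
    have h1 := hB.span _ (hD.sub_mem_planeCompl h he hf hz)
    simp only [map_sub, map_add, map_smul, LinearMap.sub_apply, LinearMap.add_apply,
      LinearMap.smul_apply, e1', e2, e3', e4, smul_zero, add_zero, sub_zero] at h1
    rw [Fin.sum_univ_succ, Fin.sum_univ_succ]
    simp only [Fin.cons_zero, Fin.cons_succ]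
    rw [sub_eq_iff_eq_add] at h1
    conv_lhs => rw [h1]
    abel

include hS

/-- Construction of a hyperbolic basis by successively splitting off hyperbolic planes. -/
theorem exists_hypBasis [FiniteDimensional K X] (P : X → Prop) (R : Submodule K X → Prop)
    (step : ∀ Z, D.IsNS tr Z → R Z → Z ≠ ⊥ → ∃ e ∈ Z, ∃ f ∈ Z, D.HypPair tr φ φ' e f ∧ P e ∧ P f ∧
      R (D.planeCompl tr Z e f)) {Y : Submodule K X} (hY : D.IsNS tr Y) (hR : R Y) :
    ∃ (m : ℕ) (e f : Fin m → X), D.HypBasis tr φ φ' Y e f ∧ ∀ i, P (e i) ∧ P (f i) := by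
  obtain ⟨d, hd⟩ : ∃ d, Module.finrank K Y = d := ⟨_, rfl⟩
  induction d using Nat.strong_induction_on generalizing Y with
  | _ d ih =>
    by_cases h0 : Y = ⊥
    · refine ⟨0, Fin.elim0, Fin.elim0, ⟨fun i => i.elim0, fun i => i.elim0, fun i => i.elim0,
        fun i => i.elim0, fun i => i.elim0, fun i => i.elim0, fun i => i.elim0, fun y hy => ?_⟩,
        fun i => i.elim0⟩
      rw [h0, Submodule.mem_bot] at hy
      simp [hy]
    · obtain ⟨e₀, he, f₀, hf, hp, hP1, hP2, hR'⟩ := step Y hY hR h0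
      have hfr := hD.finrank_planeCompl hp he hf
      obtain ⟨m, e, f, hB, hP⟩ := ih _ (by omega) (hD.isNS_planeCompl hS hY hp he hf) hR' rfl
      exact ⟨m + 1, _, _, hD.hypBasis_cons hp he hf hB,
        Fin.cases ⟨hP1, hP2⟩ hP⟩

/-- Stable nondegenerate subspaces of the same dimension have bases of the same type. -/
theorem exists_frame [IsAlgClosed K] (h2 : (2 : K) ≠ 0) [FiniteDimensional K X] (n : ℕ) :
    ∃ (G : Fin n → Fin n → K) (χ : Fin n → S → K), ∀ Z, D.IsNS tr Z → Module.finrank K Z = n →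
      ∃ g : Fin n → X, (∀ i, g i ∈ Z) ∧ (∀ i, g i ∈ eigSp D.opX (χ i)) ∧
        (∀ i j, D.bX tr (g i) (g j) = G i j) ∧ Z ≤ Submodule.span K (Set.range g) := by
  induction n using Nat.twoStepInduction with
  | zero =>
    refine ⟨fun _ _ => 0, fun _ => φ, fun Z hZ h0 => ⟨Fin.elim0, fun i => i.elim0, fun i => i.elim0,
      fun i => i.elim0, ?_⟩⟩
    rw [Submodule.finrank_eq_zero.1 h0]
    exact bot_le
  | one =>
    refine ⟨fun _ _ => 1, fun _ => φ, fun Z hZ h1 => ?_⟩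
    have hne : Z ≠ ⊥ := by
      rintro rfl
      simp at h1
    by_cases heq : φ = φ'
    · obtain ⟨z, hz, hz0⟩ := Submodule.exists_mem_ne_zero_of_ne_bot hne
      have hspan : ∀ y ∈ Z, ∃ c : K, c • z = y := fun y hy => by
        obtain ⟨c, hc⟩ := (finrank_eq_one_iff_of_nonzero' (⟨z, hz⟩ : Z)
          (by simpa using hz0)).1 h1 ⟨y, hy⟩
        exact ⟨c, congrArg Subtype.val hc⟩
      have hzz : D.bX tr z z ≠ 0 := by
        obtain ⟨y, hy, hzy⟩ := hD.exists_bX_ne_zero hZ hz hz0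
        obtain ⟨c, rfl⟩ := hspan y hy
        intro h
        simp [h] at hzy
      -- A square root normalizes the generator of the line to have square `1`, the entry prescribed
      -- by the Gram matrix.
      obtain ⟨r, hr⟩ := IsAlgClosed.exists_eq_mul_self (D.bX tr z z)
      have hr0 : r ≠ 0 := by
        rintro rfl
        simp [hr] at hzz
      refine ⟨fun _ => r⁻¹ • z, fun _ => Z.smul_mem _ hz, fun _ => hS.mem_eigSp_of_eq heq _,
        fun i j => ?_, fun y hy => ?_⟩
      · simp only [map_smul, LinearMap.smul_apply, smul_eq_mul, hr]
        field_simp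
      · obtain ⟨c, rfl⟩ := hspan y hy
        have : c • z = (c * r) • (r⁻¹ • z) := by
          rw [smul_smul, mul_assoc, mul_inv_cancel₀ hr0, mul_one]
        rw [this]
        exact Submodule.smul_mem _ _ (Submodule.subset_span ⟨0, rfl⟩)
    -- For distinct eigenvalue systems a stable nondegenerate line cannot exist: it would contain a
    -- hyperbolic plane.
    · obtain ⟨e, he, f, hf, hp⟩ := hD.exists_hypPair hS h2 hZ hne fun h => absurd h heq
      have := hD.finrank_planeCompl hp he hf
      omega
  | more n ih _ =>
    obtain ⟨G, χ, ih⟩ := ih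
    refine ⟨Fin.cons (Fin.cons 0 (Fin.cons 1 fun _ => 0)) (Fin.cons (Fin.cons D.eps
      (Fin.cons 0 fun _ => 0)) fun i => Fin.cons 0 (Fin.cons 0 (G i))), Fin.cons φ (Fin.cons φ' χ),
      fun Z hZ hd => ?_⟩
    have hne : Z ≠ ⊥ := by
      rintro rfl
      simp at hd
    obtain ⟨e, he, f, hf, hp⟩ := hD.exists_hypPair hS h2 hZ hne fun _ => by omega
    have hfr := hD.finrank_planeCompl hp he hf
    obtain ⟨g, hg1, hg2, hg3, hg4⟩ := ih _ (hD.isNS_planeCompl hS hZ hp he hf) (by omega)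
    have e1 : ∀ i, D.bX tr e (g i) = 0 := fun i => (mem_planeCompl.1 (hg1 i)).2.1
    have e2 : ∀ i, D.bX tr f (g i) = 0 := fun i => (mem_planeCompl.1 (hg1 i)).2.2
    have e1' : ∀ i, D.bX tr (g i) e = 0 := fun i => by rw [hD.bX_symm, e1, mul_zero]
    have e2' : ∀ i, D.bX tr (g i) f = 0 := fun i => by rw [hD.bX_symm, e2, mul_zero]
    refine ⟨Fin.cons e (Fin.cons f g), Fin.cases he (Fin.cases hf fun i => (hg1 i).1),
      Fin.cases hp.he (Fin.cases hp.hf hg2), ?_, fun z hz => ?_⟩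
    · exact Fin.cases (Fin.cases hp.ee (Fin.cases hp.ef e1)) (Fin.cases (Fin.cases (hD.fe hp)
        (Fin.cases hp.ff e2)) fun i => Fin.cases (e1' i) (Fin.cases (e2' i) (hg3 i)))
    · have h1 := hg4 (hD.sub_mem_planeCompl hp he hf hz)
      set V := Submodule.span K (Set.range (Fin.cons e (Fin.cons f g) : Fin (n + 2) → X))
      have hle : Submodule.span K (Set.range g) ≤ V := by
        rw [Submodule.span_le]
        rintro _ ⟨i, rfl⟩
        exact Submodule.subset_span ⟨i.succ.succ, rfl⟩
      have he' : e ∈ V := Submodule.subset_span ⟨0, rfl⟩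
      have hf' : f ∈ V := Submodule.subset_span ⟨1, rfl⟩
      have := V.add_mem (hle h1) (V.add_mem (V.smul_mem (D.bX tr z f) he')
        (V.smul_mem (D.bX tr e z) hf'))
      rwa [sub_add_cancel] at this

omit hS in
/-- Bases of the same type are conjugate under the isometry group. -/
theorem basis_equiv_mem [FiniteDimensional K X] {J : Type*} [Finite J] (v w : Module.Basis J K X)
    (χ : J → S → K) (hv : ∀ i, v i ∈ eigSp D.opX (χ i)) (hw : ∀ i, w i ∈ eigSp D.opX (χ i))
    (hG : ∀ i j, D.bX tr (v i) (v j) = D.bX tr (w i) (w j)) :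
    v.equiv w (Equiv.refl J) ∈ D.isomX := by
  set h := v.equiv w (Equiv.refl J) with hh
  have hvw : ∀ i, h (v i) = w i := fun i => by simp [hh]
  refine (hD.mem_isomX_iff _).2 ⟨fun s => ?_, ?_⟩
  · have : (h : X →ₗ[K] X) ∘ₗ D.opX s = D.opX s ∘ₗ (h : X →ₗ[K] X) := v.ext fun i => by
      simp [hvw, hv i s, hw i s]
    exact fun x => LinearMap.congr_fun this x
  · have : (D.bX tr).compl₁₂ (h : X →ₗ[K] X) (h : X →ₗ[K] X) = D.bX tr :=
      v.ext fun i => v.ext fun j => by simp [hvw, hG]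
    exact fun x y => LinearMap.congr_fun₂ this x y

omit hS in
/-- The basis of `X` that consists of a hyperbolic basis of `Y` and a basis of its complement. -/
theorem exists_basis_of_hypBasis [FiniteDimensional K X] {Y : Submodule K X} (hY : D.IsNS tr Y)
    {m : ℕ} {e f : Fin m → X} (hB : D.HypBasis tr φ φ' Y e f) {n : ℕ}
    (hn : Module.finrank K (D.orth tr Y) = n) {g : Fin n → X}
    (hg : D.orth tr Y ≤ Submodule.span K (Set.range g)) :
    ∃ v : Module.Basis ((Fin m ⊕ Fin m) ⊕ Fin n) K X,
      ⇑v = Sum.elim (Sum.elim e f) g := by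
  have hspan : ⊤ ≤ Submodule.span K (Set.range (Sum.elim (Sum.elim e f) g)) := by
    intro x _
    set V := Submodule.span K (Set.range (Sum.elim (Sum.elim e f) g))
    obtain ⟨q, hq1, hq2⟩ := hD.exists_proj hY
    have h1 : q x ∈ V := by
      rw [hB.span _ (hq1 x)]
      exact V.add_mem (V.sum_mem fun i _ => V.smul_mem _ (Submodule.subset_span ⟨.inl (.inl i), rfl⟩))
        (V.sum_mem fun i _ => V.smul_mem _ (Submodule.subset_span ⟨.inl (.inr i), rfl⟩))
    have hle : Submodule.span K (Set.range g) ≤ V := by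
      rw [Submodule.span_le]
      rintro _ ⟨i, rfl⟩
      exact Submodule.subset_span ⟨.inr i, rfl⟩
    have := V.add_mem h1 (hle (hg (hq2 x)))
    rwa [add_sub_cancel] at this
  have hc : IsCompl Y (D.orth tr Y) := by
    refine ⟨?_, ?_⟩
    · rw [Submodule.disjoint_def]
      exact fun x h1 h2 => hD.eq_zero_of_mem_orth hY h1 h2
    · rw [codisjoint_iff, Submodule.eq_top_iff']
      intro x
      obtain ⟨q, hq1, hq2⟩ := hD.exists_proj hY
      exact Submodule.mem_sup.2 ⟨q x, hq1 x, _, hq2 x, by abel⟩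
  have hcard : Fintype.card ((Fin m ⊕ Fin m) ⊕ Fin n) = Module.finrank K X := by
    rw [← Submodule.finrank_add_eq_of_isCompl hc, hB.finrank_eq, hn]
    simp
    ring
  exact ⟨basisOfTopLeSpanOfCardEqFinrank _ hspan hcard, by simp⟩

omit hS in
theorem hypBasis_equiv_mem [FiniteDimensional K X] {Y Y' : Submodule K X} {m : ℕ}
    {e f e' f' : Fin m → X} (hB : D.HypBasis tr φ φ' Y e f) (hB' : D.HypBasis tr φ φ' Y' e' f')
    {n : ℕ} {g g' : Fin n → X} {χ : Fin n → S → K} {G : Fin n → Fin n → K}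
    (hg1 : ∀ i, g i ∈ D.orth tr Y) (hg1' : ∀ i, g' i ∈ D.orth tr Y')
    (hg2 : ∀ i, g i ∈ eigSp D.opX (χ i)) (hg2' : ∀ i, g' i ∈ eigSp D.opX (χ i))
    (hg3 : ∀ i j, D.bX tr (g i) (g j) = G i j) (hg3' : ∀ i j, D.bX tr (g' i) (g' j) = G i j)
    {v w : Module.Basis ((Fin m ⊕ Fin m) ⊕ Fin n) K X} (hv : ⇑v = Sum.elim (Sum.elim e f) g)
    (hw : ⇑w = Sum.elim (Sum.elim e' f') g') : v.equiv w (Equiv.refl _) ∈ D.isomX := by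
  have o1 : ∀ i j, D.bX tr (e i) (g j) = 0 := fun i j => hg1 j _ (hB.memE i)
  have o2 : ∀ i j, D.bX tr (f i) (g j) = 0 := fun i j => hg1 j _ (hB.memF i)
  have o3 : ∀ i j, D.bX tr (g j) (e i) = 0 := fun i j => hD.mem_orth'.1 (hg1 j) _ (hB.memE i)
  have o4 : ∀ i j, D.bX tr (g j) (f i) = 0 := fun i j => hD.mem_orth'.1 (hg1 j) _ (hB.memF i)
  have o1' : ∀ i j, D.bX tr (e' i) (g' j) = 0 := fun i j => hg1' j _ (hB'.memE i)
  have o2' : ∀ i j, D.bX tr (f' i) (g' j) = 0 := fun i j => hg1' j _ (hB'.memF i)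
  have o3' : ∀ i j, D.bX tr (g' j) (e' i) = 0 := fun i j => hD.mem_orth'.1 (hg1' j) _ (hB'.memE i)
  have o4' : ∀ i j, D.bX tr (g' j) (f' i) = 0 := fun i j => hD.mem_orth'.1 (hg1' j) _ (hB'.memF i)
  refine hD.basis_equiv_mem v w (Sum.elim (Sum.elim (fun _ => φ) fun _ => φ') χ) ?_ ?_ ?_
  · rw [hv]
    rintro ((i | i) | i)
    · exact hB.he i
    · exact hB.hf i
    · exact hg2 i
  · rw [hw]
    rintro ((i | i) | i)
    · exact hB'.he i
    · exact hB'.hf i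
    · exact hg2' i
  · rw [hv, hw]
    rintro ((i | i) | i) ((j | j) | j) <;>
    simp only [Sum.elim_inl, Sum.elim_inr, hB.ee, hB'.ee, hB.ff, hB'.ff, hB.ef, hB'.ef,
      hD.hypBasis_fe hB, hD.hypBasis_fe hB', hg3, hg3', o1, o2, o3, o4, o1', o2', o3', o4']

/-- Hyperbolic bases of the same size are conjugate under `H`. -/
theorem exists_isomX_hypBasis [IsAlgClosed K] (h2 : (2 : K) ≠ 0) [FiniteDimensional K X]
    {Y Y' : Submodule K X} (hY : D.IsNS tr Y) (hY' : D.IsNS tr Y') {m : ℕ}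
    {e f e' f' : Fin m → X} (hB : D.HypBasis tr φ φ' Y e f) (hB' : D.HypBasis tr φ φ' Y' e' f')
    (hfr : Module.finrank K (D.orth tr Y) = Module.finrank K (D.orth tr Y')) :
    ∃ h ∈ D.isomX, (∀ i, h (e i) = e' i) ∧ ∀ i, h (f i) = f' i := by
  -- This is Witt's theorem by bases: the two complements have frames with the same Gram matrix and
  -- the same eigenvalue types, so matching the completed bases of `X` is an isometry commuting with
  -- the operators.
  obtain ⟨G, χ, hG⟩ := hD.exists_frame hS h2 (Module.finrank K (D.orth tr Y))
  obtain ⟨g, hg1, hg2, hg3, hg4⟩ := hG _ (hD.isNS_orth hY) rfl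
  obtain ⟨g', hg1', hg2', hg3', hg4'⟩ := hG _ (hD.isNS_orth hY') hfr.symm
  obtain ⟨v, hv⟩ := hD.exists_basis_of_hypBasis hY hB rfl hg4
  obtain ⟨w, hw⟩ := hD.exists_basis_of_hypBasis hY' hB' hfr.symm hg4'
  refine ⟨_, hD.hypBasis_equiv_mem hB hB' hg1 hg1' hg2 hg2' hg3 hg3' hv hw, fun i => ?_,
    fun i => ?_⟩
  · have := v.equiv_apply (.inl (.inl i)) w (Equiv.refl _)
    simpa [hv, hw] using this
  · have := v.equiv_apply (.inl (.inr i)) w (Equiv.refl _)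
    simpa [hv, hw] using this

/-- Hyperbolic bases of `Y` are conjugate under `H_Y`. -/
theorem exists_isomFix_hypBasis [IsAlgClosed K] (h2 : (2 : K) ≠ 0) [FiniteDimensional K X]
    {Y : Submodule K X} (hY : D.IsNS tr Y) {m : ℕ}
    {e f e' f' : Fin m → X} (hB : D.HypBasis tr φ φ' Y e f) (hB' : D.HypBasis tr φ φ' Y e' f') :
    ∃ h ∈ D.isomFix Y, (∀ i, h (e i) = e' i) ∧ ∀ i, h (f i) = f' i := by
  obtain ⟨G, χ, hG⟩ := hD.exists_frame hS h2 (Module.finrank K (D.orth tr Y))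
  obtain ⟨g, hg1, hg2, hg3, hg4⟩ := hG _ (hD.isNS_orth hY) rfl
  obtain ⟨v, hv⟩ := hD.exists_basis_of_hypBasis hY hB rfl hg4
  -- Both bases are completed by the same frame of `Y^⊥`, so that the resulting isometry fixes
  -- `Y^⊥`.
  obtain ⟨w, hw⟩ := hD.exists_basis_of_hypBasis hY hB' rfl hg4
  set h := v.equiv w (Equiv.refl _) with hh
  refine ⟨h, ⟨hD.hypBasis_equiv_mem hB hB' hg1 hg1 hg2 hg2 hg3 hg3 hv hw, fun x hx => ?_⟩,
    fun i => ?_, fun i => ?_⟩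
  · have h1 := hg4 ((hD.mem_perp_iff hY.1).1 hx)
    have h3 : ∀ i, h (g i) = g i := fun i => by
      have := v.equiv_apply (.inr i) w (Equiv.refl _)
      simpa [hv, hw] using this
    have h4 : Submodule.span K (Set.range g) ≤ LinearMap.eqLocus (h : X →ₗ[K] X) LinearMap.id := by
      rw [Submodule.span_le]
      rintro _ ⟨i, rfl⟩
      exact h3 i
    exact h4 h1
  · have := v.equiv_apply (.inl (.inl i)) w (Equiv.refl _)
    simpa [hv, hw] using this
  · have := v.equiv_apply (.inl (.inr i)) w (Equiv.refl _)
    simpa [hv, hw] using this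

end IsHerm

end HypBases

end LeviDatum

/-! ### Diagonal subgroups and regular elements -/

namespace LeviDatum

section Diag

variable {K S C W X U : Type*} [Field K] [AddCommGroup C] [Module K C]
    [AddCommGroup W] [Module K W] [AddCommGroup X] [Module K X] [AddCommGroup U] [Module K U]
variable {D : LeviDatum K S C W X U} {tr : C →ₗ[K] K} {σ : S → S} {opC : S → Module.End K C}
variable {φ φ' : S → K} {δ : S} {a b : K}

theorem inv_smul_eq {h : X ≃ₗ[K] X} {v : X} (hv : ∃ c : K, h v = c • v) :
    ∃ c : K, h⁻¹ v = c • v := by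
  obtain ⟨c, hc⟩ := hv
  by_cases h0 : c = 0
  · have : v = 0 := h.injective (by rw [hc, h0, zero_smul, map_zero])
    exact ⟨0, by rw [this]; simp⟩
  · refine ⟨c⁻¹, h.injective ?_⟩
    rw [map_smul, hc, smul_smul, inv_mul_cancel₀ h0, one_smul]
    exact h.apply_symm_apply v

/-- The subgroup of `H_Y` that is diagonal with respect to a hyperbolic basis of `Y`. -/
def diagSub (D : LeviDatum K S C W X U) (Y : Submodule K X) {m : ℕ} (e f : Fin m → X) :
    Subgroup (X ≃ₗ[K] X) where
  carrier := {h | h ∈ D.isomFix Y ∧ ∀ i, (∃ c : K, h (e i) = c • e i) ∧ ∃ c : K, h (f i) = c • f i}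
  one_mem' := ⟨Subgroup.one_mem _, fun i => ⟨⟨1, by simp⟩, 1, by simp⟩⟩
  mul_mem' {g h} hg hh := by
    refine ⟨Subgroup.mul_mem _ hg.1 hh.1, fun i => ⟨?_, ?_⟩⟩
    · obtain ⟨c, hc⟩ := (hg.2 i).1
      obtain ⟨d, hd⟩ := (hh.2 i).1
      exact ⟨d * c, by rw [LinearEquiv.mul_apply, hd, map_smul, hc, smul_smul]⟩
    · obtain ⟨c, hc⟩ := (hg.2 i).2
      obtain ⟨d, hd⟩ := (hh.2 i).2
      exact ⟨d * c, by rw [LinearEquiv.mul_apply, hd, map_smul, hc, smul_smul]⟩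
  inv_mem' {g} hg := ⟨Subgroup.inv_mem _ hg.1, fun i =>
    ⟨inv_smul_eq (hg.2 i).1, inv_smul_eq (hg.2 i).2⟩⟩

/-- The eigenvalues `c_i`, `c_i⁻¹` are distinct where they have to be for a regular element. -/
def Dist {S K : Type*} [Field K] (φ φ' : S → K) {m : ℕ} (c : Fin m → K) : Prop :=
  Function.Injective c ∧ (∀ i, c i ≠ 1) ∧ (φ = φ' → ∀ i j, c i * c j ≠ 1)

namespace IsHerm

variable (hD : D.IsHerm tr σ opC) (hS : D.IsSplit σ φ φ' δ a b)
include hD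

omit hD in
theorem hypBasis_ne {Y : Submodule K X} {m : ℕ} {e f : Fin m → X}
    (hB : D.HypBasis tr φ φ' Y e f) (i : Fin m) : e i ≠ 0 ∧ f i ≠ 0 := by
  have := (hB.hypPair i).ef
  constructor
  · intro h
    simp [h] at this
  · intro h
    simp [h] at this

omit hD in
-- Vectors with a hyperbolic Gram matrix form a hyperbolic basis of their span, which has dimension
-- `2 m` and therefore fills `Y`.
theorem hypBasis_of_gram [FiniteDimensional K X] {Y : Submodule K X} {m : ℕ} {e f : Fin m → X}
    (hfr : Module.finrank K Y ≤ 2 * m) (hE : ∀ i, e i ∈ Y) (hF : ∀ i, f i ∈ Y)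
    (he : ∀ i, e i ∈ eigSp D.opX φ) (hf : ∀ i, f i ∈ eigSp D.opX φ')
    (ee : ∀ i j, D.bX tr (e i) (e j) = 0) (ff : ∀ i j, D.bX tr (f i) (f j) = 0)
    (ef : ∀ i j, D.bX tr (e i) (f j) = if i = j then 1 else 0) :
    D.HypBasis tr φ φ' Y e f := by
  let Z := Submodule.span K (Set.range e ∪ Set.range f)
  have hZ : D.HypBasis tr φ φ' Z e f := by
    refine ⟨fun i => Submodule.subset_span (.inl ⟨i, rfl⟩),
      fun i => Submodule.subset_span (.inr ⟨i, rfl⟩), he, hf, ee, ff, ef, fun y hy => ?_⟩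
    induction hy using Submodule.span_induction with
    | mem y hy =>
      rcases hy with ⟨i, rfl⟩ | ⟨i, rfl⟩
      · simp [ef, ee]
      · simp [ef, ff]
    | zero => simp
    | add y z _ _ hy hz =>
      conv_lhs => rw [hy, hz]
      simp only [map_add, LinearMap.add_apply, add_smul, Finset.sum_add_distrib]
      abel
    | smul c y _ hy =>
      conv_lhs => rw [hy]
      simp only [map_smul, LinearMap.smul_apply, smul_eq_mul, mul_smul, smul_add, Finset.smul_sum]
  have hle : Z ≤ Y := by
    rw [Submodule.span_le]
    rintro _ (⟨i, rfl⟩ | ⟨i, rfl⟩)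
    · exact hE i
    · exact hF i
  have : Z = Y := Submodule.eq_of_le_of_finrank_le hle (by rw [hZ.finrank_eq]; exact hfr)
  rwa [← this]

omit hD in
/-- A linear map is determined by its values on a hyperbolic basis and on the complement. -/
theorem ext_hypBasis [FiniteDimensional K X] (hD : D.IsHerm tr σ opC) {A : Type*} [AddCommGroup A]
    [Module K A] {Y : Submodule K X} (hY : D.IsNS tr Y) {m : ℕ} {e f : Fin m → X}
    (hB : D.HypBasis tr φ φ' Y e f) {g g' : X →ₗ[K] A} (he : ∀ i, g (e i) = g' (e i))
    (hf : ∀ i, g (f i) = g' (f i)) (ho : ∀ x ∈ D.orth tr Y, g x = g' x) : g = g' := by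
  refine hD.ext_of_nondeg hY (fun y hy => ?_) ho
  rw [hB.span y hy]
  simp [he, hf]

/-- The eigenvalues of a diagonal element. -/
theorem exists_coeff_of_diag {h : X ≃ₗ[K] X} (hh : h ∈ D.isomX) {Y : Submodule K X} {m : ℕ}
    {e f : Fin m → X} (hB : D.HypBasis tr φ φ' Y e f)
    (hd : ∀ i, (∃ c : K, h (e i) = c • e i) ∧ ∃ c : K, h (f i) = c • f i) :
    ∃ c : Fin m → K, (∀ i, c i ≠ 0) ∧ (∀ i, h (e i) = c i • e i) ∧
      ∀ i, h (f i) = (c i)⁻¹ • f i := by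
  choose c hc using fun i => (hd i).1
  choose d hd' using fun i => (hd i).2
  have hcd : ∀ i, c i * d i = 1 := fun i => by
    have := ((hD.mem_isomX_iff h).1 hh).2 (e i) (f i)
    rw [hc, hd', map_smul, map_smul, LinearMap.smul_apply, (hB.hypPair i).ef] at this
    simpa [mul_comm] using this
  refine ⟨c, fun i h0 => ?_, hc, fun i => ?_⟩
  · have := hcd i
    simp [h0] at this
  · rw [hd', eq_inv_of_mul_eq_one_right (hcd i)]

/-- For `z` in `Y^⊥`, fixed by `t`, invariance of the product of `x` and `z` multiplies it by `c ≠
1`; so `x` is orthogonal to `Y^⊥`. -/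
theorem eigenline_mem [FiniteDimensional K X] {Y : Submodule K X} (hY : D.IsNS tr Y)
    {t : X ≃ₗ[K] X} (ht : t ∈ D.isomFix Y) {c : K} (hc : c ≠ 1) {x : X} (hx : t x = c • x) :
    x ∈ Y := by
  refine hD.mem_of_orth_orth hY fun z hz => ?_
  have h1 := ((hD.mem_isomX_iff t).1 ht.1).2 x z
  rw [hD.isomFix_orth hY ht hz, hx, map_smul, LinearMap.smul_apply, smul_eq_mul] at h1
  have h3 : (c - 1) * D.bX tr x z = 0 := by linear_combination h1
  exact (mul_eq_zero.1 h3).resolve_left (sub_ne_zero.2 hc)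

omit hD in
theorem eq_zero_of_scale {c r : K} (hc : c ≠ 1) (h : c * r = r) : r = 0 := by
  have h3 : (c - 1) * r = 0 := by linear_combination h
  exact (mul_eq_zero.1 h3).resolve_left (sub_ne_zero.2 hc)

theorem bX_eq_zero_of_eig {t : X ≃ₗ[K] X} (ht : t ∈ D.isomX) {x y : X} {c d : K}
    (hx : t x = c • x) (hy : t y = d • y) (hcd : c * d ≠ 1) : D.bX tr x y = 0 := by
  refine eq_zero_of_scale hcd ?_
  have h1 := ((hD.mem_isomX_iff t).1 ht).2 x y
  rw [hx, hy, map_smul, map_smul, LinearMap.smul_apply, smul_eq_mul, smul_eq_mul] at h1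
  linear_combination h1

include hS

/-- Eigenvectors of an isometry whose eigenvalues have product other than `1` are orthogonal. By
`Dist`, helped by the isotropy of `X_φ` when `φ ≠ φ'`, only the coordinate along `e i` can be
nonzero. -/
theorem eigenline [FiniteDimensional K X] {Y : Submodule K X} (hY : D.IsNS tr Y)
    {m : ℕ} {e f : Fin m → X} (hB : D.HypBasis tr φ φ' Y e f) {t : X ≃ₗ[K] X}
    (ht : t ∈ D.isomFix Y) {c : Fin m → K} (hc0 : ∀ i, c i ≠ 0) (hte : ∀ i, t (e i) = c i • e i)
    (htf : ∀ i, t (f i) = (c i)⁻¹ • f i) (hc : Dist φ φ' c) {i : Fin m} {x : X}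
    (hx : x ∈ eigSp D.opX φ) (htx : t x = c i • x) : x = D.bX tr x (f i) • e i := by
  have hxY := hD.eigenline_mem hY ht (hc.2.1 i) htx
  have h1 : ∀ j, j ≠ i → D.bX tr x (f j) = 0 := fun j hj =>
    hD.bX_eq_zero_of_eig ht.1 htx (htf j) fun h => hj (hc.1 (by
      have := mul_inv_eq_one₀ (hc0 j) |>.1 h
      exact this.symm))
  have h2 : ∀ j, D.bX tr (e j) x = 0 := fun j => by
    by_cases heq : φ = φ'
    · exact hD.bX_eq_zero_of_eig ht.1 (hte j) htx (hc.2.2 heq j i)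
    · exact hD.bX_eig_self hS heq (hB.he j) hx
  have h3 := hB.span x hxY
  rw [Finset.sum_eq_single i (fun j _ hj => by rw [h1 j hj, zero_smul]) (by simp)] at h3
  simpa [h2] using h3

theorem eigenline' [FiniteDimensional K X] {Y : Submodule K X} (hY : D.IsNS tr Y)
    {m : ℕ} {e f : Fin m → X} (hB : D.HypBasis tr φ φ' Y e f) {t : X ≃ₗ[K] X}
    (ht : t ∈ D.isomFix Y) {c : Fin m → K} (hc0 : ∀ i, c i ≠ 0) (hte : ∀ i, t (e i) = c i • e i)
    (htf : ∀ i, t (f i) = (c i)⁻¹ • f i) (hc : Dist φ φ' c) {i : Fin m} {x : X}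
    (hx : x ∈ eigSp D.opX φ') (htx : t x = (c i)⁻¹ • x) : x = D.bX tr (e i) x • f i := by
  have hxY := hD.eigenline_mem hY ht (c := (c i)⁻¹) (by simpa using hc.2.1 i) htx
  have h1 : ∀ j, j ≠ i → D.bX tr (e j) x = 0 := fun j hj =>
    hD.bX_eq_zero_of_eig ht.1 (hte j) htx fun h => hj (hc.1 (mul_inv_eq_one₀ (hc0 i) |>.1 h))
  have h2 : ∀ j, D.bX tr x (f j) = 0 := fun j => by
    by_cases heq : φ = φ'
    · refine hD.bX_eq_zero_of_eig ht.1 htx (htf j) fun h => hc.2.2 heq i j ?_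
      rw [← inv_inj, mul_inv, h, inv_one]
    · exact hD.bX_eig_self' hS heq hx (hB.hf j)
  have h3 := hB.span x hxY
  rw [Finset.sum_eq_single (f := fun i => D.bX tr (e i) x • f i) i
    (fun j _ hj => by rw [h1 j hj, zero_smul]) (by simp)] at h3
  simpa [h2] using h3

/-- What commutes with a regular diagonal element is diagonal. -/
theorem diag_of_comm [FiniteDimensional K X] {Y : Submodule K X} (hY : D.IsNS tr Y)
    {m : ℕ} {e f : Fin m → X} (hB : D.HypBasis tr φ φ' Y e f) {t : X ≃ₗ[K] X}
    (ht : t ∈ D.isomFix Y) {c : Fin m → K} (hc0 : ∀ i, c i ≠ 0) (hte : ∀ i, t (e i) = c i • e i)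
    (htf : ∀ i, t (f i) = (c i)⁻¹ • f i) (hc : Dist φ φ' c) {g : Module.End K X}
    (hg : ∀ s x, g (D.opX s x) = D.opX s (g x)) (hgt : ∀ x, g (t x) = t (g x)) (i : Fin m) :
    (∃ r : K, g (e i) = r • e i) ∧ ∃ r : K, g (f i) = r • f i := by
  refine ⟨⟨_, hD.eigenline hS hY hB ht hc0 hte htf hc (i := i) (fun s => ?_) ?_⟩,
    _, hD.eigenline' hS hY hB ht hc0 hte htf hc (i := i) (fun s => ?_) ?_⟩
  · rw [← hg, hB.he i s, map_smul]
  · rw [← hgt, hte, map_smul]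
  · rw [← hg, hB.hf i s, map_smul]
  · rw [← hgt, htf, map_smul]

omit hS in
theorem bijOn_of_fix [FiniteDimensional K X] {Y : Submodule K X} (hY : D.IsNS tr Y)
    {t : X ≃ₗ[K] X} (ht : t ∈ D.isomFix Y) (h0 : ∀ y ∈ Y, t y = y → y = 0) :
    Set.BijOn (fun y => t y - y) Y Y := by
  have hm : ∀ y ∈ Y, t y - y ∈ Y := fun y hy => Y.sub_mem (hD.isomFix_mem hY ht hy) hy
  let L : Y →ₗ[K] Y := ((t : X →ₗ[K] X) - LinearMap.id).restrict hm
  have hinj : Function.Injective L := by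
    rw [injective_iff_map_eq_zero]
    exact fun y hy => Subtype.ext (h0 y y.2 (sub_eq_zero.1 (congrArg Subtype.val hy)))
  have hs := LinearMap.injective_iff_surjective.1 hinj
  refine ⟨hm, fun y hy z hz hyz => ?_, fun y hy => ?_⟩
  · exact congrArg Subtype.val (hinj (a₁ := ⟨y, hy⟩) (a₂ := ⟨z, hz⟩) (Subtype.ext hyz))
  · obtain ⟨z, hz⟩ := hs ⟨y, hy⟩
    exact ⟨z, z.2, congrArg Subtype.val hz⟩

/-- What commutes with `t` and the operators preserves the eigenlines, which are the lines of the
basis; and no eigenvalue on `Y` is `1`. -/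
theorem mem_regSet_of_dist [FiniteDimensional K X] {Y : Submodule K X} (hY : D.IsNS tr Y)
    {m : ℕ} {e f : Fin m → X} (hB : D.HypBasis tr φ φ' Y e f) {t : X ≃ₗ[K] X}
    (ht : t ∈ D.isomFix Y) {c : Fin m → K} (hc0 : ∀ i, c i ≠ 0) (hte : ∀ i, t (e i) = c i • e i)
    (htf : ∀ i, t (f i) = (c i)⁻¹ • f i) (hc : Dist φ φ' c) :
    t ∈ D.regSet Y (D.diagSub Y e f) := by
  refine ⟨⟨ht, fun i => ⟨⟨_, hte i⟩, _, htf i⟩⟩, fun h hh hht => ⟨hh, fun i => ?_⟩,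
    hD.bijOn_of_fix hY ht fun y hy hty => ?_⟩
  · exact hD.diag_of_comm hS hY hB ht hc0 hte htf hc (g := (h : X →ₗ[K] X))
      ((hD.mem_isomX_iff h).1 hh.1).1 (fun x => congrArg (fun g : X ≃ₗ[K] X => g x) hht) i
  · have hty' : t y = (1 : K) • y := by rw [hty, one_smul]
    rw [hB.span y hy]
    have h1 : ∀ i, D.bX tr y (f i) = 0 := fun i =>
      hD.bX_eq_zero_of_eig ht.1 hty' (htf i) (by simpa using hc.2.1 i)
    have h2 : ∀ i, D.bX tr (e i) y = 0 := fun i =>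
      hD.bX_eq_zero_of_eig ht.1 (hte i) hty' (by simpa using hc.2.1 i)
    simp [h1, h2]

/-- The eigenvectors of a regular diagonal element lie on the lines of the basis. -/
theorem proportional_of_regSet [IsAlgClosed K] (h2 : (2 : K) ≠ 0) [FiniteDimensional K X]
    {Y : Submodule K X} (hY : D.IsNS tr Y)
    {m : ℕ} {e f : Fin m → X} (hB : D.HypBasis tr φ φ' Y e f) {t : X ≃ₗ[K] X}
    (ht : t ∈ D.regSet Y (D.diagSub Y e f)) {c : Fin m → K} (hte : ∀ i, t (e i) = c i • e i)
    (htf : ∀ i, t (f i) = (c i)⁻¹ • f i) {e' f' : Fin m → X}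
    (hB' : D.HypBasis tr φ φ' Y e' f') (hte' : ∀ i, t (e' i) = c i • e' i)
    (htf' : ∀ i, t (f' i) = (c i)⁻¹ • f' i) (i : Fin m) : ∃ r : K, e' i = r • e i := by
  obtain ⟨h, hh, he, hf⟩ := hD.exists_isomFix_hypBasis hS h2 hY hB hB'
  have htY := ht.1.1
  have hcomm : h * t = t * h := by
    have : (h : X →ₗ[K] X) ∘ₗ (t : X →ₗ[K] X) = (t : X →ₗ[K] X) ∘ₗ (h : X →ₗ[K] X) := by
      refine hD.ext_hypBasis hY hB (fun i => ?_) (fun i => ?_) fun x hx => ?_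
      · simp [hte, he, hte']
      · simp [htf, hf, htf']
      · simp [hD.isomFix_orth hY hh hx, hD.isomFix_orth hY htY hx]
    exact LinearEquiv.ext fun x => LinearMap.congr_fun this x
  obtain ⟨r, hr⟩ := ((ht.2.1 h hh hcomm).2 i).1
  exact ⟨r, by rw [← he, hr]⟩

/-- If `c i = c j`, exchange `e i` with `e j`; if `c i * c j = 1` and `φ = φ'`, exchange `e i` with
`f j`. In the new hyperbolic basis `t` is diagonal with the same eigenvalues, so the isometry
between the bases commutes with `t` without being diagonal, against regularity. An eigenvalue `1`
contradicts the injectivity of `t - 1` on `Y`. -/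
theorem dist_of_regSet [IsAlgClosed K] (h2 : (2 : K) ≠ 0) [FiniteDimensional K X]
    {Y : Submodule K X} (hY : D.IsNS tr Y)
    {m : ℕ} {e f : Fin m → X} (hB : D.HypBasis tr φ φ' Y e f) {t : X ≃ₗ[K] X}
    (ht : t ∈ D.regSet Y (D.diagSub Y e f)) {c : Fin m → K}
    (hte : ∀ i, t (e i) = c i • e i)
    (htf : ∀ i, t (f i) = (c i)⁻¹ • f i) : Dist φ φ' c := by
  refine ⟨fun i j hij => ?_, fun i hi => ?_, fun heq i j hij => ?_⟩
  · by_contra hne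
    have hcs : ∀ k, c (Equiv.swap i j k) = c k := fun k => by
      rcases eq_or_ne k i with rfl | h1
      · rw [Equiv.swap_apply_left, hij]
      rcases eq_or_ne k j with rfl | h3
      · rw [Equiv.swap_apply_right, hij]
      rw [Equiv.swap_apply_of_ne_of_ne h1 h3]
    have hB' : D.HypBasis tr φ φ' Y (e ∘ Equiv.swap i j) (f ∘ Equiv.swap i j) :=
      hypBasis_of_gram hB.finrank_eq.le (fun k => hB.memE _) (fun k => hB.memF _)
        (fun k => hB.he _) (fun k => hB.hf _) (fun k l => hB.ee _ _) (fun k l => hB.ff _ _)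
        fun k l => by simp [hB.ef]
    obtain ⟨r, hr⟩ := hD.proportional_of_regSet hS h2 hY hB ht hte htf hB'
      (fun k => by simp [hte, hcs]) (fun k => by simp [htf, hcs]) i
    have h3 := (hB.hypPair j).ef
    rw [Function.comp_apply, Equiv.swap_apply_left] at hr
    rw [hr, map_smul, LinearMap.smul_apply, hB.ef, if_neg hne, smul_zero] at h3
    exact zero_ne_one h3
  · refine (hypBasis_ne hB i).1 (ht.2.2.2.1 (hB.memE i) Y.zero_mem ?_)
    simp [hte, hi]
  · have hci : c i = (c j)⁻¹ := eq_inv_of_mul_eq_one_left hij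
    have hcj : c j = (c i)⁻¹ := eq_inv_of_mul_eq_one_right hij
    have hee := D.eps_mul_eps
    have hfe := hD.hypBasis_fe hB
    -- The case `i = j` is included: the first branch then replaces `(e i, f i)` by `(f i, ε e i)`.
    -- The sign `ε` keeps the product of the pair equal to `1`.
    have hB' : D.HypBasis tr φ φ' Y
        (fun k => if k = i then f j else if k = j then f i else e k)
        (fun k => if k = i then D.eps • e j else if k = j then D.eps • e i else f k) := by
      refine hypBasis_of_gram hB.finrank_eq.le (fun k => ?_) (fun k => ?_)
        (fun k => hS.mem_eigSp_of_eq heq _) (fun k => by rw [← heq]; exact hS.mem_eigSp_of_eq heq _)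
        (fun k l => ?_) (fun k l => ?_) (fun k l => ?_)
      · split_ifs
        exacts [hB.memF _, hB.memF _, hB.memE _]
      · split_ifs
        exacts [Y.smul_mem _ (hB.memE _), Y.smul_mem _ (hB.memE _), hB.memF _]
      · split_ifs <;> simp only [map_smul, LinearMap.smul_apply, smul_eq_mul, hB.ee, hB.ff, hB.ef,
          hfe, mul_zero] <;> grind
      · split_ifs <;> simp only [map_smul, LinearMap.smul_apply, smul_eq_mul, hB.ee, hB.ff, hB.ef,
          hfe, mul_zero] <;> grind
      · split_ifs <;> simp only [map_smul, LinearMap.smul_apply, smul_eq_mul, hB.ee, hB.ff, hB.ef,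
          hfe, mul_zero] <;> grind
    obtain ⟨r, hr⟩ := hD.proportional_of_regSet hS h2 hY hB ht hte htf hB'
      (fun k => by
        split_ifs with h1 h3
        · rw [htf, h1, hci]
        · rw [htf, h3, hcj]
        · exact hte k)
      (fun k => by
        split_ifs with h1 h3
        · rw [map_smul, hte, h1, hcj, smul_comm]
        · rw [map_smul, hte, h3, hci, smul_comm]
        · exact htf k) i
    rw [if_pos rfl] at hr
    have h3 := (hB.hypPair j).ef
    rw [hr, map_smul, hB.ee, smul_zero] at h3
    exact zero_ne_one h3

theorem exists_diag [IsAlgClosed K] (h2 : (2 : K) ≠ 0) [FiniteDimensional K X]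
    {Y : Submodule K X} (hY : D.IsNS tr Y)
    {m : ℕ} {e f : Fin m → X} (hB : D.HypBasis tr φ φ' Y e f) {c : Fin m → K}
    (hc0 : ∀ i, c i ≠ 0) : ∃ t ∈ D.isomFix Y, (∀ i, t (e i) = c i • e i) ∧
      ∀ i, t (f i) = (c i)⁻¹ • f i := by
  refine hD.exists_isomFix_hypBasis hS h2 hY hB (hypBasis_of_gram hB.finrank_eq.le
    (fun i => Y.smul_mem _ (hB.memE i)) (fun i => Y.smul_mem _ (hB.memF i))
    (fun i => Submodule.smul_mem _ _ (hB.he i)) (fun i => Submodule.smul_mem _ _ (hB.hf i))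
    (fun i j => by simp [hB.ee]) (fun i j => by simp [hB.ff]) fun i j => ?_)
  simp only [map_smul, LinearMap.smul_apply, hB.ef, smul_eq_mul]
  split_ifs with h
  · rw [h, mul_one, inv_mul_cancel₀ (hc0 j)]
  · simp

omit hD hS in
-- Prescribe pairwise distinct values of `c + c⁻¹` other than `2` and `-2`. Both `c i = c j` and `c
-- i * c j = 1` make these values equal, and `±2` are the values at `±1`.
theorem exists_dist [IsAlgClosed K] (m : ℕ) : ∃ c : Fin m → K, (∀ i, c i ≠ 0) ∧ Dist φ φ' c := by
  have hinf : (({2, -2} : Set K)ᶜ).Infinite := (Set.toFinite _).infinite_compl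
  have := hinf.to_subtype
  obtain ⟨r⟩ : Nonempty (Fin m ↪ (({2, -2} : Set K)ᶜ : Set K)) :=
    ⟨(Fin.valEmbedding).trans (Infinite.natEmbedding _)⟩
  have key : ∀ i, ∃ c : K, c ≠ 0 ∧ c + c⁻¹ = r i := fun i => by
    obtain ⟨c, hc⟩ := IsAlgClosed.exists_root (k := K)
      (Polynomial.X ^ 2 - Polynomial.C (r i : K) * Polynomial.X + 1) (by
        have : (Polynomial.X ^ 2 - Polynomial.C (r i : K) * Polynomial.X + 1).degree = 2 := by
          compute_degree!
        rw [this]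
        decide)
    simp only [Polynomial.IsRoot.def, Polynomial.eval_add, Polynomial.eval_sub, Polynomial.eval_pow,
      Polynomial.eval_X, Polynomial.eval_mul, Polynomial.eval_C, Polynomial.eval_one] at hc
    have hc0 : c ≠ 0 := by
      rintro rfl
      simp at hc
    refine ⟨c, hc0, ?_⟩
    field_simp
    linear_combination hc
  choose c hc0 hc using key
  have hr : ∀ i, (r i : K) ≠ 2 ∧ (r i : K) ≠ -2 := fun i => by
    have := (r i).2
    rwa [Set.mem_compl_iff, Set.mem_insert_iff, Set.mem_singleton_iff, not_or] at this
  refine ⟨c, hc0, fun i j hij => ?_, fun i hi => ?_, fun _ i j hij => ?_⟩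
  · refine r.injective (Subtype.ext ?_)
    rw [← hc, ← hc, hij]
  · apply (hr i).1
    rw [← hc, hi]
    norm_num
  · have h1 : c i = (c j)⁻¹ := eq_inv_of_mul_eq_one_left hij
    have h3 : i = j := r.injective (Subtype.ext (by rw [← hc, ← hc, h1, inv_inv, add_comm]))
    rw [h3] at hij
    rcases mul_self_eq_one_iff.1 hij with h | h
    · apply (hr j).1
      rw [← hc, h]
      norm_num
    · apply (hr j).2
      rw [← hc, h]
      norm_num

end IsHerm

end Diag

end LeviDatum

/-! ### Hyperbolic bases of common eigenvectors -/

namespace LeviDatum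

section Eigen

variable {K S C W X U : Type*} [Field K] [AddCommGroup C] [Module K C]
    [AddCommGroup W] [Module K W] [AddCommGroup X] [Module K X] [AddCommGroup U] [Module K U]
variable {D : LeviDatum K S C W X U} {tr : C →ₗ[K] K} {σ : S → S} {opC : S → Module.End K C}
variable {φ φ' : S → K} {δ : S} {a b : K}

/-- Common eigenvectors of a set of isometries and of the operators. -/
def IsEig (D : LeviDatum K S C W X U) (φ φ' : S → K) (T : Set (X ≃ₗ[K] X)) (v : X) : Prop :=
  (v ∈ eigSp D.opX φ ∨ v ∈ eigSp D.opX φ') ∧ ∀ t ∈ T, ∃ c : K, t v = c • v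

/-- A stable nondegenerate subspace, also stable under a set of isometries, and not of odd
dimension in the symplectic and orthogonal cases. -/
structure IsStab (D : LeviDatum K S C W X U) (φ φ' : S → K) (Y : Submodule K X)
    (T : Set (X ≃ₗ[K] X)) (Z : Submodule K X) : Prop where
  le : Z ≤ Y
  stable : ∀ t ∈ T, ∀ z ∈ Z, t z ∈ Z
  even : φ = φ' → Even (Module.finrank K Z)

theorem IsEig.smul {T : Set (X ≃ₗ[K] X)} {v : X} (hv : D.IsEig φ φ' T v) (r : K) :
    D.IsEig φ φ' T (r • v) :=
  ⟨hv.1.imp (Submodule.smul_mem _ r) (Submodule.smul_mem _ r), fun t ht => by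
    obtain ⟨c, hc⟩ := hv.2 t ht
    exact ⟨c, by rw [map_smul, hc, smul_comm]⟩⟩

namespace IsHerm

variable (hD : D.IsHerm tr σ opC) (hS : D.IsSplit σ φ φ' δ a b)
include hD
variable [FiniteDimensional K X]

theorem stable_orth {T : Set (X ≃ₗ[K] X)} (hT : T ⊆ D.isomX) {Z : Submodule K X}
    (hZT : ∀ t ∈ T, ∀ z ∈ Z, t z ∈ Z) {t : X ≃ₗ[K] X} (ht : t ∈ T) {x : X}
    (hx : x ∈ D.orth tr Z) : t x ∈ D.orth tr Z := by
  have hle : Z.map (t : X →ₗ[K] X) ≤ Z := by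
    rintro _ ⟨z, hz, rfl⟩
    exact hZT t ht z hz
  have heq : Z.map (t : X →ₗ[K] X) = Z :=
    Submodule.eq_of_le_of_finrank_eq hle (LinearEquiv.finrank_map_eq t Z)
  refine hD.isomX_orth (hT ht) (fun y => ⟨fun hy => ?_, hZT t ht y⟩) x hx
  rw [← heq] at hy
  obtain ⟨z, hz, hzy⟩ := hy
  rwa [← t.injective hzy]

/-- The orthogonal projection onto `Z` commutes with the isometries and with the operators, so it
maps common eigenvectors to common eigenvectors in `Z`. -/
theorem span_isEig {T : Set (X ≃ₗ[K] X)} (hT : T ⊆ D.isomX) {Z : Submodule K X}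
    (hZ : D.IsNS tr Z) (hZT : ∀ t ∈ T, ∀ z ∈ Z, t z ∈ Z)
    (hs : Z ≤ Submodule.span K {v | D.IsEig φ φ' T v}) :
    Z ≤ Submodule.span K {v | v ∈ Z ∧ D.IsEig φ φ' T v} := by
  obtain ⟨q, hq1, hq2⟩ := hD.exists_proj hZ
  have hqT : ∀ t ∈ T, ∀ x, q (t x) = t (q x) := fun t ht x =>
    hD.proj_comm hZ hq1 hq2 (g := (t : X →ₗ[K] X)) (hZT t ht)
      (fun y hy => hD.stable_orth hT hZT ht hy) x
  have hqs : ∀ s x, q (D.opX s x) = D.opX s (q x) := fun s x =>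
    hD.proj_comm hZ hq1 hq2 (hZ.1 s) (hD.orth_op hZ.1 s) x
  intro z hz
  have h1 : q z ∈ (Submodule.span K {v | D.IsEig φ φ' T v}).map q :=
    Submodule.mem_map_of_mem (hs hz)
  rw [hD.proj_of_mem hZ hq1 hq2 hz, Submodule.map_span] at h1
  refine Submodule.span_mono ?_ h1
  rintro _ ⟨v, hv, rfl⟩
  refine ⟨hq1 v, hv.1.imp (fun h s => ?_) (fun h s => ?_), fun t ht => ?_⟩
  · rw [← hqs, h s, map_smul]
  · rw [← hqs, h s, map_smul]
  · obtain ⟨c, hc⟩ := hv.2 t ht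
    exact ⟨c, by rw [← hqT t ht, hc, map_smul]⟩

/-- Common eigenvectors in `Z` are detected by their products with each other. -/
theorem exists_partner {T : Set (X ≃ₗ[K] X)} (hT : T ⊆ D.isomX) {Z : Submodule K X}
    (hZ : D.IsNS tr Z) (hZT : ∀ t ∈ T, ∀ z ∈ Z, t z ∈ Z)
    (hs : Z ≤ Submodule.span K {v | D.IsEig φ φ' T v}) {z : X} (hz : z ∈ Z) (h0 : z ≠ 0) :
    ∃ f ∈ Z, D.IsEig φ φ' T f ∧ D.bX tr z f ≠ 0 := by
  by_contra! h
  refine h0 (hZ.2 z hz fun y hy => ?_)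
  have hle : Submodule.span K {v | v ∈ Z ∧ D.IsEig φ φ' T v} ≤ LinearMap.ker (D.bX tr z) := by
    rw [Submodule.span_le]
    exact fun v hv => h v hv.1 hv.2
  exact hle (hD.span_isEig hT hZ hZT hs hy)

omit [FiniteDimensional K X] in
theorem planeCompl_stable {T : Set (X ≃ₗ[K] X)} (hT : T ⊆ D.isomX) {Z : Submodule K X}
    (hZT : ∀ t ∈ T, ∀ z ∈ Z, t z ∈ Z) {e f : X} (hp : D.HypPair tr φ φ' e f)
    (he : ∀ t ∈ T, ∃ c : K, t e = c • e) (hf : ∀ t ∈ T, ∃ c : K, t f = c • f) :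
    ∀ t ∈ T, ∀ z ∈ D.planeCompl tr Z e f, t z ∈ D.planeCompl tr Z e f := by
  intro t ht z hz
  obtain ⟨c, hc⟩ := he t ht
  obtain ⟨d, hd⟩ := hf t ht
  have hti := ((hD.mem_isomX_iff t).1 (hT ht)).2
  have hcd := hti e f
  rw [hc, hd, map_smul, map_smul, LinearMap.smul_apply, hp.ef, smul_eq_mul, smul_eq_mul,
    mul_one] at hcd
  rw [mem_planeCompl] at hz ⊢
  refine ⟨hZT t ht z hz.1, ?_, ?_⟩
  · have h1 := hti e z
    rw [hc, map_smul, LinearMap.smul_apply, hz.2.1, smul_eq_mul] at h1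
    exact (mul_eq_zero.1 h1).resolve_left (right_ne_zero_of_mul_eq_one hcd)
  · have h1 := hti f z
    rw [hd, map_smul, LinearMap.smul_apply, hz.2.2, smul_eq_mul] at h1
    exact (mul_eq_zero.1 h1).resolve_left (left_ne_zero_of_mul_eq_one hcd)

include hS

/-- Some common eigenvector has nonzero product with `z`. If `φ ≠ φ'` the two vectors lie in
opposite eigenspaces, and the pair is ordered so that the one in `X_φ` comes first. -/
theorem exists_eig_pair {T : Set (X ≃ₗ[K] X)} (hT : T ⊆ D.isomX) {Z : Submodule K X}
    (hZ : D.IsNS tr Z) (hZT : ∀ t ∈ T, ∀ z ∈ Z, t z ∈ Z)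
    (hs : Z ≤ Submodule.span K {v | D.IsEig φ φ' T v}) {z : X} (hz : z ∈ Z) (h0 : z ≠ 0)
    (hze : D.IsEig φ φ' T z) (hzz : D.bX tr z z = 0)
    (hff : ∀ f ∈ Z, D.IsEig φ φ' T f → D.bX tr z f ≠ 0 → D.bX tr f f = 0) :
    ∃ e ∈ Z, ∃ f ∈ Z, D.HypPair tr φ φ' e f ∧ D.IsEig φ φ' T e ∧ D.IsEig φ φ' T f := by
  obtain ⟨f, hf, hfe, hzf⟩ := hD.exists_partner hT hZ hZT hs hz h0
  have hf0 := hff f hf hfe hzf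
  by_cases hzφ : z ∈ eigSp D.opX φ
  · refine ⟨z, hz, (D.bX tr z f)⁻¹ • f, Z.smul_mem _ hf, ⟨hzφ, ?_, hzz, by simp [hf0], ?_⟩, hze,
      hfe.smul _⟩
    · refine Submodule.smul_mem _ _ ?_
      by_cases heq : φ = φ'
      · rw [← heq]
        exact hS.mem_eigSp_of_eq heq _
      · exact hfe.1.resolve_left fun h => hzf (hD.bX_eig_self hS heq hzφ h)
    · rw [map_smul, smul_eq_mul, inv_mul_cancel₀ hzf]
  · have hne : φ ≠ φ' := fun heq => hzφ (hS.mem_eigSp_of_eq heq _)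
    have hzφ' := hze.1.resolve_left hzφ
    have hfz : D.bX tr f z ≠ 0 := by
      rw [hD.bX_symm]
      exact mul_ne_zero D.eps_ne_zero hzf
    refine ⟨f, hf, (D.bX tr f z)⁻¹ • z, Z.smul_mem _ hz, ⟨?_, Submodule.smul_mem _ _ hzφ', hf0,
      by simp [hzz], ?_⟩, hfe, hze.smul _⟩
    · exact hfe.1.resolve_right fun h => hzf (hD.bX_eig_self' hS hne hzφ' h)
    · rw [map_smul, smul_eq_mul, inv_mul_cancel₀ hfz]

/-- A common eigenvector with a weight that is not `±1` is part of a hyperbolic pair. -/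
theorem exists_eig_pair_of_weight {T : Set (X ≃ₗ[K] X)} (hT : T ⊆ D.isomX) {Z : Submodule K X}
    (hZ : D.IsNS tr Z) (hZT : ∀ t ∈ T, ∀ z ∈ Z, t z ∈ Z)
    (hs : Z ≤ Submodule.span K {v | D.IsEig φ φ' T v}) {z : X} (hz : z ∈ Z) (h0 : z ≠ 0)
    (hze : D.IsEig φ φ' T z) {t : X ≃ₗ[K] X} (ht : t ∈ T) {c : K} (hc : t z = c • z)
    (hcc : c * c ≠ 1) :
    ∃ e ∈ Z, ∃ f ∈ Z, D.HypPair tr φ φ' e f ∧ D.IsEig φ φ' T e ∧ D.IsEig φ φ' T f := by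
  refine hD.exists_eig_pair hS hT hZ hZT hs hz h0 hze (hD.bX_eq_zero_of_eig (hT ht) hc hc hcc)
    fun f hf hfe hzf => ?_
  obtain ⟨d, hd⟩ := hfe.2 t ht
  refine hD.bX_eq_zero_of_eig (hT ht) hd hd fun hdd => ?_
  -- A partner of `z` must have eigenvalue `d = c⁻¹`; then `d * d = 1` would give `c * c = 1`, so
  -- the partner is isotropic too.
  by_cases hcd : c * d = 1
  · apply hcc
    calc c * c = c * c * (d * d) := by rw [hdd, mul_one]
      _ = (c * d) * (c * d) := by ring
      _ = 1 := by rw [hcd, mul_one]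
  · exact hzf (hD.bX_eq_zero_of_eig (hT ht) hc hd hcd)

theorem exists_hypBasis_isEig {T : Set (X ≃ₗ[K] X)} (hT : T ⊆ D.isomX) {Y : Submodule K X}
    (hY : D.IsNS tr Y) (hYT : D.IsStab φ φ' Y T Y)
    (step : ∀ Z, D.IsNS tr Z → D.IsStab φ φ' Y T Z → Z ≠ ⊥ →
      ∃ e ∈ Z, ∃ f ∈ Z, D.HypPair tr φ φ' e f ∧ D.IsEig φ φ' T e ∧ D.IsEig φ φ' T f) :
    ∃ (m : ℕ) (e f : Fin m → X), D.HypBasis tr φ φ' Y e f ∧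
      ∀ i, D.IsEig φ φ' T (e i) ∧ D.IsEig φ φ' T (f i) := by
  refine hD.exists_hypBasis hS (D.IsEig φ φ' T) (D.IsStab φ φ' Y T) (fun Z hZ hZT h0 => ?_) hY hYT
  obtain ⟨e, he, f, hf, hp, hee, hfe⟩ := step Z hZ hZT h0
  refine ⟨e, he, f, hf, hp, hee, hfe, inf_le_left.trans hZT.le,
    hD.planeCompl_stable hT hZT.stable hp hee.2 hfe.2, fun heq => ?_⟩
  have h1 := hZT.even heq
  rw [← hD.finrank_planeCompl hp he hf, Nat.even_add] at h1
  exact h1.2 even_two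

/-- A group of isometries that is diagonalizable, and that has no characters of order two, is
diagonal in a hyperbolic basis. -/
theorem exists_hypBasis_of_torus [IsAlgClosed K] (h2 : (2 : K) ≠ 0) {T : Subgroup (X ≃ₗ[K] X)}
    {Y : Submodule K X} (hT : T ≤ D.isomFix Y) (hY : D.IsNS tr Y)
    (heven : φ = φ' → Even (Module.finrank K Y)) {n : ℕ} (v : Module.Basis (Fin n) K X)
    (hv : ∀ t ∈ T, ∀ i, ∃ c : K, t (v i) = c • v i)
    (hconn : ∀ x : X, x ≠ 0 → (∀ t ∈ T, ∃ c : K, t x = c • x ∧ c * c = 1) → ∀ t ∈ T, t x = x) :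
    ∃ (m : ℕ) (e f : Fin m → X), D.HypBasis tr φ φ' Y e f ∧
      ∀ i, D.IsEig φ φ' T (e i) ∧ D.IsEig φ φ' T (f i) := by
  have hT' : (T : Set (X ≃ₗ[K] X)) ⊆ D.isomX := fun t ht => (hT ht).1
  refine hD.exists_hypBasis_isEig hS hT' hY ⟨le_rfl, fun t ht z hz => hD.isomFix_mem hY (hT ht) hz,
    heven⟩ fun Z hZ hZT h0 => ?_
  -- The components of a vector of the diagonalizing basis in the two eigenspaces of the operators
  -- are still eigenvectors of `T`, which commutes with the operators.
  have hs : (⊤ : Submodule K X) ≤ Submodule.span K {v | D.IsEig φ φ' T v} := by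
    rw [← v.span_eq, Submodule.span_le]
    rintro _ ⟨i, rfl⟩
    obtain ⟨p1, p2⟩ := hS.projX (v i)
    have hc : ∀ t ∈ (T : Set (X ≃ₗ[K] X)), ∀ c : K, t (v i) = c • v i →
        t (affOp a b (D.opX δ) (v i)) = c • affOp a b (D.opX δ) (v i) := fun t ht c hc => by
      rw [affOp_apply, map_add, map_smul, map_smul, ((hD.mem_isomX_iff t).1 (hT' ht)).1, hc,
        map_smul, smul_add, smul_comm a, smul_comm b]
    have := Submodule.add_mem _ (Submodule.subset_span (R := K) (s := {v | D.IsEig φ φ' T v})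
      (a := affOp a b (D.opX δ) (v i))
      ⟨.inl p1, fun t ht => by
        obtain ⟨c, hc'⟩ := hv t ht i
        exact ⟨c, hc t ht c hc'⟩⟩) (Submodule.subset_span (R := K) (s := {v | D.IsEig φ φ' T v})
      (a := v i - affOp a b (D.opX δ) (v i)) ⟨.inr p2, fun t ht => by
        obtain ⟨c, hc'⟩ := hv t ht i
        exact ⟨c, by rw [map_sub, hc t ht c hc', hc', smul_sub]⟩⟩)
    rwa [add_sub_cancel] at this
  have hsZ : Z ≤ Submodule.span K {v | D.IsEig φ φ' T v} := le_top.trans hs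
  -- Where `T` acts trivially any hyperbolic pair will do; parity rules out dimension one when `φ =
  -- φ'`. Otherwise some eigenvector is moved, and by `hconn` it has an eigenvalue other than `±1`.
  by_cases htriv : ∀ t ∈ T, ∀ z ∈ Z, t z = z
  · have hfr : φ = φ' → 2 ≤ Module.finrank K Z := fun heq => by
      have := hZT.even heq
      have hpos : 0 < Module.finrank K Z := Nat.pos_of_ne_zero fun h =>
        h0 (Submodule.finrank_eq_zero.1 h)
      obtain ⟨r, hr⟩ := this
      omega
    obtain ⟨e, he, f, hf, hp⟩ := hD.exists_hypPair hS h2 hZ h0 hfr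
    exact ⟨e, he, f, hf, hp, ⟨.inl hp.he, fun t ht => ⟨1, by rw [htriv t ht e he, one_smul]⟩⟩,
      .inr hp.hf, fun t ht => ⟨1, by rw [htriv t ht f hf, one_smul]⟩⟩
  · push Not at htriv
    obtain ⟨t₀, ht₀, z₀, hz₀, hne⟩ := htriv
    obtain ⟨x, ⟨hxZ, hxe⟩, hx⟩ : ∃ x ∈ {v | v ∈ Z ∧ D.IsEig φ φ' T v}, t₀ x ≠ x := by
      by_contra! h
      have hle : Submodule.span K {v | v ∈ Z ∧ D.IsEig φ φ' T v} ≤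
          LinearMap.eqLocus (t₀ : X →ₗ[K] X) LinearMap.id := by
        rw [Submodule.span_le]
        exact fun v hv => h v hv
      exact hne (hle (hD.span_isEig hT' hZ hZT.stable hsZ hz₀))
    have hx0 : x ≠ 0 := by
      rintro rfl
      simp at hx
    obtain ⟨t, ht, c, hc, hcc⟩ : ∃ t ∈ T, ∃ c : K, t x = c • x ∧ c * c ≠ 1 := by
      by_contra! h
      refine hx (hconn x hx0 (fun t ht => ?_) t₀ ht₀)
      obtain ⟨c, hc⟩ := hxe.2 t ht
      exact ⟨c, hc, h t ht c hc⟩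
    exact hD.exists_eig_pair_of_weight hS hT' hZ hZT.stable hsZ hxZ hx0 hxe ht hc hcc

/-- An isometry with eigenvalues of multiplicity one is diagonal in a hyperbolic basis. -/
theorem exists_hypBasis_of_mult_one {t : X ≃ₗ[K] X} {Y : Submodule K X} (ht : t ∈ D.isomFix Y)
    (hY : D.IsNS tr Y) (heven : φ = φ' → Even (Module.finrank K Y))
    (hs : Y ≤ Submodule.span K {v | D.IsEig φ φ' {t} v}) (h1 : ∀ y ∈ Y, t y = y → y = 0)
    (hmul : ∀ v ∈ Y, ∀ w ∈ Y, v ∈ eigSp D.opX φ → w ∈ eigSp D.opX φ → ∀ c : K, t v = c • v →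
      t w = c • w → v ≠ 0 → ∃ r : K, w = r • v) :
    ∃ (m : ℕ) (e f : Fin m → X), D.HypBasis tr φ φ' Y e f ∧
      ∀ i, D.IsEig φ φ' {t} (e i) ∧ D.IsEig φ φ' {t} (f i) := by
  have hT' : ({t} : Set (X ≃ₗ[K] X)) ⊆ D.isomX := fun t' ht' => by
    rw [Set.mem_singleton_iff.1 ht']
    exact ht.1
  refine hD.exists_hypBasis_isEig hS hT' hY ⟨le_rfl, fun t' ht' z hz => ?_, heven⟩
    fun Z hZ hZT h0 => ?_
  · rw [Set.mem_singleton_iff.1 ht']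
    exact hD.isomFix_mem hY ht hz
  have hsZ := hZT.le.trans hs
  have hspan := hD.span_isEig hT' hZ hZT.stable hsZ
  obtain ⟨x, ⟨hxZ, hxe⟩, hx0⟩ : ∃ x ∈ {v | v ∈ Z ∧ D.IsEig φ φ' {t} v}, x ≠ 0 := by
    by_contra! h
    apply h0
    rw [eq_bot_iff]
    refine hspan.trans ?_
    rw [Submodule.span_le]
    exact fun v hv => h v hv
  by_cases heq : φ = φ'
  -- Without a pair every eigenvector in `Z` has eigenvalue `±1`, hence `-1` by `h1`. Multiplicity
  -- one then makes `Z` a line, against its even dimension.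
  · by_contra hno
    have hc : ∀ z ∈ Z, D.IsEig φ φ' {t} z → z ≠ 0 → t z = (-1 : K) • z := fun z hz hze hz0 => by
      obtain ⟨c, hc⟩ := hze.2 t rfl
      have hcc : c * c = 1 := by
        by_contra hcc
        exact hno (hD.exists_eig_pair_of_weight hS hT' hZ hZT.stable hsZ hz hz0 hze rfl hc hcc)
      rcases mul_self_eq_one_iff.1 hcc with h | h
      · exact absurd (h1 z (hZT.le hz) (by rw [hc, h, one_smul])) hz0
      · rw [hc, h]
    have hle : Z ≤ Submodule.span K {x} := by
      refine hspan.trans ?_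
      rw [Submodule.span_le]
      rintro v ⟨hvZ, hve⟩
      by_cases hv0 : v = 0
      · rw [hv0]
        exact Submodule.zero_mem _
      · obtain ⟨r, hr⟩ := hmul x (hZT.le hxZ) v (hZT.le hvZ) (hS.mem_eigSp_of_eq heq _)
          (hS.mem_eigSp_of_eq heq _) (-1) (hc x hxZ hxe hx0) (hc v hvZ hve hv0) hx0
        rw [hr]
        exact Submodule.smul_mem _ _ (Submodule.mem_span_singleton_self x)
    have hfr := Submodule.finrank_mono hle
    rw [finrank_span_singleton hx0] at hfr
    obtain ⟨r, hr⟩ := hZT.even heq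
    have hpos : 0 < Module.finrank K Z := Nat.pos_of_ne_zero fun h =>
      h0 (Submodule.finrank_eq_zero.1 h)
    omega
  · have hiso : ∀ z, D.IsEig φ φ' {t} z → D.bX tr z z = 0 := fun z hz => by
      rcases hz.1 with h | h
      · exact hD.bX_eig_self hS heq h h
      · exact hD.bX_eig_self' hS heq h h
    exact hD.exists_eig_pair hS hT' hZ hZT.stable hsZ hxZ hx0 hxe (hiso x hxe)
      fun f _ hfe _ => hiso f hfe

end IsHerm

end Eigen

end LeviDatum

/-! ### Zariski topology and polynomial functions -/

section ZariskiBasics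

variable {K M : Type*} [Field K] [AddCommGroup M] [Module K M]

theorem mem_polyFun_of_linear {p : M → K} (h1 : ∀ x y, p (x + y) = p x + p y)
    (h2 : ∀ (c : K) x, p (c • x) = c * p x) : p ∈ polyFun K M :=
  Algebra.subset_adjoin ⟨{ toFun := p, map_add' := h1, map_smul' := h2 }, rfl⟩

theorem const_mem_polyFun (c : K) : (fun _ : M => c) ∈ polyFun K M :=
  (polyFun K M).algebraMap_mem c

theorem isOpen_ne_zero {p : M → K} (hp : p ∈ polyFun K M) :
    @IsOpen _ (zariski K M) {x | p x ≠ 0} :=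
  TopologicalSpace.GenerateOpen.basic _ ⟨p, hp, rfl⟩

theorem isClosed_eq_zero {p : M → K} (hp : p ∈ polyFun K M) :
    @IsClosed _ (zariski K M) {x | p x = 0} := by
  let := zariski K M
  rw [← isOpen_compl_iff]
  exact isOpen_ne_zero hp

theorem isClosed_eq_of_polyFun {p q : M → K} (hp : p ∈ polyFun K M) (hq : q ∈ polyFun K M) :
    @IsClosed _ (zariski K M) {x | p x = q x} := by
  have h : {x | p x = q x} = {x | (p - q) x = 0} := by
    ext x
    simp [sub_eq_zero]
  rw [h]
  exact isClosed_eq_zero ((polyFun K M).sub_mem hp hq)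

/-- The basic open sets form a basis of the Zariski topology. -/
theorem exists_polyFun_of_isOpen {O : Set M} (hO : @IsOpen _ (zariski K M) O) {x : M}
    (hx : x ∈ O) : ∃ p ∈ polyFun K M, p x ≠ 0 ∧ ∀ y, p y ≠ 0 → y ∈ O := by
  change TopologicalSpace.GenerateOpen _ O at hO
  induction hO with
  | basic s hs =>
    obtain ⟨p, hp, rfl⟩ := hs
    exact ⟨p, hp, hx, fun _ h => h⟩
  | univ => exact ⟨1, Subalgebra.one_mem _, one_ne_zero, fun _ _ => trivial⟩
  | inter s t _ _ hs ht =>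
    obtain ⟨p, hp, hpx, hps⟩ := hs hx.1
    obtain ⟨q, hq, hqx, hqt⟩ := ht hx.2
    exact ⟨p * q, Subalgebra.mul_mem _ hp hq, mul_ne_zero hpx hqx, fun y hy =>
      ⟨hps y (left_ne_zero_of_mul hy), hqt y (right_ne_zero_of_mul hy)⟩⟩
  | sUnion S _ ih =>
    obtain ⟨s, hs, hxs⟩ := hx
    obtain ⟨p, hp, hpx, hps⟩ := ih s hs hxs
    exact ⟨p, hp, hpx, fun y hy => ⟨s, hs, hps y hy⟩⟩

/-- If the generators of an algebra of functions pull back to fractions with denominator a power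
of `d`, then so do all its elements. -/
theorem exists_mul_pow_mem {F I N : Type*} [Field F] [Algebra F K] (R : Subalgebra F (I → K))
    {d : I → K} (hd : d ∈ R) (ψ : I → N) {G : Set (N → K)}
    (hG : ∀ l ∈ G, ∃ n : ℕ, (l ∘ ψ) * d ^ n ∈ R) {p : N → K} (hp : p ∈ Algebra.adjoin F G) :
    ∃ n : ℕ, (p ∘ ψ) * d ^ n ∈ R := by
  induction hp using Algebra.adjoin_induction with
  | mem l hl => exact hG l hl
  | algebraMap c => exact ⟨0, by
      rw [pow_zero, mul_one]
      exact R.algebraMap_mem c⟩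
  | add p q _ _ hp hq =>
    obtain ⟨n, hn⟩ := hp
    obtain ⟨k, hk⟩ := hq
    refine ⟨n + k, ?_⟩
    have h : ((p + q) ∘ ψ) * d ^ (n + k) = (p ∘ ψ) * d ^ n * d ^ k + (q ∘ ψ) * d ^ k * d ^ n := by
      rw [pow_add]
      ext i
      simp only [Function.comp_apply, Pi.mul_apply, Pi.add_apply]
      ring
    rw [h]
    exact R.add_mem (R.mul_mem hn (R.pow_mem hd k)) (R.mul_mem hk (R.pow_mem hd n))
  | mul p q _ _ hp hq =>
    obtain ⟨n, hn⟩ := hp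
    obtain ⟨k, hk⟩ := hq
    refine ⟨n + k, ?_⟩
    have h : ((p * q) ∘ ψ) * d ^ (n + k) = (p ∘ ψ) * d ^ n * ((q ∘ ψ) * d ^ k) := by
      rw [pow_add]
      ext i
      simp only [Function.comp_apply, Pi.mul_apply]
      ring
    rw [h]
    exact R.mul_mem hn hk

variable {X : Type*} [AddCommGroup X] [Module K X]

theorem apply_mem_polyFun (l : X →ₗ[K] K) (x : X) :
    (fun a : Module.End K X => l (a x)) ∈ polyFun K (Module.End K X) :=
  mem_polyFun_of_linear (fun _ _ => by simp) (fun _ _ => by simp)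

theorem isClosed_eq_of_linear {A : Type*} [AddCommGroup A] [Module K A] (f g : M →ₗ[K] A) (v : A) :
    @IsClosed _ (zariski K M) {x | f x = g x + v} := by
  let := zariski K M
  have h : {x | f x = g x + v} = ⋂ l : Module.Dual K A, {x | l ((f - g) x) = l v} := by
    ext x
    simp only [Set.mem_ofPred_eq, Set.mem_iInter]
    exact ⟨fun h l => by rw [LinearMap.sub_apply, h, add_sub_cancel_left], fun h => by
      rw [← sub_eq_iff_eq_add', ← LinearMap.sub_apply, ← sub_eq_zero, ← Module.forall_dual_apply_eq_zero_iff K]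
      intro l
      rw [map_sub, h l, sub_self]⟩
  rw [h]
  exact isClosed_iInter fun l => isClosed_eq_of_polyFun
    (mem_polyFun_of_linear (p := fun x => l ((f - g) x)) (fun _ _ => by rw [map_add, map_add])
      (fun _ _ => by rw [map_smul, map_smul, smul_eq_mul])) (const_mem_polyFun _)

theorem bilin_mem_polyFun [FiniteDimensional K X] (B : X →ₗ[K] X →ₗ[K] K) (x y : X) :
    (fun a : Module.End K X => B (a x) (a y)) ∈ polyFun K (Module.End K X) := by
  have h : (fun a : Module.End K X => B (a x) (a y)) =
      ∑ i, (fun a : Module.End K X => (Module.finBasis K X).coord i (a x)) *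
        fun a : Module.End K X => B (Module.finBasis K X i) (a y) := by
    ext a
    conv_lhs => rw [← (Module.finBasis K X).sum_repr (a x)]
    simp [-Module.Basis.sum_repr]
  rw [h]
  exact Subalgebra.sum_mem _ fun i _ =>
    Subalgebra.mul_mem _ (apply_mem_polyFun _ _) (apply_mem_polyFun _ _)

/-- In a connected group, a vector whose weights are all `1` or `-1` is fixed. -/
theorem fixed_of_isConnected (h2 : (2 : K) ≠ 0) {T : Subgroup (X ≃ₗ[K] X)}
    (hT : @IsConnected _ (zariski K (Module.End K X)) (endSet T)) {x : X} (hx : x ≠ 0)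
    (h : ∀ t ∈ T, ∃ c : K, t x = c • x ∧ c * c = 1) : ∀ t ∈ T, t x = x := by
  let := zariski K (Module.End K X)
  obtain ⟨l, hl⟩ : ∃ l : Module.Dual K X, l x ≠ 0 := by
    by_contra! hc
    exact hx ((Module.forall_dual_apply_eq_zero_iff K x).1 hc)
  have hcl : ∀ r : K, IsClosed {a : Module.End K X | l (a x) = r} := fun r =>
    isClosed_eq_of_polyFun (apply_mem_polyFun l x) (const_mem_polyFun r)
  by_contra! hc
  obtain ⟨t, ht, htx⟩ := hc
  have hpm : ∀ t ∈ T, t x = x ∨ t x = -x := by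
    intro t ht
    obtain ⟨c, hc, hcc⟩ := h t ht
    rcases mul_self_eq_one_iff.1 hcc with rfl | rfl
    · exact Or.inl (by simpa using hc)
    · exact Or.inr (by simpa using hc)
  -- The closed conditions `l (a x) = l x` and `l (a x) = -l x` cover the group, and each is
  -- satisfied somewhere. Connectedness gives a common point, where `2 * l x = 0`.
  obtain ⟨a, -, h1, h3⟩ := isPreconnected_closed_iff.1 hT.2 _ _ (hcl (l x)) (hcl (-l x))
    (by
      rintro _ ⟨s, hs, rfl⟩
      rcases hpm s hs with h | h
      · left; simp [h]
      · right; simp [h])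
    ⟨_, ⟨1, T.one_mem, rfl⟩, by simp⟩
    ⟨_, ⟨t, ht, rfl⟩, by simp [(hpm t ht).resolve_left htx]⟩
  have h4 : l x = - l x := h1.symm.trans h3
  have h5 : (2 : K) * l x = 0 := by linear_combination h4
  exact hl ((mul_eq_zero.1 h5).resolve_left h2)

end ZariskiBasics

/-! ### Maximal tori over an algebraically closed field -/

namespace LeviDatum

section Tori

variable {K S C W X U : Type*} [Field K] [AddCommGroup C] [Module K C]
    [AddCommGroup W] [Module K W] [AddCommGroup X] [Module K X] [AddCommGroup U] [Module K U]
variable {D : LeviDatum K S C W X U} {tr : C →ₗ[K] K} {σ : S → S} {opC : S → Module.End K C}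
variable {φ φ' : S → K} {δ : S} {a b : K}

/-- The endomorphism acting on a hyperbolic basis by `c i` and `d i`. -/
def diagEnd (D : LeviDatum K S C W X U) (tr : C →ₗ[K] K) {m : ℕ} (e f : Fin m → X)
    (c d : Fin m → K) : Module.End K X :=
  1 + ∑ i, (c i - 1) • (((D.bX tr).flip (f i)).smulRight (e i)) +
    ∑ i, (d i - 1) • ((D.bX tr (e i)).smulRight (f i))

theorem diagEnd_apply {m : ℕ} (e f : Fin m → X) (c d : Fin m → K) (x : X) :
    D.diagEnd tr e f c d x = x + ∑ i, (c i - 1) • D.bX tr x (f i) • e i +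
      ∑ i, (d i - 1) • D.bX tr (e i) x • f i := by
  simp [diagEnd, LinearMap.sum_apply]

/-- On diagonal elements a linear functional becomes a Laurent polynomial in the `c i` whose
denominator divides their product; `exists_mul_pow_mem` extends this to all polynomial functions. -/
theorem exists_mvPolynomial_of_polyFun {m : ℕ} (e f : Fin m → X) {p : Module.End K X → K}
    (hp : p ∈ polyFun K (Module.End K X)) : ∃ (q : MvPolynomial (Fin m) K) (n : ℕ),
      ∀ c : Fin m → Kˣ, p (D.diagEnd tr e f (fun i => c i) (fun i => ((c i)⁻¹ : Kˣ))) *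
        (∏ i, (c i : K)) ^ n = MvPolynomial.eval (fun i => (c i : K)) q := by
  classical
  let E : MvPolynomial (Fin m) K →ₐ[K] ((Fin m → Kˣ) → K) :=
    AlgHom.pi fun c : Fin m → Kˣ => MvPolynomial.aeval fun i => (c i : K)
  have hE : ∀ q c, E q c = MvPolynomial.eval (fun i => (c i : K)) q := fun q c => by
    simp [E, MvPolynomial.aeval_eq_eval]
  let d : (Fin m → Kˣ) → K := fun c => ∏ i, (c i : K)
  let ψ : (Fin m → Kˣ) → Module.End K X := fun c =>
    D.diagEnd tr e f (fun i => c i) (fun i => ((c i)⁻¹ : Kˣ))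
  have hd : d ∈ E.range := ⟨∏ i, MvPolynomial.X i, by
    ext c
    change E _ c = _
    rw [hE]
    simp [d]⟩
  obtain ⟨n, q, hq⟩ := exists_mul_pow_mem E.range hd ψ
    (G := Set.range fun l : Module.Dual K (Module.End K X) => (l : Module.End K X → K))
    (by
      rintro _ ⟨l, rfl⟩
      refine ⟨1, MvPolynomial.C (l 1) * ∏ j, MvPolynomial.X j +
        ∑ i, (MvPolynomial.X i - 1) * (∏ j, MvPolynomial.X j) *
          MvPolynomial.C (l (((D.bX tr).flip (f i)).smulRight (e i))) +
        ∑ i, ((∏ j ∈ Finset.univ.erase i, MvPolynomial.X j) - ∏ j, MvPolynomial.X j) *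
          MvPolynomial.C (l ((D.bX tr (e i)).smulRight (f i))), ?_⟩
      ext c
      change E _ c = _
      rw [hE]
      have hdc : ∀ i, d c = c i * ∏ j ∈ Finset.univ.erase i, (c j : K) := fun i =>
        (Finset.mul_prod_erase Finset.univ (fun j => (c j : K)) (Finset.mem_univ i)).symm
      have hdc' : ∀ i, ∏ j ∈ Finset.univ.erase i, (c j : K) = (c i : K)⁻¹ * d c := fun i => by
        rw [hdc i, inv_mul_cancel_left₀ (c i).ne_zero]
      simp only [map_add, map_mul, map_sum, map_sub, map_prod, MvPolynomial.eval_C,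
        MvPolynomial.eval_X, map_one, hdc', Function.comp_apply, Pi.mul_apply, pow_one, ψ, diagEnd,
        map_smul, smul_eq_mul, add_mul, Finset.sum_mul, Units.val_inv_eq_inv_val]
      change _ + ∑ i, (_ * d c * _) + ∑ i, ((_ - d c) * _) = _
      congr 1
      · congr 1
        exact Finset.sum_congr rfl fun i _ => by ring
      · exact Finset.sum_congr rfl fun i _ => by ring) hp
  refine ⟨q, n, fun c => ?_⟩
  rw [← hE]
  exact (congrFun hq c).symm

namespace IsHerm

variable (hD : D.IsHerm tr σ opC) (hS : D.IsSplit σ φ φ' δ a b)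
include hD
variable [FiniteDimensional K X]

theorem diagEnd_left {Y : Submodule K X} {m : ℕ} {e f : Fin m → X}
    (hB : D.HypBasis tr φ φ' Y e f) (c d : Fin m → K) (i : Fin m) :
    D.diagEnd tr e f c d (e i) = c i • e i := by
  rw [diagEnd_apply]
  simp only [hB.ef, hB.ee, zero_smul, smul_zero, Finset.sum_const_zero, add_zero, ite_smul,
    one_smul, smul_ite]
  simp [sub_smul]

theorem diagEnd_orth {Y : Submodule K X} {m : ℕ} {e f : Fin m → X}
    (hB : D.HypBasis tr φ φ' Y e f) (c d : Fin m → K) {x : X} (hx : x ∈ D.orth tr Y) :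
    D.diagEnd tr e f c d x = x := by
  rw [diagEnd_apply]
  have h1 : ∀ i, D.bX tr (e i) x = 0 := fun i => hx _ (hB.memE i)
  have h2 : ∀ i, D.bX tr x (f i) = 0 := fun i => by
    rw [hD.bX_symm, hx _ (hB.memF i), mul_zero]
  simp [h1, h2]

theorem diagEnd_right {Y : Submodule K X} {m : ℕ} {e f : Fin m → X}
    (hB : D.HypBasis tr φ φ' Y e f) (c d : Fin m → K) (i : Fin m) :
    D.diagEnd tr e f c d (f i) = d i • f i := by
  rw [diagEnd_apply]
  simp only [hB.ef, hB.ff, zero_smul, smul_zero, Finset.sum_const_zero, add_zero, ite_smul,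
    one_smul, smul_ite]
  simp [sub_smul]

theorem eq_diagEnd {Y : Submodule K X} (hY : D.IsNS tr Y) {m : ℕ} {e f : Fin m → X}
    (hB : D.HypBasis tr φ φ' Y e f) {t : X ≃ₗ[K] X} (ht : t ∈ D.isomFix Y) {c : Fin m → K}
    (hte : ∀ i, t (e i) = c i • e i) (htf : ∀ i, t (f i) = (c i)⁻¹ • f i) :
    (t : X →ₗ[K] X) = D.diagEnd tr e f c (fun i => (c i)⁻¹) :=
  hD.ext_hypBasis hY hB (fun i => by rw [hD.diagEnd_left hB]; exact hte i)
    (fun i => by rw [hD.diagEnd_right hB]; exact htf i)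
    (fun x hx => by rw [hD.diagEnd_orth hB _ _ hx]; exact hD.isomFix_orth hY ht hx)

include hS

theorem endSet_diagSub [IsAlgClosed K] (h2 : (2 : K) ≠ 0) {Y : Submodule K X}
    (hY : D.IsNS tr Y) {m : ℕ} {e f : Fin m → X} (hB : D.HypBasis tr φ φ' Y e f) :
    endSet (D.diagSub Y e f) = Set.range fun c : Fin m → Kˣ =>
      D.diagEnd tr e f (fun i => c i) (fun i => ((c i)⁻¹ : Kˣ)) := by
  ext g
  constructor
  · rintro ⟨t, ht, rfl⟩
    obtain ⟨c, hc0, hte, htf⟩ := hD.exists_coeff_of_diag ht.1.1 hB ht.2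
    refine ⟨fun i => Units.mk0 (c i) (hc0 i), ?_⟩
    rw [hD.eq_diagEnd hY hB ht.1 hte htf]
    simp
  · rintro ⟨c, rfl⟩
    obtain ⟨t, ht, hte, htf⟩ := hD.exists_diag hS h2 hY hB (fun i => (c i).ne_zero)
    refine ⟨t, ⟨ht, fun i => ⟨⟨_, hte i⟩, _, htf i⟩⟩, ?_⟩
    rw [hD.eq_diagEnd hY hB ht hte htf]
    simp

/-- The group is the image of a power of `Kˣ`. Nonempty open subsets of it contain the nonvanishing
loci of nonzero polynomials in the parameters, and these meet because the product of the polynomials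
is nonzero. So the group is even irreducible. -/
theorem isConnected_diagSub [IsAlgClosed K] (h2 : (2 : K) ≠ 0) {Y : Submodule K X}
    (hY : D.IsNS tr Y) {m : ℕ} {e f : Fin m → X} (hB : D.HypBasis tr φ φ' Y e f) :
    @IsConnected _ (zariski K (Module.End K X)) (endSet (D.diagSub Y e f)) := by
  let := zariski K (Module.End K X)
  refine ⟨⟨_, 1, Subgroup.one_mem _, rfl⟩, IsPreirreducible.isPreconnected ?_⟩
  rw [hD.endSet_diagSub hS h2 hY hB]
  rintro u v hu hv ⟨_, ⟨c, rfl⟩, hcu⟩ ⟨_, ⟨c', rfl⟩, hcv⟩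
  obtain ⟨p, hp, hpc, hpu⟩ := exists_polyFun_of_isOpen hu hcu
  obtain ⟨p', hp', hpc', hpv⟩ := exists_polyFun_of_isOpen hv hcv
  obtain ⟨q, n, hq⟩ := exists_mvPolynomial_of_polyFun (D := D) (tr := tr) e f hp
  obtain ⟨q', n', hq'⟩ := exists_mvPolynomial_of_polyFun (D := D) (tr := tr) e f hp'
  have hd0 : ∀ (c : Fin m → Kˣ) (n : ℕ), (∏ i, (c i : K)) ^ n ≠ 0 := fun c n =>
    pow_ne_zero n (Finset.prod_ne_zero_iff.2 fun i _ => (c i).ne_zero)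
  have hq0 : q ≠ 0 := fun h => mul_ne_zero hpc (hd0 c n) (by rw [hq, h, map_zero])
  have hq0' : q' ≠ 0 := fun h => mul_ne_zero hpc' (hd0 c' n') (by rw [hq', h, map_zero])
  have hX : (∏ i : Fin m, MvPolynomial.X i : MvPolynomial (Fin m) K) ≠ 0 :=
    Finset.prod_ne_zero_iff.2 fun i _ => MvPolynomial.X_ne_zero i
  obtain ⟨r, hr⟩ : ∃ r, MvPolynomial.eval r (q * q' * ∏ i : Fin m, MvPolynomial.X i) ≠ 0 := by
    by_contra! h
    exact mul_ne_zero (mul_ne_zero hq0 hq0') hX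
      (MvPolynomial.funext fun r => by rw [h r, map_zero])
  have hr2 := left_ne_zero_of_mul ((map_mul (MvPolynomial.eval r) _ _).symm.trans_ne hr)
  have hr0 : ∀ i, r i ≠ 0 := by
    have := right_ne_zero_of_mul ((map_mul (MvPolynomial.eval r) _ _).symm.trans_ne hr)
    rw [map_prod, Finset.prod_ne_zero_iff] at this
    simpa using this
  rw [map_mul] at hr2
  have h1 := hq (fun i => Units.mk0 (r i) (hr0 i))
  have h1' := hq' (fun i => Units.mk0 (r i) (hr0 i))
  refine ⟨_, ⟨fun i => Units.mk0 (r i) (hr0 i), rfl⟩, hpu _ ?_, hpv _ ?_⟩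
  · exact left_ne_zero_of_mul (h1.trans_ne (left_ne_zero_of_mul hr2))
  · exact left_ne_zero_of_mul (h1'.trans_ne (right_ne_zero_of_mul hr2))

theorem isTorus_diagSub [IsAlgClosed K] (h2 : (2 : K) ≠ 0) {Y : Submodule K X}
    (hY : D.IsNS tr Y) {m : ℕ} {e f : Fin m → X} (hB : D.HypBasis tr φ φ' Y e f) :
    IsTorus (D.diagSub Y e f) := by
  let := zariski K (Module.End K X)
  -- Each eigenvector condition names its eigenvalue as a product with the dual basis vector, which
  -- makes it linear in `g` and hence closed.
  refine ⟨⟨{g | (∀ s x, g (D.opX s x) = D.opX s (g x)) ∧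
    (∀ x y, D.bX tr (g x) (g y) = D.bX tr x y) ∧ (∀ x ∈ D.orth tr Y, g x = x) ∧
    ∀ i, g (e i) = D.bX tr (g (e i)) (f i) • e i ∧ g (f i) = D.bX tr (e i) (g (f i)) • f i}, ?_, ?_⟩,
    hD.isConnected_diagSub hS h2 hY hB, ?_⟩
  · simp only [Set.ofPred_and, Set.ofPred_forall]
    refine IsClosed.inter ?_ (IsClosed.inter ?_ (IsClosed.inter ?_ ?_))
    · exact isClosed_iInter fun s => isClosed_iInter fun x => by
        simpa using isClosed_eq_of_linear
          (LinearMap.applyₗ (D.opX s x)) (D.opX s ∘ₗ LinearMap.applyₗ x) 0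
    · exact isClosed_iInter fun x => isClosed_iInter fun y => isClosed_eq_of_polyFun
        (bilin_mem_polyFun _ _ _) (const_mem_polyFun _)
    · refine isClosed_iInter fun x => isClosed_iInter fun _ => ?_
      simpa using isClosed_eq_of_linear (LinearMap.applyₗ x) (0 : Module.End K X →ₗ[K] X) x
    · refine isClosed_iInter fun i => IsClosed.inter ?_ ?_
      · simpa using isClosed_eq_of_linear (LinearMap.applyₗ (e i))
          (((D.bX tr).flip (f i) ∘ₗ LinearMap.applyₗ (e i)).smulRight (e i)) 0
      · simpa using isClosed_eq_of_linear (LinearMap.applyₗ (f i))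
          ((D.bX tr (e i) ∘ₗ LinearMap.applyₗ (f i)).smulRight (f i)) 0
  · intro t
    constructor
    · intro ht
      have h1 := (hD.mem_isomX_iff t).1 ht.1.1
      refine ⟨h1.1, h1.2, fun x hx => hD.isomFix_orth hY ht.1 hx, fun i => ?_⟩
      obtain ⟨⟨c, hc⟩, d, hd⟩ := ht.2 i
      simp only [LinearEquiv.coe_coe]
      rw [hc, hd]
      simp [hB.ef]
    · rintro ⟨h1, h3, h4, h5⟩
      refine ⟨⟨(hD.mem_isomX_iff t).2 ⟨h1, h3⟩, fun x hx => h4 x ?_⟩, fun i =>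
        ⟨⟨_, (h5 i).1⟩, _, (h5 i).2⟩⟩
      exact (hD.mem_perp_iff hY.1).1 hx
  · obtain ⟨G, χ, hG⟩ := hD.exists_frame hS h2 (Module.finrank K (D.orth tr Y))
    obtain ⟨g, hg1, -, -, hg4⟩ := hG _ (hD.isNS_orth hY) rfl
    obtain ⟨v, hv⟩ := hD.exists_basis_of_hypBasis hY hB rfl hg4
    refine ⟨_, v.reindex (Fintype.equivFin _), fun t ht i => ?_⟩
    rw [Module.Basis.reindex_apply, hv]
    rcases (Fintype.equivFin _).symm i with (j | j) | j
    · exact (ht.2 j).1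
    · exact (ht.2 j).2
    · exact ⟨1, by simpa using hD.isomFix_orth hY ht.1 (hg1 j)⟩

/-- A larger torus is simultaneously diagonalizable, hence commutative, and it contains a diagonal
element satisfying `Dist`. Everything in `H_Y` that commutes with this element is diagonal. -/
theorem isMaxTorus_diagSub [IsAlgClosed K] (h2 : (2 : K) ≠ 0) {Y : Submodule K X}
    (hY : D.IsNS tr Y) {m : ℕ} {e f : Fin m → X} (hB : D.HypBasis tr φ φ' Y e f) :
    D.IsMaxTorus Y (D.diagSub Y e f) := by
  refine ⟨fun t ht => ht.1, hD.isTorus_diagSub hS h2 hY hB, fun T' hT' hT hle =>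
    le_antisymm (fun g hg => ⟨hT' hg, fun i => ?_⟩) hle⟩
  obtain ⟨c, hc0, hc⟩ := exists_dist (φ := φ) (φ' := φ') (K := K) m
  obtain ⟨t, ht, hte, htf⟩ := hD.exists_diag hS h2 hY hB hc0
  obtain ⟨n, v, hv⟩ := hT.2.2
  have htT : t ∈ T' := hle ⟨ht, fun i => ⟨⟨_, hte i⟩, _, htf i⟩⟩
  refine hD.diag_of_comm hS hY hB ht hc0 hte htf hc (g := (g : X →ₗ[K] X))
    (hT' hg).1.1 (fun x => ?_) i
  have h : (g : X →ₗ[K] X) ∘ₗ (t : X →ₗ[K] X) = (t : X →ₗ[K] X) ∘ₗ (g : X →ₗ[K] X) := by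
    refine v.ext fun j => ?_
    obtain ⟨r, hr⟩ := hv g hg j
    obtain ⟨r', hr'⟩ := hv t htT j
    simp [hr, hr', smul_comm r r']
  exact LinearMap.congr_fun h x

/-- The maximal tori are the diagonal groups of the hyperbolic bases. -/
theorem exists_eq_diagSub [IsAlgClosed K] (h2 : (2 : K) ≠ 0) {Y : Submodule K X}
    (hY : D.IsNS tr Y) (hfr : Module.finrank K Y = Module.finrank K W)
    {T : Subgroup (X ≃ₗ[K] X)} (hT : D.IsMaxTorus Y T) :
    ∃ (m : ℕ) (e f : Fin m → X), D.HypBasis tr φ φ' Y e f ∧ T = D.diagSub Y e f := by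
  obtain ⟨hle, htor, hmax⟩ := hT
  obtain ⟨n, v, hv⟩ := htor.2.2
  obtain ⟨m, e, f, hB, hef⟩ := hD.exists_hypBasis_of_torus hS h2 hle hY
    (fun h => hfr ▸ hS.even h) v hv (fun x hx h => fixed_of_isConnected h2 htor.2.1 hx h)
  refine ⟨m, e, f, hB, (hmax (D.diagSub Y e f) (fun t ht => ht.1) (hD.isTorus_diagSub hS h2 hY hB)
    fun t ht => ⟨hle ht, fun i => ⟨(hef i).1.2 t ht, (hef i).2.2 t ht⟩⟩).symm⟩

end IsHerm

end Tori

end LeviDatum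

/-! ### Conjugacy of regular elements; independence of Y and T -/

namespace LeviDatum

section Conjugacy

variable {K S C W X U : Type*} [Field K] [AddCommGroup C] [Module K C]
    [AddCommGroup W] [Module K W] [AddCommGroup X] [Module K X] [AddCommGroup U] [Module K U]
variable {D : LeviDatum K S C W X U} {tr : C →ₗ[K] K} {σ : S → S} {opC : S → Module.End K C}
variable {φ φ' : S → K} {δ : S} {a b : K}

namespace IsHerm

variable (hD : D.IsHerm tr σ opC)
include hD
variable [FiniteDimensional K X]

theorem finrank_orth {Y : Submodule K X} (hY : D.IsNS tr Y) :
    Module.finrank K Y + Module.finrank K (D.orth tr Y) = Module.finrank K X := by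
  refine Submodule.finrank_add_eq_of_isCompl ⟨?_, ?_⟩
  · rw [Submodule.disjoint_def]
    exact fun x hx hx' => hD.eq_zero_of_mem_orth hY hx hx'
  · rw [codisjoint_iff, Submodule.eq_top_iff']
    intro x
    obtain ⟨q, hq1, hq2⟩ := hD.exists_proj hY
    rw [← add_sub_cancel (q x) x]
    exact Submodule.add_mem_sup (hq1 x) (hq2 x)

variable (hS : D.IsSplit σ φ φ' δ a b)
include hS

/-- The number of hyperbolic pairs is half of `k`, so some `h` in `H` carries one hyperbolic basis
to the other. The conjugate of `t` is diagonal with the same eigenvalues, and regularity depends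
only on these. -/
theorem exists_conj_mem_regSet [IsAlgClosed K] (h2 : (2 : K) ≠ 0) {Y Y' : Submodule K X}
    (hY : D.IsNS tr Y) (hY' : D.IsNS tr Y') (hfr : Module.finrank K Y = Module.finrank K W)
    (hfr' : Module.finrank K Y' = Module.finrank K W) {T T' : Subgroup (X ≃ₗ[K] X)}
    (hT : D.IsMaxTorus Y T) (hT' : D.IsMaxTorus Y' T') {t : X ≃ₗ[K] X} (ht : t ∈ D.regSet Y T) :
    ∃ h ∈ D.isomX, h * t * h⁻¹ ∈ D.regSet Y' T' := by
  obtain ⟨m, e, f, hB, rfl⟩ := hD.exists_eq_diagSub hS h2 hY hfr hT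
  obtain ⟨m', e', f', hB', rfl⟩ := hD.exists_eq_diagSub hS h2 hY' hfr' hT'
  obtain rfl : m = m' := by
    have h1 := hB.finrank_eq
    have h3 := hB'.finrank_eq
    omega
  obtain ⟨h, hh, he, hf⟩ := hD.exists_isomX_hypBasis hS h2 hY hY' hB hB' (by
    have h1 := hD.finrank_orth hY
    have h3 := hD.finrank_orth hY'
    omega)
  obtain ⟨c, hc0, hte, htf⟩ := hD.exists_coeff_of_diag ht.1.1.1 hB ht.1.2
  have hd := hD.dist_of_regSet hS h2 hY hB ht hte htf
  have he' : ∀ i, h⁻¹ (e' i) = e i := fun i => h.injective (by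
    rw [he]; exact h.apply_symm_apply _)
  have hf' : ∀ i, h⁻¹ (f' i) = f i := fun i => h.injective (by
    rw [hf]; exact h.apply_symm_apply _)
  have hfix : ∀ x ∈ D.orth tr Y', (h * t * h⁻¹) x = x := by
    intro x hx
    have h3 : h⁻¹ x ∈ D.orth tr Y := by
      intro y hy
      have h4 := ((hD.mem_isomX_iff h).1 hh).2 y (h⁻¹ x)
      rw [show h (h⁻¹ x) = x from h.apply_symm_apply x] at h4
      rw [← h4]
      refine hx _ ?_
      rw [hB.span y hy, map_add, map_sum, map_sum]
      refine Submodule.add_mem _ (Submodule.sum_mem _ fun i _ => ?_)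
        (Submodule.sum_mem _ fun i _ => ?_)
      · rw [map_smul, he]
        exact Submodule.smul_mem _ _ (hB'.memE i)
      · rw [map_smul, hf]
        exact Submodule.smul_mem _ _ (hB'.memF i)
    change h (t (h⁻¹ x)) = x
    rw [hD.isomFix_orth hY ht.1.1 h3]
    exact h.apply_symm_apply x
  refine ⟨h, hh, hD.mem_regSet_of_dist hS hY' hB' ⟨D.isomX.mul_mem (D.isomX.mul_mem hh ht.1.1.1)
    (D.isomX.inv_mem hh), fun x hx => hfix x ((hD.mem_perp_iff hY'.1).1 hx)⟩ hc0 (fun i => ?_)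
    (fun i => ?_) hd⟩
  · change h (t (h⁻¹ (e' i))) = _
    rw [he', hte, map_smul, he]
  · change h (t (h⁻¹ (f' i))) = _
    rw [hf', htf, map_smul, hf]

/-- An element conjugate to a regular element is regular for some maximal torus. -/
theorem exists_maxTorus_of_conj [IsAlgClosed K] (h2 : (2 : K) ≠ 0) {Y Y₀ : Submodule K X}
    (hY : D.IsNS tr Y) (hY₀ : D.IsNS tr Y₀) (hfr : Module.finrank K Y = Module.finrank K W)
    (hfr₀ : Module.finrank K Y₀ = Module.finrank K W) {T₀ : Subgroup (X ≃ₗ[K] X)}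
    (hT₀ : D.IsMaxTorus Y₀ T₀) {t h : X ≃ₗ[K] X} (ht : t ∈ D.isomFix Y) (hh : h ∈ D.isomX)
    (hth : h * t * h⁻¹ ∈ D.regSet Y₀ T₀) :
    ∃ T, D.IsMaxTorus Y T ∧ t ∈ D.regSet Y T := by
  obtain ⟨m, e, f, hB, rfl⟩ := hD.exists_eq_diagSub hS h2 hY₀ hfr₀ hT₀
  obtain ⟨c, hc0, hte, htf⟩ := hD.exists_coeff_of_diag hth.1.1.1 hB hth.1.2
  have hd := hD.dist_of_regSet hS h2 hY₀ hB hth hte htf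
  have hte' : ∀ i, t (h⁻¹ (e i)) = c i • h⁻¹ (e i) := fun i => h.injective (by
    rw [map_smul]
    exact (hte i).trans (congrArg _ (h.apply_symm_apply _).symm))
  have htf' : ∀ i, t (h⁻¹ (f i)) = (c i)⁻¹ • h⁻¹ (f i) := fun i => h.injective (by
    rw [map_smul]
    exact (htf i).trans (congrArg _ (h.apply_symm_apply _).symm))
  have hi := (hD.mem_isomX_iff _).1 (D.isomX.inv_mem hh)
  -- It is not assumed that `h⁻¹` maps `Y₀` to `Y`; the transported vectors lie in `Y` because their
  -- eigenvalues are not `1`.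
  have hB' : D.HypBasis tr φ φ' Y (fun i => h⁻¹ (e i)) (fun i => h⁻¹ (f i)) := by
    refine hypBasis_of_gram (by rw [hfr, ← hfr₀, hB.finrank_eq])
      (fun i => hD.eigenline_mem hY ht (hd.2.1 i) (hte' i))
      (fun i => hD.eigenline_mem hY ht (fun h1 => hd.2.1 i (inv_eq_one.1 h1)) (htf' i))
      (fun i s => by rw [← hi.1, hB.he i s, map_smul])
      (fun i s => by rw [← hi.1, hB.hf i s, map_smul])
      (fun i j => by rw [hi.2, hB.ee]) (fun i j => by rw [hi.2, hB.ff])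
      (fun i j => by rw [hi.2, hB.ef])
  exact ⟨_, hD.isMaxTorus_diagSub hS h2 hY hB',
    hD.mem_regSet_of_dist hS hY hB' ht hc0 hte' htf' hd⟩

omit hD hS in
-- Commutativity of a torus gives one inclusion and regularity of `t` the other. A torus is thus
-- recovered from any of its regular elements.
theorem mem_torus_iff {Y : Submodule K X} {T : Subgroup (X ≃ₗ[K] X)}
    (hT : D.IsMaxTorus Y T) {t : X ≃ₗ[K] X} (ht : t ∈ D.regSet Y T) {g : X ≃ₗ[K] X} :
    g ∈ T ↔ g ∈ D.isomFix Y ∧ g * t = t * g := by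
  refine ⟨fun hg => ⟨hT.1 hg, ?_⟩, fun hg => ht.2.1 g hg.1 hg.2⟩
  obtain ⟨n, v, hv⟩ := hT.2.1.2.2
  have h : (g : X →ₗ[K] X) ∘ₗ (t : X →ₗ[K] X) = (t : X →ₗ[K] X) ∘ₗ (g : X →ₗ[K] X) := by
    refine v.ext fun j => ?_
    obtain ⟨r, hr⟩ := hv g hg j
    obtain ⟨r', hr'⟩ := hv t ht.1 j
    simp [hr, hr', smul_comm r r']
  exact LinearEquiv.ext fun x => LinearMap.congr_fun h x

theorem regUnip_subset [IsAlgClosed K] (h2 : (2 : K) ≠ 0) {Y Y' : Submodule K X}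
    (hY : D.IsNS tr Y) (hY' : D.IsNS tr Y') (hfr : Module.finrank K Y = Module.finrank K W)
    (hfr' : Module.finrank K Y' = Module.finrank K W) {T T' : Subgroup (X ≃ₗ[K] X)}
    (hT : D.IsMaxTorus Y T) (hT' : D.IsMaxTorus Y' T') : D.regUnip Y T ⊆ D.regUnip Y' T' := by
  rintro n ⟨hn, h, hh, t, ht, hnt⟩
  obtain ⟨g, hg, hgt⟩ := hD.exists_conj_mem_regSet hS h2 hY hY' hfr hfr' hT hT' ht
  refine ⟨hn, h * g⁻¹, D.isomX.mul_mem hh (D.isomX.inv_mem hg), _, hgt, ?_⟩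
  rw [hnt]
  congr 1
  group

end IsHerm

end Conjugacy

end LeviDatum

/-! ### Simple spectrum and the discriminant -/

section SimpleSpectrum

open Polynomial

/-- The discriminant, up to sign, of the characteristic polynomial. -/
noncomputable def discMat {R : Type*} [CommRing R] {r : ℕ} (N : Matrix (Fin r) (Fin r) R) : R :=
  resultant N.charpoly (derivative N.charpoly) r r

theorem discMat_map {R R' : Type*} [CommRing R] [CommRing R'] {r : ℕ}
    (N : Matrix (Fin r) (Fin r) R) (g : R →+* R') : discMat (N.map g) = g (discMat N) := by
  rw [discMat, discMat, Matrix.charpoly_map, derivative_map, resultant_map_map]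

variable {K : Type*} [Field K]

/-- Both formal degrees in `discMat` are `r`, so that it commutes with every ring homomorphism.
Since the characteristic polynomial is monic, raising the formal degree of its derivative does not
change the resultant. -/
theorem discMat_ne_zero_iff {r : ℕ} (N : Matrix (Fin r) (Fin r) K) :
    discMat N ≠ 0 ↔ N.charpoly.Separable := by
  have hm := N.charpoly_monic
  have hdeg : N.charpoly.natDegree = r := by simp [Matrix.charpoly_natDegree_eq_dim]
  have hle : (derivative N.charpoly).natDegree ≤ r :=
    (natDegree_derivative_le _).trans (by omega)
  have h : discMat N = resultant N.charpoly (derivative N.charpoly) := by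
    have h1 := resultant_add_right_deg N.charpoly (derivative N.charpoly) r
      (derivative N.charpoly).natDegree (r - (derivative N.charpoly).natDegree) le_rfl
    have h2 : N.charpoly.coeff r = 1 := by
      have := hm.coeff_natDegree
      rwa [hdeg] at this
    rw [Nat.add_sub_cancel' hle, h2, one_pow, one_mul] at h1
    rw [discMat, h1, hdeg]
  rw [h, Ne, resultant_eq_zero_iff, separable_def]
  simp [hm.ne_zero]

variable {V : Type*} [AddCommGroup V] [Module K V]

/-- `f` is diagonalizable on `Z`, with simple eigenvalues. -/
def SimpleOn (f : Module.End K V) (Z : Submodule K V) : Prop :=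
  Z ≤ Submodule.span K {v | v ∈ Z ∧ ∃ c : K, f v = c • v} ∧
    ∀ v ∈ Z, ∀ w ∈ Z, ∀ c : K, f v = c • v → f w = c • w → v ≠ 0 → ∃ r : K, w = r • v

theorem SimpleOn.smul {f : Module.End K V} {Z : Submodule K V} (hf : SimpleOn f Z) {r : K}
    (hr : r ≠ 0) : SimpleOn (r • f) Z := by
  refine ⟨hf.1.trans (Submodule.span_mono fun v hv => ⟨hv.1, ?_⟩), fun v hv w hw c hvc hwc h0 =>
    hf.2 v hv w hw (r⁻¹ * c) ?_ ?_ h0⟩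
  · obtain ⟨c, hc⟩ := hv.2
    exact ⟨r * c, by rw [LinearMap.smul_apply, hc, smul_smul]⟩
  · rw [mul_smul, ← hvc, LinearMap.smul_apply, inv_smul_smul₀ hr]
  · rw [mul_smul, ← hwc, LinearMap.smul_apply, inv_smul_smul₀ hr]

variable [FiniteDimensional K V]

theorem simpleOn_top_of_basis {f : Module.End K V} {ι : Type*} [Finite ι] (v : Module.Basis ι K V)
    {c : ι → K} (hc : Function.Injective c) (hv : ∀ i, f (v i) = c i • v i) : SimpleOn f ⊤ := by
  have hrepr : ∀ x i, v.repr (f x) i = c i * v.repr x i := by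
    intro x i
    have h : v.coord i ∘ₗ f = c i • v.coord i := by
      classical
      refine v.ext fun j => ?_
      by_cases hij : j = i
      · subst hij
        simp [hv]
      · simp [hv, hij]
    simpa using LinearMap.congr_fun h x
  refine ⟨?_, fun x _ y _ r hx hy h0 => ?_⟩
  · refine v.span_eq.ge.trans (Submodule.span_mono ?_)
    rintro _ ⟨i, rfl⟩
    exact ⟨Submodule.mem_top, c i, hv i⟩
  · have key : ∀ z i, f z = r • z → v.repr z i ≠ 0 → c i = r := by
      intro z i hz hi
      have h1 := hrepr z i
      rw [hz] at h1
      simp only [map_smul, Finsupp.smul_apply, smul_eq_mul] at h1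
      exact (mul_right_cancel₀ hi h1).symm
    obtain ⟨i, hi⟩ : ∃ i, v.repr x i ≠ 0 := by
      by_contra! h
      exact h0 (v.repr.injective (by ext i; simp [h i]))
    refine ⟨v.repr y i * (v.repr x i)⁻¹, v.repr.injective (Finsupp.ext fun j => ?_)⟩
    rw [map_smul, Finsupp.smul_apply, smul_eq_mul]
    by_cases hij : j = i
    · subst hij
      rw [mul_assoc, inv_mul_cancel₀ hi, mul_one]
    · have h1 : ∀ z, f z = r • z → v.repr z j = 0 := fun z hz => by
        by_contra h
        exact hij (hc ((key z j hz h).trans (key x i hx hi).symm))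
      rw [h1 x hx, h1 y hy, mul_zero]

/-- Distinct roots of the characteristic polynomial provide as many independent eigenvectors as the
dimension. Conversely, a basis extracted from the eigenvectors has distinct eigenvalues by
simplicity, and the characteristic polynomial is the product of the corresponding linear factors. -/
theorem separable_charpoly_iff [IsAlgClosed K] (f : Module.End K V) :
    f.charpoly.Separable ↔ SimpleOn f ⊤ := by
  classical
  constructor
  · intro hsep
    have hnd := nodup_roots hsep
    have hcard : f.charpoly.roots.toFinset.card = Module.finrank K V := by
      rw [Multiset.toFinset_card_of_nodup hnd,
        ← (IsAlgClosed.splits f.charpoly).natDegree_eq_card_roots, LinearMap.charpoly_natDegree]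
    have hev : ∀ c : f.charpoly.roots.toFinset, ∃ v, f.HasEigenvector c v := fun c => by
      have h1 : f.charpoly.IsRoot c := isRoot_of_mem_roots (Multiset.mem_toFinset.1 c.2)
      exact ((Module.End.hasEigenvalue_iff_isRoot_charpoly f c).2 h1).exists_hasEigenvector
    choose v hv using hev
    have hli := Module.End.eigenvectors_linearIndependent' f
      (fun c : f.charpoly.roots.toFinset => (c : K)) Subtype.coe_injective v hv
    by_cases hne : Nonempty f.charpoly.roots.toFinset
    · let B := basisOfLinearIndependentOfCardEqFinrank hli (by simpa using hcard)
      refine simpleOn_top_of_basis B (c := fun c => (c : K)) Subtype.coe_injective fun c => ?_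
      simp only [B, coe_basisOfLinearIndependentOfCardEqFinrank]
      exact (hv c).apply_eq_smul
    · have h0 : Module.finrank K V = 0 := by
        rw [← hcard, Finset.card_eq_zero]
        by_contra h
        exact hne (Finset.nonempty_iff_ne_empty.2 h).to_subtype
      have := Module.finrank_zero_iff.1 h0
      exact ⟨fun x _ => by rw [Subsingleton.elim x 0]; exact zero_mem _,
        fun x _ y _ _ _ _ h => absurd (Subsingleton.elim x 0) h⟩
  · rintro ⟨hs, hm⟩
    obtain ⟨b, hb, hspan, hli⟩ := exists_linearIndependent K {v : V | v ∈ (⊤ : Submodule K V) ∧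
      ∃ c : K, f v = c • v}
    let B := Module.Basis.mk hli (by rw [Subtype.range_coe, hspan]; exact hs)
    have hfin : Finite b := Module.Finite.finite_basis B
    let := Fintype.ofFinite b
    have hBi : ∀ i, B i = i := fun i => by simp [B]
    choose c hc using fun i : b => (hb i.2).2
    have hinj : Function.Injective c := by
      intro i j hij
      obtain ⟨r, hr⟩ := hm _ trivial _ trivial _ (hc i) (by rw [hij]; exact hc j) (hli.ne_zero i)
      by_contra hne
      have h1 : B.repr (B j) j = r * B.repr (B i) j := by
        rw [hBi, hBi, hr, map_smul, Finsupp.smul_apply, smul_eq_mul]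
      rw [B.repr_self, B.repr_self, Finsupp.single_eq_same,
        Finsupp.single_eq_of_ne (Ne.symm hne), mul_zero] at h1
      exact one_ne_zero h1
    have hmat : LinearMap.toMatrix B B f = Matrix.diagonal c := by
      ext i j
      rw [LinearMap.toMatrix_apply, hBi, hc j, map_smul, ← hBi, B.repr_self, Matrix.diagonal_apply,
        Finsupp.smul_apply, Finsupp.single_apply, smul_eq_mul]
      by_cases hij : i = j
      · simp [hij]
      · simp [hij, Ne.symm hij]
    rw [← LinearMap.charpoly_toMatrix f B, hmat, Matrix.charpoly_diagonal]
    exact separable_prod_X_sub_C_iff.2 hinj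

/-- Simplicity on a stable subspace, in terms of the compression. -/
theorem separable_charpoly_compress_iff [IsAlgClosed K] {f : Module.End K V} {Z : Submodule K V}
    (hZ : ∀ z ∈ Z, f z ∈ Z) {p : V →ₗ[K] Z} (hp : p ∘ₗ Z.subtype = LinearMap.id) :
    (p ∘ₗ f ∘ₗ Z.subtype).charpoly.Separable ↔ SimpleOn f Z := by
  have hr : ∀ z : Z, ((p ∘ₗ f ∘ₗ Z.subtype) z : V) = f z := fun z => by
    have h1 := LinearMap.congr_fun hp ⟨f z, hZ z z.2⟩
    exact congrArg Subtype.val h1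
  rw [separable_charpoly_iff (p ∘ₗ f ∘ₗ Z.subtype)]
  have hset : Z.subtype '' {v | v ∈ (⊤ : Submodule K Z) ∧ ∃ c : K, (p ∘ₗ f ∘ₗ Z.subtype) v = c • v} =
      {v | v ∈ Z ∧ ∃ c : K, f v = c • v} := by
    ext v
    constructor
    · rintro ⟨z, ⟨-, c, hc⟩, rfl⟩
      exact ⟨z.2, c, by rw [Submodule.subtype_apply, ← hr, hc]; rfl⟩
    · rintro ⟨hv, c, hc⟩
      exact ⟨⟨v, hv⟩, ⟨trivial, c, Subtype.ext (by rw [hr]; exact hc)⟩, rfl⟩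
  unfold SimpleOn
  refine and_congr ?_ ?_
  · rw [← hset, ← Submodule.map_span, top_le_iff]
    constructor
    · intro h z hz
      rw [h]
      exact ⟨⟨z, hz⟩, trivial, rfl⟩
    · intro h
      rw [eq_top_iff]
      intro z _
      obtain ⟨z', hz', he⟩ := h z.2
      rwa [← Subtype.ext he]
  · constructor
    · intro h v hv w hw c hvc hwc h0
      obtain ⟨r, hr'⟩ := h ⟨v, hv⟩ trivial ⟨w, hw⟩ trivial c (Subtype.ext (by rw [hr]; exact hvc))
        (Subtype.ext (by rw [hr]; exact hwc)) (fun h => h0 (congrArg Subtype.val h))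
      exact ⟨r, congrArg Subtype.val hr'⟩
    · intro h v _ w _ c hvc hwc h0
      obtain ⟨r, hr'⟩ := h v v.2 w w.2 c (by rw [← hr, hvc]; rfl) (by rw [← hr, hwc]; rfl)
        (fun h => h0 (Subtype.ext h))
      exact ⟨r, Subtype.ext hr'⟩

end SimpleSpectrum

/-! ### The image of ξ* and the endomorphism η⁻¹ξξ* -/

namespace LeviDatum

section RangeAdj

variable {K S C W X U : Type*} [Field K] [AddCommGroup C] [Module K C]
    [AddCommGroup W] [Module K W] [AddCommGroup X] [Module K X] [AddCommGroup U] [Module K U]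
variable {D : LeviDatum K S C W X U} {tr : C →ₗ[K] K} {σ : S → S} {opC : S → Module.End K C}
variable {φ φ' : S → K} {δ : S} {a b : K}

/-- The endomorphism `η⁻¹ ξ ξ*` of `U`. -/
noncomputable def innerEnd (D : LeviDatum K S C W X U) (n : Module.End K (W × X × U)) :
    Module.End K U := linInv (etaOf n) ∘ₗ xiOf n ∘ₗ D.adj (xiOf n)

namespace IsHerm

variable (hD : D.IsHerm tr σ opC)
include hD
variable [FiniteDimensional K X]

/-- If `ξ* u` is orthogonal to the image of `ξ*`, then `u` pairs to zero with the image of `ξξ*`,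
which is `W`. -/
theorem isNS_range_adj {f : X →ₗ[K] W} (hf : ∀ s x, f (D.opX s x) = D.opW s (f x))
    (hb : Function.Bijective (f ∘ₗ D.adj (U := U) f)) :
    D.IsNS tr (LinearMap.range (D.adj (U := U) f)) := by
  refine ⟨?_, ?_⟩
  · rintro s _ ⟨u, rfl⟩
    exact ⟨D.opU s u, hD.adj_op hf s u⟩
  · rintro _ ⟨u, rfl⟩ h
    have : u = 0 := hD.pair_nondeg_left u fun w => by
      obtain ⟨v, rfl⟩ := hb.2 w
      rw [LinearMap.comp_apply, ← hD.bX_adj hf]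
      exact h _ ⟨v, rfl⟩
    rw [this, map_zero]

theorem xi_orth_range_adj {f : X →ₗ[K] W} (hf : ∀ s x, f (D.opX s x) = D.opW s (f x)) {x : X}
    (hx : x ∈ D.orth tr (LinearMap.range (D.adj (U := U) f))) : f x = 0 :=
  hD.pair_nondeg_right _ fun u => by
    rw [← hD.bX_adj hf]
    exact hx _ ⟨u, rfl⟩

omit hD in
theorem normMap_apply (n : Module.End K (W × X × U)) (x : X) :
    D.normMap n x = x + D.adj (xiOf n) (linInv (etaOf n) (xiOf n x)) := by
  simp [normMap]

omit hD in
-- This moves spectral questions about the norm from the varying subspace `im ξ*` to the fixed space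
-- `U`, on which `1 + innerEnd n` acts in its place.
theorem normMap_adj (n : Module.End K (W × X × U)) (u : U) :
    D.normMap n (D.adj (xiOf n) u) = D.adj (xiOf n) (u + D.innerEnd n u) := by
  rw [normMap_apply, map_add]
  rfl

omit hD in
theorem adj_injective_of_bijective {f : X →ₗ[K] W}
    (hb : Function.Bijective (f ∘ₗ D.adj (U := U) f)) : Function.Injective (D.adj (U := U) f) :=
  Function.Injective.of_comp (f := f) hb.1

variable [FiniteDimensional K W] [FiniteDimensional K U]

theorem finrank_range_adj {f : X →ₗ[K] W} (hb : Function.Bijective (f ∘ₗ D.adj (U := U) f)) :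
    Module.finrank K (LinearMap.range (D.adj (U := U) f)) = Module.finrank K W := by
  rw [LinearMap.finrank_range_of_inj (adj_injective_of_bijective hb), hD.finrank_eq]

/-- The norm fixes the orthogonal complement of the image of `ξ*`. -/
theorem norm_mem_isomFix {n : Module.End K (W × X × U)} (hn : n ∈ D.unipRadInv)
    {g : X ≃ₗ[K] X} (hg : g ∈ D.isomX) (hgn : (g : X →ₗ[K] X) = D.normMap n) :
    g ∈ D.isomFix (LinearMap.range (D.adj (U := U) (xiOf n))) := by
  have hf := xiOf_op hn.1.1
  refine ⟨hg, fun x hx => ?_⟩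
  have h1 : x ∈ D.orth tr (LinearMap.range (D.adj (U := U) (xiOf n))) := by
    refine (hD.mem_perp_iff ?_).1 hx
    rintro s _ ⟨u, rfl⟩
    exact ⟨D.opU s u, hD.adj_op hf s u⟩
  have h2 : g x = D.normMap n x := LinearMap.congr_fun hgn x
  rw [h2, normMap_apply, hD.xi_orth_range_adj hf h1]
  simp

omit hD in
theorem innerEnd_bijective {n : Module.End K (W × X × U)} (hn : n ∈ D.unipRadInv)
    (hb : Function.Bijective (xiOf n ∘ₗ D.adj (U := U) (xiOf n))) :
    Function.Bijective (D.innerEnd n) := (linInv_bijective hn.2).comp hb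

theorem innerEnd_op {n : Module.End K (W × X × U)} (hn : n ∈ D.unipRadInv) (s : S) (u : U) :
    D.innerEnd n (D.opU s u) = D.opU s (D.innerEnd n u) := by
  refine hn.2.1 ?_
  rw [etaOf_op hn.1.1]
  simp only [innerEnd, LinearMap.comp_apply, apply_linInv hn.2]
  rw [hD.adj_op (xiOf_op hn.1.1), xiOf_op hn.1.1]

end IsHerm

end RangeAdj

section Symm

variable {K S C W X U : Type*} [Field K] [AddCommGroup C] [Module K C]
    [AddCommGroup W] [Module K W] [AddCommGroup X] [Module K X] [AddCommGroup U] [Module K U]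
variable {D : LeviDatum K S C W X U} {tr : C →ₗ[K] K} {σ : S → S} {opC : S → Module.End K C}
variable {φ φ' : S → K} {δ : S} {a b : K}

/-- The complementary projection is again affine in the operator `δ`. This symmetry transfers what
is proved for `φ` to `φ'`. -/
theorem IsSplit.symm (hD : D.IsHerm tr σ opC) (hS : D.IsSplit σ φ φ' δ a b) :
    D.IsSplit σ φ' φ δ (1 - a) (-b) := by
  refine ⟨fun s => ?_, fun x => ?_, fun x => ?_, fun x => ?_, hS.swap, fun h => hS.even h.symm⟩
  · rw [hS.conj, hD.invol]
  · rw [affOp_apply, sub_smul, one_smul, neg_smul, ← sub_eq_add_neg, sub_sub, ← affOp_apply,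
      sub_sub_cancel]
    exact (hS.projW x).symm
  · rw [affOp_apply, sub_smul, one_smul, neg_smul, ← sub_eq_add_neg, sub_sub, ← affOp_apply,
      sub_sub_cancel]
    exact (hS.projX x).symm
  · rw [affOp_apply, sub_smul, one_smul, neg_smul, ← sub_eq_add_neg, sub_sub, ← affOp_apply,
      sub_sub_cancel]
    exact (hS.projU x).symm

theorem HypBasis.symm (hD : D.IsHerm tr σ opC) {Y : Submodule K X} {m : ℕ} {e f : Fin m → X}
    (hB : D.HypBasis tr φ φ' Y e f) : D.HypBasis tr φ' φ Y f (fun i => (D.eps : K) • e i) where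
  memE := hB.memF
  memF i := Submodule.smul_mem _ _ (hB.memE i)
  he := hB.hf
  hf i := Submodule.smul_mem _ _ (hB.he i)
  ee := hB.ff
  ff i j := by simp [hB.ee]
  ef i j := by
    rw [map_smul, hD.hypBasis_fe hB]
    by_cases h : i = j <;> simp [h, eps_mul_eps]
  span y hy := by
    conv_lhs => rw [hB.span y hy, add_comm]
    have h1 : ∀ i, D.bX tr y ((D.eps : K) • e i) = D.bX tr (e i) y := fun i => by
      rw [map_smul, smul_eq_mul, ← hD.bX_symm]
    have h3 : ∀ i, (D.bX tr (f i) y) • (D.eps : K) • e i = D.bX tr y (f i) • e i := fun i => by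
      rw [hD.bX_symm (f i) y, smul_smul, mul_comm]
    simp only [h1, h3]

theorem Dist.symm {m : ℕ} {c : Fin m → K} (hc : Dist φ φ' c) :
    Dist φ' φ fun i => (c i)⁻¹ :=
  ⟨fun _ _ h => hc.1 (inv_injective h), fun i h => hc.2.1 i (inv_eq_one.1 h), fun h i j hij =>
    hc.2.2 h.symm i j (by rw [← inv_inj, mul_inv, hij, inv_one])⟩

namespace IsHerm

variable (hD : D.IsHerm tr σ opC) (hS : D.IsSplit σ φ φ' δ a b)
include hD hS
variable [FiniteDimensional K X]

/-- A nonzero coordinate of `x` identifies its eigenvalue as some `c i`, or as `(c i)⁻¹`, the latter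
only if `φ = φ'`. Then `eigenline` or `eigenline'` places `x` and `y` on the same line of the basis.
-/
theorem proportional_of_dist {Y : Submodule K X} (hY : D.IsNS tr Y)
    {m : ℕ} {e f : Fin m → X} (hB : D.HypBasis tr φ φ' Y e f) {t : X ≃ₗ[K] X}
    (ht : t ∈ D.isomFix Y) {c : Fin m → K} (hc0 : ∀ i, c i ≠ 0) (hte : ∀ i, t (e i) = c i • e i)
    (htf : ∀ i, t (f i) = (c i)⁻¹ • f i) (hc : Dist φ φ' c) {x y : X} (hxY : x ∈ Y)
    (hx : x ∈ eigSp D.opX φ) (hy : y ∈ eigSp D.opX φ) {r : K} (hxt : t x = r • x)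
    (hyt : t y = r • y) (h0 : x ≠ 0) : ∃ s : K, y = s • x := by
  have hti := (hD.mem_isomX_iff t).1 ht.1
  have aux : ∀ (z : X) (p q : K), x = p • z → y = q • z → ∃ s : K, y = s • x := by
    intro z p q hp hq
    have hp0 : p ≠ 0 := fun h => h0 (by rw [hp, h, zero_smul])
    exact ⟨q * p⁻¹, by rw [hp, hq, smul_smul, mul_assoc, inv_mul_cancel₀ hp0, mul_one]⟩
  by_cases h1 : ∃ i, D.bX tr x (f i) ≠ 0
  · obtain ⟨i, hi⟩ := h1
    have h3 := hti.2 x (f i)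
    rw [hxt, htf] at h3
    simp only [map_smul, LinearMap.smul_apply, smul_eq_mul] at h3
    have h4 : r = c i := by
      have h5 : (r * (c i)⁻¹) * D.bX tr x (f i) = 1 * D.bX tr x (f i) := by
        linear_combination h3
      exact (mul_inv_eq_one₀ (hc0 i)).1 (mul_right_cancel₀ hi h5)
    subst h4
    exact aux _ _ _ (hD.eigenline hS hY hB ht hc0 hte htf hc hx hxt)
      (hD.eigenline hS hY hB ht hc0 hte htf hc hy hyt)
  · push Not at h1
    by_cases h3 : ∃ i, D.bX tr (e i) x ≠ 0
    · obtain ⟨i, hi⟩ := h3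
      have hφ : φ = φ' := by
        by_contra hne
        exact hi (hD.bX_eig_self hS hne (hB.he i) hx)
      have h3 := hti.2 (e i) x
      rw [hxt, hte] at h3
      simp only [map_smul, LinearMap.smul_apply, smul_eq_mul] at h3
      have h4 : r = (c i)⁻¹ := by
        have h5 : (r * c i) * D.bX tr (e i) x = 1 * D.bX tr (e i) x := by
          linear_combination h3
        exact eq_inv_of_mul_eq_one_left (mul_right_cancel₀ hi h5)
      subst h4
      rw [hφ] at hx hy
      exact aux _ _ _ (hD.eigenline' hS hY hB ht hc0 hte htf hc hx hxt)
        (hD.eigenline' hS hY hB ht hc0 hte htf hc hy hyt)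
    · push Not at h3
      refine absurd ?_ h0
      rw [hB.span x hxY]
      simp [h1, h3]

end IsHerm

end Symm

end LeviDatum

/-! ### Regular elements of N in terms of simple spectra -/

namespace LeviDatum

section RegUnip

variable {K S C W X U : Type*} [Field K] [AddCommGroup C] [Module K C]
    [AddCommGroup W] [Module K W] [AddCommGroup X] [Module K X] [AddCommGroup U] [Module K U]
variable {D : LeviDatum K S C W X U} {tr : C →ₗ[K] K} {σ : S → S} {opC : S → Module.End K C}
variable {φ φ' : S → K} {δ : S} {a b : K}

namespace IsHerm

variable (hD : D.IsHerm tr σ opC)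
include hD
variable [FiniteDimensional K X] [FiniteDimensional K W] [FiniteDimensional K U]

theorem exists_adj_eq {Y : Submodule K X} (hY : D.IsNS tr Y) {f : X →ₗ[K] W} (hf : D.IsXi Y f)
    {y : X} (hy : y ∈ Y) : ∃ u : U, D.adj f u = y := by
  obtain ⟨u, hu⟩ := (hD.comp_adj_bijective (U := U) hY hf).2 (f y)
  exact ⟨u, hf.2.1.2.1 (hD.adj_mem hY hf u) hy hu⟩

theorem mem_eigSp_of_adj {f : X →ₗ[K] W} (hf : ∀ s x, f (D.opX s x) = D.opW s (f x))
    (hi : Function.Injective (D.adj (U := U) f)) {χ : S → K} {u : U} :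
    D.adj f u ∈ eigSp D.opX χ ↔ u ∈ eigSp D.opU χ := by
  rw [mem_eigSp, mem_eigSp]
  refine forall_congr' fun s => ?_
  rw [← hD.adj_op hf, ← map_smul, hi.eq_iff]

omit hD in
theorem innerEnd_eig_iff {n : Module.End K (W × X × U)}
    (hi : Function.Injective (D.adj (U := U) (xiOf n))) {u : U} {c : K} :
    D.normMap n (D.adj (xiOf n) u) = c • D.adj (xiOf n) u ↔ D.innerEnd n u = (c - 1) • u := by
  rw [normMap_adj, ← map_smul, hi.eq_iff, sub_smul, one_smul, eq_sub_iff_add_eq, add_comm]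

variable (hS : D.IsSplit σ φ φ' δ a b)
include hS

/-- `ξ*` is an isomorphism of `U` with `Y` that intertwines `1 + innerEnd n` with `t` and respects
the eigenspaces of the operators, so the hyperbolic basis pulls back to eigenvectors. If `φ ≠ φ'`
only the `e i` contribute to `U_φ`. -/
theorem simpleOn_of_dist {n : Module.End K (W × X × U)} {Y : Submodule K X} (hY : D.IsNS tr Y)
    (hxi : D.IsXi Y (xiOf n)) {m : ℕ} {e f : Fin m → X} (hB : D.HypBasis tr φ φ' Y e f)
    {t : X ≃ₗ[K] X} (ht : t ∈ D.isomFix Y) (htn : D.normMap n = (t : X →ₗ[K] X))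
    {c : Fin m → K} (hc0 : ∀ i, c i ≠ 0) (hte : ∀ i, t (e i) = c i • e i)
    (htf : ∀ i, t (f i) = (c i)⁻¹ • f i) (hc : Dist φ φ' c) :
    SimpleOn (D.innerEnd n) (eigSp D.opU φ) := by
  have hi := adj_injective_of_bijective (hD.comp_adj_bijective (U := U) hY hxi)
  have htn' : ∀ x, D.normMap n x = t x := fun x => LinearMap.congr_fun htn x
  have hmem : ∀ {χ : S → K} {u : U}, D.adj (xiOf n) u ∈ eigSp D.opX χ ↔ u ∈ eigSp D.opU χ :=
    hD.mem_eigSp_of_adj hxi.1 hi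
  constructor
  · intro u hu
    have hJu := hmem.2 hu
    choose v hv using fun i => hD.exists_adj_eq (U := U) hY hxi (hB.memE i)
    choose w hw using fun i => hD.exists_adj_eq (U := U) hY hxi (hB.memF i)
    have hsum : u = ∑ i, D.bX tr (D.adj (xiOf n) u) (f i) • v i +
        ∑ i, D.bX tr (e i) (D.adj (xiOf n) u) • w i := by
      apply hi
      conv_lhs => rw [hB.span _ (hD.adj_mem hY hxi u)]
      simp [map_sum, hv, hw]
    rw [hsum]
    refine Submodule.add_mem _ (Submodule.sum_mem _ fun i _ => Submodule.smul_mem _ _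
      (Submodule.subset_span ⟨hmem.1 (by rw [hv]; exact hB.he i), c i - 1, ?_⟩))
      (Submodule.sum_mem _ fun i _ => ?_)
    · rw [← innerEnd_eig_iff hi, hv, htn', hte]
    · by_cases hφ : φ = φ'
      · refine Submodule.smul_mem _ _ (Submodule.subset_span
          ⟨hmem.1 (by rw [hw, hφ]; exact hB.hf i), (c i)⁻¹ - 1, ?_⟩)
        rw [← innerEnd_eig_iff hi, hw, htn', htf]
      · rw [hD.bX_eig_self hS hφ (hB.he i) hJu, zero_smul]
        exact zero_mem _
  · intro v hv w hw r hrv hrw h0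
    have hr : ∀ u, D.innerEnd n u = r • u → t (D.adj (xiOf n) u) = (r + 1) • D.adj (xiOf n) u := by
      intro u hu
      rw [← htn', innerEnd_eig_iff hi, add_sub_cancel_right, hu]
    obtain ⟨s, hs⟩ := hD.proportional_of_dist hS hY hB ht hc0 hte htf hc
      (hD.adj_mem hY hxi v) (hmem.2 hv) (hmem.2 hw) (hr v hrv) (hr w hrw)
      (fun h => h0 (hi (by rw [h, map_zero])))
    exact ⟨s, hi (by rw [hs, map_smul])⟩

/-- The norm is a regular element for the subspace `h Y₀`, which by `isXi_of_norm` is carried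
isomorphically to `W` by `ξ`. The statement for `φ'` follows by exchanging the two halves of the
hyperbolic basis. -/
theorem simpleOn_of_mem_regUnip [IsAlgClosed K] (h2 : (2 : K) ≠ 0) {Y₀ : Submodule K X}
    (hY₀ : D.IsNS tr Y₀) (hfr₀ : Module.finrank K Y₀ = Module.finrank K W)
    {T₀ : Subgroup (X ≃ₗ[K] X)} (hT₀ : D.IsMaxTorus Y₀ T₀) {n : Module.End K (W × X × U)}
    (hn : n ∈ D.regUnip Y₀ T₀) : Function.Bijective (xiOf n ∘ₗ D.adj (U := U) (xiOf n)) ∧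
      SimpleOn (D.innerEnd n) (eigSp D.opU φ) ∧ SimpleOn (D.innerEnd n) (eigSp D.opU φ') := by
  obtain ⟨hn, h, hh, t₀, ht₀, hnt⟩ := hn
  set t := h * t₀ * h⁻¹ with ht
  have hY : D.IsNS tr (Y₀.map (h : X →ₗ[K] X)) := hD.isNS_map hY₀ hh
  have hfr : Module.finrank K (Y₀.map (h : X →ₗ[K] X)) = Module.finrank K W := by
    rw [LinearEquiv.finrank_map_eq, hfr₀]
  have htY : t ∈ D.isomFix (Y₀.map (h : X →ₗ[K] X)) := hD.isomFix_map hY₀ hh (hT₀.1 ht₀.1)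
  obtain ⟨T, hT, htT⟩ := hD.exists_maxTorus_of_conj hS h2 hY hY₀ hfr hfr₀ hT₀ htY
    (D.isomX.inv_mem hh) (by
      have : h⁻¹ * t * h⁻¹⁻¹ = t₀ := by rw [ht]; group
      rwa [this])
  obtain ⟨m, e, f, hB, rfl⟩ := hD.exists_eq_diagSub hS h2 hY hfr hT
  obtain ⟨c, hc0, hte, htf⟩ := hD.exists_coeff_of_diag htY.1 hB htT.1.2
  have hc := hD.dist_of_regSet hS h2 hY hB htT hte htf
  have hxi := hD.isXi_of_norm hfr hn htY htT.2.2 hnt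
  refine ⟨hD.comp_adj_bijective hY hxi,
    hD.simpleOn_of_dist hS hY hxi hB htY hnt hc0 hte htf hc,
    hD.simpleOn_of_dist (hS.symm hD) hY hxi (hB.symm hD) htY hnt (fun i => inv_ne_zero (hc0 i)) htf
      (fun i => ?_) hc.symm⟩
  rw [map_smul, hte, inv_inv, smul_comm]

/-- On `Y = im ξ*` the norm minus one is injective because `innerEnd n` is. Simple spectrum yields a
hyperbolic eigenbasis of `Y` and makes its eigenvalues satisfy `Dist`, so the norm is regular for a
torus of `H_Y`; `exists_conj_mem_regSet` carries it into the given one. -/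
theorem mem_regUnip_of_simpleOn [IsAlgClosed K] (h2 : (2 : K) ≠ 0) {Y₀ : Submodule K X}
    (hY₀ : D.IsNS tr Y₀) (hfr₀ : Module.finrank K Y₀ = Module.finrank K W)
    {T₀ : Subgroup (X ≃ₗ[K] X)} (hT₀ : D.IsMaxTorus Y₀ T₀) {n : Module.End K (W × X × U)}
    (hn : n ∈ D.unipRadInv) (hb : Function.Bijective (xiOf n ∘ₗ D.adj (U := U) (xiOf n)))
    (hs : SimpleOn (D.innerEnd n) (eigSp D.opU φ))
    (hs' : SimpleOn (D.innerEnd n) (eigSp D.opU φ')) : n ∈ D.regUnip Y₀ T₀ := by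
  have hf := xiOf_op hn.1.1
  have hi := adj_injective_of_bijective hb
  have hA := innerEnd_bijective hn hb
  obtain ⟨g, hg, hgn⟩ := hD.exists_normMap hn
  have hgn' : ∀ x, D.normMap n x = g x := fun x => (LinearMap.congr_fun hgn x).symm
  have hY := hD.isNS_range_adj hf hb
  have hfr := hD.finrank_range_adj hb
  have hgY := hD.norm_mem_isomFix hn hg hgn
  set Y := LinearMap.range (D.adj (U := U) (xiOf n)) with hYdef
  have hmem : ∀ {χ : S → K} {u : U}, D.adj (xiOf n) u ∈ eigSp D.opX χ ↔ u ∈ eigSp D.opU χ :=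
    hD.mem_eigSp_of_adj hf hi
  have hone : ∀ y ∈ Y, g y = y → y = 0 := by
    rintro _ ⟨u, rfl⟩ hu
    rw [← hgn', ← one_smul K (D.adj (xiOf n) u), map_smul, one_smul, innerEnd_eig_iff hi, sub_self,
      zero_smul] at hu
    rw [hA.1 (hu.trans (map_zero _).symm), map_zero]
  have hmul : ∀ v ∈ Y, ∀ w ∈ Y, v ∈ eigSp D.opX φ → w ∈ eigSp D.opX φ → ∀ c : K, g v = c • v →
      g w = c • w → v ≠ 0 → ∃ r : K, w = r • v := by
    rintro _ ⟨v, rfl⟩ _ ⟨w, rfl⟩ hv hw c hvc hwc h0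
    rw [← hgn', innerEnd_eig_iff hi] at hvc hwc
    obtain ⟨r, hr⟩ := hs.2 v (hmem.1 hv) w (hmem.1 hw) _ hvc hwc
      (fun h => h0 (by rw [h, map_zero]))
    exact ⟨r, by rw [hr, map_smul]⟩
  have hspan : ∀ (χ : S → K), χ = φ ∨ χ = φ' → SimpleOn (D.innerEnd n) (eigSp D.opU χ) →
      ∀ u ∈ eigSp D.opU χ, D.adj (xiOf n) u ∈ Submodule.span K {v | D.IsEig φ φ' {g} v} := by
    intro χ hχ hsχ u hu
    have h1 := Submodule.mem_map_of_mem (f := D.adj (xiOf n)) (hsχ.1 hu)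
    rw [Submodule.map_span] at h1
    refine Submodule.span_mono ?_ h1
    rintro _ ⟨v, ⟨hv, c, hc⟩, rfl⟩
    refine ⟨?_, ?_⟩
    · rcases hχ with rfl | rfl
      · exact Or.inl (hmem.2 hv)
      · exact Or.inr (hmem.2 hv)
    · rintro _ rfl
      exact ⟨c + 1, by rw [← hgn', innerEnd_eig_iff hi, add_sub_cancel_right, hc]⟩
  obtain ⟨m, e, f, hB, hef⟩ := hD.exists_hypBasis_of_mult_one hS hgY hY (fun h => hfr ▸ hS.even h)
    (by
      rintro _ ⟨u, rfl⟩
      obtain ⟨h1, h3⟩ := hS.projU u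
      rw [← add_sub_cancel (affOp a b (D.opU δ) u) u, map_add]
      exact Submodule.add_mem _ (hspan φ (Or.inl rfl) hs _ h1) (hspan φ' (Or.inr rfl) hs' _ h3))
    hone hmul
  obtain ⟨c, hc0, hte, htf⟩ := hD.exists_coeff_of_diag hg hB
    (fun i => ⟨(hef i).1.2 g rfl, (hef i).2.2 g rfl⟩)
  have hc : Dist φ φ' c := by
    refine ⟨fun i j hij => ?_, fun i h => ?_, fun hφ i j hij => ?_⟩
    · obtain ⟨r, hr⟩ := hmul _ (hB.memE j) _ (hB.memE i) (hB.he j) (hB.he i) _ (hte j)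
        (by rw [hte, hij]) (hypBasis_ne hB j).1
      by_contra hne
      have h1 := hB.ef i i
      rw [hr, map_smul, LinearMap.smul_apply, hB.ef, if_neg (Ne.symm hne), if_pos rfl] at h1
      simp at h1
    · exact (hypBasis_ne hB i).1 (hone _ (hB.memE i) (by rw [hte, h, one_smul]))
    · have h1 : c i = (c j)⁻¹ := eq_inv_of_mul_eq_one_left hij
      obtain ⟨r, hr⟩ := hmul _ (hB.memF j) _ (hB.memE i) (by rw [hφ]; exact hB.hf j) (hB.he i) _
        (htf j) (by rw [hte, h1]) (hypBasis_ne hB j).2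
      have h3 := hB.ef i i
      rw [hr, map_smul, LinearMap.smul_apply, hB.ff, if_pos rfl] at h3
      simp at h3
  obtain ⟨h, hh, hth⟩ := hD.exists_conj_mem_regSet hS h2 hY hY₀ hfr hfr₀
    (hD.isMaxTorus_diagSub hS h2 hY hB) hT₀ (hD.mem_regSet_of_dist hS hY hB hgY hc0 hte htf hc)
  refine ⟨hn, h⁻¹, D.isomX.inv_mem hh, _, hth, ?_⟩
  rw [← hgn]
  congr 1
  group

end IsHerm

end RegUnip

end LeviDatum

/-! ### Matrices of polynomial functions -/

section PolyMat

variable {K E A B : Type*} [Field K] [AddCommGroup E] [Module K E] [AddCommGroup A] [Module K A]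
    [AddCommGroup B] [Module K B]

/-- Evaluation of polynomial functions at a point. -/
def evPoly (x : E) : polyFun K E →+* K := (Pi.evalRingHom _ x).comp (polyFun K E).val.toRingHom

theorem evPoly_apply (x : E) (p : polyFun K E) : evPoly x p = (p : E → K) x := rfl

/-- The matrix of a linear map depending linearly on `x : E`. -/
noncomputable def polyMat {k l : ℕ} (bA : Module.Basis (Fin k) K A) (bB : Module.Basis (Fin l) K B)
    (g : E → (A →ₗ[K] B)) (hg : IsLinearMap K g) : Matrix (Fin l) (Fin k) (polyFun K E) :=
  Matrix.of fun i j => ⟨fun x => bB.repr (g x (bA j)) i,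
    mem_polyFun_of_linear (fun x y => by simp [hg.map_add]) (fun c x => by simp [hg.map_smul])⟩

theorem polyMat_map {k l : ℕ} (bA : Module.Basis (Fin k) K A) (bB : Module.Basis (Fin l) K B)
    (g : E → (A →ₗ[K] B)) (hg : IsLinearMap K g) (x : E) :
    (polyMat bA bB g hg).map (evPoly x) = LinearMap.toMatrix bA bB (g x) := by
  ext i j
  rw [LinearMap.toMatrix_apply]
  rfl

theorem map_algebraMap_evPoly {k l : ℕ} (N : Matrix (Fin l) (Fin k) K) (x : E) :
    (N.map (algebraMap K (polyFun K E))).map (evPoly x) = N := by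
  ext i j
  rfl

theorem det_toMatrix_ne_zero_iff {k : ℕ} (bA : Module.Basis (Fin k) K A)
    (bB : Module.Basis (Fin k) K B) (f : A →ₗ[K] B) :
    (LinearMap.toMatrix bA bB f).det ≠ 0 ↔ Function.Bijective f := by
  let ι : B ≃ₗ[K] A := bB.equiv bA (Equiv.refl _)
  have h : LinearMap.toMatrix bA bA ((ι : B →ₗ[K] A) ∘ₗ f) = LinearMap.toMatrix bA bB f := by
    ext i j
    simp [LinearMap.toMatrix_apply, ι, Module.Basis.equiv]
  rw [← h, ← isUnit_iff_ne_zero, ← Matrix.isUnit_iff_isUnit_det, LinearMap.isUnit_toMatrix_iff,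
    Module.End.isUnit_iff]
  exact ι.bijective.of_comp_iff' f

end PolyMat

/-! ### Openness -/

namespace LeviDatum

section Openness

variable {K S C W X U : Type*} [Field K] [AddCommGroup C] [Module K C]
    [AddCommGroup W] [Module K W] [AddCommGroup X] [Module K X] [AddCommGroup U] [Module K U]
variable {D : LeviDatum K S C W X U} {tr : C →ₗ[K] K} {σ : S → S} {opC : S → Module.End K C}
variable {φ φ' : S → K} {δ : S} {a b : K}

/-- The component `U → X` of an endomorphism of `V`. -/
def zetaOf (n : Module.End K (W × X × U)) : U →ₗ[K] X :=
  LinearMap.fst K X U ∘ₗ LinearMap.snd K W (X × U) ∘ₗ n ∘ₗ LinearMap.inr K W (X × U) ∘ₗ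
    LinearMap.inr K X U

theorem isLinearMap_etaOf : IsLinearMap K (etaOf : Module.End K (W × X × U) → (U →ₗ[K] W)) :=
  ⟨fun _ _ => by ext; simp [etaOf], fun _ _ => by ext; simp [etaOf]⟩

theorem isLinearMap_xiOf : IsLinearMap K (xiOf : Module.End K (W × X × U) → (X →ₗ[K] W)) :=
  ⟨fun _ _ => by ext; simp [xiOf], fun _ _ => by ext; simp [xiOf]⟩

theorem isLinearMap_zetaOf : IsLinearMap K (zetaOf : Module.End K (W × X × U) → (U →ₗ[K] X)) :=
  ⟨fun _ _ => by ext; simp [zetaOf], fun _ _ => by ext; simp [zetaOf]⟩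

theorem IsHerm.zetaOf_eq (hD : D.IsHerm tr σ opC) [FiniteDimensional K X]
    {n : Module.End K (W × X × U)} (hn : n ∈ D.unipRad) :
    zetaOf n = - D.adj (xiOf n) := by
  ext u
  conv_lhs => rw [hD.eq_unip hn]
  simp [zetaOf, unip_apply]

section Polynomials

variable {k l r : ℕ} (bW : Module.Basis (Fin k) K W) (bU : Module.Basis (Fin k) K U)
    (bX : Module.Basis (Fin l) K X)

/-- The discriminant of the compression to `Z` of the endomorphism `adj(η) ξ ζ` of `U`. -/
noncomputable def discPoly {Z : Submodule K U} (bZ : Module.Basis (Fin r) K Z) (p : U →ₗ[K] Z) :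
    polyFun K (Module.End K (W × X × U)) :=
  discMat ((LinearMap.toMatrix bU bZ p).map (algebraMap K (polyFun K (Module.End K (W × X × U)))) *
    ((polyMat bU bW (E := Module.End K (W × X × U)) etaOf isLinearMap_etaOf).adjugate * (polyMat bX bW (E := Module.End K (W × X × U)) xiOf isLinearMap_xiOf *
      polyMat bU bX (E := Module.End K (W × X × U)) zetaOf isLinearMap_zetaOf)) *
    (LinearMap.toMatrix bZ bU Z.subtype).map (algebraMap K (polyFun K (Module.End K (W × X × U)))))

/-- The endomorphism `adj(η) ξ ζ` of `U`. -/
noncomputable def adjugateEnd (n : Module.End K (W × X × U)) : Module.End K U :=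
  Matrix.toLin bW bU (LinearMap.toMatrix bU bW (etaOf n)).adjugate ∘ₗ xiOf n ∘ₗ zetaOf n

theorem discPoly_apply {Z : Submodule K U} (bZ : Module.Basis (Fin r) K Z) (p : U →ₗ[K] Z)
    (n : Module.End K (W × X × U)) : (discPoly bW bU bX bZ p : Module.End K (W × X × U) → K) n =
      discMat (LinearMap.toMatrix bZ bZ (p ∘ₗ adjugateEnd bW bU n ∘ₗ Z.subtype)) := by
  rw [← evPoly_apply, discPoly, ← discMat_map, Matrix.map_mul, Matrix.map_mul, Matrix.map_mul,
    Matrix.map_mul, ← RingHom.mapMatrix_apply (evPoly n) (Matrix.adjugate _), RingHom.map_adjugate,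
    RingHom.mapMatrix_apply, polyMat_map, polyMat_map, polyMat_map, map_algebraMap_evPoly,
    map_algebraMap_evPoly, LinearMap.toMatrix_comp bZ bU bZ, LinearMap.toMatrix_comp bZ bU bU,
    adjugateEnd, LinearMap.toMatrix_comp bU bW bU, LinearMap.toMatrix_comp bU bX bW,
    LinearMap.toMatrix_toLin, Matrix.mul_assoc (LinearMap.toMatrix bU bZ p)]

/-- On `N'` the adjugate of `η` is `det η · η⁻¹` and `ζ = -ξ*`. The nonzero scalar does not affect
simplicity of the spectrum, so the inverse of `η` is replaced by an expression polynomial in `n`. -/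
theorem adjugateEnd_eq (hD : D.IsHerm tr σ opC) [FiniteDimensional K X]
    {n : Module.End K (W × X × U)} (hn : n ∈ D.unipRadInv) : adjugateEnd bW bU n =
      (-(LinearMap.toMatrix bU bW (etaOf n)).det) • D.innerEnd n := by
  have key : ∀ u, Matrix.toLin bW bU (LinearMap.toMatrix bU bW (etaOf n)).adjugate (etaOf n u) =
      (LinearMap.toMatrix bU bW (etaOf n)).det • u := by
    intro u
    have h1 : Matrix.toLin bW bU (LinearMap.toMatrix bU bW (etaOf n)).adjugate ∘ₗ etaOf n =
        (LinearMap.toMatrix bU bW (etaOf n)).det • LinearMap.id := by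
      conv_lhs => rw [← Matrix.toLin_toMatrix bU bW (etaOf n)]
      rw [← Matrix.toLin_mul bU bW bU, LinearMap.toMatrix_toLin, Matrix.adjugate_mul, map_smul,
        Matrix.toLin_one]
    exact LinearMap.congr_fun h1 u
  ext u
  rw [adjugateEnd, hD.zetaOf_eq hn.1]
  simp only [LinearMap.comp_apply, LinearMap.neg_apply, map_neg, LinearMap.smul_apply, innerEnd,
    neg_smul]
  rw [← key, apply_linInv hn.2]

end Polynomials

theorem IsHerm.discPoly_ne_zero_iff [IsAlgClosed K] (hD : D.IsHerm tr σ opC) {k l r : ℕ}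
    (bW : Module.Basis (Fin k) K W) (bU : Module.Basis (Fin k) K U)
    (bX : Module.Basis (Fin l) K X) {χ : S → K}
    (bZ : Module.Basis (Fin r) K (eigSp D.opU χ)) {p : U →ₗ[K] eigSp D.opU χ}
    (hp : p ∘ₗ (eigSp D.opU χ).subtype = LinearMap.id) {n : Module.End K (W × X × U)}
    (hn : n ∈ D.unipRadInv) :
    (discPoly bW bU bX bZ p : Module.End K (W × X × U) → K) n ≠ 0 ↔
      SimpleOn (D.innerEnd n) (eigSp D.opU χ) := by
  have := Module.Finite.of_basis bX
  have := Module.Finite.of_basis bU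
  have := Module.Finite.of_basis bW
  have hdet := (det_toMatrix_ne_zero_iff bU bW (etaOf n)).2 hn.2
  rw [discPoly_apply, discMat_ne_zero_iff, LinearMap.charpoly_toMatrix,
    separable_charpoly_compress_iff _ hp, adjugateEnd_eq bW bU hD hn]
  · refine ⟨fun h => ?_, fun h => h.smul (neg_ne_zero.2 hdet)⟩
    have := h.smul (inv_ne_zero (neg_ne_zero.2 hdet))
    rwa [inv_smul_smul₀ (neg_ne_zero.2 hdet)] at this
  · intro z hz s
    rw [adjugateEnd_eq bW bU hD hn, LinearMap.smul_apply, map_smul, ← hD.innerEnd_op hn, hz s,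
      map_smul, smul_comm]

/-- The open set is the nonvanishing locus of the product of `det η`, `det (ξζ)` and the two
discriminants. On `N` its factors express that `η` and `ξξ*` are invertible and that `innerEnd n`
has simple spectrum on both eigenspaces. -/
theorem IsHerm.isOpen_regUnip [IsAlgClosed K] (h2 : (2 : K) ≠ 0) (hD : D.IsHerm tr σ opC)
    (hS : D.IsSplit σ φ φ' δ a b) [FiniteDimensional K X] [FiniteDimensional K W]
    [FiniteDimensional K U] {Y₀ : Submodule K X}
    (hY₀ : D.IsNS tr Y₀) (hfr₀ : Module.finrank K Y₀ = Module.finrank K W)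
    {T₀ : Subgroup (X ≃ₗ[K] X)} (hT₀ : D.IsMaxTorus Y₀ T₀) :
    ∃ O, @IsOpen _ (zariski K _) O ∧ D.regUnip Y₀ T₀ = D.unipRad ∩ O := by
  let bW := Module.finBasis K W
  let bU := Module.finBasisOfFinrankEq K U hD.finrank_eq
  let bX := Module.finBasis K X
  have hex : ∀ Z : Submodule K U, ∃ p : U →ₗ[K] Z, p ∘ₗ Z.subtype = LinearMap.id := fun Z =>
    LinearMap.exists_leftInverse_of_injective _ (LinearMap.ker_eq_bot.2 Z.subtype_injective)
  obtain ⟨p, hp⟩ := hex (eigSp D.opU φ)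
  obtain ⟨p', hp'⟩ := hex (eigSp D.opU φ')
  let bZ := Module.finBasis K (eigSp D.opU φ)
  let bZ' := Module.finBasis K (eigSp D.opU φ')
  let P : polyFun K (Module.End K (W × X × U)) :=
    (polyMat bU bW (E := Module.End K (W × X × U)) etaOf isLinearMap_etaOf).det *
      (polyMat bX bW (E := Module.End K (W × X × U)) xiOf isLinearMap_xiOf * polyMat bU bX (E := Module.End K (W × X × U)) zetaOf isLinearMap_zetaOf).det *
      (discPoly bW bU bX bZ p * discPoly bW bU bX bZ' p')
  have hP : ∀ n, (P : Module.End K (W × X × U) → K) n =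
      (LinearMap.toMatrix bU bW (etaOf n)).det *
      (LinearMap.toMatrix bU bW (xiOf n ∘ₗ zetaOf n)).det *
      ((discPoly bW bU bX bZ p : Module.End K (W × X × U) → K) n *
        (discPoly bW bU bX bZ' p' : Module.End K (W × X × U) → K) n) := by
    intro n
    have h1 : (P : Module.End K (W × X × U) → K) n =
        evPoly n (polyMat bU bW (E := Module.End K (W × X × U)) etaOf isLinearMap_etaOf).det *
        evPoly n (polyMat bX bW (E := Module.End K (W × X × U)) xiOf isLinearMap_xiOf *
          polyMat bU bX (E := Module.End K (W × X × U)) zetaOf isLinearMap_zetaOf).det *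
        (evPoly n (discPoly bW bU bX bZ p) * evPoly n (discPoly bW bU bX bZ' p')) := rfl
    rw [h1, RingHom.map_det, RingHom.map_det, RingHom.mapMatrix_apply, RingHom.mapMatrix_apply,
      Matrix.map_mul, polyMat_map, polyMat_map, polyMat_map, LinearMap.toMatrix_comp bU bX bW]
    rfl
  refine ⟨{n | (P : Module.End K (W × X × U) → K) n ≠ 0}, isOpen_ne_zero P.2, ?_⟩
  have hz : ∀ n ∈ D.unipRad, (LinearMap.toMatrix bU bW (xiOf n ∘ₗ zetaOf n)).det ≠ 0 ↔
      Function.Bijective (xiOf n ∘ₗ D.adj (U := U) (xiOf n)) := by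
    intro n hn
    rw [det_toMatrix_ne_zero_iff, hD.zetaOf_eq hn, LinearMap.comp_neg]
    constructor
    · intro h
      have := (LinearEquiv.neg K (M := W)).bijective.comp h
      convert! this using 1
      ext u
      simp
    · intro h
      exact (LinearEquiv.neg K (M := W)).bijective.comp h
  ext n
  simp only [Set.mem_inter_iff]
  constructor
  · intro hn
    obtain ⟨h1, h3, h4⟩ := hD.simpleOn_of_mem_regUnip hS h2 hY₀ hfr₀ hT₀ hn
    refine ⟨hn.1.1, ?_⟩
    change (P : Module.End K (W × X × U) → K) n ≠ 0
    rw [hP]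
    exact mul_ne_zero (mul_ne_zero ((det_toMatrix_ne_zero_iff _ _ _).2 hn.1.2) ((hz n hn.1.1).2 h1))
      (mul_ne_zero ((hD.discPoly_ne_zero_iff bW bU bX bZ hp hn.1).2 h3)
        ((hD.discPoly_ne_zero_iff bW bU bX bZ' hp' hn.1).2 h4))
  · rintro ⟨hn, hne⟩
    change (P : Module.End K (W × X × U) → K) n ≠ 0 at hne
    rw [hP] at hne
    have hl := left_ne_zero_of_mul hne
    have hr := right_ne_zero_of_mul hne
    have hn' : n ∈ D.unipRadInv :=
      ⟨hn, (det_toMatrix_ne_zero_iff bU bW _).1 (left_ne_zero_of_mul hl)⟩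
    exact hD.mem_regUnip_of_simpleOn hS h2 hY₀ hfr₀ hT₀ hn'
      ((hz n hn).1 (right_ne_zero_of_mul hl))
      ((hD.discPoly_ne_zero_iff bW bU bX bZ hp hn').1 (left_ne_zero_of_mul hr))
      ((hD.discPoly_ne_zero_iff bW bU bX bZ' hp' hn').1 (right_ne_zero_of_mul hr))

end Openness

end LeviDatum

/-! ### Nonemptiness -/

namespace LeviDatum

section Nonempty

variable {K S C W X U : Type*} [Field K] [AddCommGroup C] [Module K C]
    [AddCommGroup W] [Module K W] [AddCommGroup X] [Module K X] [AddCommGroup U] [Module K U]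
variable {D : LeviDatum K S C W X U} {tr : C →ₗ[K] K} {σ : S → S} {opC : S → Module.End K C}
variable {φ φ' : S → K} {δ : S} {a b : K}

theorem IsSplit.swap_mem {τ : W ≃ₗ[K] W} (hτ : ∀ s w, τ (D.opW s w) = D.opW (σ s) (τ w))
    (hσ : ∀ s, σ (σ s) = s) {χ χ' : S → K} (hχ : ∀ s, χ' s = χ (σ s)) {w : W}
    (hw : w ∈ eigSp D.opW χ) : τ w ∈ eigSp D.opW χ' := fun s => by
  rw [hχ, ← hσ s, ← hτ, hσ, hw, map_smul]

theorem disjoint_eigSp {M : Type*} [AddCommGroup M] [Module K M] {op : S → Module.End K M}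
    (h : φ ≠ φ') : Disjoint (eigSp op φ) (eigSp op φ') := by
  rw [Submodule.disjoint_def]
  intro x hx hx'
  obtain ⟨s, hs⟩ := Function.ne_iff.1 h
  have h1 : (φ s - φ' s) • x = 0 := by rw [sub_smul, ← hx s, ← hx' s, sub_self]
  exact (smul_eq_zero.1 h1).resolve_left (sub_ne_zero.2 hs)

/-- If `φ ≠ φ'`, the map in `swap` exchanges the two eigenspaces of `W`, so each has dimension `m`.
If `φ = φ'`, any basis can be cut in two. -/
theorem IsSplit.exists_basis (hS : D.IsSplit σ φ φ' δ a b) (hσ : ∀ s, σ (σ s) = s)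
    [FiniteDimensional K W] {m : ℕ} (hm : Module.finrank K W = 2 * m) :
    ∃ (w w' : Fin m → W) (v : Module.Basis (Fin m ⊕ Fin m) K W),
      ⇑v = Sum.elim w w' ∧ (∀ i, w i ∈ eigSp D.opW φ) ∧ ∀ i, w' i ∈ eigSp D.opW φ' := by
  by_cases hφ : φ = φ'
  · let v : Module.Basis (Fin m ⊕ Fin m) K W := (Module.finBasis K W).reindex
      (Fintype.equivOfCardEq (by simp [hm, two_mul]))
    have hmem : ∀ w : W, w ∈ eigSp D.opW φ := fun w => by
      rw [← add_sub_cancel (affOp a b (D.opW δ) w) w]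
      exact add_mem (hS.projW w).1 (hφ ▸ (hS.projW w).2)
    refine ⟨fun i => v (Sum.inl i), fun i => v (Sum.inr i), v, ?_, fun i => hmem _,
      fun i => hφ ▸ hmem _⟩
    ext (i | i) <;> rfl
  · obtain ⟨τ, hτ⟩ := hS.swap
    have hconj : ∀ s, φ s = φ' (σ s) := fun s => by rw [hS.conj, hσ]
    have hle : Module.finrank K (eigSp D.opW φ) ≤ Module.finrank K (eigSp D.opW φ') := by
      rw [← LinearEquiv.finrank_map_eq τ]
      refine Submodule.finrank_mono ?_
      rintro _ ⟨w, hw, rfl⟩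
      exact IsSplit.swap_mem hτ hσ hS.conj hw
    have hle' : Module.finrank K (eigSp D.opW φ') ≤ Module.finrank K (eigSp D.opW φ) := by
      rw [← LinearEquiv.finrank_map_eq τ]
      refine Submodule.finrank_mono ?_
      rintro _ ⟨w, hw, rfl⟩
      exact IsSplit.swap_mem hτ hσ hconj hw
    have hsum := Submodule.finrank_add_eq_of_isCompl (U := eigSp D.opW φ) (W := eigSp D.opW φ')
      ⟨disjoint_eigSp hφ, by
        rw [codisjoint_iff, Submodule.eq_top_iff']
        intro w
        rw [← add_sub_cancel (affOp a b (D.opW δ) w) w]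
        exact Submodule.add_mem_sup (hS.projW w).1 (hS.projW w).2⟩
    let c := Module.finBasisOfFinrankEq K (eigSp D.opW φ) (n := m) (by omega)
    let c' := Module.finBasisOfFinrankEq K (eigSp D.opW φ') (n := m) (by omega)
    have hspan : ⊤ ≤ Submodule.span K (Set.range
        (Sum.elim (fun i => (c i : W)) fun i => (c' i : W))) := by
      have h1 : ∀ z : eigSp D.opW φ, (z : W) ∈ Submodule.span K (Set.range
          (Sum.elim (fun i => (c i : W)) fun i => (c' i : W))) := fun z => by
        rw [← c.sum_repr z, Submodule.coe_sum]
        exact Submodule.sum_mem _ fun i _ =>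
          Submodule.smul_mem _ _ (Submodule.subset_span ⟨Sum.inl i, rfl⟩)
      have h3 : ∀ z : eigSp D.opW φ', (z : W) ∈ Submodule.span K (Set.range
          (Sum.elim (fun i => (c i : W)) fun i => (c' i : W))) := fun z => by
        rw [← c'.sum_repr z, Submodule.coe_sum]
        exact Submodule.sum_mem _ fun i _ =>
          Submodule.smul_mem _ _ (Submodule.subset_span ⟨Sum.inr i, rfl⟩)
      intro w _
      rw [← add_sub_cancel (affOp a b (D.opW δ) w) w]
      exact Submodule.add_mem _ (h1 ⟨_, (hS.projW w).1⟩) (h3 ⟨_, (hS.projW w).2⟩)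
    exact ⟨fun i => c i, fun i => c' i, basisOfTopLeSpanOfCardEqFinrank _ hspan
      (by simp [hm, two_mul]), by simp, fun i => (c i).2, fun i => (c' i).2⟩

namespace IsHerm

variable (hD : D.IsHerm tr σ opC) (hS : D.IsSplit σ φ φ' δ a b)
include hD hS
variable [FiniteDimensional K X] [FiniteDimensional K W] [FiniteDimensional K U]

/-- The vectors `e i` and `f i` are sent to basis vectors of `W` in the eigenspaces of the same
type, which makes the map commute with the operators. -/
theorem exists_isXi {Y : Submodule K X} (hY : D.IsNS tr Y) {m : ℕ} {e f : Fin m → X}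
    (hB : D.HypBasis tr φ φ' Y e f) (hm : Module.finrank K W = 2 * m) :
    ∃ g : X →ₗ[K] W, D.IsXi Y g := by
  obtain ⟨w, w', v, hv, hw, hw'⟩ := hS.exists_basis hD.invol hm
  let g : X →ₗ[K] W := ∑ i, ((D.bX tr).flip (f i)).smulRight (w i) +
    ∑ i, (D.bX tr (e i)).smulRight (w' i)
  have hg : ∀ x, g x = ∑ i, D.bX tr x (f i) • w i + ∑ i, D.bX tr (e i) x • w' i := fun x => by
    simp [g, LinearMap.sum_apply]
  refine ⟨g, fun s x => ?_, ⟨fun _ _ => trivial, ?_, ?_⟩, fun x hx => ?_⟩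
  · rw [hg, hg, map_add, map_sum, map_sum]
    congr 1
    · refine Finset.sum_congr rfl fun i _ => ?_
      rw [hD.bX_op_left, hB.hf i, map_smul, map_smul, hw i, hS.conj, hD.invol, smul_smul,
        smul_eq_mul, mul_comm]
    · refine Finset.sum_congr rfl fun i _ => ?_
      rw [hD.bX_op_right, hB.he i, map_smul, LinearMap.smul_apply, map_smul, hw' i, hS.conj,
        smul_smul, smul_eq_mul, mul_comm]
  · intro x hx y hy hxy
    rw [← sub_eq_zero]
    have hz : x - y ∈ Y := Y.sub_mem hx hy
    have h0 : g (x - y) = 0 := by rw [map_sub, hxy, sub_self]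
    rw [hg] at h0
    have h1 := Fintype.linearIndependent_iff.1 v.linearIndependent
      (Sum.elim (fun i => D.bX tr (x - y) (f i)) fun i => D.bX tr (e i) (x - y))
      (by rw [Fintype.sum_sum_type, hv]; exact h0)
    rw [hB.span _ hz, Finset.sum_eq_zero fun i _ => ?_, Finset.sum_eq_zero fun i _ => ?_, add_zero]
    · have := h1 (Sum.inr i)
      rw [Sum.elim_inr] at this
      rw [this, zero_smul]
    · have := h1 (Sum.inl i)
      rw [Sum.elim_inl] at this
      rw [this, zero_smul]
  · intro z _
    refine ⟨∑ i, v.repr z (Sum.inl i) • e i + ∑ i, v.repr z (Sum.inr i) • f i,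
      Submodule.add_mem _ (Submodule.sum_mem _ fun i _ => Submodule.smul_mem _ _ (hB.memE i))
        (Submodule.sum_mem _ fun i _ => Submodule.smul_mem _ _ (hB.memF i)), ?_⟩
    have h1 : ∀ i, g (e i) = w i := fun i => by simp [hg, hB.ef, hB.ee]
    have h3 : ∀ i, g (f i) = w' i := fun i => by simp [hg, hB.ef, hB.ff]
    conv_rhs => rw [← v.sum_repr z, Fintype.sum_sum_type, hv]
    simp [map_sum, h1, h3]
  · have hx' := (hD.mem_perp_iff hY.1).1 hx
    have h1 : ∀ i, D.bX tr (e i) x = 0 := fun i => hx' _ (hB.memE i)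
    have h3 : ∀ i, D.bX tr x (f i) = 0 := fun i => hD.mem_orth'.1 hx' _ (hB.memF i)
    simp [hg, h1, h3]

/-- A diagonal element with the eigenvalues of `exists_dist` is regular, and `n_Y` lifts it to `N'`.
-/
theorem regUnip_nonempty [IsAlgClosed K] (h2 : (2 : K) ≠ 0) {Y : Submodule K X}
    (hY : D.IsNS tr Y) (hfr : Module.finrank K Y = Module.finrank K W)
    {T : Subgroup (X ≃ₗ[K] X)} (hT : D.IsMaxTorus Y T) : (D.regUnip (U := U) Y T).Nonempty := by
  obtain ⟨m, e, f, hB, rfl⟩ := hD.exists_eq_diagSub hS h2 hY hfr hT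
  obtain ⟨c, hc0, hc⟩ := exists_dist (φ := φ) (φ' := φ') (K := K) m
  obtain ⟨t, ht, hte, htf⟩ := hD.exists_diag hS h2 hY hB hc0
  have htr := hD.mem_regSet_of_dist hS hY hB ht hc0 hte htf hc
  obtain ⟨g, hg⟩ := hD.exists_isXi hS hY hB (by rw [← hfr, hB.finrank_eq])
  obtain ⟨h1, h3⟩ := hD.nY_mem (U := U) hY hg ht htr.2.2
  exact ⟨_, h1, 1, D.isomX.one_mem, t, htr, by rw [h3]; simp⟩

end IsHerm

end Nonempty

end LeviDatum

/-! ### Sets parametrized by rational functions over F -/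

section RatPoly

variable {F K X : Type*} [Field F] [Field K] [Algebra F K] [AddCommGroup X] [Module F X]
variable {r : ℕ} (bX : Module.Basis (Fin r) F X)

theorem eq_sum_baseChange_linearMap (g : Module.End K (K ⊗[F] X)) :
    g = ∑ i, ∑ j, LinearMap.toMatrix (Algebra.TensorProduct.basis K bX)
      (Algebra.TensorProduct.basis K bX) g i j • (bX.linearMap bX (i, j)).baseChange K := by
  apply (LinearMap.toMatrix (Algebra.TensorProduct.basis K bX)
    (Algebra.TensorProduct.basis K bX)).injective
  simp only [map_sum, map_smul, LinearMap.toMatrix_baseChange]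
  conv_lhs => rw [Matrix.matrix_eq_sum_single (LinearMap.toMatrix _ _ g)]
  refine Finset.sum_congr rfl fun i _ => Finset.sum_congr rfl fun j _ => ?_
  simp [Module.Basis.linearMap, Matrix.stdBasis_eq_single, Matrix.map_single, Matrix.smul_single]

/-- Polynomial functions are combinations of polynomials with coefficients in `F`. -/
theorem exists_sum_ratPolyFun [FiniteDimensional F X] {ι : Type*} (κ : Module.Basis ι F K)
    {p : Module.End K (K ⊗[F] X) → K} (hp : p ∈ polyFun K (Module.End K (K ⊗[F] X))) :
    ∃ q : ι →₀ ratPolyFun F K X, p = ∑ i ∈ q.support, κ i • (q i : Module.End K (K ⊗[F] X) → K) := by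
  let μ : K ⊗[F] ratPolyFun F K X →ₐ[K] (Module.End K (K ⊗[F] X) → K) :=
    Algebra.TensorProduct.lift (Algebra.ofId K _) (ratPolyFun F K X).val fun _ _ => Commute.all _ _
  have hμ : ∀ c q, μ (c ⊗ₜ q) = c • (q : Module.End K (K ⊗[F] X) → K) := fun c q => by
    rw [Algebra.TensorProduct.lift_tmul, Algebra.ofId_apply, Algebra.smul_def]
    rfl
  have hle : polyFun K (Module.End K (K ⊗[F] X)) ≤ μ.range := by
    refine Algebra.adjoin_le ?_
    rintro _ ⟨l, rfl⟩
    let bX := Module.finBasis F X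
    let ρ : Fin (Module.finrank F X) → Fin (Module.finrank F X) →
        Module.Dual K (Module.End K (K ⊗[F] X)) := fun i j =>
      { toFun := fun g => LinearMap.toMatrix (Algebra.TensorProduct.basis K bX)
          (Algebra.TensorProduct.basis K bX) g i j
        map_add' := fun _ _ => by simp
        map_smul' := fun _ _ => by simp }
    have hρ : ∀ i j, (ρ i j : Module.End K (K ⊗[F] X) → K) ∈ ratPolyFun F K X := fun i j =>
      Algebra.subset_adjoin ⟨ρ i j, fun g => ⟨LinearMap.toMatrix bX bX g i j, by
        simp [ρ]⟩, rfl⟩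
    refine ⟨∑ i, ∑ j, l ((bX.linearMap bX (i, j)).baseChange K) ⊗ₜ ⟨_, hρ i j⟩, ?_⟩
    ext g
    change μ _ g = _
    conv_rhs => rw [eq_sum_baseChange_linearMap bX g]
    simp only [map_sum, hμ, Finset.sum_apply, Pi.smul_apply, map_smul, smul_eq_mul]
    exact Finset.sum_congr rfl fun i _ => Finset.sum_congr rfl fun j _ => mul_comm _ _
  obtain ⟨z, rfl⟩ := hle hp
  obtain ⟨q, rfl⟩ := TensorProduct.eq_repr_basis_left κ z
  refine ⟨q, ?_⟩
  change μ _ = _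
  rw [Finsupp.sum, map_sum]
  simp only [hμ]

/-- A set parametrized by an open subset of an affine space, by rational functions with
coefficients in `F`, is defined over `F`. -/
theorem isDefinedOver_of_param [Infinite K] {N : ℕ}
    (P Q : Matrix (Fin r) (Fin r) (MvPolynomial (Fin N) F)) {s : Set (Module.End K (K ⊗[F] X))}
    (hs : s.Nonempty)
    (h1 : ∀ x : Fin N → K, (Q.map (MvPolynomial.aeval x)).det ≠ 0 → ∃ g ∈ s,
      LinearMap.toMatrix (Algebra.TensorProduct.basis K bX) (Algebra.TensorProduct.basis K bX) g *
        Q.map (MvPolynomial.aeval x) = P.map (MvPolynomial.aeval x))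
    (h2 : ∀ g ∈ s, ∃ x : Fin N → K, (Q.map (MvPolynomial.aeval x)).det ≠ 0 ∧
      LinearMap.toMatrix (Algebra.TensorProduct.basis K bX) (Algebra.TensorProduct.basis K bX) g *
        Q.map (MvPolynomial.aeval x) = P.map (MvPolynomial.aeval x)) :
    IsDefinedOver F K X s := by
  classical
  have := Module.Finite.of_basis bX
  intro p hp hps
  let κ := Module.Free.chooseBasis F K
  -- Write `p` as a combination of polynomials `q i` over `F` with coefficients from a basis of `K`
  -- over `F`. It suffices that every `q i` vanishes on `s`.
  obtain ⟨q, rfl⟩ := exists_sum_ratPolyFun (X := X) κ hp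
  let I := {x : Fin N → K // (Q.map (MvPolynomial.aeval x)).det ≠ 0}
  choose! ψ hψs hψ using h1
  have huniq : ∀ (g g' : Module.End K (K ⊗[F] X)) (x : Fin N → K),
      (Q.map (MvPolynomial.aeval x)).det ≠ 0 →
      LinearMap.toMatrix (Algebra.TensorProduct.basis K bX) (Algebra.TensorProduct.basis K bX) g *
        Q.map (MvPolynomial.aeval x) = P.map (MvPolynomial.aeval x) →
      LinearMap.toMatrix (Algebra.TensorProduct.basis K bX) (Algebra.TensorProduct.basis K bX) g' *
        Q.map (MvPolynomial.aeval x) = P.map (MvPolynomial.aeval x) → g = g' := by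
    intro g g' x hx hg hg'
    apply (LinearMap.toMatrix (Algebra.TensorProduct.basis K bX)
      (Algebra.TensorProduct.basis K bX)).injective
    have hu : IsUnit (Q.map (MvPolynomial.aeval x)) :=
      (Matrix.isUnit_iff_isUnit_det _).2 (isUnit_iff_ne_zero.2 hx)
    exact hu.mul_left_injective (hg.trans hg'.symm)
  have hevdet : ∀ x : Fin N → K, MvPolynomial.aeval x Q.det =
      (Q.map (MvPolynomial.aeval x)).det := fun x => by
    rw [AlgHom.map_det, AlgHom.mapMatrix_apply]
  let E : MvPolynomial (Fin N) F →ₐ[F] (I → K) := AlgHom.pi fun x : I => MvPolynomial.aeval x.1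
  have hE : ∀ f x, E f x = MvPolynomial.aeval x.1 f := fun f x => rfl
  have hent : ∀ (x : I) i j, LinearMap.toMatrix (Algebra.TensorProduct.basis K bX)
      (Algebra.TensorProduct.basis K bX) (ψ x.1) i j * E Q.det x = E ((P * Q.adjugate) i j) x := by
    intro x i j
    have h3 := congrArg (· * (Q.map (MvPolynomial.aeval x.1)).adjugate) (hψ x.1 x.2)
    simp only [Matrix.mul_assoc, Matrix.mul_adjugate, Matrix.mul_smul, Matrix.mul_one] at h3
    have h4 := congrFun (congrFun h3 i) j
    rw [Matrix.smul_apply, smul_eq_mul, mul_comm] at h4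
    have h5 : P.map (MvPolynomial.aeval x.1) * (Q.map (MvPolynomial.aeval x.1)).adjugate =
        (P * Q.adjugate).map (MvPolynomial.aeval x.1) := by
      have h6 := AlgHom.map_adjugate (MvPolynomial.aeval x.1 : _ →ₐ[F] K) Q
      rw [AlgHom.mapMatrix_apply, AlgHom.mapMatrix_apply] at h6
      rw [Matrix.map_mul, h6]
    rw [hE, hE, hevdet, h4, h5]
    rfl
  -- Along the parametrization `g = P Q⁻¹` each `q i` becomes a polynomial over `F` divided by a
  -- power of `det Q`.
  have hpull : ∀ i, ∃ n : ℕ, ((q i : Module.End K (K ⊗[F] X) → K) ∘ fun x : I => ψ x.1) *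
      E Q.det ^ n ∈ E.range := by
    intro i
    refine exists_mul_pow_mem E.range ⟨Q.det, rfl⟩ _ ?_ (q i).2
    rintro _ ⟨l, hl, rfl⟩
    choose c hc using fun i j => hl (bX.linearMap bX (i, j))
    refine ⟨1, ∑ i, ∑ j, (P * Q.adjugate) i j * MvPolynomial.C (c i j), ?_⟩
    ext x
    change E _ x = l (ψ x.1) * (E Q.det ^ 1) x
    conv_rhs => rw [eq_sum_baseChange_linearMap bX (ψ x.1), pow_one]
    simp only [map_sum, Finset.sum_apply, map_mul, Pi.mul_apply, ← hent, map_smul, smul_eq_mul,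
      Finset.sum_mul, ← hc]
    refine Finset.sum_congr rfl fun i _ => Finset.sum_congr rfl fun j _ => ?_
    rw [hE (MvPolynomial.C _), MvPolynomial.aeval_C]
    ring
  choose n f hf using hpull
  set M := ∑ i ∈ q.support, n i with hM
  let f' : Module.Free.ChooseBasisIndex F K → MvPolynomial (Fin N) F := fun i =>
    f i * Q.det ^ (M - n i)
  have hf' : ∀ i ∈ q.support, ∀ x : I, MvPolynomial.aeval x.1 (f' i) =
      (q i : Module.End K (K ⊗[F] X) → K) (ψ x.1) * (MvPolynomial.aeval x.1 Q.det) ^ M := by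
    intro i hi x
    have h3 := congrFun (hf i) x
    change E _ x = (q i : Module.End K (K ⊗[F] X) → K) (ψ x.1) * (E Q.det x) ^ n i at h3
    rw [hE, hE] at h3
    have hle : n i ≤ M := Finset.single_le_sum (f := n) (fun _ _ => Nat.zero_le _) hi
    rw [map_mul, map_pow, h3, mul_assoc, ← pow_add, Nat.add_sub_cancel' hle]
  have hQ0 : MvPolynomial.map (algebraMap F K) Q.det ≠ 0 := by
    obtain ⟨g, hg⟩ := hs
    obtain ⟨x, hx, -⟩ := h2 g hg
    intro h
    rw [← hevdet, MvPolynomial.aeval_def, ← MvPolynomial.eval_map, h, map_zero] at hx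
    exact hx rfl
  -- The sum vanishes where `det Q ≠ 0`, since `p` vanishes on `s`. Multiplying by `det Q` covers
  -- the remaining points; as `K` is infinite the product is the zero polynomial, and `det Q`
  -- cancels.
  have hzero : ∑ i ∈ q.support, κ i • MvPolynomial.map (algebraMap F K) (f' i) = 0 := by
    have h3 : (∑ i ∈ q.support, κ i • MvPolynomial.map (algebraMap F K) (f' i)) *
        MvPolynomial.map (algebraMap F K) Q.det = 0 := by
      refine MvPolynomial.funext fun x => ?_
      rw [map_mul, map_zero]
      by_cases hx : (Q.map (MvPolynomial.aeval x)).det = 0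
      · rw [MvPolynomial.eval_map, ← MvPolynomial.aeval_def, hevdet, hx, mul_zero]
      · have h4 : ∀ i ∈ q.support, MvPolynomial.eval x (κ i • MvPolynomial.map (algebraMap F K) (f' i)) =
            κ i • (q i : Module.End K (K ⊗[F] X) → K) (ψ x) * (MvPolynomial.aeval x Q.det) ^ M := by
          intro i hi
          rw [MvPolynomial.smul_eval, MvPolynomial.eval_map, ← MvPolynomial.aeval_def,
            hf' i hi ⟨x, hx⟩, smul_eq_mul, mul_assoc]
        rw [map_sum, Finset.sum_congr rfl h4, ← Finset.sum_mul]
        have h5 := hps _ (hψs x hx)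
        rw [Finset.sum_apply] at h5
        simp only [Pi.smul_apply] at h5
        rw [h5, zero_mul, zero_mul]
    exact (mul_eq_zero.1 h3).resolve_right hQ0
  -- The coefficients of the `f' i` lie in `F`, over which the `κ i` are independent.
  have hf0 : ∀ i ∈ q.support, f' i = 0 := by
    intro i hi
    ext m
    have h3 := congrArg (MvPolynomial.coeff m) hzero
    rw [MvPolynomial.coeff_sum, MvPolynomial.coeff_zero] at h3
    have h4 : ∑ i ∈ q.support, (MvPolynomial.coeff m (f' i)) • κ i = 0 := by
      rw [← h3]
      refine Finset.sum_congr rfl fun i _ => ?_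
      rw [MvPolynomial.coeff_smul, MvPolynomial.coeff_map, Algebra.smul_def, smul_eq_mul, mul_comm]
    rw [MvPolynomial.coeff_zero]
    exact linearIndependent_iff'.1 κ.linearIndependent _ _ h4 i hi
  refine Submodule.sum_mem _ fun i hi => Submodule.smul_mem _ _ (Submodule.subset_span
    ⟨(q i).2, fun g hg => ?_⟩)
  obtain ⟨x, hx, hgx⟩ := h2 g hg
  have h3 := hf' i hi ⟨x, hx⟩
  rw [hf0 i hi, map_zero, huniq _ g x hx (hψ x hx) hgx] at h3
  refine (mul_eq_zero.1 h3.symm).resolve_right (pow_ne_zero _ ?_)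
  rw [hevdet]
  exact hx

end RatPoly

/-! ### Descent of linear conditions -/

section Descent

variable {F K X : Type*} [Field F] [Field K] [Algebra F K] [AddCommGroup X] [Module F X]

/-- The `i`-th coordinate of a tensor, for a basis of the extension. -/
noncomputable def tensorCoord {ι : Type*} (κ : Module.Basis ι F K) (i : ι) : K ⊗[F] X →ₗ[F] X :=
  (TensorProduct.lid F X : F ⊗[F] X →ₗ[F] X) ∘ₗ (κ.coord i).rTensor X

theorem tensorCoord_baseChange {ι : Type*} (κ : Module.Basis ι F K) (i : ι) (g : Module.End F X)
    (z : K ⊗[F] X) : tensorCoord κ i (g.baseChange K z) = g (tensorCoord κ i z) := by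
  induction z with
  | zero => simp
  | add z w hz hw => rw [map_add, map_add, hz, hw, map_add, map_add]
  | tmul k x => simp [tensorCoord]

theorem exists_sum_tensorCoord {ι : Type*} (κ : Module.Basis ι F K) (z : K ⊗[F] X) :
    ∃ s : Finset ι, ∀ t : Finset ι, s ⊆ t → z = ∑ i ∈ t, κ i ⊗ₜ[F] tensorCoord κ i z := by
  classical
  refine ⟨(TensorProduct.equivFinsuppOfBasisLeft κ z).support, fun t ht => ?_⟩
  have h := (TensorProduct.equivFinsuppOfBasisLeft κ).symm_apply_apply z
  rw [TensorProduct.equivFinsuppOfBasisLeft_symm_apply] at h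
  conv_lhs => rw [← h]
  rw [Finsupp.sum_of_support_subset _ ht _ (fun _ _ => by simp)]
  refine Finset.sum_congr rfl fun i _ => ?_
  rw [TensorProduct.equivFinsuppOfBasisLeft_apply]
  rfl

/-- The endomorphisms of `K ⊗ X` that satisfy linear conditions with coefficients in `F` are
spanned by those of `X`. -/
theorem mem_span_baseChange [FiniteDimensional F X] {J : Type*} (g : J → Module.End F X)
    (q : Module.End F X) {B : Submodule F (Module.End F X)}
    (hB : ∀ a : Module.End F X, (∀ j, a ∘ₗ g j = g j ∘ₗ a) → a ∘ₗ q = 0 → a ∈ B)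
    {A : Module.End K (K ⊗[F] X)} (hg : ∀ j, A ∘ₗ (g j).baseChange K = (g j).baseChange K ∘ₗ A)
    (hq : A ∘ₗ q.baseChange K = 0) :
    A ∈ Submodule.span K {a' | ∃ a ∈ B, a' = a.baseChange K} := by
  classical
  let κ := Module.Free.chooseBasis F K
  let b := Module.finBasis F X
  -- The coordinates over `F` of the restriction of `A` to `X`. Conditions with coefficients in `F`
  -- pass to each coordinate.
  let a : Module.Free.ChooseBasisIndex F K → Module.End F X := fun i =>
    tensorCoord κ i ∘ₗ A.restrictScalars F ∘ₗ TensorProduct.mk F K X 1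
  have ha : ∀ i x, a i x = tensorCoord κ i (A (1 ⊗ₜ x)) := fun _ _ => rfl
  choose s hs using fun j => exists_sum_tensorCoord κ (A (1 ⊗ₜ b j))
  have hsum : A = ∑ i ∈ Finset.univ.biUnion s, κ i • (a i).baseChange K := by
    refine (Algebra.TensorProduct.basis K b).ext fun j => ?_
    rw [Algebra.TensorProduct.basis_apply,
      hs j _ (Finset.subset_biUnion_of_mem s (Finset.mem_univ j)), LinearMap.sum_apply]
    refine Finset.sum_congr rfl fun i _ => ?_
    rw [LinearMap.smul_apply, LinearMap.baseChange_tmul, TensorProduct.smul_tmul', smul_eq_mul,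
      mul_one, ha]
  rw [hsum]
  refine Submodule.sum_mem _ fun i _ => Submodule.smul_mem _ _ (Submodule.subset_span
    ⟨_, hB _ (fun j => ?_) ?_, rfl⟩)
  · ext x
    have h1 := LinearMap.congr_fun (hg j) (1 ⊗ₜ x)
    simp only [LinearMap.comp_apply, LinearMap.baseChange_tmul] at h1
    have h3 : a i (g j x) = g j (a i x) := by rw [ha, ha, h1, tensorCoord_baseChange]
    exact h3
  · ext x
    have h1 := LinearMap.congr_fun hq (1 ⊗ₜ x)
    simp only [LinearMap.comp_apply, LinearMap.baseChange_tmul] at h1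
    have h3 : a i (q x) = 0 := by rw [ha, h1, LinearMap.zero_apply, map_zero]
    exact h3

/-- The matrix of a generic linear combination. -/
noncomputable def genMat {r N : ℕ} (bX : Module.Basis (Fin r) F X) (g : Fin N → Module.End F X)
    (g₀ : Module.End F X) : Matrix (Fin r) (Fin r) (MvPolynomial (Fin N) F) :=
  Matrix.of fun i j => ∑ k, MvPolynomial.X k * MvPolynomial.C (LinearMap.toMatrix bX bX (g k) i j) +
    MvPolynomial.C (LinearMap.toMatrix bX bX g₀ i j)

theorem genMat_map {r N : ℕ} (bX : Module.Basis (Fin r) F X) (g : Fin N → Module.End F X)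
    (g₀ : Module.End F X) (x : Fin N → K) : (genMat bX g g₀).map (MvPolynomial.aeval x) =
      LinearMap.toMatrix (Algebra.TensorProduct.basis K bX) (Algebra.TensorProduct.basis K bX)
        (∑ k, x k • (g k).baseChange K + g₀.baseChange K) := by
  ext i j
  simp only [genMat, Matrix.map_apply, Matrix.of_apply, map_add, map_sum, map_mul,
    MvPolynomial.aeval_X, MvPolynomial.aeval_C, map_smul, LinearMap.toMatrix_baseChange,
    Matrix.add_apply, Matrix.sum_apply, Matrix.smul_apply, smul_eq_mul]

end Descent

/-! ### Tori through rational regular elements are defined over F -/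

namespace LeviDatum

section AdjointDiag

variable {K S C W X U : Type*} [Field K] [AddCommGroup C] [Module K C]
    [AddCommGroup W] [Module K W] [AddCommGroup X] [Module K X] [AddCommGroup U] [Module K U]
variable {D : LeviDatum K S C W X U} {tr : C →ₗ[K] K} {σ : S → S} {opC : S → Module.End K C}
variable {φ φ' : S → K} {δ : S} {a b : K}

theorem IsHerm.exists_adjoint (hD : D.IsHerm tr σ opC) [FiniteDimensional K X]
    (g : Module.End K X) :
    ∃ g' : Module.End K X, ∀ x y, D.bX tr (g x) y = D.bX tr x (g' y) := by
  obtain ⟨g', hg'⟩ := hD.exists_linear_bX_eq ((D.bX tr).compl₂ g)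
  refine ⟨g', fun x y => ?_⟩
  rw [hD.bX_symm (g' y) x, hg']
  exact hD.bX_symm _ _

/-- The adjoint of a diagonal endomorphism. -/
theorem IsHerm.adjoint_diag (hD : D.IsHerm tr σ opC) [FiniteDimensional K X] {Y : Submodule K X}
    (hY : D.IsNS tr Y) {m : ℕ} {e f : Fin m → X} (hB : D.HypBasis tr φ φ' Y e f)
    {g g' : Module.End K X} (hg' : ∀ x y, D.bX tr (g x) y = D.bX tr x (g' y)) {c d : Fin m → K}
    (he : ∀ i, g (e i) = c i • e i) (hf : ∀ i, g (f i) = d i • f i)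
    (ho : ∀ x ∈ D.orth tr Y, g x = 0) : (∀ i, g' (e i) = d i • e i) ∧
      (∀ i, g' (f i) = c i • f i) ∧ ∀ x ∈ D.orth tr Y, g' x = 0 := by
  have key : ∀ z z', (∀ i, c i * D.bX tr (e i) z = D.bX tr (e i) z') →
      (∀ i, d i * D.bX tr (f i) z = D.bX tr (f i) z') → (∀ x ∈ D.orth tr Y, D.bX tr x z' = 0) →
      g' z = z' := by
    intro z z' h1 h3 h4
    refine hD.bX_ext_right fun x => ?_
    have h5 : (D.bX tr).flip z ∘ₗ g = (D.bX tr).flip z' := by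
      refine hD.ext_hypBasis hY hB (fun i => ?_) (fun i => ?_) fun x hx => ?_
      · simp [he, h1]
      · simp [hf, h3]
      · simp [ho x hx, h4 x hx]
    rw [← hg']
    exact LinearMap.congr_fun h5 x
  refine ⟨fun i => key _ _ (fun j => ?_) (fun j => ?_) fun x hx => ?_,
    fun i => key _ _ (fun j => ?_) (fun j => ?_) fun x hx => ?_,
    fun x hx => key _ _ (fun j => ?_) (fun j => ?_) fun x hx => ?_⟩
  · simp [hB.ee]
  · rw [map_smul, hD.hypBasis_fe hB]
    by_cases h : j = i <;> simp [h]
  · rw [map_smul, hD.mem_orth'.1 hx _ (hB.memE i), smul_zero]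
  · rw [map_smul, hB.ef]
    by_cases h : j = i <;> simp [h]
  · simp [hB.ff]
  · rw [map_smul, hD.mem_orth'.1 hx _ (hB.memF i), smul_zero]
  · rw [hx _ (hB.memE j), map_zero, mul_zero]
  · rw [hx _ (hB.memF j), map_zero, mul_zero]
  · rw [map_zero]

end AdjointDiag

section Defined

variable {F K S C W X U : Type*} [Field F] [Field K] [Algebra F K] [AddCommGroup C] [Module F C]
    [AddCommGroup W] [Module F W] [AddCommGroup X] [Module F X] [AddCommGroup U] [Module F U]
variable {D : LeviDatum F S C W X U} {tr : C →ₗ[F] F} {σ : S → S} {opC : S → Module.End F C}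
variable {φ φ' : S → K} {δ : S} {a b : K}

/-- A maximal torus that contains a rational regular element is defined over `F`. -/
theorem IsHerm.isDefinedOver_of_regular [IsAlgClosed K] (h2 : (2 : K) ≠ 0)
    (hD : D.IsHerm tr σ opC) (hS : (D.baseChange K).IsSplit σ φ φ' δ a b)
    [FiniteDimensional F X] [FiniteDimensional F W] {Y : Submodule F X} (hY : D.IsNS tr Y)
    (hfr : Module.finrank F Y = Module.finrank F W) {γ : X ≃ₗ[F] X} (hγ : γ ∈ D.isomFix Y)
    {T : Subgroup ((K ⊗[F] X) ≃ₗ[K] (K ⊗[F] X))}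
    (hT : (D.baseChange K).IsMaxTorus (Y.baseChange K) T)
    (hγT : γ.baseChange F K X X ∈ (D.baseChange K).regSet (Y.baseChange K) T) :
    IsDefinedOver F K X (endSet T) := by
  have hDK := hD.baseChange (K := K)
  have hYK := hD.isNS_baseChange (K := K) hY
  have hfrK : Module.finrank K (Y.baseChange K) = Module.finrank K (K ⊗[F] W) := by
    rw [finrank_submodule_baseChange, hfr, Module.finrank_baseChange]
  have hγK := hD.isomFix_baseChange (K := K) hY hγ
  obtain ⟨m, e, f, hB, rfl⟩ := hDK.exists_eq_diagSub hS h2 hYK hfrK hT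
  obtain ⟨c, hc0, hte, htf⟩ := hDK.exists_coeff_of_diag hγK.1 hB hγT.1.2
  have hc := hDK.dist_of_regSet hS h2 hYK hB hγT hte htf
  obtain ⟨q, hq1, hq2⟩ := hD.exists_proj hY
  have hqK1 : ∀ z, q.baseChange K z ∈ Y.baseChange K := fun z => (hD.proj_baseChange hq1 hq2 z).1
  have hqK2 := fun z : K ⊗[F] X => (hD.proj_baseChange hq1 hq2 z).2
  have hco : ∀ z, (1 - q : Module.End F X).baseChange K z = z - q.baseChange K z := fun z => by
    rw [LinearMap.baseChange_sub, LinearMap.baseChange_one]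
    rfl
  have hcY : ∀ z ∈ Y.baseChange K, (1 - q : Module.End F X).baseChange K z = 0 := fun z hz => by
    rw [hco, hDK.proj_of_mem hYK hqK1 hqK2 hz, sub_self]
  have hcO : ∀ z ∈ (D.baseChange K).orth (Module.Dual.extend K tr) (Y.baseChange K),
      (1 - q : Module.End F X).baseChange K z = z := fun z hz => by
    rw [hco, hDK.proj_of_mem_orth hYK hqK1 hqK2 hz, sub_zero]
  -- Commuting with `γ` (index `none`) and with the operators (`some s`) and vanishing on `Y^⊥` are
  -- linear conditions over `F`; they define `B`. By regularity of `γ` the elements of `K ⊗ B` are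
  -- diagonal in the basis `e, f`.
  let g : Option S → Module.End F X := fun o => o.elim (γ : X →ₗ[F] X) D.opX
  let B : Submodule F (Module.End F X) :=
    { carrier := {a | (∀ j, a ∘ₗ g j = g j ∘ₗ a) ∧ a ∘ₗ (1 - q) = 0}
      add_mem' := fun ha hb => ⟨fun j => by
        rw [LinearMap.add_comp, LinearMap.comp_add, ha.1, hb.1], by
        rw [LinearMap.add_comp, ha.2, hb.2, add_zero]⟩
      zero_mem' := ⟨fun j => by simp, by simp⟩
      smul_mem' := fun k a ha => ⟨fun j => by
        rw [LinearMap.smul_comp, LinearMap.comp_smul, ha.1], by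
        rw [LinearMap.smul_comp, ha.2, smul_zero]⟩ }
  let bB := Module.finBasis F B
  choose a' ha' using fun k => hD.exists_adjoint (bB k : Module.End F X)
  let bX := Module.finBasis F X
  let A : (Fin (Module.finrank F B) → K) → Module.End K (K ⊗[F] X) := fun x =>
    ∑ k, x k • ((bB k : Module.End F X)).baseChange K
  let A' : (Fin (Module.finrank F B) → K) → Module.End K (K ⊗[F] X) := fun x =>
    ∑ k, x k • (a' k).baseChange K
  have hAg : ∀ x j z, A x ((g j).baseChange K z) = (g j).baseChange K (A x z) := by
    intro x j z
    simp only [A, LinearMap.sum_apply, LinearMap.smul_apply, map_sum, map_smul]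
    refine Finset.sum_congr rfl fun k _ => ?_
    rw [baseChange_comp_apply, baseChange_comp_apply, (bB k).2.1 j]
  have hAo : ∀ x, ∀ z ∈ (D.baseChange K).orth (Module.Dual.extend K tr) (Y.baseChange K),
      A x z = 0 := by
    intro x z hz
    simp only [A, LinearMap.sum_apply, LinearMap.smul_apply]
    refine Finset.sum_eq_zero fun k _ => ?_
    rw [← hcO z hz, baseChange_comp_apply, (bB k).2.2]
    simp
  have hAA' : ∀ x y z, (D.baseChange K).bX (Module.Dual.extend K tr) (A x y) z =
      (D.baseChange K).bX (Module.Dual.extend K tr) y (A' x z) := by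
    intro x y z
    simp only [A, A', LinearMap.sum_apply, LinearMap.smul_apply, map_sum, map_smul]
    refine Finset.sum_congr rfl fun k _ => ?_
    congr 1
    exact tensor_ext₂ (f := fun y z => (D.baseChange K).bX (Module.Dual.extend K tr)
        (((bB k : Module.End F X)).baseChange K y) z)
      (g := fun y z => (D.baseChange K).bX (Module.Dual.extend K tr) y ((a' k).baseChange K z))
      (fun a a' b => by simp) (fun a b b' => by simp)
      (fun a a' b => by simp) (fun a b b' => by simp) (fun k a l b => by
      simp [bX_baseChange_tmul, ha']) y z
  have hAd : ∀ x, ∃ r s : Fin m → K, (∀ i, A x (e i) = r i • e i) ∧ ∀ i, A x (f i) = s i • f i := by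
    intro x
    have h3 := fun i => hDK.diag_of_comm hS hYK hB hγK hc0 hte htf hc (g := A x)
      (fun s z => hAg x (some s) z) (fun z => hAg x none z) i
    choose r hr using fun i => (h3 i).1
    choose s hs using fun i => (h3 i).2
    exact ⟨r, s, hr, hs⟩
  -- The torus is parametrized by `(A + 1 - q) (A' + 1 - q)⁻¹`, where `A` runs through `K ⊗ B` and
  -- `A'` is its adjoint; the summand `1 - q` supplies the identity on the complement of `Y`.
  have hiff : ∀ (h : Module.End K (K ⊗[F] X)) (x : Fin (Module.finrank F B) → K),
      LinearMap.toMatrix (Algebra.TensorProduct.basis K bX) (Algebra.TensorProduct.basis K bX) h *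
        (genMat bX a' (1 - q)).map (MvPolynomial.aeval x) =
      (genMat bX (fun k => (bB k : Module.End F X)) (1 - q)).map (MvPolynomial.aeval x) ↔
      h ∘ₗ (A' x + (1 - q : Module.End F X).baseChange K) =
        A x + (1 - q : Module.End F X).baseChange K := by
    intro h x
    rw [genMat_map, genMat_map, ← LinearMap.toMatrix_comp, EmbeddingLike.apply_eq_iff_eq]
  have hdet : ∀ x : Fin (Module.finrank F B) → K,
      ((genMat bX a' (1 - q)).map (MvPolynomial.aeval x)).det ≠ 0 ↔
      Function.Bijective (A' x + (1 - q : Module.End F X).baseChange K) := by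
    intro x
    rw [genMat_map, det_toMatrix_ne_zero_iff]
  refine isDefinedOver_of_param bX (genMat bX (fun k => (bB k : Module.End F X)) (1 - q))
    (genMat bX a' (1 - q)) ⟨_, 1, Subgroup.one_mem _, rfl⟩ (fun x hx => ?_) ?_
  -- If `A` acts by `r i` on `e i` and by `s i` on `f i`, its adjoint acts with `r` and `s`
  -- exchanged, so the quotient has the eigenvalues `r i / s i` and `s i / r i` of an element of the
  -- torus.
  · rw [hdet] at hx
    obtain ⟨r, s, hr, hs⟩ := hAd x
    obtain ⟨h3, h4, h5⟩ := hDK.adjoint_diag hYK hB (hAA' x) hr hs (hAo x)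
    have hr0 : ∀ i, r i ≠ 0 := fun i hi => (hypBasis_ne hB i).2 (hx.1 (by
      rw [map_zero, LinearMap.add_apply, h4, hi, zero_smul, hcY _ (hB.memF i), zero_add]))
    have hs0 : ∀ i, s i ≠ 0 := fun i hi => (hypBasis_ne hB i).1 (hx.1 (by
      rw [map_zero, LinearMap.add_apply, h3, hi, zero_smul, hcY _ (hB.memE i), zero_add]))
    obtain ⟨t, ht, hte', htf'⟩ := hDK.exists_diag hS h2 hYK hB (c := fun i => r i / s i)
      (fun i => div_ne_zero (hr0 i) (hs0 i))
    refine ⟨_, ⟨t, ⟨ht, fun i => ⟨⟨_, hte' i⟩, _, htf' i⟩⟩, rfl⟩, (hiff _ x).2 ?_⟩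
    refine hDK.ext_hypBasis hYK hB (fun i => ?_) (fun i => ?_) fun z hz => ?_
    · rw [LinearMap.comp_apply, LinearMap.add_apply, LinearMap.add_apply, hcY _ (hB.memE i), h3, hr,
        add_zero, add_zero, map_smul]
      change s i • t (e i) = _
      rw [hte', smul_smul, mul_div_cancel₀ _ (hs0 i)]
    · rw [LinearMap.comp_apply, LinearMap.add_apply, LinearMap.add_apply, hcY _ (hB.memF i), h4, hs,
        add_zero, add_zero, map_smul]
      change r i • t (f i) = _
      rw [htf', smul_smul, inv_div, mul_div_cancel₀ _ (hr0 i)]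
    · rw [LinearMap.comp_apply, LinearMap.add_apply, LinearMap.add_apply, hcO _ hz, h5 z hz,
        hAo x z hz, zero_add]
      exact hDK.isomFix_orth hYK ht hz
  · rintro _ ⟨t, ht, rfl⟩
    obtain ⟨d, hd0, hde, hdf⟩ := hDK.exists_coeff_of_diag ht.1.1 hB ht.2
    -- The element with eigenvalues `d i` arises from the endomorphism acting by `d i` on `e i` and
    -- by `1` on `f i`. It satisfies the conditions defining `B`, so by `mem_span_baseChange` it is
    -- some `A x`.
    let Z : Module.End K (K ⊗[F] X) := (D.baseChange K).diagEnd (Module.Dual.extend K tr) e f d 1 ∘ₗ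
      q.baseChange K
    have hqY : ∀ z ∈ Y.baseChange K, q.baseChange K z = z := fun z hz =>
      hDK.proj_of_mem hYK hqK1 hqK2 hz
    have hZe : ∀ i, Z (e i) = d i • e i := fun i => by
      simp only [Z, LinearMap.comp_apply]
      rw [hqY _ (hB.memE i), hDK.diagEnd_left hB]
    have hZf : ∀ i, Z (f i) = f i := fun i => by
      simp only [Z, LinearMap.comp_apply]
      rw [hqY _ (hB.memF i), hDK.diagEnd_right hB, Pi.one_apply, one_smul]
    have hZo : ∀ z ∈ (D.baseChange K).orth (Module.Dual.extend K tr) (Y.baseChange K), Z z = 0 :=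
      fun z hz => by
        simp only [Z, LinearMap.comp_apply]
        rw [hDK.proj_of_mem_orth hYK hqK1 hqK2 hz, map_zero]
    have hmem : Z ∈ Submodule.span K {h | ∃ a ∈ B, h = a.baseChange K} := by
      refine mem_span_baseChange g (1 - q) (B := B) (fun a h3 h4 => ⟨h3, h4⟩) (fun j => ?_) ?_
      · cases j with
        | none =>
          refine hDK.ext_hypBasis hYK hB (fun i => ?_) (fun i => ?_) fun z hz => ?_
          · change Z (γ.baseChange F K X X (e i)) = γ.baseChange F K X X (Z (e i))
            rw [hte, map_smul, hZe, map_smul, hte, smul_comm]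
          · change Z (γ.baseChange F K X X (f i)) = γ.baseChange F K X X (Z (f i))
            rw [htf, map_smul, hZf, htf]
          · change Z (γ.baseChange F K X X z) = γ.baseChange F K X X (Z z)
            rw [hDK.isomFix_orth hYK hγK hz, hZo z hz, map_zero]
        | some s =>
          refine hDK.ext_hypBasis hYK hB (fun i => ?_) (fun i => ?_) fun z hz => ?_
          · change Z ((D.baseChange K).opX s (e i)) = (D.baseChange K).opX s (Z (e i))
            rw [hB.he, map_smul, hZe, map_smul, hB.he, smul_comm]
          · change Z ((D.baseChange K).opX s (f i)) = (D.baseChange K).opX s (Z (f i))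
            rw [hB.hf, map_smul, hZf, hB.hf]
          · change Z ((D.baseChange K).opX s z) = (D.baseChange K).opX s (Z z)
            rw [hZo _ (hDK.orth_op hYK.1 s z hz), hZo z hz, map_zero]
      · ext z
        change Z ((1 - q : Module.End F X).baseChange K _) = 0
        refine hZo _ ?_
        rw [hco]
        exact hqK2 _
    obtain ⟨x, hx⟩ : ∃ x, A x = Z := by
      have hle : Submodule.span K {h : Module.End K (K ⊗[F] X) | ∃ a ∈ B, h = a.baseChange K} ≤
          Submodule.span K (Set.range fun k => ((bB k : Module.End F X)).baseChange K) := by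
        refine Submodule.span_le.2 ?_
        rintro _ ⟨a, ha, rfl⟩
        have h3 := congrArg (fun a : B => (a : Module.End F X).baseChange K) (bB.sum_repr ⟨a, ha⟩)
        simp only at h3
        rw [SetLike.mem_coe, ← h3, Submodule.coe_sum, ← LinearMap.baseChangeHom_apply, map_sum]
        refine Submodule.sum_mem _ fun k _ => ?_
        rw [Submodule.coe_smul, map_smul, LinearMap.baseChangeHom_apply,
          ← algebraMap_smul K]
        exact Submodule.smul_mem _ _ (Submodule.subset_span ⟨k, rfl⟩)
      exact (Submodule.mem_span_range_iff_exists_fun K).1 (hle hmem)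
    obtain ⟨h3, h4, h5⟩ := hDK.adjoint_diag hYK hB (hAA' x) (c := d) (d := 1)
      (fun i => by rw [hx, hZe]) (fun i => by rw [hx, hZf, Pi.one_apply, one_smul])
      (hAo x)
    have hcomp : (t : (K ⊗[F] X) →ₗ[K] (K ⊗[F] X)) ∘ₗ
        (A' x + (1 - q : Module.End F X).baseChange K) =
        A x + (1 - q : Module.End F X).baseChange K := by
      refine hDK.ext_hypBasis hYK hB (fun i => ?_) (fun i => ?_) fun z hz => ?_
      · rw [LinearMap.comp_apply, LinearMap.add_apply, LinearMap.add_apply, hcY _ (hB.memE i), h3,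
          hx, hZe, add_zero, add_zero, Pi.one_apply, one_smul]
        exact hde i
      · rw [LinearMap.comp_apply, LinearMap.add_apply, LinearMap.add_apply, hcY _ (hB.memF i), h4,
          hx, hZf, add_zero, add_zero, map_smul]
        change d i • t (f i) = _
        rw [hdf, smul_smul, mul_inv_cancel₀ (hd0 i), one_smul]
      · rw [LinearMap.comp_apply, LinearMap.add_apply, LinearMap.add_apply, hcO _ hz, h5 z hz,
          hAo x z hz, zero_add]
        exact hDK.isomFix_orth hYK ht.1 hz
    refine ⟨x, (hdet x).2 ?_, (hiff _ x).2 hcomp⟩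
    have hinv : (A' x + (1 - q : Module.End F X).baseChange K) ∘ₗ
        (D.baseChange K).diagEnd (Module.Dual.extend K tr) e f 1 (fun i => (d i)⁻¹) =
        LinearMap.id := by
      refine hDK.ext_hypBasis hYK hB (fun i => ?_) (fun i => ?_) fun z hz => ?_
      · rw [LinearMap.comp_apply, hDK.diagEnd_left hB, Pi.one_apply, one_smul, LinearMap.add_apply,
          hcY _ (hB.memE i), h3, add_zero, Pi.one_apply, one_smul, LinearMap.id_apply]
      · rw [LinearMap.comp_apply, hDK.diagEnd_right hB, map_smul, LinearMap.add_apply,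
          hcY _ (hB.memF i), h4, add_zero, smul_smul, inv_mul_cancel₀ (hd0 i), one_smul,
          LinearMap.id_apply]
      · rw [LinearMap.comp_apply, hDK.diagEnd_orth hB _ _ hz, LinearMap.add_apply, h5 z hz, hcO z hz,
          zero_add, LinearMap.id_apply]
    have hsurj : Function.Surjective (A' x + (1 - q : Module.End F X).baseChange K) := fun z =>
      ⟨_, LinearMap.congr_fun hinv z⟩
    exact ⟨LinearMap.injective_iff_surjective.2 hsurj, hsurj⟩

end Defined

end LeviDatum

/-! ### Conjugation and comparison of regular elements -/

namespace LeviDatum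

section ConjReg

variable {K S C W X U : Type*} [Field K] [AddCommGroup C] [Module K C]
    [AddCommGroup W] [Module K W] [AddCommGroup X] [Module K X] [AddCommGroup U] [Module K U]
variable {D : LeviDatum K S C W X U} {tr : C →ₗ[K] K} {σ : S → S} {opC : S → Module.End K C}

theorem IsHerm.conj_mem_regSet (hD : D.IsHerm tr σ opC) [FiniteDimensional K X]
    {Y : Submodule K X} (hY : D.IsNS tr Y) {T : Subgroup (X ≃ₗ[K] X)} {t h : X ≃ₗ[K] X}
    (ht : t ∈ D.regSet Y T) (htY : t ∈ D.isomFix Y) (hh : h ∈ D.isomFix Y) :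
    h * t * h⁻¹ ∈ D.regSet Y (T.map (MulAut.conj h).toMonoidHom) := by
  have hh' := (D.isomFix Y).inv_mem hh
  refine ⟨⟨t, ht.1, rfl⟩, fun g hg hgt => ⟨h⁻¹ * g * h, ht.2.1 _
    ((D.isomFix Y).mul_mem ((D.isomFix Y).mul_mem hh' hg) hh) ?_, ?_⟩,
    hD.bijOn_of_fix hY ((D.isomFix Y).mul_mem ((D.isomFix Y).mul_mem hh htY) hh')
      fun y hy hty => ?_⟩
  · calc h⁻¹ * g * h * t = h⁻¹ * (g * (h * t * h⁻¹)) * h := by group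
      _ = t * (h⁻¹ * g * h) := by rw [hgt]; group
  · change h * (h⁻¹ * g * h) * h⁻¹ = g
    group
  · have h1 : t (h⁻¹ y) = h⁻¹ y := h.injective (hty.trans (h.apply_symm_apply y).symm)
    have h2 : h⁻¹ y = 0 := ht.2.2.2.1 (hD.isomFix_mem hY hh' hy) Y.zero_mem (by
      change t (h⁻¹ y) - h⁻¹ y = t 0 - 0
      rw [h1]
      simp)
    simpa using congrArg h h2

/-- An isometry that conjugates one element to another maps the space on which the first acts to
that on which the second acts. -/
theorem IsHerm.map_eq_of_conj (hD : D.IsHerm tr σ opC) [FiniteDimensional K X]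
    {Y Y' : Submodule K X} (hY' : D.IsNS tr Y')
    (hfr : Module.finrank K Y = Module.finrank K Y') {t t' u : X ≃ₗ[K] X}
    (ht' : t' ∈ D.isomFix Y') (hb : Set.BijOn (fun y => t y - y) Y Y)
    (hu : t' = u * t * u⁻¹) : Y' = Y.map (u : X →ₗ[K] X) := by
  symm
  refine Submodule.eq_of_le_of_finrank_eq ?_ ?_
  · rintro _ ⟨y, hy, rfl⟩
    -- Since `Y = (t - 1) Y` and `u (t - 1) = (t' - 1) u`, the image `u Y` consists of values of `t'
    -- - 1`, which lie in `Y'`.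
    obtain ⟨z, hz, rfl⟩ := hb.2.2 hy
    have h1 : u (t z - z) = t' (u z) - u z := by
      rw [hu, map_sub]
      change _ = u (t (u⁻¹ (u z))) - u z
      rw [show u⁻¹ (u z) = z from u.symm_apply_apply z]
    change u (t z - z) ∈ Y'
    rw [h1]
    obtain ⟨q, hq1, hq2⟩ := hD.exists_proj hY'
    have h2 : t' (u z) - u z = t' (q (u z)) - q (u z) := by
      have := hD.isomFix_orth hY' ht' (hq2 (u z))
      rw [map_sub] at this
      rw [← sub_eq_zero] at this ⊢
      rw [← this]
      abel
    rw [h2]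
    exact Y'.sub_mem (hD.isomFix_mem hY' ht' (hq1 _)) (hq1 _)
  · rw [← hfr]
    exact LinearEquiv.finrank_map_eq u Y

/-- An isometry that preserves `Y` coincides on `Y` with an element of `H_Y`. -/
theorem IsHerm.exists_isomFix (hD : D.IsHerm tr σ opC) [FiniteDimensional K X]
    {Y : Submodule K X} (hY : D.IsNS tr Y) {u : X ≃ₗ[K] X} (hu : u ∈ D.isomX)
    (huY : ∀ y ∈ Y, u y ∈ Y) : ∃ v ∈ D.isomFix Y, ∀ y ∈ Y, v y = u y := by
  obtain ⟨q, hq1, hq2⟩ := hD.exists_proj hY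
  have hu' := (hD.mem_isomX_iff u).1 hu
  have hqo : ∀ s x, q (D.opX s x) = D.opX s (q x) := fun s x =>
    hD.proj_comm hY hq1 hq2 (hY.1 s) (hD.orth_op hY.1 s) x
  -- `u` on `Y` and the identity on `Y^⊥`.
  obtain ⟨v, hv, hvu⟩ := hD.exists_isomX ((u : X →ₗ[K] X) ∘ₗ q + (LinearMap.id - q))
    (fun s x => by simp [hqo, hu'.1]) (fun x y => by
      have h1 : ∀ x y, D.bX tr (q x) (y - q y) = 0 := fun x y => hq2 y _ (hq1 x)
      have h2 : ∀ x y, D.bX tr (x - q x) (q y) = 0 := fun x y =>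
        (hD.mem_orth'.1 (hq2 x)) _ (hq1 y)
      have h3 : D.bX tr (u (q x)) (y - q y) = 0 := hq2 y _ (huY _ (hq1 x))
      have h4 : D.bX tr (x - q x) (u (q y)) = 0 := (hD.mem_orth'.1 (hq2 x)) _ (huY _ (hq1 y))
      have h5 : D.bX tr x y = D.bX tr (q x + (x - q x)) (q y + (y - q y)) := by simp
      rw [h5]
      simp only [LinearMap.add_apply, LinearMap.comp_apply, LinearEquiv.coe_coe,
        LinearMap.sub_apply (f := LinearMap.id), LinearMap.id_apply]
      rw [map_add, map_add, LinearMap.add_apply, LinearMap.add_apply, LinearMap.map_add,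
        LinearMap.map_add, h3, h4, hu'.2, LinearMap.add_apply, LinearMap.add_apply,
        h1, h2])
  have hv' : ∀ x, v x = u (q x) + (x - q x) := fun x => LinearMap.congr_fun hvu x
  refine ⟨v, ⟨hv, fun x hx => ?_⟩, fun y hy => ?_⟩
  · rw [hv', hD.proj_of_mem_orth hY hq1 hq2 ((hD.mem_perp_iff hY.1).1 hx)]
    simp
  · rw [hv', hD.proj_of_mem hY hq1 hq2 hy]
    simp

end ConjReg

/-! ### The sets N^{Y,T} and the M-orbits, through the norm -/

section RationalOrbits

variable {F K S C W X U : Type*} [Field F] [Field K] [Algebra F K] [AddCommGroup C] [Module F C]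
    [AddCommGroup W] [Module F W] [AddCommGroup X] [Module F X] [AddCommGroup U] [Module F U]
variable {D : LeviDatum F S C W X U} {tr : C →ₗ[F] F} {σ : S → S} {opC : S → Module.End F C}

namespace IsHerm

variable (hD : D.IsHerm tr σ opC)
include hD
variable [FiniteDimensional F X]

theorem bijOn_of_ratRegSet {Y : Submodule F X} (hY : D.IsNS tr Y)
    {T : Subgroup ((K ⊗[F] X) ≃ₗ[K] (K ⊗[F] X))} {t : X ≃ₗ[F] X} (ht : t ∈ D.ratRegSet K Y T) :
    Set.BijOn (fun y => t y - y) Y Y := by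
  refine hD.bijOn_of_fix hY ht.1 fun y hy hty => one_tmul_injective (F := F) (K := K) ?_
  rw [TensorProduct.tmul_zero]
  refine ht.2.2.2.2.1 (Submodule.tmul_mem_baseChange_of_mem 1 hy) (Submodule.zero_mem _) ?_
  change (1 : K) ⊗ₜ[F] t y - 1 ⊗ₜ y = _
  simp [hty]

theorem conj_mem_ratRegSet {Y : Submodule F X} (hY : D.IsNS tr Y)
    {T : Subgroup ((K ⊗[F] X) ≃ₗ[K] (K ⊗[F] X))} {t h : X ≃ₗ[F] X}
    (htY : t ∈ D.isomFix Y) (ht : t.baseChange F K X X ∈ (D.baseChange K).regSet (Y.baseChange K) T)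
    (hh : h ∈ D.isomFix Y) : h * t * h⁻¹ ∈ D.ratRegSet K Y
      (T.map (MulAut.conj (h.baseChange F K X X)).toMonoidHom) := by
  refine ⟨(D.isomFix Y).mul_mem ((D.isomFix Y).mul_mem hh htY) ((D.isomFix Y).inv_mem hh), ?_⟩
  rw [equiv_baseChange_mul, equiv_baseChange_mul, equiv_baseChange_inv]
  exact hD.baseChange.conj_mem_regSet (hD.isNS_baseChange hY) ht (hD.isomFix_baseChange hY htY)
    (hD.isomFix_baseChange hY hh)

/-- Membership in `N_{Y,T}` up to conjugation by `H`, in terms of the norm. -/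
theorem mem_upperSet_of_norm [FiniteDimensional F W] [FiniteDimensional F U] {Y : Submodule F X}
    {T : Subgroup ((K ⊗[F] X) ≃ₗ[K] (K ⊗[F] X))} {n : Module.End F (W × X × U)}
    (hn : n ∈ D.unipRadInv) {h t : X ≃ₗ[F] X} (hh : h ∈ D.isomX) (ht : t ∈ D.ratRegSet K Y T)
    (hnt : D.normMap n = ((h * t * h⁻¹ : X ≃ₗ[F] X) : X →ₗ[F] X)) :
    n ∈ D.upperSet K Y T := by
  obtain ⟨h1, h2⟩ := hD.conj_mem_unipRadInv hn (isLevi_of_mem (D.isomX.inv_mem hh))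
  refine ⟨h, hh, (blockDiag (LinearEquiv.refl F W) h⁻¹ (LinearEquiv.refl F U)).conj n,
    ⟨h1, 1, (D.isomFix Y).one_mem, t, ht, ?_⟩, ?_⟩
  · rw [h2, hnt]
    ext x
    change h⁻¹ ((h * t * h⁻¹) ((h⁻¹)⁻¹ x)) = (1 * t * 1⁻¹ : X ≃ₗ[F] X) x
    simp only [← LinearEquiv.mul_apply]
    congr 1
    group
  · change _ = (blockDiag (LinearEquiv.refl F W) h (LinearEquiv.refl F U)).conj _
    rw [conj_blockDiag_blockDiag]
    have : (h⁻¹).trans h = LinearEquiv.refl F X := LinearEquiv.ext fun x => h.apply_symm_apply x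
    rw [this]
    rfl

theorem norm_of_mem_upperSet [FiniteDimensional F W] [FiniteDimensional F U] {Y : Submodule F X}
    {T : Subgroup ((K ⊗[F] X) ≃ₗ[K] (K ⊗[F] X))} {n : Module.End F (W × X × U)}
    (hn : n ∈ D.upperSet K Y T) : n ∈ D.unipRadInv ∧ ∃ h ∈ D.isomX, ∃ t ∈ D.ratRegSet K Y T,
      D.normMap n = ((h * t * h⁻¹ : X ≃ₗ[F] X) : X →ₗ[F] X) := by
  obtain ⟨h, hh, a, ⟨ha, h₁, hh₁, t, ht, hat⟩, rfl⟩ := hn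
  obtain ⟨h1, h2⟩ := hD.conj_mem_unipRadInv ha (isLevi_of_mem hh)
  refine ⟨h1, h * h₁, D.isomX.mul_mem hh hh₁.1, t, ht, ?_⟩
  refine h2.trans ?_
  rw [hat]
  ext x
  exact LinearEquiv.congr_fun
    (show h * (h₁ * t * h₁⁻¹) * h⁻¹ = h * h₁ * t * (h * h₁)⁻¹ by group) x

/-- After conjugation by `H` the norm is `t` itself, and `exists_conj_nY` provides an element of
`GL(W)` leading to `n_Y(t)`. Conversely, an element of `M` acts on the norm only through its
component in `H`. -/
theorem upperSet_eq_orbitSet [FiniteDimensional F W] [FiniteDimensional F U] {Y : Submodule F X}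
    (hY : D.IsNS tr Y) (hfr : Module.finrank F Y = Module.finrank F W)
    {T : Subgroup ((K ⊗[F] X) ≃ₗ[K] (K ⊗[F] X))} {f : X →ₗ[F] W} (hf : D.IsXi Y f) :
    D.upperSet (U := U) K Y T = D.orbitSet K Y T f := by
  ext n
  constructor
  · intro hn
    obtain ⟨hn, h, hh, t, ht, hnt⟩ := hD.norm_of_mem_upperSet hn
    obtain ⟨h1, h2⟩ := hD.conj_mem_unipRadInv hn (isLevi_of_mem (D.isomX.inv_mem hh))
    obtain ⟨g, g', hl, hg⟩ := hD.exists_conj_nY hY hfr h1 ht.1 (hD.bijOn_of_ratRegSet hY ht) (by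
      rw [h2, hnt]
      ext x
      change h⁻¹ ((h * t * h⁻¹) ((h⁻¹)⁻¹ x)) = t x
      simp only [← LinearEquiv.mul_apply]
      congr 1
      group) hf
    refine ⟨_, hD.blockDiag_mem_levi (hl.trans (isLevi_of_mem hh)), t, ht, ?_⟩
    rw [← conj_blockDiag_blockDiag, ← hg, conj_blockDiag_blockDiag]
    have : (h⁻¹).trans h = LinearEquiv.refl F X := LinearEquiv.ext fun x => h.apply_symm_apply x
    rw [this]
    rfl
  · rintro ⟨m, hm, t, ht, rfl⟩
    obtain ⟨g, h, g', hl, rfl⟩ := hD.exists_blockDiag hm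
    obtain ⟨h1, h2⟩ := hD.nY_mem hY hf ht.1 (hD.bijOn_of_ratRegSet hY ht)
    obtain ⟨h3, h4⟩ := hD.conj_mem_unipRadInv h1 hl
    refine hD.mem_upperSet_of_norm h3 hl.mem ht ?_
    rw [h4, h2]
    rfl

/-- The points of `N_reg` over `F`, from those over `K`. -/
theorem mem_ratPoints_of_norm {Y : Submodule F X}
    {T : Subgroup ((K ⊗[F] X) ≃ₗ[K] (K ⊗[F] X))} {n : Module.End F (W × X × U)}
    (hn : n ∈ D.unipRadInv) {h t : X ≃ₗ[F] X} (hh : h ∈ D.isomX) (ht : t ∈ D.ratRegSet K Y T)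
    (hnt : D.normMap n = ((h * t * h⁻¹ : X ≃ₗ[F] X) : X →ₗ[F] X)) :
    n ∈ ratPoints K ((D.baseChange K).regUnip (Y.baseChange K) T) := by
  refine ⟨_, ⟨⟨hD.unip_baseChange_mem hn.1, ?_⟩, h.baseChange F K X X, hD.isomX_baseChange hh, _,
    ht.2, ?_⟩, hD.unip_baseChange_apply hn.1⟩
  · rw [etaOf_unip]
    exact baseChange_bijective hn.2
  · rw [hD.normMap_baseChange hn, hnt, ← equiv_baseChange_inv, ← equiv_baseChange_mul,
      ← equiv_baseChange_mul]
    rfl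

end IsHerm

end RationalOrbits

end LeviDatum

/-! ### The rational decomposition -/

namespace LeviDatum

section RationalUnion

variable {F K S C W X U : Type*} [Field F] [Field K] [Algebra F K] [AddCommGroup C] [Module F C]
    [AddCommGroup W] [Module F W] [AddCommGroup X] [Module F X] [AddCommGroup U] [Module F U]
variable {D : LeviDatum F S C W X U} {tr : C →ₗ[F] F} {σ : S → S} {opC : S → Module.End F C}
variable {φ φ' : S → K} {δ : S} {a b : K}
variable [FiniteDimensional F X] [FiniteDimensional F W] [FiniteDimensional F U]

namespace IsHerm

variable (hD : D.IsHerm tr σ opC)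
include hD

/-- The subspace is `im ξ*`, which is already defined over `F`, moved by `H` to its representative
`Z`. The moved norm is a rational element of `H_Z` that is regular for some maximal torus over `K`;
by `isDefinedOver_of_regular` this torus is defined over `F` and is conjugate to a representative.
-/
theorem exists_mem_upperSet [IsAlgClosed K] (hS : (D.baseChange K).IsSplit σ φ φ' δ a b)
    (h2 : (2 : K) ≠ 0) {Y₀ : Submodule K (K ⊗[F] X)}
    (hY₀ : (D.baseChange K).IsNS (Module.Dual.extend K tr) Y₀)
    (hfr₀ : Module.finrank K Y₀ = Module.finrank F W)
    {T₀ : Subgroup ((K ⊗[F] X) ≃ₗ[K] (K ⊗[F] X))} (hT₀ : (D.baseChange K).IsMaxTorus Y₀ T₀)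
    {RY : Set (Submodule F X)} (hRY : D.IsSubspaceReps RY)
    {RT : Submodule F X → Set (Subgroup ((K ⊗[F] X) ≃ₗ[K] (K ⊗[F] X)))}
    (hRT : ∀ Y ∈ RY, D.IsTorusReps K Y (RT Y)) {n : Module.End F (W × X × U)}
    (hn : n ∈ ratPoints K ((D.baseChange K).regUnip Y₀ T₀)) :
    ∃ Y ∈ RY, ∃ T ∈ RT Y, n ∈ D.upperSet K Y T := by
  obtain ⟨c, hc, hcn⟩ := hn
  obtain ⟨hn1, rfl⟩ := hD.mem_unipRad_of_baseChange hc.1.1 hcn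
  have hfr₀' : Module.finrank K Y₀ = Module.finrank K (K ⊗[F] W) := by
    rw [hfr₀, Module.finrank_baseChange]
  have hn : n ∈ D.unipRadInv := by
    have h1 := hc.1.2
    rw [etaOf_unip] at h1
    have h3 := injective_of_baseChange h1.1
    exact ⟨hn1, h3,
      (LinearMap.injective_iff_surjective_of_finrank_eq_finrank hD.finrank_eq).1 h3⟩
  have hf := xiOf_op hn1.1
  have hb : Function.Bijective (xiOf n ∘ₗ D.adj (U := U) (xiOf n)) := by
    have h1 := (hD.baseChange.simpleOn_of_mem_regUnip hS h2 hY₀ hfr₀' hT₀ hc).1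
    rw [xiOf_unip, hD.adj_baseChange hf, ← LinearMap.baseChange_comp] at h1
    have h3 := injective_of_baseChange h1.1
    exact ⟨h3, (LinearMap.injective_iff_surjective_of_finrank_eq_finrank hD.finrank_eq).1 h3⟩
  have hY := hD.isNS_range_adj hf hb
  have hfr := hD.finrank_range_adj hb
  obtain ⟨g, hg, hgn⟩ := hD.exists_normMap hn
  have hgY := hD.norm_mem_isomFix hn hg hgn
  set Y := LinearMap.range (D.adj (U := U) (xiOf n)) with hYdef
  obtain ⟨Z, ⟨hZ, h, hh, hZY⟩, -⟩ := hRY.2 Y ((hD.isNondegSub_iff Y).2 ⟨hY, hfr⟩)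
  have hZ' := (hD.isNondegSub_iff Z).1 (hRY.1 Z hZ)
  have htZ : h * g * h⁻¹ ∈ D.isomFix Z := hZY ▸ hD.isomFix_map hY hh hgY
  obtain ⟨k, hk, r, hr, hkr⟩ := hc.2
  rw [hD.normMap_baseChange hn, ← hgn] at hkr
  have hgK : g.baseChange F K X X = k * r * k⁻¹ :=
    LinearEquiv.ext fun x => LinearMap.congr_fun hkr x
  have hhK := hD.isomX_baseChange (K := K) hh
  have hfrZ : Module.finrank K (Z.baseChange K) = Module.finrank K (K ⊗[F] W) := by
    rw [finrank_submodule_baseChange, hZ'.2, Module.finrank_baseChange]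
  have hconj : (h.baseChange F K X X * k)⁻¹ * (h * g * h⁻¹).baseChange F K X X *
      ((h.baseChange F K X X * k)⁻¹)⁻¹ = r := by
    rw [equiv_baseChange_mul, equiv_baseChange_mul, equiv_baseChange_inv, hgK]
    group
  obtain ⟨T, hT, hTr⟩ := hD.baseChange.exists_maxTorus_of_conj hS h2 (hD.isNS_baseChange hZ'.1)
    hY₀ hfrZ hfr₀' hT₀ (hD.isomFix_baseChange hZ'.1 htZ)
    ((D.baseChange K).isomX.inv_mem ((D.baseChange K).isomX.mul_mem hhK hk)) (hconj ▸ hr)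
  obtain ⟨T', ⟨hT', v, hv, hvT⟩, -⟩ := (hRT Z hZ).2 T ⟨hT,
    isDefinedOver_of_regular h2 hD hS hZ'.1 hZ'.2 htZ hT hTr⟩
  have hreg := hD.conj_mem_ratRegSet hZ'.1 htZ hTr hv
  rw [← hvT] at hreg
  refine ⟨Z, hZ, T', hT', hD.mem_upperSet_of_norm (h := (v * h)⁻¹) hn
    (D.isomX.inv_mem (D.isomX.mul_mem hv.1 hh)) hreg ?_⟩
  rw [← hgn]
  congr 1
  group

/-- The points of `N_reg` over `F`. -/
theorem ratPoints_regUnip [IsAlgClosed K] (hS : (D.baseChange K).IsSplit σ φ φ' δ a b)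
    (h2 : (2 : K) ≠ 0) {Y₀ : Submodule K (K ⊗[F] X)}
    (hY₀ : (D.baseChange K).IsNS (Module.Dual.extend K tr) Y₀)
    (hfr₀ : Module.finrank K Y₀ = Module.finrank F W)
    {T₀ : Subgroup ((K ⊗[F] X) ≃ₗ[K] (K ⊗[F] X))} (hT₀ : (D.baseChange K).IsMaxTorus Y₀ T₀)
    {RY : Set (Submodule F X)} (hRY : D.IsSubspaceReps RY)
    {RT : Submodule F X → Set (Subgroup ((K ⊗[F] X) ≃ₗ[K] (K ⊗[F] X)))}
    (hRT : ∀ Y ∈ RY, D.IsTorusReps K Y (RT Y)) :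
    ratPoints K ((D.baseChange K).regUnip (U := K ⊗[F] U) Y₀ T₀) =
      ⋃ Y ∈ RY, ⋃ T ∈ RT Y, D.upperSet K Y T := by
  ext n
  simp only [Set.mem_iUnion, exists_prop]
  refine ⟨fun hn => hD.exists_mem_upperSet hS h2 hY₀ hfr₀ hT₀ hRY hRT hn, ?_⟩
  rintro ⟨Y, hY, T, hT, hn⟩
  have hY' := (hD.isNondegSub_iff Y).1 (hRY.1 Y hY)
  obtain ⟨hn, h, hh, t, ht, hnt⟩ := hD.norm_of_mem_upperSet hn
  obtain ⟨c, hc, hcn⟩ := hD.mem_ratPoints_of_norm hn hh ht hnt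
  refine ⟨c, hD.baseChange.regUnip_subset hS h2 (hD.isNS_baseChange hY'.1) hY₀ ?_ ?_
    ((hRT Y hY).1 T hT).1 hT₀ hc, hcn⟩
  · rw [finrank_submodule_baseChange, hY'.2, Module.finrank_baseChange]
  · rw [hfr₀, Module.finrank_baseChange]

/-- Two descriptions of the norm give `t' = u t u⁻¹` with `u` in `H`. Then `u Y = Y'` because `Y` is
the image of `t - 1`, so `Y = Y'`. Replacing `u` by the element `v` of `H_Y` that agrees with it on
`Y` conjugates `t` to `t'` and hence their centralizers, the tori `T` and `T'`. -/
theorem eq_of_mem_upperSet {RY : Set (Submodule F X)} (hRY : D.IsSubspaceReps RY)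
    {RT : Submodule F X → Set (Subgroup ((K ⊗[F] X) ≃ₗ[K] (K ⊗[F] X)))}
    (hRT : ∀ Y ∈ RY, D.IsTorusReps K Y (RT Y)) {Y Y' : Submodule F X} (hY : Y ∈ RY) (hY' : Y' ∈ RY)
    {T T' : Subgroup ((K ⊗[F] X) ≃ₗ[K] (K ⊗[F] X))} (hT : T ∈ RT Y) (hT' : T' ∈ RT Y')
    {n : Module.End F (W × X × U)} (hn : n ∈ D.upperSet K Y T) (hn' : n ∈ D.upperSet K Y' T') :
    (Y, T) = (Y', T') := by
  obtain ⟨-, h, hh, t, ht, hnt⟩ := hD.norm_of_mem_upperSet hn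
  obtain ⟨-, h', hh', t', ht', hnt'⟩ := hD.norm_of_mem_upperSet hn'
  have hNY := (hD.isNondegSub_iff Y).1 (hRY.1 Y hY)
  have hNY' := (hD.isNondegSub_iff Y').1 (hRY.1 Y' hY')
  have hb := hD.bijOn_of_ratRegSet hNY.1 ht
  have heq : h * t * h⁻¹ = h' * t' * h'⁻¹ :=
    LinearEquiv.ext fun x => LinearMap.congr_fun (hnt.symm.trans hnt') x
  obtain ⟨u, hu, htu⟩ : ∃ u ∈ D.isomX, t' = u * t * u⁻¹ := by
    refine ⟨h'⁻¹ * h, D.isomX.mul_mem (D.isomX.inv_mem hh') hh, ?_⟩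
    calc t' = h'⁻¹ * (h' * t' * h'⁻¹) * h' := by group
      _ = _ := by rw [← heq]; group
  have hmap := hD.map_eq_of_conj hNY'.1 (hNY.2.trans hNY'.2.symm) ht'.1 hb htu
  obtain rfl : Y = Y' := (hRY.2 Y (hRY.1 Y hY)).unique
    ⟨hY, 1, D.isomX.one_mem, Submodule.map_id Y |>.symm⟩ ⟨hY', u, hu, hmap⟩
  congr 1
  have huY : ∀ y ∈ Y, u y ∈ Y := fun y hy => by
    rw [hmap]
    exact ⟨y, hy, rfl⟩
  obtain ⟨v, hv, hvu⟩ := hD.exists_isomFix hNY.1 hu huY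
  have htv : v * t = t' * v := by
    have h1 : ((v * t : X ≃ₗ[F] X) : X →ₗ[F] X) = ((t' * v : X ≃ₗ[F] X) : X →ₗ[F] X) := by
      refine hD.ext_of_nondeg hNY.1 (fun y hy => ?_) fun y hy => ?_
      · change v (t y) = t' (v y)
        rw [hvu y hy, hvu _ (hD.isomFix_mem hNY.1 ht.1 hy), htu]
        change _ = u (t (u.symm (u y)))
        rw [u.symm_apply_apply]
      · change v (t y) = t' (v y)
        rw [hD.isomFix_orth hNY.1 hv hy, hD.isomFix_orth hNY.1 ht'.1 hy,
          hD.isomFix_orth hNY.1 ht.1 hy, hD.isomFix_orth hNY.1 hv hy]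
    exact LinearEquiv.ext fun x => LinearMap.congr_fun h1 x
  have hR := (hRT Y hY).1 T hT
  have hR' := (hRT Y hY).1 T' hT'
  refine ((hRT Y hY).2 T hR).unique ⟨hT, 1, (D.isomFix Y).one_mem, ?_⟩ ⟨hT', v, hv, ?_⟩
  · rw [equiv_baseChange_one, map_one]
    exact (Subgroup.map_id T).symm
  · have hvK := hD.isomFix_baseChange (K := K) hNY.1 hv
    have htvK : v.baseChange F K X X * t.baseChange F K X X =
        t'.baseChange F K X X * v.baseChange F K X X := by
      rw [← equiv_baseChange_mul, ← equiv_baseChange_mul, htv]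
    set vK := v.baseChange F K X X
    have hvK' := ((D.baseChange K).isomFix _).inv_mem hvK
    ext g
    rw [mem_torus_iff hR'.1 ht'.2]
    constructor
    · rintro ⟨hg, hgt⟩
      refine ⟨vK⁻¹ * g * vK, (mem_torus_iff hR.1 ht.2).2 ⟨Subgroup.mul_mem _
        (Subgroup.mul_mem _ hvK' hg) hvK, ?_⟩, ?_⟩
      · calc vK⁻¹ * g * vK * t.baseChange F K X X
            = vK⁻¹ * g * (vK * t.baseChange F K X X) := by group
          _ = vK⁻¹ * (g * t'.baseChange F K X X) * vK := by rw [htvK]; group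
          _ = vK⁻¹ * (t'.baseChange F K X X * vK) * vK⁻¹ * g * vK := by rw [hgt]; group
          _ = _ := by rw [← htvK]; group
      · change vK * (vK⁻¹ * g * vK) * vK⁻¹ = g
        group
    · rintro ⟨g, hg, rfl⟩
      obtain ⟨hg1, hg2⟩ := (mem_torus_iff hR.1 ht.2).1 hg
      refine ⟨Subgroup.mul_mem _ (Subgroup.mul_mem _ hvK hg1) hvK', ?_⟩
      change vK * g * vK⁻¹ * t'.baseChange F K X X = t'.baseChange F K X X * (vK * g * vK⁻¹)
      calc vK * g * vK⁻¹ * t'.baseChange F K X X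
          = vK * g * vK⁻¹ * (t'.baseChange F K X X * vK) * vK⁻¹ := by group
        _ = vK * (g * t.baseChange F K X X) * vK⁻¹ := by rw [← htvK]; group
        _ = (vK * t.baseChange F K X X) * g * vK⁻¹ := by rw [hg2]; group
        _ = _ := by rw [htvK]; group

end IsHerm

end RationalUnion

end LeviDatum

/-! ### Quadratic extensions -/

section Quadratic

variable {F E : Type*} [Field F] [Field E] [Algebra F E]

theorem exists_algebraMap_of_finrank_eq_one (h : Module.finrank F E = 1) (c : E) :
    ∃ r : F, c = algebraMap F E r := by
  obtain ⟨r, hr⟩ := (finrank_eq_one_iff_of_nonzero' (1 : E) one_ne_zero).1 h c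
  exact ⟨r, by rw [← hr, Algebra.smul_def, mul_one]⟩

theorem AlgEquiv.apply_apply_of_finrank (s : E ≃ₐ[F] E)
    (h : Module.finrank F E = 1 ∨ Module.finrank F E = 2) (c : E) : s (s c) = c := by
  rcases h with h | h
  · obtain ⟨r, rfl⟩ := exists_algebraMap_of_finrank_eq_one h c
    simp
  · have : FiniteDimensional F E := Module.finite_of_finrank_pos (by omega)
    have h1 : Fintype.card (E ≃ₐ[F] E) ≤ 2 := h ▸ AlgEquiv.card_le
    have h2 : s ^ Fintype.card (E ≃ₐ[F] E) = 1 := pow_card_eq_one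
    have h3 : 0 < Fintype.card (E ≃ₐ[F] E) := Fintype.card_pos
    have h4 : s * s = 1 := by
      interval_cases hc : Fintype.card (E ≃ₐ[F] E)
      · rw [pow_one] at h2
        rw [h2, one_mul]
      · rw [← pow_two, h2]
    exact congrArg (fun f : E ≃ₐ[F] E => f c) h4

/-- A quadratic extension is generated by the square root of an element of the base field. -/
theorem exists_sqrt_generator (h2 : (2 : F) ≠ 0) (h : Module.finrank F E = 2) (s : E ≃ₐ[F] E)
    (hs : s ≠ AlgEquiv.refl) : ∃ δ : E, s δ = -δ ∧ δ ≠ 0 ∧ (∃ d : F, δ * δ = algebraMap F E d) ∧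
      ∀ c, ∃ r t : F, c = algebraMap F E r + t • δ := by
  have : FiniteDimensional F E := Module.finite_of_finrank_pos (by omega)
  have h2E : (2 : E) ≠ 0 := by
    rw [← map_ofNat (algebraMap F E) 2]
    simpa using h2
  obtain ⟨x, hx⟩ : ∃ x, s x ≠ x := by
    by_contra! hx
    exact hs (AlgEquiv.ext hx)
  -- `x - s x` is nonzero and changes sign under `s`. As `2 ≠ 0` it is not in `F`, so it forms a
  -- basis with `1`.
  obtain ⟨δ, hδ⟩ : ∃ δ, δ = x - s x := ⟨_, rfl⟩
  have hδs : s δ = -δ := by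
    rw [hδ, map_sub, s.apply_apply_of_finrank (Or.inr h)]
    ring
  have hδ0 : δ ≠ 0 := by
    rw [hδ, sub_ne_zero]
    exact hx.symm
  have hneg : ∀ r : F, δ ≠ algebraMap F E r := by
    intro r hr
    have h1 : s δ = δ := by rw [hr, AlgEquiv.commutes]
    rw [hδs, neg_eq_iff_add_eq_zero, ← two_mul] at h1
    exact (mul_ne_zero h2E hδ0) h1
  have hli : LinearIndependent F ![(1 : E), δ] := by
    rw [LinearIndependent.pair_iff' one_ne_zero]
    intro r hr
    exact hneg r (by rw [← hr, Algebra.smul_def, mul_one])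
  have hspan := hli.span_eq_top_of_card_eq_finrank (by simp [h])
  have hc : ∀ c, ∃ r t : F, c = algebraMap F E r + t • δ := by
    intro c
    have : c ∈ Submodule.span F (Set.range ![(1 : E), δ]) := hspan ▸ Submodule.mem_top
    rw [Matrix.range_cons, Matrix.range_cons, Matrix.range_empty, Set.union_empty,
      Set.singleton_union, Submodule.mem_span_pair] at this
    obtain ⟨r, t, hrt⟩ := this
    exact ⟨r, t, by rw [← hrt, Algebra.smul_def r, mul_one]⟩
  refine ⟨δ, hδs, hδ0, ?_, hc⟩
  obtain ⟨r, t, hrt⟩ := hc (δ * δ)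
  refine ⟨r, ?_⟩
  -- `s` fixes `δ²` and sends `r + t δ` to `r - t δ`, hence `t δ = 0`.
  have h1 := congrArg s hrt
  rw [map_mul, hδs, neg_mul_neg, map_add, map_smul, hδs, AlgEquiv.commutes, hrt,
    add_left_cancel_iff, smul_neg, eq_neg_iff_add_eq_zero, ← two_mul] at h1
  rw [hrt, (mul_eq_zero.1 h1).resolve_left h2E, add_zero]

end Quadratic

/-! ### The axioms for Hermitian data -/

namespace LeviDatum

section

variable {F E K M : Type*} [Field F] [Field E] [Field K] [Algebra F E] [Algebra F K]
    [AddCommGroup M] [Module F M] [Module E M] [IsScalarTower F E M]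

/-- The base change of the multiplication by elements of `E`. -/
noncomputable def lsmulBaseChange (F E K M : Type*) [Field F] [Field E] [Field K] [Algebra F E]
    [Algebra F K] [AddCommGroup M] [Module F M] [Module E M] [IsScalarTower F E M] :
    E →ₐ[F] Module.End K (K ⊗[F] M) :=
  (Module.End.baseChangeHom F K M).comp (Algebra.lsmul F F M)

theorem lsmulBaseChange_algebraMap (r : F) (x : K ⊗[F] M) :
    lsmulBaseChange F E K M (algebraMap F E r) x = algebraMap F K r • x := by
  rw [AlgHom.commutes, Module.algebraMap_end_apply, algebraMap_smul]

/-- From `δ² = d` in `F` and `ψ(δ)² = d`, the operator `(1 + δ / ψ(δ)) / 2` projects onto the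
`ψ(δ)`-eigenspace of `δ`; and `δ` generates `E` over `F`. -/
theorem affOp_mem_eigSp {δ : E} (hδ : δ ≠ 0) (h2 : (2 : K) ≠ 0) {d : F}
    (hd : δ * δ = algebraMap F E d) (hc : ∀ c, ∃ r t : F, c = algebraMap F E r + t • δ)
    (ψ : E →ₐ[F] K) (x : K ⊗[F] M) :
    affOp (1 / 2) (1 / (2 * ψ δ)) (lsmulBaseChange F E K M δ) x ∈
      eigSp (lsmulBaseChange F E K M) ψ := by
  have hψ : ψ δ ≠ 0 := (map_ne_zero ψ).2 hδ
  have hψd : algebraMap F K d = ψ δ * ψ δ := by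
    rw [← map_mul, hd, AlgHom.commutes]
  have key : lsmulBaseChange F E K M δ
      (affOp (1 / 2) (1 / (2 * ψ δ)) (lsmulBaseChange F E K M δ) x) =
      ψ δ • affOp (1 / 2) (1 / (2 * ψ δ)) (lsmulBaseChange F E K M δ) x := by
    have h1 : lsmulBaseChange F E K M δ (lsmulBaseChange F E K M δ x) = (ψ δ * ψ δ) • x := by
      rw [← Module.End.mul_apply, ← map_mul, hd, lsmulBaseChange_algebraMap, hψd]
    rw [affOp_apply, map_add, map_smul, map_smul, h1, smul_add, smul_smul, smul_smul, smul_smul,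
      add_comm]
    congr 2
    · field_simp
    · field_simp
  intro c
  obtain ⟨r, t, rfl⟩ := hc c
  rw [map_add, LinearMap.add_apply, lsmulBaseChange_algebraMap, map_smul, LinearMap.smul_apply,
    key, ← algebraMap_smul K t, smul_smul, ← add_smul, map_add, map_smul, AlgHom.commutes,
    Algebra.smul_def]

/-- For `E = F` the projection is the identity and its complement is zero; the generator `0` is a
placeholder with coefficient `0`. -/
theorem affOp_one_mem_eigSp (h : Module.finrank F E = 1) (ψ : E →ₐ[F] K) {s : E ≃ₐ[F] E}
    (x : K ⊗[F] M) : affOp 1 0 (lsmulBaseChange F E K M 0) x ∈ eigSp (lsmulBaseChange F E K M) ψ ∧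
      x - affOp 1 0 (lsmulBaseChange F E K M 0) x ∈
        eigSp (lsmulBaseChange F E K M) (fun c => ψ (s c)) := by
  rw [affOp_apply, one_smul, zero_smul, add_zero, sub_self]
  refine ⟨fun c => ?_, Submodule.zero_mem _⟩
  obtain ⟨r, rfl⟩ := exists_algebraMap_of_finrank_eq_one h c
  rw [lsmulBaseChange_algebraMap, AlgHom.commutes]

theorem affOp_mem_eigSp_pair (h2 : (2 : K) ≠ 0) {s : E ≃ₐ[F] E} {δ : E} (hs : s δ = -δ)
    (hδ : δ ≠ 0) {d : F} (hd : δ * δ = algebraMap F E d)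
    (hc : ∀ c, ∃ r t : F, c = algebraMap F E r + t • δ) (ψ : E →ₐ[F] K) (x : K ⊗[F] M) :
    affOp (1 / 2) (1 / (2 * ψ δ)) (lsmulBaseChange F E K M δ) x ∈
        eigSp (lsmulBaseChange F E K M) ψ ∧
      x - affOp (1 / 2) (1 / (2 * ψ δ)) (lsmulBaseChange F E K M δ) x ∈
        eigSp (lsmulBaseChange F E K M) (fun c => ψ (s c)) := by
  refine ⟨affOp_mem_eigSp hδ h2 hd hc ψ x, ?_⟩
  have h1 := affOp_mem_eigSp hδ h2 hd hc (ψ.comp (s : E →ₐ[F] E)) x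
  have h3 : x - affOp (1 / 2) (1 / (2 * ψ δ)) (lsmulBaseChange F E K M δ) x =
      affOp (1 / 2) (1 / (2 * (ψ.comp (s : E →ₐ[F] E)) δ)) (lsmulBaseChange F E K M δ) x := by
    have h4 : (ψ.comp (s : E →ₐ[F] E)) δ = - ψ δ := by
      change ψ (s δ) = _
      rw [hs, map_neg]
    rw [h4, affOp_apply, affOp_apply, mul_neg, one_div_neg_eq_neg_one_div, neg_smul,
      ← sub_sub, ← sub_eq_add_neg]
    congr 1
    nth_rewrite 1 [← one_smul K x]
    rw [← sub_smul]
    congr 1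
    field_simp
    norm_num
  rw [h3]
  exact h1

end

section

variable {F E K W X U : Type*} [Field F] [Field E] [Field K] [Algebra F E] [Algebra F K]
    [AddCommGroup W] [Module F W] [Module E W] [IsScalarTower F E W]
    [AddCommGroup X] [Module F X] [Module E X] [IsScalarTower F E X]
    [AddCommGroup U] [Module F U] [Module E U] [IsScalarTower F E U]
variable {s : E ≃ₐ[F] E} {e : ℤˣ} {form : X →ₛₗ[(s : E →+* E)] X →ₗ[E] E}
    {pair : U →ₛₗ[(s : E →+* E)] W →ₗ[E] E}

/-- For `c ≠ 0` the choice `x = c⁻¹` gives the trace of `1`, which is the degree `1` or `2` and is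
not zero in `F`. -/
theorem trace_mul_separating (h2 : (2 : F) ≠ 0)
    (h : Module.finrank F E = 1 ∨ Module.finrank F E = 2) {c : E}
    (hc : ∀ x, Algebra.trace F E (x * c) = 0) : c = 0 := by
  by_contra hc0
  have h1 := hc (algebraMap F E 1 * c⁻¹)
  rw [mul_assoc, inv_mul_cancel₀ hc0, mul_one, Algebra.trace_algebraMap] at h1
  rcases h with h | h <;> rw [h] at h1
  · simp at h1
  · exact h2 (by simpa using h1)

theorem isHerm_hermitianDatum (h2 : (2 : F) ≠ 0)
    (h : Module.finrank F E = 1 ∨ Module.finrank F E = 2) (hform : form.Nondegenerate)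
    (hherm : ∀ x y, form y x = (e : ℤ) • s (form x y)) (hpair : pair.Nondegenerate) :
    (hermitianDatum s e form pair).IsHerm (Algebra.trace F E) s (Algebra.lsmul F F E) where
  invol := s.apply_apply_of_finrank h
  conj_conj := s.apply_apply_of_finrank h
  tr_conj c := Algebra.trace_eq_of_algEquiv s c
  form_symm := hherm
  form_op c x y := (form x).map_smul c y
  pair_op c x y := (pair x).map_smul c y
  form_op_left c x y := by
    change form (c • x) y = form x (s c • y)
    simp
  conj_op c x := by
    change s (s c * x) = c * s x
    rw [map_mul, s.apply_apply_of_finrank h]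
  pair_op_left c x y := by
    change pair (c • x) y = pair x (s c • y)
    simp
  tr_sep _ hc := trace_mul_separating h2 h hc
  form_nondeg x hx := hform.1 x fun y => trace_mul_separating h2 h fun c => by
    rw [← smul_eq_mul, ← map_smul]
    exact hx (c • y)
  pair_nondeg_left u hu := hpair.1 u fun w => trace_mul_separating h2 h fun c => by
    rw [← smul_eq_mul, ← map_smul]
    exact hu (c • w)
  pair_nondeg_right w hw := hpair.2 w fun u => trace_mul_separating h2 h fun c => by
    have := hw (s.symm c • u)
    change Algebra.trace F E (pair (s.symm c • u) w) = 0 at this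
    simpa using this

/-- Apply `s` to the coordinates in an `E`-basis of `W` and extend to `K`. The existence of this map
forces the two eigenspaces of `K ⊗ W` to have the same dimension. -/
theorem exists_semilinear_baseChange [FiniteDimensional E W] :
    ∃ τ : (K ⊗[F] W) ≃ₗ[K] (K ⊗[F] W), ∀ c w, τ (lsmulBaseChange F E K W c w) =
      lsmulBaseChange F E K W (s c) (τ w) := by
  let v := Module.finBasis E W
  let τ₀ : W ≃ₗ[F] W := (v.equivFun.restrictScalars F).trans
    ((LinearEquiv.piCongrRight fun _ => s.toLinearEquiv).trans
      (v.equivFun.restrictScalars F).symm)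
  have h0 : ∀ (c : E) w, τ₀ (c • w) = s c • τ₀ w := by
    intro c w
    have h1 : ∀ w, v.equivFun (τ₀ w) = fun i => s (v.equivFun w i) := fun w =>
      v.equivFun.apply_symm_apply _
    apply v.equivFun.injective
    rw [h1, map_smul, map_smul, h1]
    ext i
    simp
  refine ⟨τ₀.baseChange F K W W, fun c w => ?_⟩
  induction w with
  | zero => simp
  | add w w' hw hw' => simp only [map_add, hw, hw']
  | tmul k w =>
    change k ⊗ₜ[F] τ₀ (c • w) = k ⊗ₜ (s c • τ₀ w)
    rw [h0]

theorem isSplit_of_finrank_eq_one (h : Module.finrank F E = 1) [FiniteDimensional E W]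
    (heven : Even (Module.finrank E W)) (ψ : E →ₐ[F] K) :
    ((hermitianDatum s e form pair).baseChange K).IsSplit s ψ (fun c => ψ (s c)) 0 1 0 := by
  exact
  { conj := fun _ => rfl
    projW := affOp_one_mem_eigSp h ψ
    projX := affOp_one_mem_eigSp h ψ
    projU := affOp_one_mem_eigSp h ψ
    swap := exists_semilinear_baseChange
    even := fun _ => by
      rwa [Module.finrank_baseChange, ← Module.finrank_mul_finrank F E W, h, one_mul] }

/-- The parity condition is void: the two systems of eigenvalues take opposite nonzero values at
`δ`. -/
theorem isSplit_of_finrank_eq_two (h2 : (2 : K) ≠ 0) [FiniteDimensional E W]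
    {δ : E} (hs : s δ = -δ) (hδ : δ ≠ 0) {d : F}
    (hd : δ * δ = algebraMap F E d) (hc : ∀ c, ∃ r t : F, c = algebraMap F E r + t • δ)
    (ψ : E →ₐ[F] K) :
    ((hermitianDatum s e form pair).baseChange K).IsSplit s ψ (fun c => ψ (s c)) δ (1 / 2)
      (1 / (2 * ψ δ)) := by
  exact
  { conj := fun _ => rfl
    projW := affOp_mem_eigSp_pair h2 hs hδ hd hc ψ
    projX := affOp_mem_eigSp_pair h2 hs hδ hd hc ψ
    projU := affOp_mem_eigSp_pair h2 hs hδ hd hc ψ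
    swap := exists_semilinear_baseChange
    even := fun h => by
      have h1 := congrFun h δ
      have h3 : ψ δ ≠ 0 := (map_ne_zero ψ).2 hδ
      rw [hs, map_neg, eq_neg_iff_add_eq_zero, ← two_mul] at h1
      exact absurd h1 (mul_ne_zero h2 h3) }

end

end LeviDatum

/-! ### The main theorem -/

theorem mainTheorem3 {F E K W X U : Type*} [Field F] [Field E] [Field K]
    [Algebra F E] [Algebra F K] [IsAlgClosure F K] (hchar : (2 : F) ≠ 0)
    -- `s` is the Galois involution, `e = 1` and `e = -1` are the symmetric (or Hermitian) and the
    -- antisymmetric case; the unitary case is the one where `E` is quadratic over `F`.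
    (s : E ≃ₐ[F] E) (e : ℤˣ)
    (htype : Module.finrank F E = 1 ∨ (Module.finrank F E = 2 ∧ s ≠ AlgEquiv.refl ∧ e = 1))
    [AddCommGroup W] [Module F W] [Module E W] [IsScalarTower F E W] [FiniteDimensional E W]
    [AddCommGroup X] [Module F X] [Module E X] [IsScalarTower F E X] [FiniteDimensional E X]
    [AddCommGroup U] [Module F U] [Module E U] [IsScalarTower F E U] [FiniteDimensional E U]
    -- the form on `X` and the pairing of `U` with `W`
    (form : X →ₛₗ[(s : E →+* E)] X →ₗ[E] E) (hform : form.Nondegenerate)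
    (hherm : ∀ x y, form y x = (e : ℤ) • s (form x y))
    (pair : U →ₛₗ[(s : E →+* E)] W →ₗ[E] E) (hpair : pair.Nondegenerate)
    (hdim : Module.finrank E W ≤ Module.finrank E X)
    -- `k` is even in the symplectic case
    (hsymp : ¬ (Module.finrank F E = 1 ∧ e = -1 ∧ Odd (Module.finrank E W)))
    -- `H_Y` is not odd orthogonal
    (horth : ¬ (Module.finrank F E = 1 ∧ e = 1 ∧ Odd (Module.finrank E W)))
    (D : LeviDatum F E E W X U) (hD : D = hermitianDatum s e form pair)
    -- the nondegenerate subspace and the maximal torus over the algebraic closure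
    (Y₀ : Submodule K (TensorProduct F K X)) (hY₀ : (D.baseChange K).IsNondegSub Y₀)
    (T₀ : Subgroup (TensorProduct F K X ≃ₗ[K] TensorProduct F K X))
    (hT₀ : (D.baseChange K).IsMaxTorus Y₀ T₀)
    -- representatives of the subspaces and of the tori, and the isomorphisms `Y ≃ W`
    (RY : Set (Submodule F X)) (hRY : D.IsSubspaceReps RY)
    (RT : Submodule F X → Set (Subgroup (TensorProduct F K X ≃ₗ[K] TensorProduct F K X)))
    (hRT : ∀ Y ∈ RY, D.IsTorusReps K Y (RT Y))
    (xi : Submodule F X → (X →ₗ[F] W)) (hxi : ∀ Y ∈ RY, D.IsXi Y (xi Y)) :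
    (((D.baseChange K).regUnip Y₀ T₀).Nonempty ∧
      ∃ O, @IsOpen _ (zariski K _) O ∧
        (D.baseChange K).regUnip Y₀ T₀ = (D.baseChange K).unipRad ∩ O) ∧
    LeviDatum.ratPoints K ((D.baseChange K).regUnip Y₀ T₀) =
      (⋃ Y ∈ RY, ⋃ T ∈ RT Y, D.upperSet K Y T) ∧
    LeviDatum.ratPoints K ((D.baseChange K).regUnip Y₀ T₀) =
      (⋃ Y ∈ RY, ⋃ T ∈ RT Y, D.orbitSet K Y T (xi Y)) ∧
    ∀ Y ∈ RY, ∀ T ∈ RT Y, ∀ Y' ∈ RY, ∀ T' ∈ RT Y', (Y, T) ≠ (Y', T') →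
      Disjoint (D.orbitSet K Y T (xi Y)) (D.orbitSet K Y' T' (xi Y')) := by
  subst hD
  have h12 : Module.finrank F E = 1 ∨ Module.finrank F E = 2 := htype.imp_right And.left
  have hfE : FiniteDimensional F E := Module.finite_of_finrank_pos (by omega)
  have : FiniteDimensional F W := Module.Finite.trans E W
  have : FiniteDimensional F X := Module.Finite.trans E X
  have : FiniteDimensional F U := Module.Finite.trans E U
  have : IsAlgClosed K := IsAlgClosure.isAlgClosed F
  have h2 : (2 : K) ≠ 0 := by
    rw [← map_ofNat (algebraMap F K) 2]
    exact (map_ne_zero (algebraMap F K)).2 hchar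
  have hD := LeviDatum.isHerm_hermitianDatum hchar h12 hform hherm hpair
  -- An embedding of `E` in the algebraic closure; `ψ` and `ψ ∘ s` serve as the two systems of
  -- eigenvalues.
  let ψ : E →ₐ[F] K := IsAlgClosed.lift
  obtain ⟨φ', δ, a, b, hS⟩ : ∃ φ' δ a b,
      ((hermitianDatum s e form pair).baseChange K).IsSplit s ψ φ' δ a b := by
    rcases htype with h | ⟨h, hs, -⟩
    -- For `E = F` the sign leaves only the symplectic and orthogonal cases, and the two parity
    -- hypotheses together make `k` even.
    · refine ⟨_, _, _, _, LeviDatum.isSplit_of_finrank_eq_one h (Nat.not_odd_iff_even.1 fun ho => ?_) ψ⟩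
      rcases Int.units_eq_one_or e with he | he
      · exact horth ⟨h, he, ho⟩
      · exact hsymp ⟨h, he, ho⟩
    · obtain ⟨δ, hδ, hδ0, ⟨d, hd⟩, hc⟩ := exists_sqrt_generator hchar h s hs
      exact ⟨_, _, _, _, LeviDatum.isSplit_of_finrank_eq_two h2 hδ hδ0 hd hc ψ⟩
  obtain ⟨hY, hfr⟩ := (hD.baseChange.isNondegSub_iff Y₀).1 hY₀
  have hRY' := fun Y hY => (hD.isNondegSub_iff Y).1 (hRY.1 Y hY)
  have hunion := hD.ratPoints_regUnip hS h2 hY (by rw [hfr, Module.finrank_baseChange]) hT₀ hRY hRT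
  have horbit : ∀ Y ∈ RY, ∀ T, LeviDatum.upperSet K (hermitianDatum s e form pair) Y T =
      LeviDatum.orbitSet K (hermitianDatum s e form pair) Y T (xi Y) := fun Y hY T =>
    hD.upperSet_eq_orbitSet (hRY' Y hY).1 (hRY' Y hY).2 (hxi Y hY)
  refine ⟨⟨hD.baseChange.regUnip_nonempty hS h2 hY hfr hT₀,
    hD.baseChange.isOpen_regUnip h2 hS hY hfr hT₀⟩, hunion, ?_, ?_⟩
  · rw [hunion]
    exact Set.iUnion₂_congr fun Y hY => Set.iUnion₂_congr fun T _ => horbit Y hY T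
  · intro Y hY T hT Y' hY' T' hT' hne
    rw [← horbit Y hY, ← horbit Y' hY', Set.disjoint_left]
    exact fun n hn hn' => hne (hD.eq_of_mem_upperSet hRY hRT hY hY' hT hT' hn hn')
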